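/- Let $P^n=(\mathbb P^1_{\mathbb C})^n$ with coordinates $z_1,\dots,z_n$, let $H_{i,\alpha}=\{z_i=\alpha\}$ for $1\le i\le n$, $\alpha\in\{0,\infty\}$, let the cubical faces be the intersections of the $H_{i,\alpha}$ (including $P^n$), and let $\mathbf D^n=\bigcup_i\{z_i=1\}$. A good triangulation $K$ of $P^n$ is a finite semi-algebraic triangulation such that $\mathbf D^n$ and each $\{|z_i|\le 1\}$ are subcomplexes, the image of each open simplex is a regular submanifold, and each union of cubical faces is a full subcomplex. A semi-algebraic set $S\subset P^n$ is admissible if $\dim(S\cap(H-\mathbf D^n))\le\dim S-2\operatorname{codim}H$ for every cubical face $H$ (with $\dim\emptyset=-\infty$). A relative simplicial chain $\gamma\in C_p(K,\mathbf D^n;\mathbb Q)$ is admissible if the support of a representative is admissible; $AC_p(K,\mathbf D^n;\mathbb Q)$ is the space of those $\gamma$ for which $\gamma$ and its boundary $\delta\gamma$ are admissible, and $AC_p(P^n,\mathbf D^n;\mathbb Q)=\varinjlim_K AC_p(K,\mathbf D^n;\mathbb Q)$, the limit being taken over the good triangulations with respect to the subdivision operators. Let $w=z_i$ if $\alpha=0$,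 $w=1/z_i$ if $\alpha=\infty$, let $\Delta=\{|w|<1\}\subset P^n$, and let $W$ be the union of the simplices of $K$ which do not meet $H_{i,\alpha}$. A Thom cocycle of $H_{i,\alpha}$ is a simplicial cocycle $T\in C^2(K,W;\mathbb Q)$ whose class corresponds, under $H^2(K,W;\mathbb Q)\simeq H^2_{\rm sing}(P^n,P^n-H_{i,\alpha};\mathbb Q)\simeq H^2_{\rm sing}(\Delta,\Delta-H_{i,\alpha};\mathbb Q)$, to the image of the de Rham class $\big[\frac{dw}{2\pi i\,w}\big]\in H^1_{\rm sing}(\Delta-H_{i,\alpha};\mathbb Q)$ under the connecting homomorphism. An ordering $\mathcal O$ of $K$ (a partial ordering of its vertices which is total on each simplex) is good with respect to $H_{i,\alpha}$ if $v\in H_{i,\alpha}$ and $w\ge v$ imply $w\in H_{i,\alpha}$ for vertices $v,w$. The cap product is $T\overset{\mathcal O}{\cap}[v_0,\dots,v_k]=T([v_0,v_1,v_2])\,[v_2,\dots,v_k]$ for $v_0<\dots<v_k$. Then: (1) For all $n\ge1$, $p\ge2$, $1\le i\le n$, $\alpha\in\{0,\infty\}$ there is a unique linear map (the face map) $$\partial_{i,\alpha}:AC_p(P^n,\mathbf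 D^n;\mathbb Q)\to AC_{p-2}(P^{n-1},\mathbf D^{n-1};\mathbb Q)$$ such that for every good triangulation $K$, every Thom cocycle $T$ of $H_{i,\alpha}$, every good ordering $\mathcal O$ with respect to $H_{i,\alpha}$ and every $\gamma\in AC_p(K,\mathbf D^n;\mathbb Q)$, the chain $T\overset{\mathcal O}{\cap}\gamma$ lies in $AC_{p-2}(K\cap H_{i,\alpha},\mathbf D^{n-1};\mathbb Q)$, and $\partial_{i,\alpha}$ maps the class of $\gamma$ to the class of $T\overset{\mathcal O}{\cap}\gamma$, where $H_{i,\alpha}$ is identified with $P^{n-1}$ by omitting the $i$-th coordinate. (2) The cubical differential $\partial=\sum_{i=1}^n(-1)^{i-1}(\partial_{i,0}-\partial_{i,\infty})$ satisfies $\partial^2=0$: for all $n\ge2$ and $p\ge4$ the composite $$\partial^2:AC_p(P^n,\mathbf D^n;\mathbb Q)\to AC_{p-2}(P^{n-1},\mathbf D^{n-1};\mathbb Q)\to AC_{p-4}(P^{n-2},\mathbf D^{n-2};\mathbb Q)$$ is the zero map. -/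

import Mathlib

open scoped ContDiff

noncomputable section

namespace CubicalChains

/-! ### Semi-algebraic sets -/

/-- Semi-algebraic subsets of `ℝ^ι`: the smallest family of subsets which contains all the sets
`{f > 0}`, `f` a polynomial, and is closed under complements and finite unions. -/
inductive IsSemialgebraic {ι : Type} : Set (ι → ℝ) → Prop
  | pos (f : MvPolynomial ι ℝ) : IsSemialgebraic {x | 0 < MvPolynomial.eval x f}
  | compl {S : Set (ι → ℝ)} : IsSemialgebraic S → IsSemialgebraic Sᶜ
  | union {S S' : Set (ι → ℝ)} : IsSemialgebraic S → IsSemialgebraic S' → IsSemialgebraic (S ∪ S')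

theorem IsSemialgebraic.preimage {ι κ : Type} {S : Set (κ → ℝ)} (hS : IsSemialgebraic S)
    (φ : κ → MvPolynomial ι ℝ) :
    IsSemialgebraic {x : ι → ℝ | (fun k => MvPolynomial.eval x (φ k)) ∈ S} := by
  induction hS with
  | pos f =>
    have h := IsSemialgebraic.pos (MvPolynomial.bind₁ φ f)
    convert h using 1
    ext x
    have key : MvPolynomial.eval x (MvPolynomial.bind₁ φ f) =
        MvPolynomial.eval (fun k => MvPolynomial.eval x (φ k)) f :=
      MvPolynomial.eval₂Hom_bind₁ (RingHom.id ℝ) x φ f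
    simp only [Set.mem_ofPred_eq, key]
  | compl _ ih => exact ih.compl
  | union _ _ ih₁ ih₂ => exact ih₁.union ih₂

open Classical in
/-- The dimension of a semi-algebraic set `S ⊆ ℝ^ι`: the largest `d` such that the projection of
`S` to some `d` of the coordinates has non-empty interior; `dim ∅ = ⊥` (that is, `-∞`). -/
def saDim {ι : Type} [Fintype ι] (S : Set (ι → ℝ)) : WithBot ℕ :=
  (Finset.univ.filter fun I : Finset ι =>
    (interior ((fun (x : ι → ℝ) (i : I) => x i) '' S)).Nonempty).sup
    fun I => ((I.card : ℕ) : WithBot ℕ)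

/-- `M ⊆ ℝ^ι` is a regular (embedded) `C^∞` submanifold of dimension `d`: locally `M` is
diffeomorphic to an open subset of `ℝ^d`, the inverse `g` of the local parametrization `f` being
the restriction of a smooth map on an open subset of `ℝ^ι`. -/
def IsRegularSubmanifold {ι : Type} [Fintype ι] (d : ℕ) (M : Set (ι → ℝ)) : Prop :=
  ∀ x ∈ M, ∃ (U : Set (ι → ℝ)) (V : Set (Fin d → ℝ)) (f : (Fin d → ℝ) → ι → ℝ)
    (g : (ι → ℝ) → Fin d → ℝ), IsOpen U ∧ x ∈ U ∧ IsOpen V ∧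
    ContDiffOn ℝ ∞ f V ∧ ContDiffOn ℝ ∞ g U ∧ f '' V = M ∩ U ∧ ∀ v ∈ V, g (f v) = v

theorem IsRegularSubmanifold.of_image {ι κ : Type} [Fintype ι] [Fintype κ] {d : ℕ}
    {M : Set (ι → ℝ)} (j : (ι → ℝ) → κ → ℝ) (r : (κ → ℝ) → ι → ℝ) (hj : ContDiff ℝ ∞ j)
    (hr : ContDiff ℝ ∞ r) (hrj : ∀ x, r (j x) = x) (h : IsRegularSubmanifold d (j '' M)) :
    IsRegularSubmanifold d M := by
  intro x hx
  obtain ⟨U, V, f, g, hU, hxU, hV, hf, hg, hfV, hgf⟩ := h (j x) ⟨x, hx, rfl⟩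
  refine ⟨j ⁻¹' U, V, fun v => r (f v), fun y => g (j y), hU.preimage hj.continuous, hxU, hV,
    hr.comp_contDiffOn hf, hg.comp hj.contDiffOn (fun _ h => h), ?_, ?_⟩
  · ext y
    constructor
    · rintro ⟨v, hv, rfl⟩
      obtain ⟨⟨m, hm, hmv⟩, hvU⟩ : f v ∈ j '' M ∩ U := hfV ▸ ⟨v, hv, rfl⟩
      simp only [← hmv, hrj] at hvU ⊢
      exact ⟨hm, hvU⟩
    · rintro ⟨hy, hyU⟩
      obtain ⟨v, hv, hvy⟩ : j y ∈ f '' V := hfV ▸ ⟨⟨y, hy, rfl⟩, hyU⟩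
      exact ⟨v, hv, by simp [hvy, hrj]⟩
  · intro v hv
    obtain ⟨⟨m, _, hmv⟩, _⟩ : f v ∈ j '' M ∩ U := hfV ▸ ⟨v, hv, rfl⟩
    change g (j (r (f v))) = v
    rw [← hmv, hrj, hmv, hgf v hv]

/-! ### The space `P^n = (ℙ¹_ℂ)^n`, its faces and the divisor `D^n` -/

/-- `P^n`, the `n`-fold product of `ℙ¹_ℂ = ℂ ∪ {∞}`. -/
abbrev P (n : ℕ) : Type := Fin n → OnePoint ℂ

/-- The embedding of `ℙ¹_ℂ` in `ℝ³` as the unit sphere (inverse stereographic projection). -/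
def sphere (z : OnePoint ℂ) : Fin 3 → ℝ :=
  z.elim ![0, 0, 1] fun c => ![2 * c.re / (1 + ‖c‖ ^ 2), 2 * c.im / (1 + ‖c‖ ^ 2),
    (‖c‖ ^ 2 - 1) / (1 + ‖c‖ ^ 2)]

theorem sphere_injective : Function.Injective sphere := by
  have key : ∀ c : ℂ, (1 - sphere (c : OnePoint ℂ) 2) * (1 + ‖c‖ ^ 2) = 2 ∧
      sphere (c : OnePoint ℂ) 0 = c.re * (1 - sphere (c : OnePoint ℂ) 2) ∧
      sphere (c : OnePoint ℂ) 1 = c.im * (1 - sphere (c : OnePoint ℂ) 2) := by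
    intro c
    have h : (1 + ‖c‖ ^ 2 : ℝ) ≠ 0 := by positivity
    simp only [sphere, OnePoint.elim_some, Matrix.cons_val]
    refine ⟨?_, ?_, ?_⟩ <;> field_simp <;> ring
  have hinf : sphere OnePoint.infty 2 = 1 := by simp [sphere]
  have hne : ∀ c : ℂ, sphere (c : OnePoint ℂ) 2 ≠ 1 := by
    intro c hc
    have := (key c).1
    rw [hc] at this
    norm_num at this
  intro z w h
  induction z using OnePoint.rec with
  | infty =>
    induction w using OnePoint.rec with
    | infty => rfl
    | coe c => exact absurd ((congrFun h 2).symm.trans hinf) (hne c)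
  | coe b =>
    induction w using OnePoint.rec with
    | infty => exact absurd ((congrFun h 2).trans hinf) (hne b)
    | coe c =>
      obtain ⟨-, hb0, hb1⟩ := key b
      obtain ⟨-, hc0, hc1⟩ := key c
      have h0 : 1 - sphere (c : OnePoint ℂ) 2 ≠ 0 := sub_ne_zero.2 (hne c).symm
      rw [h] at hb0 hb1
      congr 1
      exact Complex.ext (mul_right_cancel₀ h0 (hb0.symm.trans hc0))
        (mul_right_cancel₀ h0 (hb1.symm.trans hc1))

/-- The embedding of `P^n` as a compact semi-algebraic subset of `ℝ^{3n}`. -/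
def embed {n : ℕ} (z : P n) : Fin n × Fin 3 → ℝ := fun k => sphere (z k.1) k.2

/-- The two values `α = 0, ∞`. -/
inductive Pole
  | zero
  | infty

/-- `0` or `∞` as a point of `ℙ¹_ℂ`. -/
def Pole.pt : Pole → OnePoint ℂ
  | .zero => ((0 : ℂ) : OnePoint ℂ)
  | .infty => OnePoint.infty

/-- The local coordinate of `ℙ¹_ℂ` centred at `α`: `z` for `α = 0` and `1/z` for `α = ∞`
(with value `0` at the opposite pole, where it is not used). -/
def Pole.coord : Pole → OnePoint ℂ → ℂ
  | .zero, z => z.elim 0 fun c => c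
  | .infty, z => z.elim 0 fun c => c⁻¹

/-- The open disc around `α`: `{|z| < 1}` for `α = 0` and `{|z| > 1}` for `α = ∞`. -/
def Pole.disc : Pole → Set (OnePoint ℂ)
  | .zero => {z | ∃ c : ℂ, z = (c : OnePoint ℂ) ∧ ‖c‖ < 1}
  | .infty => {z | z = OnePoint.infty ∨ ∃ c : ℂ, z = (c : OnePoint ℂ) ∧ 1 < ‖c‖}

/-- The hypersurface `H_{i,α} = {z_i = α}`. -/
def hyper {n : ℕ} (i : Fin n) (α : Pole) : Set (P n) := {z | z i = α.pt}

/-- The cubical face of `P^n` on which `z_i = α` whenever `J i = some α`. -/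
def cubicalFace {n : ℕ} (J : Fin n → Option Pole) : Set (P n) :=
  {z | ∀ i, ∀ α ∈ J i, z i = α.pt}

/-- The codimension of the cubical face `cubicalFace J`. -/
def codim {n : ℕ} (J : Fin n → Option Pole) : ℕ :=
  (Finset.univ.filter fun i => (J i).isSome).card

/-- The divisor `D^n = ⋃ {z_i = 1}`. -/
def divisor (n : ℕ) : Set (P n) := {z | ∃ i, z i = ((1 : ℂ) : OnePoint ℂ)}

/-- The set `{|z_i| ≤ 1}`. -/
def closedDisc {n : ℕ} (i : Fin n) : Set (P n) :=
  {z | ∃ c : ℂ, z i = (c : OnePoint ℂ) ∧ ‖c‖ ≤ 1}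

/-- A subset `S` of `P^n` is admissible if `dim (S ∩ (H - D^n)) ≤ dim S - 2 codim H` for each
cubical face `H`. -/
def IsAdmissible {n : ℕ} (S : Set (P n)) : Prop :=
  ∀ J : Fin n → Option Pole,
    saDim (embed '' (S ∩ (cubicalFace J \ divisor n))) + ((2 * codim J : ℕ) : WithBot ℕ)
      ≤ saDim (embed '' S)

/-! ### Semi-algebraic triangulations -/

/-- A finite semi-algebraic triangulation `Φ : |K| ≃ P^n`: a finite simplicial complex in some
`ℝ^N` with a homeomorphism from `|K|` onto `P^n` whose graph is semi-algebraic. -/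
structure Triangulation (n : ℕ) where
  N : ℕ
  K : Geometry.SimplicialComplex ℝ (Fin N → ℝ)
  finite : K.faces.Finite
  Φ : K.space ≃ₜ P n
  semialgebraic : IsSemialgebraic {w : Fin N ⊕ (Fin n × Fin 3) → ℝ |
    ∃ x : K.space, (∀ k, w (Sum.inl k) = x.1 k) ∧ ∀ k, w (Sum.inr k) = embed (Φ x) k}

namespace Triangulation

variable {n : ℕ} (T : Triangulation n)

/-- The image in `P^n` of the simplex with vertex set `s`. -/
def cell (s : Finset (Fin T.N → ℝ)) : Set (P n) :=
  {z | ∃ x : T.K.space, x.1 ∈ convexHull ℝ (s : Set (Fin T.N → ℝ)) ∧ T.Φ x = z}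

/-- The image in `P^n` of the relative interior of the simplex with vertex set `s`, the complement
of the union of its proper faces. -/
def openCell (s : Finset (Fin T.N → ℝ)) : Set (P n) :=
  {z | ∃ x : T.K.space, (x.1 ∈ convexHull ℝ (s : Set (Fin T.N → ℝ)) ∧
    ∀ t : Finset (Fin T.N → ℝ), t ⊂ s → x.1 ∉ convexHull ℝ (t : Set (Fin T.N → ℝ))) ∧ T.Φ x = z}

/-- `S ⊆ P^n` is a subcomplex, i.e. a union of closed simplices of the triangulation. -/
def IsSubcomplex (S : Set (P n)) : Prop :=
  ∀ z ∈ S, ∃ s ∈ T.K.faces, z ∈ T.cell s ∧ T.cell s ⊆ S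

/-- `S ⊆ P^n` is a full subcomplex: it is a subcomplex, and every simplex all of whose vertices
belong to `S` is contained in `S`. -/
def IsFullSubcomplex (S : Set (P n)) : Prop :=
  T.IsSubcomplex S ∧ ∀ s ∈ T.K.faces, (∀ v ∈ s, T.cell {v} ⊆ S) → T.cell s ⊆ S

variable {T} in
theorem IsSubcomplex.inter {S S' : Set (P n)} (h : T.IsSubcomplex S) (h' : T.IsSubcomplex S') :
    T.IsSubcomplex (S ∩ S') := by
  classical
  rintro z ⟨hz, hz'⟩
  obtain ⟨s, hs, ⟨x, hx, hxz⟩, hsS⟩ := h z hz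
  obtain ⟨t, ht, ⟨y, hy, hyz⟩, htS⟩ := h' z hz'
  obtain rfl : x = y := T.Φ.injective (hxz.trans hyz.symm)
  have hst : x.1 ∈ convexHull ℝ ((s ∩ t : Finset _) : Set (Fin T.N → ℝ)) := by
    rw [Finset.coe_inter]
    exact T.K.inter_subset_convexHull hs ht ⟨hx, hy⟩
  refine ⟨s ∩ t, T.K.down_closed hs Finset.inter_subset_left ?_, ⟨x, hst, hxz⟩, ?_⟩
  · have := convexHull_nonempty_iff.1 ⟨_, hst⟩
    exact_mod_cast this
  · rintro w ⟨y, hy, rfl⟩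
    exact ⟨hsS ⟨y, convexHull_mono (by simp) hy, rfl⟩, htS ⟨y, convexHull_mono (by simp) hy, rfl⟩⟩

end Triangulation

/-- A good triangulation of `P^n`: `D^n` is a subcomplex, the triangulation is a facewise regular
embedding, each union of cubical faces is a full subcomplex, and each `{|z_i| ≤ 1}` is a
subcomplex. -/
structure GoodTriangulation (n : ℕ) extends Triangulation n where
  divisor_isSubcomplex : toTriangulation.IsSubcomplex (divisor n)
  facewise_regular : ∀ s ∈ K.faces,
    IsRegularSubmanifold (s.card - 1) (embed '' toTriangulation.openCell s)
  faces_full : ∀ 𝒥 : Set (Fin n → Option Pole),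
    toTriangulation.IsFullSubcomplex (⋃ J ∈ 𝒥, cubicalFace J)
  closedDisc_isSubcomplex : ∀ i, toTriangulation.IsSubcomplex (closedDisc i)

/-! ### The triangulation `K ∩ H_{i,α}` of `H_{i,α} = P^{n-1}` -/

/-- The identification of `P^n` with the hypersurface `H_{i,α}` of `P^{n+1}`. -/
def ins {n : ℕ} (i : Fin (n + 1)) (α : Pole) (z : P n) : P (n + 1) :=
  Fin.insertNth (α := fun _ => OnePoint ℂ) i α.pt z

/-- The corresponding map of the ambient Euclidean spaces. -/
def insR {n : ℕ} (i : Fin (n + 1)) (α : Pole) (x : Fin n × Fin 3 → ℝ) : Fin (n + 1) × Fin 3 → ℝ :=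
  fun k => Fin.insertNth (α := fun _ => ℝ) i (sphere α.pt k.2) (fun j => x (j, k.2)) k.1

variable {n : ℕ}

theorem ins_mem_hyper (i : Fin (n + 1)) (α : Pole) (z : P n) : ins i α z ∈ hyper i α := by
  simp [ins, hyper]

theorem ins_injective (i : Fin (n + 1)) (α : Pole) : Function.Injective (ins (n := n) i α) :=
  fun _ _ h => Fin.insertNth_right_injective (α := fun _ => OnePoint ℂ) _ h

theorem ins_removeNth (i : Fin (n + 1)) (α : Pole) {z : P (n + 1)} (hz : z ∈ hyper i α) :
    ins i α (i.removeNth z) = z := by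
  have h : z i = α.pt := hz
  simp [ins, ← h]

theorem continuous_ins (i : Fin (n + 1)) (α : Pole) : Continuous (ins (n := n) i α) :=
  continuous_const.finInsertNth (A := fun _ => OnePoint ℂ) i continuous_id

theorem embed_ins (i : Fin (n + 1)) (α : Pole) (z : P n) :
    embed (ins i α z) = insR i α (embed z) := by
  ext ⟨k, l⟩
  refine Fin.succAboveCases i ?_ (fun j => ?_) k <;> simp [embed, ins, insR]

theorem hyper_eq_iUnion (i : Fin (n + 1)) (α : Pole) :
    hyper i α = ⋃ J ∈ ({Function.update (fun _ => none) i (some α)} :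
      Set (Fin (n + 1) → Option Pole)), cubicalFace J := by
  ext z
  simp only [hyper, cubicalFace, Set.mem_singleton_iff, Set.iUnion_iUnion_eq_left,
    Set.mem_ofPred_eq]
  constructor
  · intro h j β hβ
    by_cases hj : j = i
    · subst hj
      simp only [Function.update_self, Option.mem_def, Option.some.injEq] at hβ
      rw [← hβ, h]
    · simp [Function.update_of_ne hj] at hβ
  · intro h
    exact h i α (by simp)

theorem ins_mem_cubicalFace (i : Fin (n + 1)) (α : Pole) (J : Fin n → Option Pole) (z : P n) :
    ins i α z ∈ cubicalFace (Fin.insertNth (α := fun _ => Option Pole) i (some α) J) ↔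
      z ∈ cubicalFace J := by
  simp only [cubicalFace, Set.mem_ofPred_eq, ins]
  rw [Fin.forall_iff_succAbove i]
  simp

namespace GoodTriangulation

variable (T : GoodTriangulation (n + 1)) (i : Fin (n + 1)) (α : Pole)

theorem hyper_full : T.IsFullSubcomplex (hyper i α) := by
  rw [hyper_eq_iUnion]
  exact T.faces_full _

/-- The subcomplex `K ∩ H_{i,α}`. -/
def faceComplex : Geometry.SimplicialComplex ℝ (Fin T.N → ℝ) where
  faces := {s | s ∈ T.K.faces ∧ T.cell s ⊆ hyper i α}
  isRelLowerSet_faces := by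
    rintro s ⟨hs, hsH⟩
    refine ⟨T.K.nonempty_of_mem_faces hs, fun t hts ht => ⟨T.K.down_closed hs hts ht, ?_⟩⟩
    rintro z ⟨x, hx, rfl⟩
    exact hsH ⟨x, convexHull_mono (by exact_mod_cast hts) hx, rfl⟩
  indep := fun hs => T.K.indep hs.1
  inter_subset_convexHull := fun hs ht => T.K.inter_subset_convexHull hs.1 ht.1

theorem faceComplex_space_subset : (T.faceComplex i α).space ⊆ T.K.space := by
  intro x hx
  obtain ⟨s, hs, hxs⟩ := Geometry.SimplicialComplex.mem_space_iff.1 hx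
  exact Geometry.SimplicialComplex.mem_space_iff.2 ⟨s, hs.1, hxs⟩

theorem mem_faceComplex_space (x : T.K.space) :
    x.1 ∈ (T.faceComplex i α).space ↔ T.Φ x ∈ hyper i α := by
  constructor
  · intro hx
    obtain ⟨s, hs, hxs⟩ := Geometry.SimplicialComplex.mem_space_iff.1 hx
    exact hs.2 ⟨x, hxs, rfl⟩
  · intro hx
    obtain ⟨s, hs, ⟨y, hy, hyx⟩, hsH⟩ := (T.hyper_full i α).1 _ hx
    obtain rfl := T.Φ.injective hyx
    exact Geometry.SimplicialComplex.mem_space_iff.2 ⟨s, ⟨hs, hsH⟩, hy⟩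

/-- The homeomorphism `|K ∩ H_{i,α}| ≃ H_{i,α} = P^n`. -/
def faceHomeo : (T.faceComplex i α).space ≃ₜ P n where
  toFun x := i.removeNth (T.Φ ⟨x.1, T.faceComplex_space_subset i α x.2⟩)
  invFun z := ⟨(T.Φ.symm (ins i α z)).1, (T.mem_faceComplex_space i α _).2 (by
    rw [Homeomorph.apply_symm_apply]; exact ins_mem_hyper i α z)⟩
  left_inv x := by
    apply Subtype.ext
    have h := (T.mem_faceComplex_space i α ⟨x.1, T.faceComplex_space_subset i α x.2⟩).1 x.2
    simp [ins_removeNth i α h]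
  right_inv z := by simp [ins]
  continuous_toFun := by
    refine continuous_pi fun j => (continuous_apply (i.succAbove j)).comp ?_
    exact T.Φ.continuous.comp (continuous_subtype_val.subtype_mk _)
  continuous_invFun := by
    refine Continuous.subtype_mk ?_ _
    exact continuous_subtype_val.comp (T.Φ.symm.continuous.comp (continuous_ins i α))

theorem ins_faceHomeo (x : (T.faceComplex i α).space) :
    ins i α (T.faceHomeo i α x) = T.Φ ⟨x.1, T.faceComplex_space_subset i α x.2⟩ :=
  ins_removeNth i α ((T.mem_faceComplex_space i α ⟨x.1, _⟩).1 x.2)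

/-- The triangulation `K ∩ H_{i,α}` of `H_{i,α} = P^n`. -/
def faceTriangulation : Triangulation n where
  N := T.N
  K := T.faceComplex i α
  finite := T.finite.subset fun _ hs => hs.1
  Φ := T.faceHomeo i α
  semialgebraic := by
    have h := T.semialgebraic.preimage (ι := Fin T.N ⊕ (Fin n × Fin 3))
      (Sum.elim (fun k => MvPolynomial.X (Sum.inl k)) (fun k =>
        Fin.insertNth (α := fun _ => MvPolynomial (Fin T.N ⊕ (Fin n × Fin 3)) ℝ) i
          (MvPolynomial.C (sphere α.pt k.2)) (fun j => MvPolynomial.X (Sum.inr (j, k.2))) k.1))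
    have key : ∀ (w : Fin T.N ⊕ (Fin n × Fin 3) → ℝ) (k : Fin (n + 1) × Fin 3),
        MvPolynomial.eval w
          (Fin.insertNth (α := fun _ => MvPolynomial (Fin T.N ⊕ (Fin n × Fin 3)) ℝ) i
          (MvPolynomial.C (sphere α.pt k.2)) (fun j => MvPolynomial.X (Sum.inr (j, k.2))) k.1) =
        insR i α (fun l => w (Sum.inr l)) k := by
      rintro w ⟨k, l⟩
      refine Fin.succAboveCases i ?_ (fun j => ?_) k <;> simp [insR]
    have hinj : ∀ a b : Fin n × Fin 3 → ℝ, insR i α a = insR i α b → a = b := by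
      intro a b hab
      ext ⟨k, l⟩
      have := congrFun hab (i.succAbove k, l)
      simpa [insR] using this
    convert h using 1
    ext w
    simp only [Set.mem_ofPred_eq, Sum.elim_inl, Sum.elim_inr, MvPolynomial.eval_X, key]
    constructor
    · rintro ⟨x, hx, hxe⟩
      refine ⟨⟨x.1, T.faceComplex_space_subset i α x.2⟩, hx, fun k => ?_⟩
      rw [← T.ins_faceHomeo i α x, embed_ins]
      congr 1
      ext l
      exact hxe l
    · rintro ⟨x, hx, hxe⟩
      have hxH : T.Φ x ∈ hyper i α := by
        have h2 : ∀ l, sphere (T.Φ x i) l = sphere α.pt l := by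
          intro l
          have := hxe (i, l)
          simp only [insR, Fin.insertNth_apply_same, embed] at this
          exact this.symm
        exact sphere_injective (funext h2)
      refine ⟨⟨x.1, (T.mem_faceComplex_space i α x).2 hxH⟩, hx, fun k => ?_⟩
      revert k
      apply congrFun
      apply hinj
      rw [← embed_ins]
      ext k
      rw [hxe k, T.ins_faceHomeo i α ⟨x.1, (T.mem_faceComplex_space i α x).2 hxH⟩]

theorem ins_image_cell {s : Finset (Fin T.N → ℝ)} (hs : s ∈ (T.faceComplex i α).faces) :
    ins i α '' (T.faceTriangulation i α).cell s = T.cell s := by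
  ext z
  constructor
  · rintro ⟨_, ⟨x, hx, rfl⟩, rfl⟩
    exact ⟨⟨x.1, T.faceComplex_space_subset i α x.2⟩, hx, (T.ins_faceHomeo i α x).symm⟩
  · rintro ⟨x, hx, rfl⟩
    have hxL := (T.mem_faceComplex_space i α x).2 (hs.2 ⟨x, hx, rfl⟩)
    exact ⟨_, ⟨⟨x.1, hxL⟩, hx, rfl⟩, T.ins_faceHomeo i α ⟨x.1, hxL⟩⟩

theorem ins_image_openCell {s : Finset (Fin T.N → ℝ)} (hs : s ∈ (T.faceComplex i α).faces) :
    ins i α '' (T.faceTriangulation i α).openCell s = T.openCell s := by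
  ext z
  constructor
  · rintro ⟨_, ⟨x, hx, rfl⟩, rfl⟩
    exact ⟨⟨x.1, T.faceComplex_space_subset i α x.2⟩, hx, (T.ins_faceHomeo i α x).symm⟩
  · rintro ⟨x, hx, rfl⟩
    have hxL := (T.mem_faceComplex_space i α x).2 (hs.2 ⟨x, hx.1, rfl⟩)
    exact ⟨_, ⟨⟨x.1, hxL⟩, hx, rfl⟩, T.ins_faceHomeo i α ⟨x.1, hxL⟩⟩

theorem cell_subset_iff {s : Finset (Fin T.N → ℝ)} (hs : s ∈ (T.faceComplex i α).faces)
    {S : Set (P n)} {S' : Set (P (n + 1))} (hSS : ∀ z, ins i α z ∈ S' ↔ z ∈ S) :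
    (T.faceTriangulation i α).cell s ⊆ S ↔ T.cell s ⊆ S' := by
  rw [← T.ins_image_cell i α hs, Set.image_subset_iff]
  exact ⟨fun h z hz => (hSS z).2 (h hz), fun h z hz => (hSS z).1 (h hz)⟩

theorem isSubcomplex_face {S : Set (P n)} {S' : Set (P (n + 1))}
    (hSS : ∀ z, ins i α z ∈ S' ↔ z ∈ S) (hS' : T.IsSubcomplex S') :
    (T.faceTriangulation i α).IsSubcomplex S := by
  intro z hz
  obtain ⟨s, hs, hzs, hsS⟩ := hS'.inter (T.hyper_full i α).1 (ins i α z)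
    ⟨(hSS z).2 hz, ins_mem_hyper i α z⟩
  have hsL : s ∈ (T.faceComplex i α).faces := ⟨hs, hsS.trans Set.inter_subset_right⟩
  refine ⟨s, hsL, ?_, (T.cell_subset_iff i α hsL hSS).2 (hsS.trans Set.inter_subset_left)⟩
  rw [← T.ins_image_cell i α hsL] at hzs
  exact (ins_injective i α).mem_set_image.1 hzs

/-- The good triangulation `K ∩ H_{i,α}` of `H_{i,α} = P^n`. -/
def face : GoodTriangulation n where
  toTriangulation := T.faceTriangulation i α
  divisor_isSubcomplex := by
    refine T.isSubcomplex_face i α (S' := divisor (n + 1)) (fun z => ?_) T.divisor_isSubcomplex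
    have h01 : α.pt ≠ ((1 : ℂ) : OnePoint ℂ) := by
      cases α <;> simp [Pole.pt]
    simp only [divisor, Set.mem_ofPred_eq, ins]
    rw [Fin.exists_iff_succAbove i]
    simp [h01]
  facewise_regular := by
    intro s hs
    have h := T.facewise_regular s hs.1
    rw [← T.ins_image_openCell i α hs, Set.image_image] at h
    simp only [embed_ins] at h
    rw [← Set.image_image (insR i α)] at h
    refine h.of_image (insR i α) (fun x k => x (i.succAbove k.1, k.2)) ?_ ?_ ?_
    · refine contDiff_pi.2 fun k => ?_
      obtain ⟨k, l⟩ := k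
      refine Fin.succAboveCases i ?_ (fun j => ?_) k
      · simp only [insR, Fin.insertNth_apply_same]
        exact contDiff_const
      · simp only [insR, Fin.insertNth_apply_succAbove]
        fun_prop
    · fun_prop
    · intro x
      ext k
      simp [insR]
  faces_full := by
    intro 𝒥
    have h := T.faces_full ((fun J => Fin.insertNth (α := fun _ => Option Pole) i (some α) J) '' 𝒥)
    have hSS : ∀ z : P n, ins i α z ∈ (⋃ J ∈ ((fun J => Fin.insertNth (α := fun _ => Option Pole)
        i (some α) J) '' 𝒥), cubicalFace J) ↔ z ∈ ⋃ J ∈ 𝒥, cubicalFace J := by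
      intro z
      simp only [Set.mem_iUnion, Set.mem_image, exists_prop, exists_exists_and_eq_and,
        ins_mem_cubicalFace]
    refine ⟨T.isSubcomplex_face i α hSS h.1, fun s hs hv => ?_⟩
    rw [T.cell_subset_iff i α hs hSS]
    refine h.2 s hs.1 fun v hvs => ?_
    have hvL : {v} ∈ (T.faceComplex i α).faces :=
      (T.faceComplex i α).down_closed hs (Finset.singleton_subset_iff.2 hvs) (by simp)
    exact (T.cell_subset_iff i α hvL hSS).1 (hv v hvs)
  closedDisc_isSubcomplex := by
    intro j
    refine T.isSubcomplex_face i α (S' := closedDisc (i.succAbove j)) (fun z => ?_)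
      (T.closedDisc_isSubcomplex _)
    simp [closedDisc, ins]

end GoodTriangulation

/-! ### Simplicial chains -/

namespace Triangulation

variable (T : Triangulation n)

open Classical in
/-- The finite set of vertices of the triangulation. -/
def verts : Finset (Fin T.N → ℝ) := T.finite.toFinset.biUnion id

open Classical in
/-- `(v_0, …, v_p)` are the distinct vertices of a `p`-simplex, in some order. -/
def IsSimplex {p : ℕ} (v : Fin (p + 1) → Fin T.N → ℝ) : Prop :=
  Function.Injective v ∧ Finset.univ.image v ∈ T.K.faces

open Classical in
/-- The image in `P^n` of the simplex `[v_0, …, v_p]`. -/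
def tupleCell {p : ℕ} (v : Fin (p + 1) → Fin T.N → ℝ) : Set (P n) :=
  T.cell (Finset.univ.image v)

/-- The group `C_p(K; ℚ)` of (oriented) simplicial chains: a chain is a function `c` on the ordered
simplices `(v_0, …, v_p)` of `K` with `c (v ∘ π) = sign π * c v`; the chain `∑ a_σ σ` is the
function with value `a_σ` on each ordering of the vertices of `σ` in the orientation class of `σ`
and `- a_σ` on the others. -/
def Chain (p : ℕ) : Submodule ℚ ((Fin (p + 1) → Fin T.N → ℝ) → ℚ) where
  carrier := {c | (∀ v, c v ≠ 0 → T.IsSimplex v) ∧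
    ∀ (v : Fin (p + 1) → Fin T.N → ℝ) (π : Equiv.Perm (Fin (p + 1))),
      c (v ∘ π) = (Equiv.Perm.sign π : ℤ) * c v}
  zero_mem' := by simp
  add_mem' := by
    rintro a b ⟨ha, ha'⟩ ⟨hb, hb'⟩
    refine ⟨fun v hv => ?_, fun v π => ?_⟩
    · by_cases h : a v = 0
      · exact hb v (by simpa [h] using hv)
      · exact ha v h
    · simp [ha', hb', mul_add]
  smul_mem' := by
    rintro r a ⟨ha, ha'⟩
    refine ⟨fun v hv => ha v (right_ne_zero_of_mul hv), fun v π => ?_⟩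
    simp only [Pi.smul_apply, ha', smul_eq_mul]
    ring

open Classical in
/-- The oriented simplex `[v_0, …, v_p]` as a chain (zero if `v` is not a simplex of `K`). -/
def elem {p : ℕ} (v : Fin (p + 1) → Fin T.N → ℝ) : T.Chain p where
  val u := if T.IsSimplex v then
    ∑ π : Equiv.Perm (Fin (p + 1)), if u = v ∘ π then ((Equiv.Perm.sign π : ℤ) : ℚ) else 0 else 0
  property := by
    by_cases hv : T.IsSimplex v
    · simp only [hv, if_true]
      refine ⟨fun u hu => ?_, fun u τ => ?_⟩
      · obtain ⟨π, -, hπ⟩ := Finset.exists_ne_zero_of_sum_ne_zero hu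
        have huv : u = v ∘ π := by
          by_contra h
          simp [h] at hπ
        subst huv
        refine ⟨hv.1.comp π.injective, ?_⟩
        have : Finset.univ.image (v ∘ π) = Finset.univ.image v := by
          ext x
          simp only [Finset.mem_image, Finset.mem_univ, true_and, Function.comp_apply]
          exact ⟨fun ⟨a, ha⟩ => ⟨π a, ha⟩, fun ⟨a, ha⟩ => ⟨π.symm a, by simpa using ha⟩⟩
        rw [this]
        exact hv.2
      · rw [Finset.mul_sum]
        refine (Fintype.sum_equiv (Equiv.mulRight τ) _ _ fun π => ?_).symm
        have h : (u ∘ τ = v ∘ (Equiv.mulRight τ π)) ↔ u = v ∘ π := by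
          constructor
          · intro h
            ext a
            have := congrFun h (τ.symm a)
            simp only [Function.comp_apply, Equiv.apply_symm_apply, Equiv.coe_mulRight,
              Equiv.Perm.mul_apply] at this
            simp [this]
          · rintro rfl
            rfl
        by_cases huv : u = v ∘ π
        · rw [if_pos (h.2 huv), if_pos huv]
          simp [mul_comm]
        · simp only [if_neg (mt h.1 huv), if_neg huv, mul_zero]
    · refine ⟨fun u hu => absurd (if_neg hv) hu, fun u τ => ?_⟩
      beta_reduce
      rw [if_neg hv, if_neg hv, mul_zero]

/-- The boundary operator `C_{p+1}(K) → C_p(K)`,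
`[v_0, …, v_{p+1}] ↦ ∑ (-1)^i [v_0, …, v̂_i, …, v_{p+1}]`: the coefficient of `[v_0, …, v_p]` in
the boundary of `c` is the sum over all vertices `w` of the coefficient of `[w, v_0, …, v_p]`
in `c`. -/
def bdSucc (p : ℕ) : T.Chain (p + 1) →ₗ[ℚ] T.Chain p where
  toFun c := ⟨fun v => ∑ w ∈ T.verts, c.1 (Fin.cons w v), by
    refine ⟨fun v hv => ?_, fun v π => ?_⟩
    · obtain ⟨w, -, hw⟩ := Finset.exists_ne_zero_of_sum_ne_zero hv
      obtain ⟨h1, h2⟩ := c.2.1 _ hw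
      refine ⟨fun a b hab => ?_, T.K.down_closed h2 ?_ (by simp)⟩
      · have := @h1 a.succ b.succ (by simpa using hab)
        simpa using this
      · intro x
        simp only [Finset.mem_image, Finset.mem_univ, true_and]
        rintro ⟨a, rfl⟩
        exact ⟨a.succ, by simp⟩
    · rw [Finset.mul_sum]
      refine Finset.sum_congr rfl fun w _ => ?_
      have h := c.2.2 (Fin.cons w v) (Equiv.Perm.decomposeFin.symm (0, π))
      rw [Equiv.Perm.decomposeFin.symm_sign] at h
      simp only [if_true, one_mul] at h
      rw [← h]
      refine congrArg c.1 (funext fun a => ?_)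
      refine Fin.cases ?_ (fun b => ?_) a <;> simp⟩
  map_add' a b := by
    apply Subtype.ext
    ext v
    simp [Finset.sum_add_distrib]
  map_smul' r a := by
    apply Subtype.ext
    ext v
    simp [Finset.mul_sum]

/-- The boundary operator `δ : C_p(K) → C_{p-1}(K)`, which is zero for `p = 0`. -/
def bd : (p : ℕ) → T.Chain p →ₗ[ℚ] T.Chain (p - 1)
  | 0 => 0
  | p + 1 => T.bdSucc p

/-- The support `|γ|` of a chain, as a subset of `P^n`. -/
def support {p : ℕ} (c : T.Chain p) : Set (P n) :=
  {z | ∃ v, c.1 v ≠ 0 ∧ z ∈ T.tupleCell v}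

/-- The chains of the subcomplex `D^n`. -/
def divisorChain (p : ℕ) : Submodule ℚ (T.Chain p) where
  carrier := {c | ∀ v, c.1 v ≠ 0 → T.tupleCell v ⊆ divisor n}
  zero_mem' := by simp
  add_mem' := by
    intro a b ha hb v hv
    by_cases h : a.1 v = 0
    · exact hb v (by simpa [h] using hv)
    · exact ha v h
  smul_mem' := by
    intro r a ha v hv
    exact ha v (right_ne_zero_of_mul hv)

theorem divisorChain_le_comap_bd (p : ℕ) :
    T.divisorChain p ≤ (T.divisorChain (p - 1)).comap (T.bd p) := by
  cases p with
  | zero => intro c _ v hv; simp [bd] at hv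
  | succ p =>
    intro c hc v hv
    obtain ⟨w, -, hw⟩ := Finset.exists_ne_zero_of_sum_ne_zero (s := T.verts) hv
    refine subset_trans ?_ (hc _ hw)
    rintro z ⟨x, hx, rfl⟩
    refine ⟨x, convexHull_mono ?_ hx, rfl⟩
    intro y
    simp only [Finset.coe_image, Finset.coe_univ, Set.image_univ, Set.mem_range]
    rintro ⟨a, rfl⟩
    exact ⟨a.succ, by simp⟩

/-- The group `C_p(K, D^n; ℚ) = C_p(K; ℚ) / C_p(D^n; ℚ)` of relative chains. -/
def RelChain (p : ℕ) : Type := T.Chain p ⧸ T.divisorChain p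

instance (p : ℕ) : AddCommGroup (T.RelChain p) :=
  inferInstanceAs (AddCommGroup (T.Chain p ⧸ T.divisorChain p))

instance (p : ℕ) : Module ℚ (T.RelChain p) :=
  inferInstanceAs (Module ℚ (T.Chain p ⧸ T.divisorChain p))

/-- The class in `C_p(K, D^n; ℚ)` of a chain. -/
def toRel {p : ℕ} : T.Chain p →ₗ[ℚ] T.RelChain p := (T.divisorChain p).mkQ

/-- The boundary operator `δ : C_p(K, D^n) → C_{p-1}(K, D^n)`. -/
def relBd (p : ℕ) : T.RelChain p →ₗ[ℚ] T.RelChain (p - 1) :=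
  (T.divisorChain p).mapQ (T.divisorChain (p - 1)) (T.bd p) (T.divisorChain_le_comap_bd p)

/-- A relative chain is admissible if the support of a representative is admissible. -/
def IsAdmissibleChain {p : ℕ} (γ : T.RelChain p) : Prop :=
  ∃ c : T.Chain p, T.toRel c = γ ∧ IsAdmissible (T.support c)

/-- The group `AC_p(K, D^n; ℚ)` of the relative chains `γ` such that `γ` and `δγ` are admissible
(written as the linear span of these chains, which already form a linear subspace). -/
def AC (p : ℕ) : Submodule ℚ (T.RelChain p) :=
  Submodule.span ℚ {γ | T.IsAdmissibleChain γ ∧ T.IsAdmissibleChain (T.relBd p γ)}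

/-! ### Subdivision -/

/-- `T'` is a subdivision of `T`. -/
def IsSubdivision (T T' : Triangulation n) : Prop :=
  (∀ s' ∈ T'.K.faces, ∃ s ∈ T.K.faces, T'.cell s' ⊆ T.cell s) ∧
    ∀ s ∈ T.K.faces, T'.IsSubcomplex (T.cell s)

/-- The augmentation `C_0(K) → ℚ`, the sum of the coefficients. -/
def augmentation (c : T.Chain 0) : ℚ := ∑ w ∈ T.verts, c.1 fun _ => w

/-- The subdivision operator `λ : C_•(K) → C_•(K')`: the augmentation preserving chain map such
that `λ(σ)` is carried by `K' ∩ σ` for each simplex `σ` of `K`. -/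
def IsSubdivisionOperator (T T' : Triangulation n) (Λ : ∀ p, T.Chain p →ₗ[ℚ] T'.Chain p) : Prop :=
  (∀ p c, T'.bdSucc p (Λ (p + 1) c) = Λ p (T.bdSucc p c)) ∧
  (∀ p (v : Fin (p + 1) → Fin T.N → ℝ), T.IsSimplex v →
    T'.support (Λ p (T.elem v)) ⊆ T.tupleCell v) ∧
  ∀ c, T'.augmentation (Λ 0 c) = T.augmentation c

end Triangulation

/-! ### The inductive limit `AC_•(P^n, D^n; ℚ)` -/

open scoped DirectSum

open Classical in
/-- The relations of the inductive limit: `γ ∈ AC_p(K, D^n)` is identified with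
`λ(γ) ∈ AC_p(K', D^n)` for each subdivision `K'` of `K`. -/
def limitRelations (n p : ℕ) : Submodule ℚ (⨁ T : GoodTriangulation n, T.AC p) :=
  Submodule.span ℚ {x | ∃ (T T' : GoodTriangulation n)
    (Λ : ∀ q, T.Chain q →ₗ[ℚ] T'.Chain q) (c : T.Chain p)
    (hc : T.toRel c ∈ T.AC p) (hc' : T'.toRel (Λ p c) ∈ T'.AC p),
    Triangulation.IsSubdivision T.toTriangulation T'.toTriangulation ∧
    Triangulation.IsSubdivisionOperator T.toTriangulation T'.toTriangulation Λ ∧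
    x = DirectSum.lof ℚ (GoodTriangulation n) (fun T => T.AC p) T ⟨T.toRel c, hc⟩ -
      DirectSum.lof ℚ (GoodTriangulation n) (fun T => T.AC p) T' ⟨T'.toRel (Λ p c), hc'⟩}

/-- `AC_p(P^n, D^n; ℚ)`, the inductive limit of the `AC_p(K, D^n; ℚ)` over the good triangulations
`K` of `P^n`. -/
abbrev ACLim (n p : ℕ) : Type :=
  (⨁ T : GoodTriangulation n, T.AC p) ⧸ limitRelations n p

open Classical in
/-- The canonical map `AC_p(K, D^n; ℚ) → AC_p(P^n, D^n; ℚ)`. -/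
def GoodTriangulation.toLim {n : ℕ} (T : GoodTriangulation n) (p : ℕ) :
    T.AC p →ₗ[ℚ] ACLim n p :=
  (limitRelations n p).mkQ ∘ₗ DirectSum.lof ℚ (GoodTriangulation n) (fun T => T.AC p) T

/-! ### Singular cochains -/

/-- Singular `p`-simplices of `P^n`. -/
abbrev SingSimplex (n p : ℕ) : Type := C(stdSimplex ℝ (Fin (p + 1)), P n)

/-- The `j`-th face of a singular simplex. -/
def SingSimplex.face {n p : ℕ} (σ : SingSimplex n (p + 1)) (j : Fin (p + 2)) : SingSimplex n p :=
  σ.comp ⟨stdSimplex.map j.succAbove, stdSimplex.continuous_map _⟩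

/-- Singular `p`-cochains of `P^n` with coefficients in `ℚ`. (The cochains of a subspace `A` are
dealt with by evaluating on the singular simplices in `A` only.) -/
abbrev SingCochain (n p : ℕ) : Type := SingSimplex n p → ℚ

/-- The coboundary of a singular cochain, `(dS)(σ) = S(∂σ)`. -/
def singCobd {n p : ℕ} (S : SingCochain n p) : SingCochain n (p + 1) :=
  fun σ => ∑ j : Fin (p + 2), (-1) ^ (j : ℕ) * S (σ.face j)

/-- A singular `1`-simplex as a path parametrized by `[0,1]`. -/
def SingSimplex.path {n : ℕ} (σ : SingSimplex n 1) (t : ℝ) : P n :=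
  σ (stdSimplexHomeomorphUnitInterval.symm (Set.projIcc 0 1 zero_le_one t))

/-- The open set `Δ = {|z_i| < 1}` (`α = 0`), `Δ = {|z_i| > 1}` (`α = ∞`). -/
def tube {n : ℕ} (i : Fin n) (α : Pole) : Set (P n) := {z | z i ∈ α.disc}

/-- The integral of `dw / (2πi w)` along a path in `Δ - H_{i,α}`, where `w = z_i` if `α = 0` and
`w = 1 / z_i` if `α = ∞`. -/
def logIntegral {n : ℕ} (i : Fin n) (α : Pole) (σ : SingSimplex n 1) : ℂ :=
  (2 * Real.pi * Complex.I)⁻¹ *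
    ∫ t in (0 : ℝ)..1, deriv (fun s => α.coord (σ.path s i)) t / α.coord (σ.path t i)

/-- The restriction of the rational singular `1`-cochain `c` to `Δ - H_{i,α}` is a cocycle whose
class in `H^1_sing(Δ - H_{i,α}; ℂ)` is the de Rham class of `dw / (2πi w)`: on the smooth singular
simplices it is equal to the integration cochain up to the coboundary of a `0`-cochain `b`. -/
def RepresentsLogForm {n : ℕ} (i : Fin n) (α : Pole) (c : SingCochain n 1) : Prop :=
  (∀ τ : SingSimplex n 2, Set.range τ ⊆ tube i α \ hyper i α → singCobd c τ = 0) ∧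
  ∃ b : P n → ℂ, ∀ σ : SingSimplex n 1, Set.range σ ⊆ tube i α \ hyper i α →
    ContDiffOn ℝ ∞ (fun t => embed (σ.path t)) (Set.Icc 0 1) →
      (c σ : ℂ) = logIntegral i α σ + (b (σ.path 1) - b (σ.path 0))

/-- The singular `2`-cochain `S` is a cocycle of `(P^n, P^n - H_{i,α})` whose restriction to
`(Δ, Δ - H_{i,α})` has the class `δ [dw / (2πi w)]`, `δ` being the connecting homomorphism
`H^1(Δ - H_{i,α}) → H^2(Δ, Δ - H_{i,α})`: on `Δ` it is the coboundary of a cochain `c` on `Δ` which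
restricts to a representative of `[dw / (2πi w)]` on `Δ - H_{i,α}`. -/
def IsSingularThomCocycle {n : ℕ} (i : Fin n) (α : Pole) (S : SingCochain n 2) : Prop :=
  (∀ τ, singCobd S τ = 0) ∧
  (∀ τ : SingSimplex n 2, Set.range τ ⊆ (hyper i α)ᶜ → S τ = 0) ∧
  ∃ c : SingCochain n 1, RepresentsLogForm i α c ∧
    ∀ τ : SingSimplex n 2, Set.range τ ⊆ tube i α → S τ = singCobd c τ

/-! ### Orderings, Thom cocycles and the cap product -/

namespace Triangulation

variable (T : Triangulation n)

/-- The singular simplex `t ↦ Φ (∑ t_k v_k)` of a simplex `[v_0, …, v_p]` of `K`. -/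
def toSingular {p : ℕ} (v : Fin (p + 1) → Fin T.N → ℝ) (hv : T.IsSimplex v) : SingSimplex n p where
  toFun t := T.Φ ⟨∑ k, t k • v k, Geometry.SimplicialComplex.mem_space_iff.2 ⟨_, hv.2, by
    refine (convex_convexHull ℝ _).sum_mem (fun k _ => t.2.1 k) t.2.2 fun k _ => ?_
    exact subset_convexHull ℝ _ (by simp)⟩⟩
  continuous_toFun := by
    refine T.Φ.continuous.comp (Continuous.subtype_mk ?_ _)
    refine continuous_finsetSum _ fun k _ => ?_
    exact ((continuous_apply k).comp continuous_subtype_val).smul continuous_const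

/-- `O` is an ordering of `K`: a partial ordering of the vertices which is total on each simplex.
(Only the restriction of `O` to the vertices of `K` matters.) -/
def IsOrdering (O : PartialOrder (Fin T.N → ℝ)) : Prop :=
  ∀ s ∈ T.K.faces, ∀ v ∈ s, ∀ w ∈ s, O.le v w ∨ O.le w v

/-- `O` is a good ordering of `K` with respect to the face `H ⊆ P^n`: if a vertex `v` is on `H` and
`w ≥ v` for a vertex `w`, then `w` is on `H`. -/
def IsGoodOrdering (O : PartialOrder (Fin T.N → ℝ)) (H : Set (P n)) : Prop :=
  T.IsOrdering O ∧ ∀ v ∈ T.verts, ∀ w ∈ T.verts, T.cell {v} ⊆ H → O.le v w → T.cell {w} ⊆ H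

/-- Simplicial `p`-cochains of `K` with coefficients in `ℚ`. -/
abbrev Cochain (p : ℕ) : Type := T.Chain p →ₗ[ℚ] ℚ

/-- The cochain `u` vanishes on the subcomplex `W` of the simplices which do not meet `H`, that is,
`u` belongs to `C^p(K, W; ℚ)`. -/
def VanishesOff {p : ℕ} (H : Set (P n)) (u : T.Cochain p) : Prop :=
  ∀ v : Fin (p + 1) → Fin T.N → ℝ, T.IsSimplex v → Disjoint (T.tupleCell v) H → u (T.elem v) = 0

/-- `u ∈ C^2(K, W; ℚ)` is a Thom cocycle of the face `H_{i,α}`: it is a cocycle, and its class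
corresponds to `δ [dw / (2πi w)]` under the isomorphisms
`H^2(K, W) ≃ H^2_sing(P^n, P^n - H_{i,α}) ≃ H^2_sing(Δ, Δ - H_{i,α})`. The comparison of simplicial
and singular cochains is made by means of an ordering `O` of `K`. -/
def IsThomCocycle (i : Fin n) (α : Pole) (u : T.Cochain 2) : Prop :=
  T.VanishesOff (hyper i α) u ∧ u ∘ₗ T.bdSucc 2 = 0 ∧
  ∃ (S : SingCochain n 2) (O : PartialOrder (Fin T.N → ℝ)) (w : T.Cochain 1),
    IsSingularThomCocycle i α S ∧ T.IsOrdering O ∧ T.VanishesOff (hyper i α) w ∧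
    ∀ (v : Fin 3 → Fin T.N → ℝ) (hv : T.IsSimplex v), (∀ a b : Fin 3, a < b → O.lt (v a) (v b)) →
      u (T.elem v) = S (T.toSingular v hv) + w (T.bdSucc 1 (T.elem v))

open Classical in
/-- The cap product `u ∩ c` with respect to the ordering `O`:
`u ∩ [v_0, …, v_{p+q}] = u([v_0, …, v_q]) [v_q, …, v_{p+q}]` if `v_0 < ⋯ < v_{p+q}`. -/
def cap (O : PartialOrder (Fin T.N → ℝ)) {p q : ℕ} (u : T.Cochain q) (c : T.Chain (p + q)) :
    T.Chain p :=
  ∑ v ∈ (Fintype.piFinset fun _ : Fin (p + q + 1) => T.verts).filter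
      (fun v => ∀ a b : Fin (p + q + 1), a < b → O.lt (v a) (v b)),
    (c.1 v * u (T.elem fun k : Fin (q + 1) => v (k.castLE (by omega)))) •
      T.elem fun k : Fin (p + 1) => v ⟨k + q, by omega⟩

end Triangulation

/-! ### Face maps and the cubical differential -/

/-- `F` is the face map `∂_{i,α} : AC_{p+2}(P^{n+1}, D^{n+1}; ℚ) → AC_p(P^n, D^n; ℚ)`: for each good
triangulation `K`, each Thom cocycle `u` of `H_{i,α}` and each good ordering `O`, the cap product
`u ∩ c` with a chain `c` representing an element of `AC_{p+2}(K, D^{n+1}; ℚ)` is a chain of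
`K ∩ H_{i,α}`, represents an element of `AC_p(K ∩ H_{i,α}, D^n; ℚ)`, and `F` maps the class of `c`
to the class of `u ∩ c`. -/
def IsFaceMap {n p : ℕ} (i : Fin (n + 1)) (α : Pole)
    (F : ACLim (n + 1) (p + 2) →ₗ[ℚ] ACLim n p) : Prop :=
  ∀ (T : GoodTriangulation (n + 1)) (u : T.Cochain 2) (O : PartialOrder (Fin T.N → ℝ)),
    T.IsThomCocycle i α u → T.IsGoodOrdering O (hyper i α) →
    ∀ (c : T.Chain (p + 2)) (hc : T.toRel c ∈ T.AC (p + 2)),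
      ∃ (c' : (T.face i α).Chain p) (hc' : (T.face i α).toRel c' ∈ (T.face i α).AC p),
        c'.1 = (T.cap O u c).1 ∧
        F (T.toLim (p + 2) ⟨T.toRel c, hc⟩) = (T.face i α).toLim p ⟨(T.face i α).toRel c', hc'⟩

/-- The face map `∂_{i,α} : AC_{p+2}(P^{n+1}, D^{n+1}; ℚ) → AC_p(P^n, D^n; ℚ)`, the linear map
satisfying `IsFaceMap` (its existence and uniqueness is part of the statement). -/
def faceMap (n p : ℕ) (i : Fin (n + 1)) (α : Pole) : ACLim (n + 1) (p + 2) →ₗ[ℚ] ACLim n p :=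
  Classical.epsilon (IsFaceMap i α)

/-- The cubical differential `∂ = ∑ (-1)^{i-1} (∂_{i,0} - ∂_{i,∞})` (the index `i` starts at `0`
here). -/
def cubicalDifferential (n p : ℕ) : ACLim (n + 1) (p + 2) →ₗ[ℚ] ACLim n p :=
  ∑ i : Fin (n + 1), (-1 : ℚ) ^ (i : ℕ) • (faceMap n p i .zero - faceMap n p i .infty)

end CubicalChains

end

/-!
The proof compares chains on different triangulations by acyclic carriers, and uses admissibility
through dimension counts: correction terms that a homotopy produces lie in `D^n`, hence vanish in
the relative chain groups.

*Admissibility.* The cubical faces are full subcomplexes and the open simplices are submanifolds, so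
the dimensions in the definition are numbers of vertices, and admissibility of a chain says which
faces its simplices may have (`GoodTriangulation.isAdmissibleChain_iff`,
`GoodTriangulation.mem_AC_iff`). For a good ordering, the cap product of a simplex with a cocycle
that vanishes off `H = H_{i,α}` is a multiple of a face in `H` (`Triangulation.capHom_carriedBy`).
Therefore the cap product of an admissible chain is an admissible chain of `H`
(`GoodTriangulation.faceRestrict_capHom_mem_AC`).

*Thom cocycles.* A singular Thom cocycle is the obstruction to choosing homogeneous coordinates of
`z_i` compatibly along a singular triangle and its edges, measured by winding numbers
(`exists_isSingularThomCocycle`). Conversely, for every Thom cocycle the value on a chain near `H`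
with boundary off `H` is the winding of `w` along the boundary. This follows by contracting the
closed tube `{|w| ≤ 1}` into `Δ` (`Triangulation.IsThomCocycle.eq_osum_edgeWinding`). The winding
does not change under subdivision, so any two Thom cocycles, on a triangulation `K` and on a
subdivision of it, are cohomologous relative to the complement of `H`
(`Triangulation.IsThomCocycle.exists_cobounding`).

*The face maps.* Let `Λ` be a subdivision operator, and let `u`, `u'` be Thom cocycles on `K` and on
the subdivision. The chain map `c ↦ Λ (u ∩ c) - u' ∩ Λ c` is carried by the intersections of the
simplices of `K` with `H`. Each of these is empty or a simplex of `K`, and the subdivision of a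
simplex is acyclic (`Triangulation.exists_bdSucc_eq_of_bd_eq_zero`). Since `u` and `u' ∘ Λ` are
cohomologous, the map is homotopic to zero, `Λ (u ∩ c) - u' ∩ Λ c = δ E c + D δ c`, with carried
maps `D` and `E` which lower the dimension by one only (`Triangulation.exists_carried_homotopy`). If
`c` and `δ c` are admissible, the simplices of `E c` and of `D δ c` are too large to lie in the
intersections with `H` of simplices of `c` and `δ c`, unless they lie in `D^n`
(`GoodTriangulation.MeetsProperly.map_mem_divisorChain`). So the class of `u ∩ c` in the limit
depends only on the class of `c`; this gives existence and uniqueness of the face maps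
(`existsUnique_isFaceMap`).

*The square of the differential.* There is an ordering which is good with respect to two given
hypersurfaces, as their union is full, too (`GoodTriangulation.exists_isGoodOrdering`). For this
ordering the commutator of the cap products with two Thom cocycles is, up to boundaries, the cap
product with their `∪_1`-product (`Triangulation.cobd_cupOne`), which lowers the dimension by three
only, whereas admissibility allows intersections with both hypersurfaces of codimension at least
four; again it lies in `D^n` (`capHom_capHom_sub_mem`). As the restriction of a Thom cocycle to
another hypersurface is a Thom cocycle, any two face maps commute (`faceMap_comp_faceMap`), and the
terms of `∂²` cancel in pairs (`cubicalDifferential_comp`).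
-/


open scoped ContDiff

noncomputable section

namespace CubicalChains

/-! ### Oriented simplices and sums over increasing simplices -/

namespace Triangulation

variable {n : ℕ} (T : Triangulation n)

theorem mem_verts {s : Finset (Fin T.N → ℝ)} (hs : s ∈ T.K.faces) {x : Fin T.N → ℝ}
    (hx : x ∈ s) : x ∈ T.verts := by
  classical
  simp only [verts, Finset.mem_biUnion, Set.Finite.mem_toFinset, id]
  exact ⟨s, hs, hx⟩

theorem singleton_mem_faces {x : Fin T.N → ℝ} (hx : x ∈ T.verts) : {x} ∈ T.K.faces := by
  classical
  simp only [verts, Finset.mem_biUnion, Set.Finite.mem_toFinset, id] at hx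
  obtain ⟨s, hs, hxs⟩ := hx
  exact T.K.down_closed hs (Finset.singleton_subset_iff.2 hxs) (by simp)

theorem IsSimplex.mem_verts {T : Triangulation n} {p : ℕ} {v : Fin (p + 1) → Fin T.N → ℝ}
    (hv : T.IsSimplex v) (k : Fin (p + 1)) : v k ∈ T.verts :=
  T.mem_verts hv.2 (by simp)

theorem isSimplex_of_ne_zero {p : ℕ} (c : T.Chain p) {v : Fin (p + 1) → Fin T.N → ℝ}
    (h : c.1 v ≠ 0) : T.IsSimplex v := c.2.1 v h

theorem Chain.ext {T : Triangulation n} {p : ℕ} {c d : T.Chain p} (h : ∀ v, c.1 v = d.1 v) :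
    c = d := Subtype.ext (funext h)

theorem chain_comp {p : ℕ} (c : T.Chain p) (v : Fin (p + 1) → Fin T.N → ℝ)
    (π : Equiv.Perm (Fin (p + 1))) : c.1 (v ∘ π) = (Equiv.Perm.sign π : ℤ) * c.1 v := c.2.2 v π

theorem IsSimplex.face {T : Triangulation n} {p q : ℕ} {v : Fin (p + 1) → Fin T.N → ℝ}
    (hv : T.IsSimplex v) {f : Fin (q + 1) → Fin (p + 1)} (hf : Function.Injective f) :
    T.IsSimplex (v ∘ f) := by
  classical
  refine ⟨hv.1.comp hf, T.K.down_closed hv.2 ?_ (by simp)⟩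
  intro x
  simp only [Finset.mem_image, Finset.mem_univ, true_and]
  rintro ⟨a, rfl⟩
  exact ⟨f a, rfl⟩

open Classical in
/-- The alternating function of the tuples of vertices which underlies the oriented simplex
`[x_0, …, x_p]`; it makes sense for every tuple, and vanishes if two of the entries coincide. -/
def altFun {V : Type*} {p : ℕ} (x u : Fin (p + 1) → V) : ℚ :=
  ∑ π : Equiv.Perm (Fin (p + 1)), if u = x ∘ π then ((Equiv.Perm.sign π : ℤ) : ℚ) else 0

theorem altFun_eq_zero {V : Type*} {p : ℕ} {x : Fin (p + 1) → V} (hx : ¬ Function.Injective x)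
    (u : Fin (p + 1) → V) : altFun x u = 0 := by
  classical
  simp only [Function.Injective, not_forall] at hx
  obtain ⟨a, b, hab, hne⟩ := hx
  have hs : x ∘ Equiv.swap a b = x := by
    funext k
    simp only [Function.comp_apply]
    rcases eq_or_ne k a with rfl | hka
    · simp [hab]
    · rcases eq_or_ne k b with rfl | hkb
      · simp [hab]
      · rw [Equiv.swap_apply_of_ne_of_ne hka hkb]
  have h : altFun x u = - altFun x u := by
    unfold altFun
    rw [← Finset.sum_neg_distrib]
    refine Fintype.sum_equiv (Equiv.mulLeft (Equiv.swap a b)) _ _ fun π => ?_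
    have : x ∘ ⇑(Equiv.mulLeft (Equiv.swap a b) π) = x ∘ π := by
      rw [Equiv.coe_mulLeft, Equiv.Perm.coe_mul, ← Function.comp_assoc, hs]
    rw [this]
    split_ifs
    · simp [Equiv.Perm.sign_swap hne]
    · simp
  linarith

theorem elem_apply {p : ℕ} {x : Fin (p + 1) → Fin T.N → ℝ}
    (hx : Finset.univ.image x ∈ T.K.faces) (u : Fin (p + 1) → Fin T.N → ℝ) :
    (T.elem x).1 u = altFun x u := by
  classical
  by_cases h : Function.Injective x
  · have h' : T.IsSimplex x := ⟨h, by convert hx⟩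
    simp only [elem, altFun, h', if_true]
    refine Finset.sum_congr rfl fun π _ => ?_
    congr
  · have h' : ¬ T.IsSimplex x := fun h' => h h'.1
    rw [altFun_eq_zero h]
    simp [elem, h']

theorem elem_eq_zero {p : ℕ} {x : Fin (p + 1) → Fin T.N → ℝ} (hx : ¬ T.IsSimplex x) :
    T.elem x = 0 := by
  apply Chain.ext
  intro v
  simp [elem, hx]

theorem elem_self {p : ℕ} {x : Fin (p + 1) → Fin T.N → ℝ} (hx : T.IsSimplex x) :
    (T.elem x).1 x = 1 := by
  classical
  simp only [elem, hx, if_true]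
  rw [Finset.sum_eq_single 1]
  · simp
  · intro π _ hπ
    rw [if_neg]
    intro h
    apply hπ
    ext a
    have := congrFun h a
    simp only [Function.comp_apply] at this
    simp [← hx.1 this]
  · simp

theorem exists_perm_of_elem_ne_zero {p : ℕ} {x u : Fin (p + 1) → Fin T.N → ℝ}
    (h : (T.elem x).1 u ≠ 0) : T.IsSimplex x ∧ ∃ π : Equiv.Perm (Fin (p + 1)), u = x ∘ π := by
  classical
  by_cases hx : T.IsSimplex x
  · refine ⟨hx, ?_⟩
    simp only [elem, hx, if_true] at h
    obtain ⟨π, -, hπ⟩ := Finset.exists_ne_zero_of_sum_ne_zero h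
    exact ⟨π, by by_contra h; simp [h] at hπ⟩
  · simp [T.elem_eq_zero hx] at h

theorem sum_perm_succ {V : Type*} [AddCommMonoid V] {p : ℕ}
    (f : Equiv.Perm (Fin (p + 2)) → V) :
    ∑ π, f π = ∑ i : Fin (p + 2), ∑ τ : Equiv.Perm (Fin (p + 1)),
      f (i.cycleRange.symm * Equiv.Perm.decomposeFin.symm (0, τ)) := by
  rw [← Fintype.sum_prod_type' (f := fun (i : Fin (p + 2)) (τ : Equiv.Perm (Fin (p + 1))) =>
      f (i.cycleRange.symm * Equiv.Perm.decomposeFin.symm (0, τ)))]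
  symm
  refine Fintype.sum_bijective (fun x : Fin (p + 2) × Equiv.Perm (Fin (p + 1)) =>
    x.1.cycleRange.symm * Equiv.Perm.decomposeFin.symm (0, x.2)) ?_ _ _ fun _ => rfl
  rw [Fintype.bijective_iff_injective_and_card]
  constructor
  · rintro ⟨i, τ⟩ ⟨j, ρ⟩ h
    have h0 := Equiv.congr_fun h 0
    simp only [Equiv.Perm.coe_mul, Function.comp_apply, Equiv.Perm.decomposeFin_symm_apply_zero,
      Fin.cycleRange_symm_zero] at h0
    subst h0
    have := mul_left_cancel h
    simpa using Equiv.Perm.decomposeFin.symm.injective this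
  · simp [Fintype.card_perm, Nat.factorial_succ]

theorem sum_altFun_cons {V : Type*} {p : ℕ} (x : Fin (p + 2) → V) (S : Finset V)
    (hx : ∀ k, x k ∈ S) (u : Fin (p + 1) → V) :
    ∑ w ∈ S, altFun x (Fin.cons w u) =
      ∑ i : Fin (p + 2), (-1) ^ (i : ℕ) * altFun (x ∘ i.succAbove) u := by
  classical
  unfold altFun
  rw [Finset.sum_comm, sum_perm_succ]
  refine Finset.sum_congr rfl fun i _ => ?_
  rw [Finset.mul_sum]
  refine Finset.sum_congr rfl fun τ _ => ?_
  have e : x ∘ ⇑(i.cycleRange.symm * Equiv.Perm.decomposeFin.symm (0, τ)) =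
      Fin.cons (x i) ((x ∘ i.succAbove) ∘ τ) := by
    funext k
    refine Fin.cases ?_ (fun j => ?_) k <;> simp
  rw [Finset.sum_eq_single (x i)]
  · rw [e]
    have : (Fin.cons (x i) u = (Fin.cons (x i) ((x ∘ i.succAbove) ∘ τ) : Fin (p + 2) → V)) ↔
        u = (x ∘ i.succAbove) ∘ τ := Fin.cons_right_injective (α := fun _ => V) (x i) |>.eq_iff
    simp only [this, Equiv.Perm.sign_mul, Equiv.Perm.sign_symm, Fin.sign_cycleRange,
      Equiv.Perm.decomposeFin.symm_sign]
    split_ifs <;> simp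
  · intro w _ hw
    rw [if_neg]
    intro h
    rw [e] at h
    exact hw (by simpa using congrFun h 0)
  · intro h
    exact absurd (hx i) h

theorem image_succAbove_mem {p : ℕ} {x : Fin (p + 2) → Fin T.N → ℝ} {f : Fin (p + 1) → Fin (p + 2)}
    [DecidableEq (Fin T.N → ℝ)]
    (hx : Finset.univ.image x ∈ T.K.faces) : Finset.univ.image (x ∘ f) ∈ T.K.faces := by
  refine T.K.down_closed hx ?_ (by simp)
  intro y
  simp only [Finset.mem_image, Finset.mem_univ, true_and]
  rintro ⟨a, rfl⟩
  exact ⟨f a, rfl⟩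

/-- The boundary formula holds for degenerate tuples, too, the oriented simplex of such a tuple
being zero. -/
theorem bdSucc_elem {p : ℕ} {x : Fin (p + 2) → Fin T.N → ℝ} [DecidableEq (Fin T.N → ℝ)]
    (hx : Finset.univ.image x ∈ T.K.faces) :
    T.bdSucc p (T.elem x) = ∑ i : Fin (p + 2), (-1 : ℚ) ^ (i : ℕ) • T.elem (x ∘ i.succAbove) := by
  classical
  apply Chain.ext
  intro u
  rw [AddSubmonoidClass.coe_finsetSum, Finset.sum_apply]
  change ∑ w ∈ T.verts, (T.elem x).1 (Fin.cons w u) = _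
  rw [Finset.sum_congr rfl fun w _ => T.elem_apply (by convert hx) (Fin.cons w u)]
  rw [sum_altFun_cons x T.verts (fun k => T.mem_verts hx (by simp)) u]
  refine Finset.sum_congr rfl fun i _ => ?_
  change _ = (-1) ^ (i : ℕ) * (T.elem (x ∘ i.succAbove)).1 u
  rw [T.elem_apply]
  have := T.image_succAbove_mem (f := i.succAbove) hx
  convert this

theorem exists_linearOrder {V : Type*} (O : PartialOrder V) :
    ∃ L : LinearOrder V, ∀ a b, O.le a b → L.le a b := by
  classical
  obtain ⟨s, hs, hrs⟩ := extend_partialOrder (α := V) O.le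
  let L : LinearOrder V :=
    { le := s
      lt := fun a b => s a b ∧ ¬ s b a
      le_refl := hs.refl
      le_trans := hs.trans
      le_antisymm := hs.antisymm
      le_total := hs.total
      lt_iff_le_not_ge := fun _ _ => Iff.rfl
      toDecidableLE := Classical.decRel _ }
  exact ⟨L, hrs⟩

theorem exists_perm_strictMono {V : Type*} [LinearOrder V] {p : ℕ} {v : Fin p → V}
    (hv : Function.Injective v) : ∃ π : Equiv.Perm (Fin p), StrictMono (v ∘ π) :=
  ⟨Tuple.sort v, (Tuple.monotone_sort v).strictMono_of_injective
    (hv.comp (Tuple.sort v).injective)⟩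

theorem strictMono_comp_eq {V : Type*} [PartialOrder V] {p : ℕ} {v : Fin p → V}
    {π : Equiv.Perm (Fin p)} (hv : StrictMono v) (hvπ : StrictMono (v ∘ π)) : v ∘ π = v :=
  (hvπ.range_inj hv).1 (by simp [Set.range_comp])

open Classical in
/-- The tuples of vertices `(v_0, …, v_p)` with `v_0 < ⋯ < v_p`. -/
def increasing (O : PartialOrder (Fin T.N → ℝ)) (p : ℕ) : Finset (Fin (p + 1) → Fin T.N → ℝ) :=
  (Fintype.piFinset fun _ : Fin (p + 1) => T.verts).filter
    (fun v => ∀ a b : Fin (p + 1), a < b → O.lt (v a) (v b))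

theorem mem_increasing {O : PartialOrder (Fin T.N → ℝ)} {p : ℕ} {v : Fin (p + 1) → Fin T.N → ℝ} :
    v ∈ T.increasing O p ↔
      (∀ k, v k ∈ T.verts) ∧ ∀ a b : Fin (p + 1), a < b → O.lt (v a) (v b) := by
  simp [increasing]

theorem increasing_face {O : PartialOrder (Fin T.N → ℝ)} {p q : ℕ} {v : Fin (p + 1) → Fin T.N → ℝ}
    (hv : v ∈ T.increasing O p) {f : Fin (q + 1) → Fin (p + 1)} (hf : StrictMono f) :
    v ∘ f ∈ T.increasing O q := by
  rw [mem_increasing] at *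
  exact ⟨fun k => hv.1 _, fun a b hab => hv.2 _ _ (hf hab)⟩

theorem IsOrdering.lt_iff {T : Triangulation n} {O : PartialOrder (Fin T.N → ℝ)}
    (hO : T.IsOrdering O)
    {L : LinearOrder (Fin T.N → ℝ)} (hL : ∀ a b, O.le a b → L.le a b)
    {s : Finset (Fin T.N → ℝ)} (hs : s ∈ T.K.faces) {a b : Fin T.N → ℝ} (ha : a ∈ s) (hb : b ∈ s) :
    O.lt a b ↔ L.lt a b := by
  rw [O.lt_iff_le_not_ge, L.lt_iff_le_not_ge]
  constructor
  · rintro ⟨h1, h2⟩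
    refine ⟨hL _ _ h1, fun h3 => h2 ?_⟩
    obtain rfl := L.le_antisymm _ _ (hL _ _ h1) h3
    exact h1
  · rintro ⟨h1, h2⟩
    rcases hO s hs a ha b hb with h | h
    · exact ⟨h, fun h3 => h2 (hL _ _ h3)⟩
    · exact absurd (hL _ _ h) h2

/-- The vertices of a simplex can be sorted. -/
theorem IsOrdering.exists_perm {T : Triangulation n} {O : PartialOrder (Fin T.N → ℝ)}
    (hO : T.IsOrdering O) {p : ℕ} {v : Fin (p + 1) → Fin T.N → ℝ} (hv : T.IsSimplex v) :
    ∃ π : Equiv.Perm (Fin (p + 1)), v ∘ π ∈ T.increasing O p := by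
  classical
  obtain ⟨L, hL⟩ := exists_linearOrder O
  obtain ⟨π, hπ⟩ := @exists_perm_strictMono _ L _ v hv.1
  refine ⟨π, ?_⟩
  rw [mem_increasing]
  refine ⟨fun k => hv.mem_verts _, fun a b hab => ?_⟩
  rw [hO.lt_iff hL hv.2 (by simp) (by simp)]
  exact hπ hab

theorem eq_of_increasing_comp {O : PartialOrder (Fin T.N → ℝ)} {p : ℕ}
    {v : Fin (p + 1) → Fin T.N → ℝ} {π : Equiv.Perm (Fin (p + 1))}
    (hv : v ∈ T.increasing O p) (hvπ : v ∘ π ∈ T.increasing O p) : v ∘ π = v := by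
  rw [mem_increasing] at hv hvπ
  exact @strictMono_comp_eq _ O _ v π (fun a b hab => hv.2 a b hab) (fun a b hab => hvπ.2 a b hab)

variable {M : Type*} [AddCommGroup M] [Module ℚ M]

/-- The extension by linearity of the function `[v_0, …, v_p] ↦ g (v_0, …, v_p)` on the simplices
with `v_0 < ⋯ < v_p`. -/
def osum (O : PartialOrder (Fin T.N → ℝ)) {p : ℕ} (g : (Fin (p + 1) → Fin T.N → ℝ) → M) :
    T.Chain p →ₗ[ℚ] M where
  toFun c := ∑ v ∈ T.increasing O p, c.1 v • g v
  map_add' a b := by simp [add_smul, Finset.sum_add_distrib]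
  map_smul' r a := by simp [mul_smul, Finset.smul_sum]

theorem osum_apply (O : PartialOrder (Fin T.N → ℝ)) {p : ℕ} (g : (Fin (p + 1) → Fin T.N → ℝ) → M)
    (c : T.Chain p) : T.osum O g c = ∑ v ∈ T.increasing O p, c.1 v • g v := rfl

theorem osum_congr (O : PartialOrder (Fin T.N → ℝ)) {p : ℕ}
    {g g' : (Fin (p + 1) → Fin T.N → ℝ) → M} {c : T.Chain p}
    (h : ∀ v ∈ T.increasing O p, c.1 v ≠ 0 → g v = g' v) : T.osum O g c = T.osum O g' c := by
  refine Finset.sum_congr rfl fun v hv => ?_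
  by_cases hc : c.1 v = 0
  · simp [hc]
  · rw [h v hv hc]

theorem osum_elem {O : PartialOrder (Fin T.N → ℝ)} {p : ℕ} (g : (Fin (p + 1) → Fin T.N → ℝ) → M)
    {v : Fin (p + 1) → Fin T.N → ℝ} (hv : T.IsSimplex v) (hvO : v ∈ T.increasing O p) :
    T.osum O g (T.elem v) = g v := by
  rw [osum_apply, Finset.sum_eq_single v]
  · rw [T.elem_self hv, one_smul]
  · intro u hu huv
    have : (T.elem v).1 u = 0 := by
      by_contra h
      obtain ⟨-, π, rfl⟩ := T.exists_perm_of_elem_ne_zero h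
      exact huv (T.eq_of_increasing_comp hvO hu)
    rw [this, zero_smul]
  · exact fun h => absurd hvO h

theorem IsOrdering.chain_ext {T : Triangulation n} {O : PartialOrder (Fin T.N → ℝ)}
    (hO : T.IsOrdering O) {p : ℕ} {c d : T.Chain p}
    (h : ∀ v ∈ T.increasing O p, T.IsSimplex v → c.1 v = d.1 v) : c = d := by
  apply Chain.ext
  intro v
  by_cases hv : T.IsSimplex v
  · obtain ⟨π, hπ⟩ := hO.exists_perm hv
    have h1 := h _ hπ (hv.face π.injective)
    rw [chain_comp, chain_comp] at h1
    exact mul_left_cancel₀ (by simp) h1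
  · have h1 : c.1 v = 0 := by
      by_contra h
      exact hv (T.isSimplex_of_ne_zero c h)
    have h2 : d.1 v = 0 := by
      by_contra h
      exact hv (T.isSimplex_of_ne_zero d h)
    rw [h1, h2]

theorem IsOrdering.osum_elem_eq {T : Triangulation n} {O : PartialOrder (Fin T.N → ℝ)}
    (hO : T.IsOrdering O) {p : ℕ} (c : T.Chain p) : T.osum O T.elem c = c := by
  refine hO.chain_ext fun v hv hvs => ?_
  rw [osum_apply, AddSubmonoidClass.coe_finsetSum, Finset.sum_apply, Finset.sum_eq_single v]
  · change c.1 v * (T.elem v).1 v = _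
    rw [T.elem_self hvs, mul_one]
  · intro u hu huv
    change c.1 u * (T.elem u).1 v = 0
    have : (T.elem u).1 v = 0 := by
      by_contra h
      obtain ⟨-, π, rfl⟩ := T.exists_perm_of_elem_ne_zero h
      exact huv (T.eq_of_increasing_comp hu hv).symm
    rw [this, mul_zero]
  · exact fun h => absurd hv h

theorem IsOrdering.map_eq_osum {T : Triangulation n} {O : PartialOrder (Fin T.N → ℝ)}
    (hO : T.IsOrdering O) {p : ℕ} (f : T.Chain p →ₗ[ℚ] M) (c : T.Chain p) :
    f c = T.osum O (fun v => f (T.elem v)) c := by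
  conv_lhs => rw [← hO.osum_elem_eq c]
  simp [osum_apply, map_sum]

theorem IsOrdering.hom_ext {T : Triangulation n} {O : PartialOrder (Fin T.N → ℝ)}
    (hO : T.IsOrdering O) {p : ℕ} {f g : T.Chain p →ₗ[ℚ] M}
    (h : ∀ v ∈ T.increasing O p, T.IsSimplex v → f (T.elem v) = g (T.elem v)) : f = g := by
  ext c
  rw [hO.map_eq_osum f, hO.map_eq_osum g]
  exact T.osum_congr O fun v hv hc => h v hv (T.isSimplex_of_ne_zero c hc)

/-- The extension by linearity is compatible with boundaries. -/
theorem IsOrdering.osum_bdSucc {T : Triangulation n} {O : PartialOrder (Fin T.N → ℝ)}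
    (hO : T.IsOrdering O) {p : ℕ} (g : (Fin (p + 1) → Fin T.N → ℝ) → M) (c : T.Chain (p + 1)) :
    T.osum O g (T.bdSucc p c) =
      T.osum O (fun v => ∑ i : Fin (p + 2), (-1 : ℚ) ^ (i : ℕ) • g (v ∘ i.succAbove)) c := by
  classical
  rw [hO.map_eq_osum ((T.osum O g).comp (T.bdSucc p)) c |> fun h => (show T.osum O g
    (T.bdSucc p c) = _ from h)]
  refine T.osum_congr O fun v hv hc => ?_
  have hvs := T.isSimplex_of_ne_zero c hc
  rw [LinearMap.comp_apply, T.bdSucc_elem hvs.2, map_sum]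
  refine Finset.sum_congr rfl fun i _ => ?_
  rw [map_smul, T.osum_elem g (hvs.face Fin.succAbove_right_injective)
    (T.increasing_face hv (Fin.strictMono_succAbove i))]

theorem exists_isOrdering : ∃ O : PartialOrder (Fin T.N → ℝ), T.IsOrdering O := by
  obtain ⟨L, -⟩ := exists_linearOrder (V := Fin T.N → ℝ) inferInstance
  exact ⟨L.toPartialOrder, fun s _ v _ w _ => L.le_total v w⟩

theorem bdSucc_bdSucc {p : ℕ} (c : T.Chain (p + 2)) : T.bdSucc p (T.bdSucc (p + 1) c) = 0 := by
  classical
  apply Chain.ext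
  intro v
  change ∑ w ∈ T.verts, ∑ w' ∈ T.verts, c.1 (Fin.cons w' (Fin.cons w v)) = 0
  have h : ∀ w w', c.1 (Fin.cons w' (Fin.cons w v)) = - c.1 (Fin.cons w (Fin.cons w' v)) := by
    intro w w'
    have := T.chain_comp c (Fin.cons w (Fin.cons w' v)) (Equiv.swap 0 1)
    rw [Equiv.Perm.sign_swap (by simp)] at this
    have e : (Fin.cons w (Fin.cons w' v) : Fin (p + 3) → Fin T.N → ℝ) ∘ (Equiv.swap 0 1) =
        Fin.cons w' (Fin.cons w v) := by
      funext k
      refine Fin.cases ?_ (fun j => Fin.cases ?_ (fun l => ?_) j) k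
      · rw [Function.comp_apply, Equiv.swap_apply_left]
        rfl
      · rw [Function.comp_apply, Fin.succ_zero_eq_one, Equiv.swap_apply_right]
        rfl
      · rw [Function.comp_apply, Equiv.swap_apply_of_ne_of_ne (Fin.succ_ne_zero _)]
        · rfl
        · intro h
          exact absurd (Fin.succ_injective _ h) (Fin.succ_ne_zero _)
    rw [e] at this
    simpa using this
  have h2 := Finset.sum_comm (s := T.verts) (t := T.verts)
    (f := fun w w' => c.1 (Fin.cons w' (Fin.cons w v)))
  have h3 : ∑ w ∈ T.verts, ∑ w' ∈ T.verts, c.1 (Fin.cons w' (Fin.cons w v)) =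
      - ∑ w ∈ T.verts, ∑ w' ∈ T.verts, c.1 (Fin.cons w (Fin.cons w' v)) := by
    simp only [← Finset.sum_neg_distrib]
    exact Finset.sum_congr rfl fun w _ => Finset.sum_congr rfl fun w' _ => h w w'
  linarith

/-! ### The cap product -/

/-- The cap product with the function `f` on the increasing `q`-simplices. -/
def capOn (O : PartialOrder (Fin T.N → ℝ)) {p : ℕ} (q : ℕ)
    (f : (Fin (q + 1) → Fin T.N → ℝ) → ℚ) : T.Chain (p + q) →ₗ[ℚ] T.Chain p :=
  T.osum O fun v => f (fun k : Fin (q + 1) => v (k.castLE (by omega))) •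
    T.elem fun k : Fin (p + 1) => v ⟨k + q, by omega⟩

theorem cap_eq_capOn (O : PartialOrder (Fin T.N → ℝ)) {p q : ℕ} (u : T.Cochain q)
    (c : T.Chain (p + q)) : T.cap O u c = T.capOn O q (fun v => u (T.elem v)) c := by
  unfold cap capOn
  rw [osum_apply]
  refine Finset.sum_congr ?_ fun v _ => by rw [mul_smul]
  unfold increasing
  congr

/-- The faces of a simplex, sorted by whether the omitted vertex lies in the front or in the back.
The term in which the last vertex of the enlarged front is omitted occurs in both sums on the right
hand side, with opposite signs. -/
theorem sum_front_back {V : Type*} {p q : ℕ} (v : Fin (p + q + 2) → V)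
    (f : (Fin (q + 1) → V) → ℚ) (e : (Fin (p + 1) → V) → M) :
    ∑ i : Fin (p + q + 2), (-1 : ℚ) ^ (i : ℕ) •
        (f (fun k : Fin (q + 1) => (v ∘ i.succAbove) (k.castLE (by omega))) •
          e fun k : Fin (p + 1) => (v ∘ i.succAbove) ⟨k + q, by omega⟩) =
      (∑ i : Fin (q + 2), (-1 : ℚ) ^ (i : ℕ) *
          f ((fun k : Fin (q + 2) => v (k.castLE (by omega))) ∘ i.succAbove)) •
          e (fun k : Fin (p + 1) => v ⟨k + (q + 1), by omega⟩) +
        (-1 : ℚ) ^ q • f (fun k : Fin (q + 1) => v (k.castLE (by omega))) •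
          ∑ j : Fin (p + 2), (-1 : ℚ) ^ (j : ℕ) •
            e ((fun k : Fin (p + 2) => v ⟨k + q, by omega⟩) ∘ j.succAbove) := by
  have hpq : (q + 1) + (p + 1) = p + q + 2 := by omega
  rw [← (finCongr hpq).sum_comp, Fin.sum_univ_add, Fin.sum_univ_castSucc (n := q + 1),
    Fin.sum_univ_succ (n := p + 1), add_smul, Finset.sum_smul, smul_add, smul_add]
  have e1 : ∀ i : Fin (q + 1),
      (-1 : ℚ) ^ (finCongr hpq (Fin.castAdd (p + 1) i) : ℕ) •
        (f (fun k : Fin (q + 1) =>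
            (v ∘ (finCongr hpq (Fin.castAdd (p + 1) i)).succAbove) (k.castLE (by omega))) •
          e fun k : Fin (p + 1) =>
            (v ∘ (finCongr hpq (Fin.castAdd (p + 1) i)).succAbove) ⟨k + q, by omega⟩) =
      ((-1 : ℚ) ^ (i.castSucc : ℕ) *
          f ((fun k : Fin (q + 2) => v (k.castLE (by omega))) ∘ i.castSucc.succAbove)) •
          e (fun k : Fin (p + 1) => v ⟨k + (q + 1), by omega⟩) := by
    intro i
    rw [smul_smul]
    congr 1
    · congr 2
      funext k
      simp only [Function.comp_apply]
      congr 1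
      ext
      simp only [Fin.succAbove, Fin.lt_def, finCongr_apply]
      split_ifs with h1 h2 h2
      all_goals simp at h1 h2 ⊢
      all_goals omega
    · congr 1
      funext k
      simp only [Function.comp_apply]
      congr 1
      ext
      simp only [Fin.succAbove, Fin.lt_def, finCongr_apply]
      split_ifs with h
      · simp at h
        omega
      · simp
        omega
  have e2 : ∀ j : Fin (p + 1),
      (-1 : ℚ) ^ (finCongr hpq (Fin.natAdd (q + 1) j) : ℕ) •
        (f (fun k : Fin (q + 1) =>
            (v ∘ (finCongr hpq (Fin.natAdd (q + 1) j)).succAbove) (k.castLE (by omega))) •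
          e fun k : Fin (p + 1) =>
            (v ∘ (finCongr hpq (Fin.natAdd (q + 1) j)).succAbove) ⟨k + q, by omega⟩) =
      (-1 : ℚ) ^ q • f (fun k : Fin (q + 1) => v (k.castLE (by omega))) •
          (-1 : ℚ) ^ (j.succ : ℕ) •
            e ((fun k : Fin (p + 2) => v ⟨k + q, by omega⟩) ∘ j.succ.succAbove) := by
    intro j
    rw [smul_smul, smul_smul, smul_smul]
    congr 1
    · have : (fun k : Fin (q + 1) =>
            (v ∘ (finCongr hpq (Fin.natAdd (q + 1) j)).succAbove) (k.castLE (by omega))) =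
            fun k : Fin (q + 1) => v (k.castLE (by omega)) := by
        funext k
        simp only [Function.comp_apply]
        congr 1
        ext
        simp only [Fin.succAbove, Fin.lt_def, finCongr_apply]
        split_ifs with h
        · simp
        · simp at h
          omega
      rw [this]
      simp only [finCongr_apply, Fin.val_cast, Fin.val_natAdd, Fin.val_succ]
      ring
    · congr 1
      funext k
      simp only [Function.comp_apply]
      congr 1
      ext
      simp only [Fin.succAbove, Fin.lt_def, finCongr_apply]
      split_ifs with h1 h2 h2 <;> simp at h1 h2 ⊢ <;> omega
  rw [Finset.sum_congr rfl fun i _ => e1 i, Finset.sum_congr rfl fun j _ => e2 j,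
    ← Finset.smul_sum, ← Finset.smul_sum]
  refine Eq.trans ?_ (add_assoc _ _ _).symm
  congr 1
  have e3 : ((fun k : Fin (q + 2) => v (k.castLE (by omega))) ∘ (Fin.last (q + 1)).succAbove) =
      fun k : Fin (q + 1) => v (k.castLE (by omega)) := by
    funext k
    simp
  have e4 : ((fun k : Fin (p + 2) => v ⟨k + q, by omega⟩) ∘ (0 : Fin (p + 2)).succAbove) =
      fun k : Fin (p + 1) => v ⟨k + (q + 1), by omega⟩ := by
    funext k
    simp only [Function.comp_apply, Fin.succAbove_zero, Fin.val_succ]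
    congr 2
    omega
  rw [e3, e4]
  simp only [Fin.val_last, Fin.val_zero, pow_zero, one_smul, pow_succ]
  module

/-- The Leibniz rule for the cap product with `2`-cochains. -/
theorem IsOrdering.bdSucc_capOn_two {T : Triangulation n} {O : PartialOrder (Fin T.N → ℝ)}
    (hO : T.IsOrdering O) {p : ℕ} (f : (Fin 3 → Fin T.N → ℝ) → ℚ) (c : T.Chain (p + 3)) :
    T.bdSucc p (T.capOn O (p := p + 1) 2 f c) = T.capOn O 2 f (T.bdSucc (p + 2) c) -
      T.capOn O 3 (fun v => ∑ i : Fin 4, (-1) ^ (i : ℕ) * f (v ∘ i.succAbove)) c := by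
  classical
  have h1 : T.bdSucc p (T.capOn O (p := p + 1) 2 f c) = T.osum O (fun v : Fin (p + 4) → _ =>
      f (fun k : Fin 3 => v (k.castLE (by omega))) •
      T.bdSucc p (T.elem fun k : Fin (p + 2) => v ⟨k + 2, by omega⟩)) c := by
    simp only [capOn, osum_apply, map_sum, map_smul]
  rw [h1]
  unfold capOn
  rw [hO.osum_bdSucc, osum_apply, osum_apply, osum_apply, ← Finset.sum_sub_distrib]
  refine Finset.sum_congr rfl fun v hv => ?_
  by_cases hc : c.1 v = 0
  · simp [hc]
  rw [← smul_sub]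
  congr 1
  have hvs := T.isSimplex_of_ne_zero c hc
  have hb : T.IsSimplex (fun k : Fin (p + 2) => v ⟨k + 2, by omega⟩) :=
    hvs.face (f := fun k : Fin (p + 2) => (⟨k + 2, by omega⟩ : Fin (p + 4)))
      (fun a b h => Fin.ext (by simpa using h))
  rw [T.bdSucc_elem (by convert hb.2), sum_front_back v f T.elem]
  simp

/-- The Leibniz rule for the cap product with `3`-cochains. -/
theorem IsOrdering.bdSucc_capOn_three {T : Triangulation n} {O : PartialOrder (Fin T.N → ℝ)}
    (hO : T.IsOrdering O) {p : ℕ} (f : (Fin 4 → Fin T.N → ℝ) → ℚ) (c : T.Chain (p + 4)) :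
    T.bdSucc p (T.capOn O (p := p + 1) 3 f c) =
      T.capOn O 4 (fun v => ∑ i : Fin 5, (-1) ^ (i : ℕ) * f (v ∘ i.succAbove)) c -
      T.capOn O 3 f (T.bdSucc (p + 3) c) := by
  classical
  have h1 : T.bdSucc p (T.capOn O (p := p + 1) 3 f c) = T.osum O (fun v : Fin (p + 5) → _ =>
      f (fun k : Fin 4 => v (k.castLE (by omega))) •
      T.bdSucc p (T.elem fun k : Fin (p + 2) => v ⟨k + 3, by omega⟩)) c := by
    simp only [capOn, osum_apply, map_sum, map_smul]
  rw [h1]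
  unfold capOn
  rw [hO.osum_bdSucc, osum_apply, osum_apply, osum_apply, ← Finset.sum_sub_distrib]
  refine Finset.sum_congr rfl fun v hv => ?_
  by_cases hc : c.1 v = 0
  · simp [hc]
  rw [← smul_sub]
  congr 1
  have hvs := T.isSimplex_of_ne_zero c hc
  have hb : T.IsSimplex (fun k : Fin (p + 2) => v ⟨k + 3, by omega⟩) :=
    hvs.face (f := fun k : Fin (p + 2) => (⟨k + 3, by omega⟩ : Fin (p + 5)))
      (fun a b h => Fin.ext (by simpa using h))
  rw [T.bdSucc_elem (by convert hb.2), sum_front_back v f T.elem]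
  module

end Triangulation
end CubicalChains

namespace CubicalChains

/-! ### Cells of a triangulation -/

namespace Triangulation

variable {n : ℕ} (T : Triangulation n)

theorem mem_cell {s : Finset (Fin T.N → ℝ)} {x : T.K.space} :
    T.Φ x ∈ T.cell s ↔ x.1 ∈ convexHull ℝ (s : Set (Fin T.N → ℝ)) :=
  ⟨fun ⟨_, hy, hyx⟩ => T.Φ.injective hyx ▸ hy, fun h => ⟨x, h, rfl⟩⟩

theorem cell_mono {s t : Finset (Fin T.N → ℝ)} (h : s ⊆ t) : T.cell s ⊆ T.cell t := by
  rintro _ ⟨x, hx, rfl⟩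
  exact ⟨x, convexHull_mono (by exact_mod_cast h) hx, rfl⟩

theorem openCell_subset_cell (s : Finset (Fin T.N → ℝ)) : T.openCell s ⊆ T.cell s := by
  rintro _ ⟨x, hx, rfl⟩
  exact ⟨x, hx.1, rfl⟩

theorem exists_openCell {s : Finset (Fin T.N → ℝ)} {z : P n} (hz : z ∈ T.cell s) :
    ∃ t ⊆ s, t.Nonempty ∧ z ∈ T.openCell t := by
  classical
  induction s using Finset.strongInduction with
  | H s ih =>
    obtain ⟨x, hx, rfl⟩ := hz
    by_cases h : ∃ t ⊂ s, x.1 ∈ convexHull ℝ (t : Set (Fin T.N → ℝ))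
    · obtain ⟨t, hts, hxt⟩ := h
      obtain ⟨t', h1, h2, h3⟩ := ih t hts ⟨x, hxt, rfl⟩
      exact ⟨t', h1.trans hts.subset, h2, h3⟩
    · push Not at h
      refine ⟨s, subset_rfl, ?_, x, ⟨hx, h⟩, rfl⟩
      have := convexHull_nonempty_iff.1 ⟨_, hx⟩
      exact_mod_cast this

theorem exists_cell (z : P n) : ∃ s ∈ T.K.faces, z ∈ T.cell s := by
  obtain ⟨s, hs, hx⟩ := Geometry.SimplicialComplex.mem_space_iff.1 (T.Φ.symm z).2
  exact ⟨s, hs, _, hx, by simp⟩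

theorem subset_of_mem_openCell {s t : Finset (Fin T.N → ℝ)} (hs : s ∈ T.K.faces)
    (ht : t ∈ T.K.faces) {z : P n} (hzt : z ∈ T.openCell t) (hzs : z ∈ T.cell s) : t ⊆ s := by
  classical
  obtain ⟨x, ⟨hxt, hx⟩, rfl⟩ := hzt
  have hxs := T.mem_cell.1 hzs
  by_contra hts
  refine hx (s ∩ t) ?_ ?_
  · refine ⟨Finset.inter_subset_right, fun h => hts (h.trans Finset.inter_subset_left)⟩
  · rw [Finset.coe_inter]
    exact T.K.inter_subset_convexHull hs ht ⟨hxs, hxt⟩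

theorem IsSubcomplex.cell_subset {T : Triangulation n} {S : Set (P n)} (hS : T.IsSubcomplex S)
    {t : Finset (Fin T.N → ℝ)} (ht : t ∈ T.K.faces) {z : P n} (hzt : z ∈ T.openCell t)
    (hz : z ∈ S) : T.cell t ⊆ S := by
  obtain ⟨s, hs, hzs, hsS⟩ := hS z hz
  exact (T.cell_mono (T.subset_of_mem_openCell hs ht hzt hzs)).trans hsS

theorem openCell_nonempty {s : Finset (Fin T.N → ℝ)} (hs : s ∈ T.K.faces) :
    (T.openCell s).Nonempty := by
  classical
  have hne := T.K.nonempty_of_mem_faces hs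
  have hc := s.centroid_mem_convexHull hne (R := ℝ)
  refine ⟨T.Φ ⟨s.centroid ℝ id, T.K.convexHull_subset_space hs hc⟩, _, ⟨hc, fun t hts ht => ?_⟩, rfl⟩
  change s.centroid ℝ id ∈ _ at ht
  obtain ⟨a, has, hat⟩ := Finset.exists_of_ssubset hts
  have hcard : (Finset.univ : Finset s).card ≠ 0 := by
    simpa using hne.ne_empty
  have h := (T.K.indep hs).eq_zero_of_affineCombination_mem_affineSpan
    (fs := Finset.univ) (w := (Finset.univ : Finset s).centroidWeights ℝ)
    (Finset.sum_centroidWeights_eq_one_of_card_ne_zero ℝ _ hcard)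
    (s := {x : s | x.1 ∈ t}) (i := ⟨a, has⟩) ?_ (Finset.mem_univ _) hat
  · simp [Finset.centroidWeights_apply] at h
    exact hne.ne_empty h
  · change Finset.univ.centroid ℝ (fun x : s => x.1) ∈ _
    rw [Finset.centroid_univ]
    refine affineSpan_mono ℝ ?_ (convexHull_subset_affineSpan _ ht)
    intro y hy
    exact ⟨⟨y, hts.subset hy⟩, hy, rfl⟩

theorem mem_tupleCell {p : ℕ} {v : Fin (p + 1) → Fin T.N → ℝ} {x : T.K.space} :
    T.Φ x ∈ T.tupleCell v ↔ x.1 ∈ convexHull ℝ (Set.range v) := by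
  rw [tupleCell, mem_cell]
  simp

theorem tupleCell_comp_subset {p q : ℕ} (v : Fin (p + 1) → Fin T.N → ℝ)
    (f : Fin (q + 1) → Fin (p + 1)) : T.tupleCell (v ∘ f) ⊆ T.tupleCell v := by
  rintro z ⟨x, hx, rfl⟩
  rw [mem_tupleCell]
  refine convexHull_mono ?_ hx
  simpa [Function.comp_def] using Set.range_comp_subset_range f v

theorem cell_subset_tupleCell {p : ℕ} {v : Fin (p + 1) → Fin T.N → ℝ}
    {s : Finset (Fin T.N → ℝ)} (hs : (s : Set (Fin T.N → ℝ)) ⊆ Set.range v) :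
    T.cell s ⊆ T.tupleCell v := by
  rintro z ⟨x, hx, rfl⟩
  rw [mem_tupleCell]
  exact convexHull_mono hs hx

theorem IsSimplex.mem_faces {T : Triangulation n} {p : ℕ} {v : Fin (p + 1) → Fin T.N → ℝ}
    (hv : T.IsSimplex v) {s : Finset (Fin T.N → ℝ)} (hs : (s : Set (Fin T.N → ℝ)) ⊆ Set.range v)
    (hne : s.Nonempty) : s ∈ T.K.faces := by
  classical
  refine T.K.down_closed hv.2 ?_ hne
  intro x hx
  obtain ⟨a, rfl⟩ := hs hx
  simp

/-- A full subcomplex meets a simplex in the face spanned by the vertices which belong to it. -/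
theorem IsFullSubcomplex.exists_face {T : Triangulation n} {S : Set (P n)}
    (hS : T.IsFullSubcomplex S) {s : Finset (Fin T.N → ℝ)} (hs : s ∈ T.K.faces)
    (hne : (T.cell s ∩ S).Nonempty) :
    ∃ t ⊆ s, t ∈ T.K.faces ∧ T.cell s ∩ S = T.cell t ∧ ∀ x ∈ s, (x ∈ t ↔ T.cell {x} ⊆ S) := by
  classical
  have key : ∀ z ∈ T.cell s ∩ S, ∃ t ⊆ s.filter fun x => T.cell {x} ⊆ S, t.Nonempty ∧
      z ∈ T.openCell t := by
    rintro z ⟨hzs, hzS⟩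
    obtain ⟨t, hts, htne, hzt⟩ := T.exists_openCell hzs
    refine ⟨t, fun x hx => ?_, htne, hzt⟩
    rw [Finset.mem_filter]
    exact ⟨hts hx, (T.cell_mono (Finset.singleton_subset_iff.2 hx)).trans
      (hS.1.cell_subset (T.K.down_closed hs hts htne) hzt hzS)⟩
  obtain ⟨z, hz⟩ := hne
  obtain ⟨t, ht, htne, -⟩ := key z hz
  have hf : (s.filter fun x => T.cell {x} ⊆ S) ∈ T.K.faces :=
    T.K.down_closed hs (Finset.filter_subset _ _) (htne.mono ht)
  refine ⟨s.filter fun x => T.cell {x} ⊆ S, Finset.filter_subset _ _, hf, ?_, ?_⟩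
  · apply Set.Subset.antisymm
    · intro z hz
      obtain ⟨t, ht, -, hzt⟩ := key z hz
      exact T.cell_mono ht (T.openCell_subset_cell t hzt)
    · exact Set.subset_inter (T.cell_mono (Finset.filter_subset _ _))
        (hS.2 _ hf fun v hv => (Finset.mem_filter.1 hv).2)
  · intro x hx
    simp [hx]

end Triangulation

/-! ### Dimensions of cells -/

theorem saDim_mono {ι : Type} [Fintype ι] {S S' : Set (ι → ℝ)} (h : S ⊆ S') :
    saDim S ≤ saDim S' := by
  classical
  unfold saDim
  refine Finset.sup_mono fun I hI => ?_
  simp only [Finset.mem_filter, Finset.mem_univ, true_and] at hI ⊢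
  exact hI.mono (interior_mono (Set.image_mono h))

theorem saDim_empty {ι : Type} [Fintype ι] : saDim (∅ : Set (ι → ℝ)) = ⊥ := by
  unfold saDim
  simp

theorem saDim_le_of_dimH_le {ι : Type} [Fintype ι] {S : Set (ι → ℝ)} {d : ℕ}
    (h : dimH S ≤ d) : saDim S ≤ d := by
  classical
  unfold saDim
  refine Finset.sup_le fun I hI => ?_
  simp only [Finset.mem_filter, Finset.mem_univ, true_and] at hI
  have h1 := Real.dimH_of_nonempty_interior hI
  have h2 : dimH ((fun (x : ι → ℝ) (i : I) => x i) '' S) ≤ dimH S := by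
    refine LipschitzWith.dimH_image_le (K := 1) ?_ S
    refine LipschitzWith.of_dist_le_mul fun x y => ?_
    rw [NNReal.coe_one, one_mul]
    exact (dist_pi_le_iff dist_nonneg).2 fun i => dist_le_pi_dist x y i
  rw [h1] at h2
  have h3 := h2.trans h
  simp only [Module.finrank_fintype_fun_eq_card, Fintype.card_coe] at h3
  exact_mod_cast h3

theorem IsRegularSubmanifold.dimH_le {ι : Type} [Fintype ι] {d : ℕ} {M : Set (ι → ℝ)}
    (h : IsRegularSubmanifold d M) : dimH M ≤ d := by
  by_contra hlt
  push Not at hlt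
  obtain ⟨x, hx, hxt⟩ := exists_mem_nhdsWithin_lt_dimH_of_lt_dimH hlt
  obtain ⟨U, V, f, g, hU, hxU, hV, hf, -, hfV, -⟩ := h x hx
  have h1 := hxt (M ∩ U) (Filter.inter_mem self_mem_nhdsWithin
    (mem_nhdsWithin_of_mem_nhds (hU.mem_nhds hxU)))
  rw [← hfV] at h1
  refine absurd h1 (not_lt.2 ?_)
  refine (dimH_image_le_of_locally_lipschitzOn (s := V) (f := f) fun v hv => ?_).trans ?_
  · have hc : ContDiffAt ℝ 1 f v := ((hf v hv).contDiffAt (hV.mem_nhds hv)).of_le (by simp)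
    obtain ⟨K, t, ht, hK⟩ := hc.exists_lipschitzOnWith
    exact ⟨K, t, mem_nhdsWithin_of_mem_nhds ht, hK⟩
  · exact (dimH_mono (Set.subset_univ V)).trans (Real.dimH_univ_pi_fin d).le

/-- Some `d` coordinates restrict to an isomorphism on the image of an injective linear map
`ℝ^d → ℝ^ι`. -/
theorem exists_coordinates {ι : Type} [Fintype ι] {d : ℕ} (L : (Fin d → ℝ) →ₗ[ℝ] (ι → ℝ))
    (hL : Function.Injective L) : ∃ I : Finset ι, I.card = d ∧
      Function.Injective fun (x : Fin d → ℝ) (i : I) => L x i := by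
  classical
  let φ : ι → Module.Dual ℝ (Fin d → ℝ) := fun i => (LinearMap.proj i).comp L
  obtain ⟨I, -, -, hI, hli⟩ := exists_linearIndepOn_extension (K := ℝ) (v := φ) (s := ∅)
    (t := Set.univ) (by simp) (Set.empty_subset _)
  have hzero : ∀ x : Fin d → ℝ, (∀ i ∈ I, L x i = 0) → x = 0 := by
    intro x hx
    apply hL
    rw [map_zero]
    funext i
    have hi : φ i ∈ Submodule.span ℝ (φ '' I) := hI (Set.mem_image_of_mem φ (Set.mem_univ i))
    have : Submodule.span ℝ (φ '' I) ≤ LinearMap.ker (Module.Dual.eval ℝ (Fin d → ℝ) x) := by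
      rw [Submodule.span_le]
      rintro _ ⟨j, hj, rfl⟩
      exact hx j hj
    exact this hi
  let P : (Fin d → ℝ) →ₗ[ℝ] (I.toFinset → ℝ) := LinearMap.pi fun i => φ i.1
  have hP : Function.Injective P := by
    rw [injective_iff_map_eq_zero]
    intro x hx
    exact hzero x fun i hi => congrFun hx ⟨i, by simpa using hi⟩
  refine ⟨I.toFinset, le_antisymm ?_ ?_, hP⟩
  · have := LinearIndependent.fintype_card_le_finrank hli
    simpa [Subspace.dual_finrank_eq, Set.toFinset_card] using this
  · simpa using LinearMap.finrank_le_finrank_of_injective hP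

/-- A non-empty submanifold of dimension `d` has a projection to `d` coordinates which is a local
diffeomorphism, so that the image has interior points. -/
theorem IsRegularSubmanifold.le_saDim {ι : Type} [Fintype ι] {d : ℕ} {M : Set (ι → ℝ)}
    (h : IsRegularSubmanifold d M) (hM : M.Nonempty) : (d : WithBot ℕ) ≤ saDim M := by
  classical
  obtain ⟨x, hx⟩ := hM
  obtain ⟨U, V, f, g, hU, hxU, hV, hf, hg, hfV, hgf⟩ := h x hx
  obtain ⟨v, hv, rfl⟩ : x ∈ f '' V := hfV ▸ ⟨hx, hxU⟩
  have hfv : ContDiffAt ℝ 1 f v := ((hf v hv).contDiffAt (hV.mem_nhds hv)).of_le (by simp)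
  have hgv : ContDiffAt ℝ 1 g (f v) := ((hg _ hxU).contDiffAt (hU.mem_nhds hxU)).of_le (by simp)
  have hfd := hfv.hasStrictFDerivAt (by simp)
  have hgd := hgv.hasStrictFDerivAt (by simp)
  have hinj : Function.Injective (fderiv ℝ f v : (Fin d → ℝ) →ₗ[ℝ] (ι → ℝ)) := by
    have h1 := hgd.hasFDerivAt.comp v hfd.hasFDerivAt
    have h2 : HasFDerivAt (g ∘ f) (ContinuousLinearMap.id ℝ (Fin d → ℝ)) v :=
      (hasFDerivAt_id v).congr_of_eventuallyEq
        (Filter.mem_of_superset (hV.mem_nhds hv) fun w hw => hgf w hw)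
    have h3 := h1.unique h2
    intro a b hab
    have ha := congrArg (fun A : (Fin d → ℝ) →L[ℝ] (Fin d → ℝ) => A a) h3
    have hb := congrArg (fun A : (Fin d → ℝ) →L[ℝ] (Fin d → ℝ) => A b) h3
    simp only [ContinuousLinearMap.comp_apply, ContinuousLinearMap.id_apply] at ha hb
    rw [← ha, ← hb]
    exact congrArg _ hab
  obtain ⟨I, hI, hIinj⟩ := exists_coordinates _ hinj
  let π : (ι → ℝ) →L[ℝ] (I → ℝ) := ContinuousLinearMap.pi fun i => ContinuousLinearMap.proj i.1
  let A : (Fin d → ℝ) ≃ₗ[ℝ] (I → ℝ) := LinearMap.linearEquivOfInjective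
    ((π.comp (fderiv ℝ f v) : (Fin d → ℝ) →L[ℝ] (I → ℝ)) : (Fin d → ℝ) →ₗ[ℝ] (I → ℝ))
    (fun a b hab => hIinj hab) (by simp [hI])
  have hπ : HasStrictFDerivAt (fun w => π (f w)) ((A.toContinuousLinearEquiv :
      (Fin d → ℝ) →L[ℝ] (I → ℝ))) v := by
    exact π.hasStrictFDerivAt.comp v hfd
  have hnhds := hπ.map_nhds_eq_of_equiv
  have hint : (interior ((fun (x : ι → ℝ) (i : I) => x i) '' M)).Nonempty := by
    refine ⟨π (f v), mem_interior_iff_mem_nhds.2 ?_⟩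
    rw [← hnhds]
    refine Filter.mem_of_superset (Filter.image_mem_map (hV.mem_nhds hv)) ?_
    rintro _ ⟨w, hw, rfl⟩
    have : f w ∈ M ∩ U := hfV ▸ ⟨w, hw, rfl⟩
    exact ⟨f w, this.1, rfl⟩
  rw [← hI]
  exact Finset.le_sup (f := fun I : Finset ι => ((I.card : ℕ) : WithBot ℕ))
    (by simpa using hint)

namespace GoodTriangulation

variable {n : ℕ} (T : GoodTriangulation n)

theorem le_saDim {s : Finset (Fin T.N → ℝ)} (hs : s ∈ T.K.faces) {S : Set (P n)}
    (hS : T.openCell s ⊆ S) : ((s.card - 1 : ℕ) : WithBot ℕ) ≤ saDim (embed '' S) :=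
  ((T.facewise_regular s hs).le_saDim ((T.openCell_nonempty hs).image _)).trans
    (saDim_mono (Set.image_mono hS))

/-- A union of open simplices has at most the maximum of their dimensions; the codimension `k` is
on the left hand side as `saDim ∅ = ⊥`. -/
theorem saDim_le {S : Set (P n)} {p k : ℕ}
    (hS : ∀ z ∈ S, ∃ t ∈ T.K.faces, z ∈ T.openCell t ∧ t.card + k ≤ p + 1) :
    saDim (embed '' S) + (k : WithBot ℕ) ≤ p := by
  classical
  rcases S.eq_empty_or_nonempty with rfl | ⟨z, hz⟩
  · simp [saDim_empty]
  · obtain ⟨t, ht, -, htk⟩ := hS z hz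
    have hcard := Finset.card_pos.2 (T.K.nonempty_of_mem_faces ht)
    have hd : dimH (embed '' S) ≤ ((p - k : ℕ) : ENNReal) := by
      have hsub : embed '' S ⊆ ⋃ t ∈ {t | t ∈ T.K.faces ∧ t.card + k ≤ p + 1},
          embed '' T.openCell t := by
        rintro _ ⟨z, hz, rfl⟩
        obtain ⟨t, ht, hzt, htk⟩ := hS z hz
        exact Set.mem_biUnion (show t ∈ {t | t ∈ T.K.faces ∧ t.card + k ≤ p + 1} from ⟨ht, htk⟩)
          ⟨z, hzt, rfl⟩
      refine (dimH_mono hsub).trans ?_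
      rw [dimH_bUnion (T.finite.subset fun _ h => h.1).countable]
      refine iSup₂_le fun t ht => ((T.facewise_regular t ht.1).dimH_le).trans ?_
      have := ht.2
      exact_mod_cast (by omega : t.card - 1 ≤ p - k)
    have h1 := saDim_le_of_dimH_le hd
    calc saDim (embed '' S) + (k : WithBot ℕ) ≤ ((p - k : ℕ) : WithBot ℕ) + (k : WithBot ℕ) := by
          gcongr
      _ = p := by
          norm_cast
          omega

/-- Dimensions are intrinsic: a simplex of one good triangulation which is contained in a simplex of
another one has at most as many vertices. -/
theorem card_le_of_cell_subset (T' : GoodTriangulation n) {s' : Finset (Fin T'.N → ℝ)}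
    (hs' : s' ∈ T'.K.faces) {s : Finset (Fin T.N → ℝ)} (hs : s ∈ T.K.faces)
    (h : T'.cell s' ⊆ T.cell s) : s'.card ≤ s.card := by
  have h1 := T'.le_saDim hs' ((T'.openCell_subset_cell s').trans h)
  have hc := Finset.card_pos.2 (T.K.nonempty_of_mem_faces hs)
  have h2 : saDim (embed '' T.cell s) + ((0 : ℕ) : WithBot ℕ) ≤ ((s.card - 1 : ℕ) : WithBot ℕ) := by
    refine T.saDim_le fun z hz => ?_
    obtain ⟨t, hts, htne, hzt⟩ := T.exists_openCell hz
    refine ⟨t, T.K.down_closed hs hts htne, hzt, ?_⟩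
    have := Finset.card_le_card hts
    omega
  rw [Nat.cast_zero, add_zero] at h2
  have h3 := h1.trans h2
  have h4 : s'.card - 1 ≤ s.card - 1 := by exact_mod_cast h3
  omega

/-! ### Admissible chains -/

theorem cubicalFace_full (J : Fin n → Option Pole) : T.IsFullSubcomplex (cubicalFace J) := by
  have := T.faces_full {J}
  simpa using this

/-- The combinatorial form of admissibility: a face of a simplex of `c` which is contained in a
cubical face of codimension `k`, but not in the divisor, has codimension at least `2k`. -/
def MeetsProperly {p : ℕ} (c : T.Chain p) : Prop :=
  ∀ v, c.1 v ≠ 0 → ¬ T.tupleCell v ⊆ divisor n → ∀ s : Finset (Fin T.N → ℝ), s.Nonempty →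
    (s : Set (Fin T.N → ℝ)) ⊆ Set.range v → ∀ J, T.cell s ⊆ cubicalFace J →
      ¬ T.cell s ⊆ divisor n → s.card + 2 * codim J ≤ p + 1

variable {T}

theorem MeetsProperly.add {p : ℕ} {c d : T.Chain p} (hc : T.MeetsProperly c)
    (hd : T.MeetsProperly d) : T.MeetsProperly (c + d) := by
  intro v hv
  by_cases h : c.1 v = 0
  · exact hd v (by
      intro h'
      apply hv
      change c.1 v + d.1 v = 0
      rw [h, h', add_zero])
  · exact hc v h

theorem MeetsProperly.smul {p : ℕ} {c : T.Chain p} (hc : T.MeetsProperly c) (r : ℚ) :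
    T.MeetsProperly (r • c) := fun v hv => hc v (right_ne_zero_of_mul (show r * c.1 v ≠ 0 from hv))

theorem MeetsProperly.congr {p : ℕ} {c d : T.Chain p} (hc : T.MeetsProperly c)
    (hcd : c - d ∈ T.divisorChain p) : T.MeetsProperly d := by
  intro v hv hvD
  refine hc v ?_ hvD
  intro h
  refine hvD (hcd v ?_)
  change c.1 v - d.1 v ≠ 0
  rw [h, zero_sub]
  exact neg_ne_zero.2 hv

theorem toRel_eq_iff {p : ℕ} {c d : T.Chain p} :
    T.toRel c = T.toRel d ↔ c - d ∈ T.divisorChain p :=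
  Submodule.Quotient.eq _

theorem saDim_support {p : ℕ} {c : T.Chain p} (hc : c ≠ 0) :
    saDim (embed '' T.support c) = p := by
  classical
  apply le_antisymm
  · have : saDim (embed '' T.support c) + ((0 : ℕ) : WithBot ℕ) ≤ p := by
      refine T.saDim_le ?_
      rintro z ⟨v, hv, hz⟩
      have hvs := T.isSimplex_of_ne_zero c hv
      obtain ⟨t, ht, htne, hzt⟩ := T.exists_openCell hz
      refine ⟨t, T.K.down_closed hvs.2 ht htne, hzt, ?_⟩
      have h1 := Finset.card_le_card ht
      have h2 := Finset.card_image_le (s := (Finset.univ : Finset (Fin (p + 1)))) (f := v)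
      simp only [Finset.card_univ, Fintype.card_fin] at h2
      exact h1.trans (by convert h2)
    simpa using this
  · obtain ⟨v, hv⟩ : ∃ v, c.1 v ≠ 0 := by
      by_contra h
      push Not at h
      exact hc (Triangulation.Chain.ext h)
    have hvs := T.isSimplex_of_ne_zero c hv
    have h1 := T.le_saDim hvs.2 (S := T.support c)
      ((T.openCell_subset_cell _).trans fun z hz => ⟨v, hv, hz⟩)
    have h2 : (Finset.univ.image v).card = p + 1 := by
      rw [Finset.card_image_of_injective _ hvs.1]
      simp
    convert h1
    have : (p : ℕ) = (Finset.univ.image v).card - 1 := by omega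
    convert this

/-- Admissibility is combinatorial: the intersection of the support with a cubical face is a union of
simplices, as the cubical faces are full subcomplexes, and the dimension of a simplex is one less
than the number of its vertices. -/
theorem isAdmissibleChain_iff {p : ℕ} (c : T.Chain p) :
    T.IsAdmissibleChain (T.toRel c) ↔ T.MeetsProperly c := by
  classical
  constructor
  · rintro ⟨d, hdc, hd⟩
    refine MeetsProperly.congr (c := d) ?_ (toRel_eq_iff.1 hdc)
    intro v hv _ s hsne hsv J hsJ hsD
    have hvs := T.isSimplex_of_ne_zero d hv
    have hs := hvs.mem_faces hsv hsne
    have h1 := hd J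
    rw [saDim_support (fun h => hv (by simp [h]))] at h1
    have h2 : T.openCell s ⊆ T.support d ∩ (cubicalFace J \ divisor n) := by
      intro z hz
      have hzs := T.openCell_subset_cell s hz
      refine ⟨⟨v, hv, T.cell_subset_tupleCell hsv hzs⟩, hsJ hzs, fun hzD => hsD ?_⟩
      exact T.divisor_isSubcomplex.cell_subset hs hz hzD
    have h3 := (add_le_add_left (T.le_saDim hs h2) ((2 * codim J : ℕ) : WithBot ℕ)).trans h1
    have h4 : s.card - 1 + 2 * codim J ≤ p := by exact_mod_cast h3
    have := Finset.card_pos.2 hsne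
    omega
  · intro hc
    -- The representative without simplices in the divisor: those would enlarge the support.
    let d : T.Chain p := ⟨fun v => if T.tupleCell v ⊆ divisor n then 0 else c.1 v, by
      refine ⟨fun v hv => ?_, fun v π => ?_⟩
      · refine T.isSimplex_of_ne_zero c fun h => hv ?_
        simp [h]
      · have : T.tupleCell (v ∘ π) = T.tupleCell v := by
          apply Set.Subset.antisymm (T.tupleCell_comp_subset v π)
          have := T.tupleCell_comp_subset (v ∘ π) π.symm
          rwa [Function.comp_assoc, Equiv.self_comp_symm, Function.comp_id] at this
        simp only [this]
        split_ifs
        · simp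
        · exact T.chain_comp c v π⟩
    have hdv : ∀ v, d.1 v ≠ 0 → c.1 v ≠ 0 ∧ ¬ T.tupleCell v ⊆ divisor n := by
      intro v hv
      simp only [d] at hv
      split_ifs at hv with h
      · exact absurd rfl hv
      · exact ⟨hv, h⟩
    refine ⟨d, toRel_eq_iff.2 ?_, ?_⟩
    · intro v hv
      by_contra h
      apply hv
      change (if T.tupleCell v ⊆ divisor n then 0 else c.1 v) - c.1 v = 0
      rw [if_neg h, sub_self]
    · intro J
      by_cases hd0 : d = 0
      · have : T.support d = ∅ := by
          ext z
          simp [Triangulation.support, hd0]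
        simp [this, saDim_empty]
      · rw [saDim_support hd0]
        refine T.saDim_le ?_
        rintro z ⟨⟨v, hv, hzv⟩, hzJ, hzD⟩
        obtain ⟨hcv, hvD⟩ := hdv v hv
        have hvs := T.isSimplex_of_ne_zero c hcv
        obtain ⟨t, ht, htne, hzt⟩ := T.exists_openCell hzv
        have htv : (t : Set (Fin T.N → ℝ)) ⊆ Set.range v := by
          intro x hx
          simpa using ht hx
        have htf := hvs.mem_faces htv htne
        exact ⟨t, htf, hzt, hc v hcv hvD t htne htv J
          ((T.cubicalFace_full J).1.cell_subset htf hzt hzJ)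
          fun h => hzD (h (T.openCell_subset_cell t hzt))⟩

theorem exists_toRel_eq {p : ℕ} (γ : T.RelChain p) : ∃ c, T.toRel c = γ :=
  Submodule.mkQ_surjective _ γ

/-- Although `AC` is defined as a span, its elements are just the chains which meet the cubical faces
properly together with their boundaries, since proper chains form a subspace. -/
theorem mem_AC_iff {p : ℕ} (c : T.Chain p) :
    T.toRel c ∈ T.AC p ↔ T.MeetsProperly c ∧ T.MeetsProperly (T.bd p c) := by
  constructor
  · intro h
    suffices h' : ∀ γ ∈ T.AC p, ∃ d, T.toRel d = γ ∧ T.MeetsProperly d ∧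
        T.MeetsProperly (T.bd p d) by
      obtain ⟨d, hdc, hd, hd'⟩ := h' _ h
      rw [toRel_eq_iff] at hdc
      refine ⟨hd.congr hdc, hd'.congr ?_⟩
      rw [← map_sub]
      exact T.divisorChain_le_comap_bd p hdc
    intro γ hγ
    induction hγ using Submodule.span_induction with
    | mem γ hγ =>
      obtain ⟨c, rfl⟩ := exists_toRel_eq γ
      refine ⟨c, rfl, (isAdmissibleChain_iff c).1 hγ.1, ?_⟩
      exact (isAdmissibleChain_iff _).1 hγ.2
    | zero => exact ⟨0, map_zero _, fun v hv => absurd rfl hv, fun v hv => by simp at hv⟩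
    | add x y _ _ hx hy =>
      obtain ⟨c, rfl, h1, h2⟩ := hx
      obtain ⟨d, rfl, h3, h4⟩ := hy
      exact ⟨c + d, map_add _ _ _, h1.add h3, by rw [map_add]; exact h2.add h4⟩
    | smul r x _ hx =>
      obtain ⟨c, rfl, h1, h2⟩ := hx
      exact ⟨r • c, map_smul _ _ _, h1.smul r, by rw [map_smul]; exact h2.smul r⟩
  · rintro ⟨h1, h2⟩
    exact Submodule.subset_span ⟨(isAdmissibleChain_iff c).2 h1, (isAdmissibleChain_iff _).2 h2⟩

end GoodTriangulation
end CubicalChains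

namespace CubicalChains

/-! ### Tuple chains and barycentric subdivision -/

namespace Tuple

variable {X Y : Type*}

/-- The boundary of a chain of tuples; a tuple of length `m` counts as a simplex of dimension
`m - 1`, so that the boundary of a tuple of length `1` is its augmentation. -/
def bd (m : ℕ) : ((Fin (m + 1) → X) →₀ ℚ) →ₗ[ℚ] (Fin m → X) →₀ ℚ :=
  Finsupp.linearCombination ℚ fun x =>
    ∑ i : Fin (m + 1), (-1 : ℚ) ^ (i : ℕ) • Finsupp.single (x ∘ i.succAbove) 1

/-- The cone `[x_1, …, x_m] ↦ [b, x_1, …, x_m]`. -/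
def cone (b : X) {m : ℕ} : ((Fin m → X) →₀ ℚ) →ₗ[ℚ] (Fin (m + 1) → X) →₀ ℚ :=
  Finsupp.lmapDomain ℚ ℚ fun x => (Fin.cons b x : Fin (m + 1) → X)

/-- The chain map induced by a map of sets. -/
def map (f : X → Y) {m : ℕ} : ((Fin m → X) →₀ ℚ) →ₗ[ℚ] (Fin m → Y) →₀ ℚ :=
  Finsupp.lmapDomain ℚ ℚ fun x => f ∘ x

theorem bd_single {m : ℕ} (x : Fin (m + 1) → X) : bd m (Finsupp.single x 1) =
    ∑ i : Fin (m + 1), (-1 : ℚ) ^ (i : ℕ) • Finsupp.single (x ∘ i.succAbove) 1 := by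
  simp [bd]

theorem cone_single (b : X) {m : ℕ} (x : Fin m → X) :
    cone b (Finsupp.single x 1) = Finsupp.single (Fin.cons b x) 1 := by
  simp [cone]

theorem map_single (f : X → Y) {m : ℕ} (x : Fin m → X) :
    map f (Finsupp.single x 1) = Finsupp.single (f ∘ x) 1 := by
  simp [map]

theorem hom_ext {M : Type*} [AddCommGroup M] [Module ℚ M] {m : ℕ}
    {f g : ((Fin m → X) →₀ ℚ) →ₗ[ℚ] M}
    (h : ∀ x, f (Finsupp.single x 1) = g (Finsupp.single x 1)) : f = g := by
  apply Finsupp.lhom_ext'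
  intro x
  apply LinearMap.ext_ring
  exact h x

theorem bd_cone_zero (b : X) (z : (Fin 0 → X) →₀ ℚ) : bd 0 (cone b z) = z := by
  have : (bd 0).comp (cone b) = LinearMap.id (R := ℚ) (M := (Fin 0 → X) →₀ ℚ) := by
    refine hom_ext fun x => ?_
    simp only [LinearMap.comp_apply, cone_single, bd_single, LinearMap.id_apply]
    simp
  exact LinearMap.congr_fun this z

theorem bd_cone (b : X) {m : ℕ} (z : (Fin (m + 1) → X) →₀ ℚ) :
    bd (m + 1) (cone b z) = z - cone b (bd m z) := by
  have : (bd (m + 1)).comp (cone b) = LinearMap.id (R := ℚ) - (cone b).comp (bd m) := by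
    refine hom_ext fun x => ?_
    simp only [LinearMap.comp_apply, cone_single, bd_single, LinearMap.id_apply,
      LinearMap.sub_apply, map_sum, map_smul]
    rw [Fin.sum_univ_succ]
    have h0 : (Fin.cons b x : Fin (m + 2) → X) ∘ (0 : Fin (m + 2)).succAbove = x := by
      funext k
      simp
    have h1 : ∀ i : Fin (m + 1), (Fin.cons b x : Fin (m + 2) → X) ∘ i.succ.succAbove =
        Fin.cons b (x ∘ i.succAbove) := by
      intro i
      funext k
      refine Fin.cases ?_ (fun j => ?_) k <;> simp
    simp only [h0, h1, Fin.val_zero, pow_zero, one_smul, Fin.val_succ, pow_succ]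
    rw [sub_eq_add_neg, ← Finset.sum_neg_distrib]
    congr 1
    refine Finset.sum_congr rfl fun i _ => ?_
    simp
  exact LinearMap.congr_fun this z

theorem bd_bd {m : ℕ} (z : (Fin (m + 2) → X) →₀ ℚ) : bd m (bd (m + 1) z) = 0 := by
  have : ∀ m, (bd m).comp (bd (X := X) (m + 1)) = 0 := by
    intro m
    induction m with
    | zero =>
      refine hom_ext fun x => ?_
      rw [← Fin.cons_self_tail x, ← cone_single, LinearMap.comp_apply, bd_cone, map_sub,
        bd_cone_zero, sub_self, LinearMap.zero_apply]
    | succ m ih =>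
      refine hom_ext fun x => ?_
      rw [← Fin.cons_self_tail x, ← cone_single, LinearMap.comp_apply, bd_cone, map_sub,
        bd_cone, ← LinearMap.comp_apply (bd m), ih, LinearMap.zero_apply, LinearMap.zero_apply]
      simp
  exact LinearMap.congr_fun (this m) z

theorem bd_map (f : X → Y) {m : ℕ} (z : (Fin (m + 1) → X) →₀ ℚ) :
    bd m (map f z) = map f (bd m z) := by
  have : (bd m).comp (map f) = (map f).comp (bd m) := by
    refine hom_ext fun x => ?_
    simp only [LinearMap.comp_apply, map_single, bd_single, map_sum, map_smul]
    rfl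
  exact LinearMap.congr_fun this z

theorem map_map_of_supported {S : Type*} (f : X → Y) (g : Y → S) (h : X → S) {m : ℕ}
    {A : Set (Fin m → X)} (hA : ∀ x ∈ A, ∀ i, g (f (x i)) = h (x i)) {z : (Fin m → X) →₀ ℚ}
    (hz : z ∈ Finsupp.supported ℚ ℚ A) : map g (map f z) = map h z := by
  rw [Finsupp.supported_eq_span_single] at hz
  induction hz using Submodule.span_induction with
  | mem z hz =>
    obtain ⟨x, hx, rfl⟩ := hz
    rw [map_single, map_single, map_single]
    congr 1
    funext i
    exact hA x hx i
  | zero => simp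
  | add a b _ _ ha hb => simp [ha, hb]
  | smul r a _ ha => simp [ha]

theorem map_id {m : ℕ} (z : (Fin m → X) →₀ ℚ) : map id z = z := by
  have : map id = LinearMap.id (R := ℚ) (M := (Fin m → X) →₀ ℚ) :=
    hom_ext fun x => by simp [map_single]
  rw [this, LinearMap.id_apply]

theorem apply_mem_of_supported {M : Type*} [AddCommGroup M] [Module ℚ M] {m : ℕ}
    (f : ((Fin m → X) →₀ ℚ) →ₗ[ℚ] M) {A : Set (Fin m → X)} {B : Submodule ℚ M}
    (h : ∀ x ∈ A, f (Finsupp.single x 1) ∈ B) {z : (Fin m → X) →₀ ℚ}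
    (hz : z ∈ Finsupp.supported ℚ ℚ A) : f z ∈ B := by
  rw [Finsupp.supported_eq_span_single] at hz
  have : Submodule.span ℚ ((fun i => Finsupp.single i (1 : ℚ)) '' A) ≤ B.comap f := by
    rw [Submodule.span_le]
    rintro _ ⟨x, hx, rfl⟩
    exact h x hx
  exact this hz

section

variable {E : Type*} [PseudoMetricSpace E]

/-- The tuples of length `m` with mutual distances at most `δ` in one of the sets of the
family `F`. -/
def small (F : Set (Set E)) (δ : ℝ) (m : ℕ) : Set (Fin m → E) :=
  {x | ∃ C ∈ F, (∀ i, x i ∈ C) ∧ ∀ i j, dist (x i) (x j) ≤ δ}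

theorem small_mono {F F' : Set (Set E)} (hF : F ⊆ F') {δ δ' : ℝ} (hδ : δ ≤ δ') (m : ℕ) :
    small F δ m ⊆ small F' δ' m :=
  fun _ ⟨C, hC, h1, h2⟩ => ⟨C, hF hC, h1, fun i j => (h2 i j).trans hδ⟩

theorem cone_mem_small {F : Set (Set E)} {C : Set E} (hC : C ∈ F) {b : E} (hb : b ∈ C) {δ : ℝ}
    (hδ : 0 ≤ δ) {m : ℕ} {z : (Fin m → E) →₀ ℚ}
    (hz : z ∈ Finsupp.supported ℚ ℚ (small {C ∩ Metric.closedBall b δ} δ m)) :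
    cone b z ∈ Finsupp.supported ℚ ℚ (small F δ (m + 1)) := by
  refine apply_mem_of_supported _ ?_ hz
  rintro x ⟨_, rfl, h1, h2⟩
  rw [cone_single]
  refine Finsupp.single_mem_supported ℚ _ ⟨C, hC, fun i => ?_, fun i j => ?_⟩
  · refine Fin.cases (by simpa using hb) (fun k => by simpa using (h1 k).1) i
  · refine Fin.cases ?_ (fun k => ?_) i <;> refine Fin.cases ?_ (fun l => ?_) j
    · simpa using hδ
    · simpa [dist_comm] using (h1 l).2
    · simpa using (h1 k).2
    · simpa using h2 k l

theorem bd_mem_small {F : Set (Set E)} {δ : ℝ} {m : ℕ} {z : (Fin (m + 1) → E) →₀ ℚ}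
    (hz : z ∈ Finsupp.supported ℚ ℚ (small F δ (m + 1))) :
    bd m z ∈ Finsupp.supported ℚ ℚ (small F δ m) := by
  refine apply_mem_of_supported _ ?_ hz
  rintro x ⟨C, hC, h1, h2⟩
  rw [bd_single]
  refine Submodule.sum_mem _ fun i _ => Submodule.smul_mem _ _ ?_
  exact Finsupp.single_mem_supported ℚ _ ⟨C, hC, fun i => h1 _, fun i j => h2 _ _⟩

end

variable {E : Type*} [NormedAddCommGroup E] [NormedSpace ℝ E]

/-- The barycentre of a tuple of points. -/
def bary {m : ℕ} (x : Fin (m + 1) → E) : E := (m + 1 : ℝ)⁻¹ • ∑ i, x i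

/-- The barycentric subdivision operator. -/
def sd : ∀ m : ℕ, ((Fin m → E) →₀ ℚ) →ₗ[ℚ] (Fin m → E) →₀ ℚ
  | 0 => LinearMap.id
  | m + 1 => Finsupp.linearCombination ℚ fun x =>
      cone (bary x) (sd m (bd m (Finsupp.single x 1)))

/-- The chain homotopy between the identity and the barycentric subdivision operator. -/
def sdHomotopy : ∀ m : ℕ, ((Fin m → E) →₀ ℚ) →ₗ[ℚ] (Fin (m + 1) → E) →₀ ℚ
  | 0 => 0
  | m + 1 => Finsupp.linearCombination ℚ fun x =>
      cone (bary x) (Finsupp.single x 1 - sdHomotopy m (bd m (Finsupp.single x 1)))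

theorem sd_single {m : ℕ} (x : Fin (m + 1) → E) : sd (m + 1) (Finsupp.single x 1) =
    cone (bary x) (sd m (bd m (Finsupp.single x 1))) := by
  simp [sd]

theorem sdHomotopy_single {m : ℕ} (x : Fin (m + 1) → E) :
    sdHomotopy (m + 1) (Finsupp.single x 1) =
    cone (bary x) (Finsupp.single x 1 - sdHomotopy m (bd m (Finsupp.single x 1))) := by
  simp [sdHomotopy]

theorem bd_sd {m : ℕ} (z : (Fin (m + 1) → E) →₀ ℚ) : bd m (sd (m + 1) z) = sd m (bd m z) := by
  have : ∀ m, (bd m).comp (sd (E := E) (m + 1)) = (sd m).comp (bd m) := by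
    intro m
    induction m with
    | zero =>
      refine hom_ext fun x => ?_
      rw [LinearMap.comp_apply, sd_single, bd_cone_zero, LinearMap.comp_apply]
    | succ m ih =>
      refine hom_ext fun x => ?_
      rw [LinearMap.comp_apply, sd_single, bd_cone, LinearMap.comp_apply,
        ← LinearMap.comp_apply (bd m), ih, LinearMap.comp_apply, bd_bd]
      simp
  exact LinearMap.congr_fun (this m) z

theorem bd_sdHomotopy {m : ℕ} (z : (Fin (m + 1) → E) →₀ ℚ) :
    bd (m + 1) (sdHomotopy (m + 1) z) = z - sd (m + 1) z - sdHomotopy m (bd m z) := by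
  have : ∀ m, (bd (m + 1)).comp (sdHomotopy (E := E) (m + 1)) =
      LinearMap.id - sd (m + 1) - (sdHomotopy m).comp (bd m) := by
    intro m
    induction m with
    | zero =>
      refine hom_ext fun x => ?_
      simp only [LinearMap.comp_apply, LinearMap.sub_apply, LinearMap.id_apply]
      rw [sdHomotopy_single, bd_cone, sd_single]
      simp [sdHomotopy, sd]
    | succ m ih =>
      refine hom_ext fun x => ?_
      simp only [LinearMap.comp_apply, LinearMap.sub_apply, LinearMap.id_apply]
      rw [sdHomotopy_single, bd_cone, sd_single, map_sub, ← LinearMap.comp_apply (bd (m + 1))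
        (sdHomotopy (m + 1)), ih]
      simp only [LinearMap.comp_apply, LinearMap.sub_apply, LinearMap.id_apply, bd_bd, map_zero,
        sub_zero]
      abel_nf
  exact LinearMap.congr_fun (this m) z

theorem dist_bary_le {m : ℕ} {x : Fin (m + 1) → E} {δ : ℝ} (hx : ∀ i j, dist (x i) (x j) ≤ δ)
    (j : Fin (m + 1)) : dist (x j) (bary x) ≤ m / (m + 1) * δ := by
  have hm : (0 : ℝ) < m + 1 := by positivity
  have h1 : x j - bary x = (m + 1 : ℝ)⁻¹ • ∑ i : Fin m, (x j - x (j.succAbove i)) := by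
    have h2 : (m + 1 : ℝ) • (x j - bary x) = ∑ i : Fin m, (x j - x (j.succAbove i)) := by
      rw [bary, smul_sub, smul_inv_smul₀ hm.ne', Fin.sum_univ_succAbove _ j,
        Finset.sum_sub_distrib]
      simp only [Finset.sum_const, Finset.card_univ, Fintype.card_fin, add_smul, one_smul,
        Nat.cast_smul_eq_nsmul]
      abel
    rw [← h2, inv_smul_smul₀ hm.ne']
  rw [dist_eq_norm, h1, norm_smul, Real.norm_of_nonneg (by positivity)]
  calc (m + 1 : ℝ)⁻¹ * ‖∑ i : Fin m, (x j - x (j.succAbove i))‖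
      ≤ (m + 1 : ℝ)⁻¹ * ∑ i : Fin m, δ := by
        gcongr
        refine norm_sum_le_of_le _ fun i _ => ?_
        rw [← dist_eq_norm]
        exact hx _ _
    _ = m / (m + 1) * δ := by
        simp
        ring

theorem bary_mem {m : ℕ} {x : Fin (m + 1) → E} {C : Set E} (hC : Convex ℝ C)
    (hx : ∀ i, x i ∈ C) : bary x ∈ C := by
  rw [bary, Finset.smul_sum]
  refine hC.sum_mem (fun i _ => by positivity) ?_ fun i _ => hx i
  simp
  field_simp

/-- Barycentric subdivision makes the simplices smaller. -/
theorem sd_mem_small {F : Set (Set E)} (hF : ∀ C ∈ F, Convex ℝ C) {δ : ℝ} (hδ : 0 ≤ δ) {m : ℕ}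
    {z : (Fin m → E) →₀ ℚ} (hz : z ∈ Finsupp.supported ℚ ℚ (small F δ m)) :
    sd m z ∈ Finsupp.supported ℚ ℚ (small F (m / (m + 1) * δ) m) := by
  induction m generalizing F with
  | zero =>
    refine Finsupp.supported_mono ?_ hz
    rintro x ⟨C, hC, h1, h2⟩
    exact ⟨C, hC, fun i => i.elim0, fun i => i.elim0⟩
  | succ m ih =>
    refine apply_mem_of_supported _ ?_ hz
    rintro x ⟨C, hC, h1, h2⟩
    rw [sd_single]
    have hle : (m / (m + 1) * δ : ℝ) ≤ ((m + 1 : ℕ) / ((m + 1 : ℕ) + 1) : ℝ) * δ := by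
      refine mul_le_mul_of_nonneg_right ?_ hδ
      push_cast
      rw [div_le_div_iff₀ (by positivity) (by positivity)]
      nlinarith
    refine Finsupp.supported_mono (small_mono subset_rfl hle _)
      (cone_mem_small hC (bary_mem (hF C hC) h1) (by positivity) ?_)
    refine ih (fun C' hC' => ?_) (bd_mem_small ?_)
    · rw [Set.mem_singleton_iff.1 hC']
      exact (hF C hC).inter (convex_closedBall _ _)
    · refine Finsupp.single_mem_supported ℚ _ ⟨_, rfl, fun i => ⟨h1 i, ?_⟩, h2⟩
      exact dist_bary_le h2 i

theorem sdHomotopy_mem_small {F : Set (Set E)} (hF : ∀ C ∈ F, Convex ℝ C) {δ : ℝ} (hδ : 0 ≤ δ)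
    {m : ℕ} {z : (Fin m → E) →₀ ℚ} (hz : z ∈ Finsupp.supported ℚ ℚ (small F δ m)) :
    sdHomotopy m z ∈ Finsupp.supported ℚ ℚ (small F δ (m + 1)) := by
  induction m generalizing F with
  | zero => simp [sdHomotopy]
  | succ m ih =>
    refine apply_mem_of_supported _ ?_ hz
    rintro x ⟨C, hC, h1, h2⟩
    rw [sdHomotopy_single]
    refine cone_mem_small hC (bary_mem (hF C hC) h1) hδ ?_
    have hx : Finsupp.single x (1 : ℚ) ∈
        Finsupp.supported ℚ ℚ (small {C ∩ Metric.closedBall (bary x) δ} δ (m + 1)) := by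
      refine Finsupp.single_mem_supported ℚ _ ⟨_, rfl, fun i => ⟨h1 i, ?_⟩, h2⟩
      refine (dist_bary_le h2 i).trans ?_
      have : (m / (m + 1) : ℝ) ≤ 1 := by
        rw [div_le_one (by positivity)]
        linarith
      nlinarith
    refine Submodule.sub_mem _ hx (ih (fun C' hC' => ?_) (bd_mem_small hx))
    rw [Set.mem_singleton_iff.1 hC']
    exact (hF C hC).inter (convex_closedBall _ _)

theorem bd_sd_iterate {m : ℕ} (k : ℕ) (z : (Fin (m + 1) → E) →₀ ℚ) :
    bd m ((sd (m + 1))^[k] z) = (sd m)^[k] (bd m z) := by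
  induction k generalizing z with
  | zero => rfl
  | succ k ih => rw [Function.iterate_succ_apply, ih, bd_sd, Function.iterate_succ_apply]

theorem sd_iterate_mem_small {F : Set (Set E)} (hF : ∀ C ∈ F, Convex ℝ C) {δ : ℝ} (hδ : 0 ≤ δ)
    {m : ℕ} (k : ℕ) {z : (Fin m → E) →₀ ℚ} (hz : z ∈ Finsupp.supported ℚ ℚ (small F δ m)) :
    (sd m)^[k] z ∈ Finsupp.supported ℚ ℚ (small F ((m / (m + 1)) ^ k * δ) m) := by
  induction k with
  | zero => simpa using hz
  | succ k ih =>
    rw [Function.iterate_succ_apply', pow_succ', mul_assoc]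
    exact sd_mem_small hF (by positivity) ih

/-- A cycle is homologous to its subdivisions. -/
theorem exists_bd_eq_sub_sd_iterate {F : Set (Set E)} (hF : ∀ C ∈ F, Convex ℝ C) {δ : ℝ}
    (hδ : 0 ≤ δ) {m : ℕ} (k : ℕ) {z : (Fin (m + 1) → E) →₀ ℚ}
    (hz : z ∈ Finsupp.supported ℚ ℚ (small F δ (m + 1))) (hcyc : bd m z = 0) :
    ∃ w ∈ Finsupp.supported ℚ ℚ (small F δ (m + 2)), bd (m + 1) w = z - (sd (m + 1))^[k] z := by
  induction k with
  | zero => exact ⟨0, Submodule.zero_mem _, by simp⟩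
  | succ k ih =>
    obtain ⟨w, hw, hwz⟩ := ih
    have hle : ((((m + 1 : ℕ) : ℝ) / ((m + 1 : ℕ) + 1)) ^ k * δ : ℝ) ≤ δ := by
      refine mul_le_of_le_one_left hδ (pow_le_one₀ (by positivity) ?_)
      rw [div_le_one (by positivity)]
      linarith
    have h1 := Finsupp.supported_mono (M := ℚ) (R := ℚ) (small_mono subset_rfl hle _)
      (sd_iterate_mem_small hF hδ k hz)
    refine ⟨w + sdHomotopy (m + 1) ((sd (m + 1))^[k] z),
      Submodule.add_mem _ hw (sdHomotopy_mem_small hF hδ h1), ?_⟩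
    rw [map_add, hwz, bd_sdHomotopy, bd_sd_iterate, hcyc, Function.iterate_succ_apply']
    have : (sd (E := E) m)^[k] 0 = 0 := Function.iterate_fixed (map_zero _) k
    simp [this]

/-- The complex of small tuples in a bounded convex set is acyclic. -/
theorem exists_bd_eq_of_convex {C : Set E} (hC : Convex ℝ C) (hb : Bornology.IsBounded C) {δ : ℝ}
    (hδ : 0 < δ) {p : E} (hp : p ∈ C) {m : ℕ} {z : (Fin (m + 1) → E) →₀ ℚ}
    (hz : z ∈ Finsupp.supported ℚ ℚ (small {C} δ (m + 1))) (hcyc : bd m z = 0) :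
    ∃ w ∈ Finsupp.supported ℚ ℚ (small {C} δ (m + 2)), bd (m + 1) w = z := by
  have hF : ∀ C' ∈ ({C} : Set (Set E)), Convex ℝ C' := by
    rintro C' rfl
    exact hC
  have hdist : ∀ x ∈ C, ∀ y ∈ C, dist x y ≤ max (Metric.diam C) δ := fun x hx y hy =>
    (Metric.dist_le_diam_of_mem hb hx hy).trans (le_max_left _ _)
  set R := max (Metric.diam C) δ with hR
  have hR0 : 0 < R := lt_max_of_lt_right hδ
  obtain ⟨k, hk⟩ := exists_pow_lt_of_lt_one (show 0 < δ / R by positivity)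
    (show (((m + 2 : ℕ) : ℝ) / ((m + 2 : ℕ) + 1)) < 1 by
      rw [div_lt_one (by positivity)]
      linarith)
  obtain ⟨w, hw, hwz⟩ := exists_bd_eq_sub_sd_iterate hF hδ.le k hz hcyc
  have hcone : cone p z ∈ Finsupp.supported ℚ ℚ (small {C} R (m + 2)) := by
    refine cone_mem_small (Set.mem_singleton C) hp hR0.le (Finsupp.supported_mono ?_ hz)
    rintro x ⟨_, rfl, h1, h2⟩
    exact ⟨_, rfl, fun i => ⟨h1 i, hdist _ (h1 i) _ hp⟩, fun i j => hdist _ (h1 i) _ (h1 j)⟩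
  refine ⟨w + (sd (m + 2))^[k] (cone p z), Submodule.add_mem _ hw ?_, ?_⟩
  · refine Finsupp.supported_mono (small_mono subset_rfl ?_ _)
      (sd_iterate_mem_small hF hR0.le k hcone)
    rw [lt_div_iff₀ hR0] at hk
    exact hk.le
  · rw [map_add, hwz, bd_sd_iterate, bd_cone, hcyc]
    simp

end Tuple
end CubicalChains

namespace CubicalChains

/-! ### Acyclicity of triangulated simplices -/

instance (n : ℕ) : CompactSpace (P n) := inferInstanceAs (CompactSpace (Fin n → OnePoint ℂ))

namespace Triangulation

variable {n : ℕ} (T : Triangulation n)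

theorem isCompact_space : IsCompact T.K.space :=
  isCompact_iff_compactSpace.2 T.Φ.symm.compactSpace

theorem isCompact_convexHull (s : Finset (Fin T.N → ℝ)) :
    IsCompact (convexHull ℝ (s : Set (Fin T.N → ℝ))) :=
  Set.Finite.isCompact_convexHull (𝕜 := ℝ) s.finite_toSet

/-- A simplicial approximation of the identity on a small scale: `π x` is a vertex of each simplex
which contains a point close to `x`. -/
theorem exists_vertex_map : ∃ δ > 0, ∃ π : (Fin T.N → ℝ) → Fin T.N → ℝ,
    ∀ x ∈ T.K.space, ∀ y ∈ T.K.space, dist x y ≤ δ → ∀ t ∈ T.K.faces,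
      y ∈ convexHull ℝ (t : Set (Fin T.N → ℝ)) → π x ∈ t := by
  classical
  let c : (Fin T.N → ℝ) → Set (Fin T.N → ℝ) := fun v =>
    (⋃ t ∈ {t | t ∈ T.K.faces ∧ v ∉ t}, convexHull ℝ (t : Set (Fin T.N → ℝ)))ᶜ
  have hc : ∀ v, IsOpen (c v) := by
    intro v
    refine (Set.Finite.isClosed_biUnion (T.finite.subset fun _ h => h.1) fun t _ => ?_).isOpen_compl
    exact (T.isCompact_convexHull t).isClosed
  have hcov : T.K.space ⊆ ⋃ v, c v := by
    intro x hx
    obtain ⟨s, hs, hxs⟩ := T.exists_cell (T.Φ ⟨x, hx⟩)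
    obtain ⟨t, hts, ⟨v, hv⟩, hxt⟩ := T.exists_openCell hxs
    refine Set.mem_iUnion.2 ⟨v, ?_⟩
    simp only [c, Set.mem_compl_iff, Set.mem_iUnion, not_exists]
    rintro t' ⟨ht', hvt'⟩ hxt'
    exact hvt' (T.subset_of_mem_openCell ht' (T.K.down_closed hs hts ⟨v, hv⟩) hxt
      (T.mem_cell.2 hxt') hv)
  obtain ⟨δ, hδ, h⟩ := lebesgue_number_lemma_of_metric T.isCompact_space hc hcov
  choose! π hπ using h
  refine ⟨δ / 2, by positivity, π, fun x hx y hy hxy t ht hyt => ?_⟩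
  by_contra hv
  have h1 := hπ x hx (Metric.mem_ball'.2 (lt_of_le_of_lt hxy (half_lt_self hδ)))
  simp only [c, Set.mem_compl_iff, Set.mem_iUnion, not_exists] at h1
  exact h1 t ⟨ht, hv⟩ hyt

open Classical in
/-- The change of coordinates between two triangulations. -/
def transition (T T' : Triangulation n) (x : Fin T.N → ℝ) : Fin T'.N → ℝ :=
  if h : x ∈ T.K.space then (T'.Φ.symm (T.Φ ⟨x, h⟩)).1 else 0

theorem transition_of_mem (T T' : Triangulation n) {x : Fin T.N → ℝ} (hx : x ∈ T.K.space) :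
    T.transition T' x = (T'.Φ.symm (T.Φ ⟨x, hx⟩)).1 := dif_pos hx

theorem transition_mem (T T' : Triangulation n) {x : Fin T.N → ℝ} (hx : x ∈ T.K.space) :
    T.transition T' x ∈ T'.K.space := by
  simp only [transition, hx, dif_pos]
  exact (T'.Φ.symm _).2

theorem Φ_transition (T T' : Triangulation n) {x : Fin T.N → ℝ} (hx : x ∈ T.K.space) :
    T'.Φ ⟨T.transition T' x, transition_mem T T' hx⟩ = T.Φ ⟨x, hx⟩ := by
  simp [transition, hx]

theorem transition_transition (T T' : Triangulation n) {x : Fin T.N → ℝ} (hx : x ∈ T.K.space) :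
    T'.transition T (T.transition T' x) = x := by
  have h := transition_mem T T' hx
  rw [transition_of_mem T' T h, Φ_transition T T' hx]
  simp

theorem exists_transition_modulus (T T' : Triangulation n) {ε : ℝ} (hε : 0 < ε) :
    ∃ δ > 0, ∀ x ∈ T.K.space, ∀ y ∈ T.K.space, dist x y ≤ δ →
      dist (T.transition T' x) (T.transition T' y) ≤ ε := by
  have : CompactSpace T.K.space := T.Φ.symm.compactSpace
  have hc : Continuous fun x : T.K.space => (T'.Φ.symm (T.Φ x)).1 :=
    continuous_subtype_val.comp (T'.Φ.symm.continuous.comp T.Φ.continuous)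
  obtain ⟨δ, hδ, h⟩ := Metric.uniformContinuous_iff.1
    (CompactSpace.uniformContinuous_of_continuous hc) ε hε
  refine ⟨δ / 2, by positivity, fun x hx y hy hxy => ?_⟩
  have := h (a := ⟨x, hx⟩) (b := ⟨y, hy⟩) (lt_of_le_of_lt hxy (half_lt_self hδ))
  simpa only [transition, hx, hy, dif_pos] using this.le

/-- The simplicial chain defined by a chain of tuples and a map to the vertices. -/
def ofTuple (π : (Fin T.N → ℝ) → Fin T.N → ℝ) (m : ℕ) :
    ((Fin (m + 1) → Fin T.N → ℝ) →₀ ℚ) →ₗ[ℚ] T.Chain m :=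
  Finsupp.linearCombination ℚ fun x => T.elem (π ∘ x)

theorem ofTuple_single (π : (Fin T.N → ℝ) → Fin T.N → ℝ) {m : ℕ}
    (x : Fin (m + 1) → Fin T.N → ℝ) : T.ofTuple π m (Finsupp.single x 1) = T.elem (π ∘ x) := by
  simp [ofTuple]

/-- The tuples which are mapped by `π` to the vertices of a simplex in `A`. -/
def tuplesOver (π : (Fin T.N → ℝ) → Fin T.N → ℝ) (A : Set (P n)) (m : ℕ) :
    Set (Fin m → Fin T.N → ℝ) :=
  {x | ∃ t ∈ T.K.faces, T.cell t ⊆ A ∧ ∀ i, π (x i) ∈ t}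

theorem bdSucc_ofTuple {π : (Fin T.N → ℝ) → Fin T.N → ℝ} {A : Set (P n)} {m : ℕ}
    {z : (Fin (m + 2) → Fin T.N → ℝ) →₀ ℚ}
    (hz : z ∈ Finsupp.supported ℚ ℚ (T.tuplesOver π A (m + 2))) :
    T.bdSucc m (T.ofTuple π (m + 1) z) = T.ofTuple π m (Tuple.bd (m + 1) z) := by
  classical
  have := Tuple.apply_mem_of_supported
    ((T.bdSucc m).comp (T.ofTuple π (m + 1)) - (T.ofTuple π m).comp (Tuple.bd (m + 1)))
    (B := ⊥) ?_ hz
  · simpa [sub_eq_zero] using this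
  · rintro x ⟨t, ht, -, hxt⟩
    rw [Submodule.mem_bot, LinearMap.sub_apply, LinearMap.comp_apply, LinearMap.comp_apply,
      ofTuple_single, T.bdSucc_elem, Tuple.bd_single, map_sum, sub_eq_zero]
    · refine Finset.sum_congr rfl fun i _ => ?_
      rw [map_smul, ofTuple_single, Function.comp_assoc]
    · refine T.K.down_closed ht ?_ (by simp)
      intro y hy
      simp only [Finset.mem_image, Finset.mem_univ, true_and] at hy
      obtain ⟨a, rfl⟩ := hy
      exact hxt a

/-- The chains of the subcomplex `A`. -/
def chainsIn (A : Set (P n)) (p : ℕ) : Submodule ℚ (T.Chain p) where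
  carrier := {c | ∀ v, c.1 v ≠ 0 → T.tupleCell v ⊆ A}
  zero_mem' := by simp
  add_mem' := by
    intro a b ha hb v hv
    by_cases h : a.1 v = 0
    · exact hb v (by simpa [h] using hv)
    · exact ha v h
  smul_mem' := by
    intro r a ha v hv
    exact ha v (right_ne_zero_of_mul hv)

theorem chainsIn_mono {A B : Set (P n)} (h : A ⊆ B) (p : ℕ) : T.chainsIn A p ≤ T.chainsIn B p :=
  fun _ hc v hv => (hc v hv).trans h

theorem tupleCell_comp_perm {p : ℕ} (v : Fin (p + 1) → Fin T.N → ℝ)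
    (π : Equiv.Perm (Fin (p + 1))) : T.tupleCell (v ∘ π) = T.tupleCell v := by
  apply Set.Subset.antisymm (T.tupleCell_comp_subset v π)
  have := T.tupleCell_comp_subset (v ∘ π) π.symm
  rwa [Function.comp_assoc, Equiv.self_comp_symm, Function.comp_id] at this

theorem elem_mem_chainsIn {A : Set (P n)} {p : ℕ} {v : Fin (p + 1) → Fin T.N → ℝ}
    (hv : T.IsSimplex v → T.tupleCell v ⊆ A) : T.elem v ∈ T.chainsIn A p := by
  intro u hu
  obtain ⟨hvs, π, rfl⟩ := T.exists_perm_of_elem_ne_zero hu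
  rw [tupleCell_comp_perm]
  exact hv hvs

theorem ofTuple_mem_chainsIn {π : (Fin T.N → ℝ) → Fin T.N → ℝ} {A : Set (P n)} {m : ℕ}
    {z : (Fin (m + 1) → Fin T.N → ℝ) →₀ ℚ}
    (hz : z ∈ Finsupp.supported ℚ ℚ (T.tuplesOver π A (m + 1))) :
    T.ofTuple π m z ∈ T.chainsIn A m := by
  refine Tuple.apply_mem_of_supported _ ?_ hz
  rintro x ⟨t, -, htA, hxt⟩
  rw [ofTuple_single]
  refine T.elem_mem_chainsIn fun _ => subset_trans ?_ htA
  refine T.cell_mono fun y hy => ?_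
  simp only [Finset.mem_image, Finset.mem_univ, true_and] at hy
  obtain ⟨a, rfl⟩ := hy
  exact hxt a

/-- A subcomplex `A` of a triangulation which is a simplex of another triangulation is acyclic.
A cycle in `A` is replaced by an iterated barycentric subdivision, which is a chain of small tuples,
and this is transported to the convex set `C` of which `A` is a homeomorphic image. There it bounds a
chain of small tuples, and a simplicial approximation `π` of the identity takes the chain back to
simplices of `A`. -/
theorem exists_bdSucc_eq_of_bd_eq_zero {T' : Triangulation n} {s : Finset (Fin T.N → ℝ)}
    (hs : s ∈ T.K.faces) (hA : T'.IsSubcomplex (T.cell s)) {O : PartialOrder (Fin T'.N → ℝ)}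
    (hO : T'.IsOrdering O) {p : ℕ} {z : T'.Chain p} (hz : z ∈ T'.chainsIn (T.cell s) p)
    (hcyc : Tuple.bd p (T'.osum O (fun v => Finsupp.single v (1 : ℚ)) z) = 0) :
    ∃ d ∈ T'.chainsIn (T.cell s) (p + 1), T'.bdSucc p d = z := by
  classical
  obtain ⟨δ₀, hδ₀, π, hπ⟩ := T'.exists_vertex_map
  obtain ⟨η, hη, hψ⟩ := exists_transition_modulus T T' hδ₀
  obtain ⟨ε, hε, hθ⟩ := exists_transition_modulus T' T hη
  set A := T.cell s with hAdef
  let C : Set (Fin T.N → ℝ) := convexHull ℝ (s : Set (Fin T.N → ℝ))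
  have hCsp : C ⊆ T.K.space := T.K.convexHull_subset_space hs
  have hmemC : ∀ x (hx : x ∈ T'.K.space), T'.Φ ⟨x, hx⟩ ∈ A → T'.transition T x ∈ C := by
    intro x hx hxA
    rw [← Φ_transition T' T hx] at hxA
    exact T.mem_cell.1 hxA
  have hmemA : ∀ x ∈ C, ∀ h : T.transition T' x ∈ T'.K.space,
      T'.Φ ⟨T.transition T' x, h⟩ ∈ A := by
    intro x hx h
    rw [Φ_transition T T' (hCsp hx)]
    exact T.mem_cell.2 hx
  let F : Set (Set (Fin T'.N → ℝ)) :=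
    {D | ∃ t ∈ T'.K.faces, T'.cell t ⊆ A ∧ D = convexHull ℝ (t : Set (Fin T'.N → ℝ))}
  have hF : ∀ D ∈ F, Convex ℝ D := by
    rintro _ ⟨t, -, -, rfl⟩
    exact convex_convexHull _ _
  have hFsp : ∀ D ∈ F, D ⊆ {x | ∃ h : x ∈ T'.K.space, T'.Φ ⟨x, h⟩ ∈ A} := by
    rintro _ ⟨t, ht, htA, rfl⟩ x hx
    exact ⟨T'.K.convexHull_subset_space ht hx, htA ⟨_, hx, rfl⟩⟩
  have hFover : ∀ δ m, Tuple.small F δ m ⊆ T'.tuplesOver π A m := by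
    rintro δ m x ⟨_, ⟨t, ht, htA, rfl⟩, hx, -⟩
    refine ⟨t, ht, htA, fun i => ?_⟩
    have hxi := T'.K.convexHull_subset_space ht (hx i)
    exact hπ _ hxi _ hxi (by simpa using hδ₀.le) t ht (hx i)
  -- the given cycle as a chain of tuples
  set z₀ := T'.osum O (fun v => Finsupp.single v (1 : ℚ)) z with hz₀
  set R := max (Metric.diam T'.K.space) ε with hR
  have hR0 : 0 < R := lt_max_of_lt_right hε
  have hz₀F : z₀ ∈ Finsupp.supported ℚ ℚ (Tuple.small F R (p + 1)) := by
    rw [hz₀, osum_apply]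
    refine Submodule.sum_mem _ fun v _ => ?_
    by_cases hv : z.1 v = 0
    · simp [hv]
    · refine Submodule.smul_mem _ _ (Finsupp.single_mem_supported ℚ _ ?_)
      have hvs := T'.isSimplex_of_ne_zero z hv
      have hmem : ∀ i, v i ∈ convexHull ℝ
          ((Finset.univ.image v : Finset _) : Set (Fin T'.N → ℝ)) :=
        fun i => subset_convexHull ℝ _ (by simp)
      refine ⟨_, ⟨_, hvs.2, hz v hv, rfl⟩, fun i => by convert hmem i, fun i j => ?_⟩
      refine le_trans (Metric.dist_le_diam_of_mem T'.isCompact_space.isBounded ?_ ?_)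
        (le_max_left _ _) <;> exact T'.K.subset_space hvs.2 (by simp)
  -- subdivision
  obtain ⟨k, hk⟩ := exists_pow_lt_of_lt_one (show 0 < ε / R by positivity)
    (show (((p + 1 : ℕ) : ℝ) / ((p + 1 : ℕ) + 1)) < 1 by
      rw [div_lt_one (by positivity)]
      linarith)
  obtain ⟨w, hw, hwz⟩ := Tuple.exists_bd_eq_sub_sd_iterate hF hR0.le k hz₀F hcyc
  set z₁ := (Tuple.sd (p + 1))^[k] z₀ with hz₁
  have hz₁F : z₁ ∈ Finsupp.supported ℚ ℚ (Tuple.small F ε (p + 1)) := by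
    refine Finsupp.supported_mono (Tuple.small_mono subset_rfl ?_ _)
      (Tuple.sd_iterate_mem_small hF hR0.le k hz₀F)
    rw [lt_div_iff₀ hR0] at hk
    exact hk.le
  have hz₁cyc : Tuple.bd p z₁ = 0 := by
    rw [hz₁, Tuple.bd_sd_iterate, hcyc]
    exact Function.iterate_fixed (map_zero _) k
  -- transport to the convex set `C`
  have hz₂ : Tuple.map (T'.transition T) z₁ ∈
      Finsupp.supported ℚ ℚ (Tuple.small {C} η (p + 1)) := by
    refine Tuple.apply_mem_of_supported _ ?_ hz₁F
    rintro x ⟨D, hD, hx, hxε⟩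
    rw [Tuple.map_single]
    refine Finsupp.single_mem_supported ℚ _ ⟨C, rfl, fun i => ?_, fun i j => ?_⟩
    · obtain ⟨h, hA⟩ := hFsp D hD (hx i)
      exact hmemC _ h hA
    · exact hθ _ (hFsp D hD (hx i)).1 _ (hFsp D hD (hx j)).1 (hxε i j)
  obtain ⟨x₀, hx₀⟩ := T.K.nonempty_of_mem_faces hs
  have hx₀C : x₀ ∈ C := subset_convexHull ℝ _ hx₀
  have hCc : Convex ℝ C := convex_convexHull ℝ _
  have hCb : Bornology.IsBounded C := (T.isCompact_convexHull s).isBounded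
  have hz₂cyc : Tuple.bd p (Tuple.map (T'.transition T) z₁) = 0 := by
    rw [Tuple.bd_map, hz₁cyc, map_zero]
  -- A filling in `C`, and the tuples in `A` which correspond to it.
  obtain ⟨y, hy, hyz⟩ := Tuple.exists_bd_eq_of_convex hCc hCb hη hx₀C hz₂ hz₂cyc
  have hback : Tuple.bd (p + 1) (Tuple.map (T.transition T') y) = z₁ := by
    rw [Tuple.bd_map, hyz, Tuple.map_map_of_supported (h := id) _ _ ?_ hz₁F, Tuple.map_id]
    rintro x ⟨D, hD, hx, -⟩ i
    exact transition_transition T' T (hFsp D hD (hx i)).1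
  have hyover : Tuple.map (T.transition T') y ∈
      Finsupp.supported ℚ ℚ (T'.tuplesOver π A (p + 2)) := by
    refine Tuple.apply_mem_of_supported _ ?_ hy
    rintro x ⟨_, rfl, hx, hxη⟩
    rw [Tuple.map_single]
    refine Finsupp.single_mem_supported ℚ _ ?_
    have h0 := transition_mem T T' (hCsp (hx 0))
    obtain ⟨t, ht, hxt⟩ := T'.exists_cell (T'.Φ ⟨_, h0⟩)
    obtain ⟨t', htt', htne, hxt'⟩ := T'.exists_openCell hxt
    have ht' := T'.K.down_closed ht htt' htne
    refine ⟨t', ht', hA.cell_subset ht' hxt' (hmemA _ (hx 0) h0), fun i => ?_⟩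
    exact hπ _ (transition_mem T T' (hCsp (hx i))) _ h0
      (hψ _ (hCsp (hx i)) _ (hCsp (hx 0)) (hxη i 0)) t' ht'
      (T'.mem_cell.1 (T'.openCell_subset_cell _ hxt'))
  have hwover : w ∈ Finsupp.supported ℚ ℚ (T'.tuplesOver π A (p + 2)) :=
    Finsupp.supported_mono (hFover _ _) hw
  -- The filling consists of the homology `w` between the cycle and its subdivision, and of the
  -- filling `y` of the subdivision. As `π` fixes the vertices, it takes the cycle to itself.
  refine ⟨T'.ofTuple π (p + 1) (w + Tuple.map (T.transition T') y),
    T'.ofTuple_mem_chainsIn (Submodule.add_mem _ hwover hyover), ?_⟩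
  rw [T'.bdSucc_ofTuple (Submodule.add_mem _ hwover hyover), map_add, hback, hwz,
    sub_add_cancel, hz₀, osum_apply, map_sum]
  conv_rhs => rw [← hO.osum_elem_eq z]
  rw [osum_apply]
  refine Finset.sum_congr rfl fun v hv => ?_
  rw [map_smul, ofTuple_single]
  congr 2
  funext i
  have hvi := (T'.mem_increasing.1 hv).1 i
  have hsp := T'.K.subset_space (T'.singleton_mem_faces hvi) (Finset.mem_singleton_self (v i))
  have := hπ _ hsp _ hsp (by simpa using hδ₀.le) {v i} (T'.singleton_mem_faces hvi) (by simp)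
  simpa using this

theorem exists_bdSucc_eq_of_cycle {T' : Triangulation n} {s : Finset (Fin T.N → ℝ)}
    (hs : s ∈ T.K.faces) (hA : T'.IsSubcomplex (T.cell s)) {p : ℕ} {z : T'.Chain (p + 1)}
    (hz : z ∈ T'.chainsIn (T.cell s) (p + 1)) (hcyc : T'.bdSucc p z = 0) :
    ∃ d ∈ T'.chainsIn (T.cell s) (p + 2), T'.bdSucc (p + 1) d = z := by
  obtain ⟨O, hO⟩ := T'.exists_isOrdering
  refine T.exists_bdSucc_eq_of_bd_eq_zero hs hA hO hz ?_
  have h := hO.osum_bdSucc (fun v => Finsupp.single v (1 : ℚ)) z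
  rw [hcyc, map_zero] at h
  rw [h, osum_apply, osum_apply, map_sum]
  refine Finset.sum_congr rfl fun v _ => ?_
  rw [map_smul, Tuple.bd_single]

theorem sum_increasing_zero (O : PartialOrder (Fin T.N → ℝ)) (z : T.Chain 0) :
    ∑ v ∈ T.increasing O 0, z.1 v = T.augmentation z := by
  unfold augmentation
  symm
  refine Finset.sum_bij (fun w _ => fun _ => w) ?_ ?_ ?_ ?_
  · intro w hw
    rw [mem_increasing]
    exact ⟨fun _ => hw, fun a b hab => absurd hab (by omega)⟩
  · intro a _ b _ h
    exact congrFun h 0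
  · intro v hv
    exact ⟨v 0, (T.mem_increasing.1 hv).1 0, by
      funext k
      rw [show k = 0 from Subsingleton.elim (α := Fin 1) k 0]⟩
  · intro _ _
    rfl

theorem exists_bdSucc_eq_of_augmentation {T' : Triangulation n} {s : Finset (Fin T.N → ℝ)}
    (hs : s ∈ T.K.faces) (hA : T'.IsSubcomplex (T.cell s)) {z : T'.Chain 0}
    (hz : z ∈ T'.chainsIn (T.cell s) 0) (hcyc : T'.augmentation z = 0) :
    ∃ d ∈ T'.chainsIn (T.cell s) 1, T'.bdSucc 0 d = z := by
  classical
  obtain ⟨O, hO⟩ := T'.exists_isOrdering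
  refine T.exists_bdSucc_eq_of_bd_eq_zero hs hA hO hz ?_
  rw [osum_apply, map_sum]
  have h1 : ∀ v : Fin 1 → Fin T'.N → ℝ, Tuple.bd 0 (z.1 v • Finsupp.single v (1 : ℚ)) =
      z.1 v • Finsupp.single Fin.elim0 1 := by
    intro v
    rw [map_smul, Tuple.bd_single]
    have : ∀ j : Fin 1, ((-1 : ℚ) ^ (j : ℕ)) • Finsupp.single (v ∘ j.succAbove) (1 : ℚ) =
        Finsupp.single Fin.elim0 1 := by
      intro j
      rw [Subsingleton.elim j 0, Fin.val_zero, pow_zero, one_smul]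
      congr 1
      exact Subsingleton.elim _ _
    rw [show (∑ j : Fin (0 + 1), ((-1 : ℚ) ^ (j : ℕ)) • Finsupp.single (v ∘ j.succAbove) (1 : ℚ)) =
      ∑ j : Fin 1, Finsupp.single Fin.elim0 1 from Finset.sum_congr rfl fun j _ => this j]
    simp
  rw [Finset.sum_congr rfl fun v _ => h1 v, ← Finset.sum_smul]
  rw [T'.sum_increasing_zero, hcyc, zero_smul]

end Triangulation
end CubicalChains

namespace CubicalChains

/-! ### Charts of the projective line -/

/-- The opposite pole. -/
def Pole.opp : Pole → Pole
  | .zero => .infty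
  | .infty => .zero

theorem Pole.opp_opp (α : Pole) : α.opp.opp = α := by cases α <;> rfl

/-- The inverse of the coordinate `Pole.coord`. -/
def Pole.chart : Pole → ℂ → OnePoint ℂ
  | .zero, c => c
  | .infty, c => if c = 0 then OnePoint.infty else ((c⁻¹ : ℂ) : OnePoint ℂ)

theorem Pole.coord_chart (α : Pole) (c : ℂ) : α.coord (α.chart c) = c := by
  cases α with
  | zero => rfl
  | infty =>
    by_cases hc : c = 0
    · simp [Pole.chart, Pole.coord, hc]
    · simp [Pole.chart, Pole.coord, hc]

theorem Pole.chart_coord (α : Pole) {z : OnePoint ℂ} (hz : z ≠ α.opp.pt) :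
    α.chart (α.coord z) = z := by
  induction z using OnePoint.rec with
  | infty =>
    cases α with
    | zero => exact absurd rfl hz
    | infty => simp [Pole.chart, Pole.coord]
  | coe c =>
    cases α with
    | zero => rfl
    | infty =>
      have hc : c ≠ 0 := fun h => hz (by rw [h]; rfl)
      simp [Pole.chart, Pole.coord, hc]

theorem Pole.chart_ne_opp (α : Pole) (c : ℂ) : α.chart c ≠ α.opp.pt := by
  cases α with
  | zero => exact OnePoint.coe_ne_infty c
  | infty =>
    by_cases hc : c = 0
    · simp [Pole.chart, Pole.opp, Pole.pt, hc]
    · simp [Pole.chart, Pole.opp, Pole.pt, hc]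

theorem Pole.pt_ne_opp (α : Pole) : α.pt ≠ α.opp.pt := by
  cases α <;> simp [Pole.pt, Pole.opp]

theorem Pole.chart_zero (α : Pole) : α.chart 0 = α.pt := by
  cases α <;> simp [Pole.pt, Pole.chart]

theorem Pole.coord_pt (α : Pole) : α.coord α.pt = 0 := by
  rw [← α.chart_zero, coord_chart]

theorem Pole.coord_eq_zero_iff (α : Pole) {z : OnePoint ℂ} (hz : z ≠ α.opp.pt) :
    α.coord z = 0 ↔ z = α.pt := by
  constructor
  · intro h
    rw [← α.chart_coord hz, h, α.chart_zero]
  · rintro rfl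
    exact α.coord_pt

theorem Pole.coord_opp (α : Pole) (z : OnePoint ℂ) : α.opp.coord z = (α.coord z)⁻¹ := by
  induction z using OnePoint.rec <;> cases α <;> simp [Pole.opp, Pole.coord]

theorem Pole.mem_disc_iff (α : Pole) {z : OnePoint ℂ} :
    z ∈ α.disc ↔ z ≠ α.opp.pt ∧ ‖α.coord z‖ < 1 := by
  induction z using OnePoint.rec with
  | infty => cases α <;> simp [Pole.disc, Pole.opp, Pole.pt, Pole.coord]
  | coe c =>
    cases α with
    | zero => simp [Pole.disc, Pole.opp, Pole.pt, Pole.coord]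
    | infty =>
      by_cases hc : c = 0
      · simp [Pole.disc, Pole.opp, Pole.pt, Pole.coord, hc]
      · have h0 : 0 < ‖c‖ := norm_pos_iff.2 hc
        simp [Pole.disc, Pole.opp, Pole.pt, Pole.coord, hc, inv_lt_one₀ h0]

theorem Pole.continuousAt_coord (α : Pole) {z : OnePoint ℂ} (hz : z ≠ α.opp.pt) :
    ContinuousAt α.coord z := by
  induction z using OnePoint.rec with
  | infty =>
    cases α with
    | zero => exact absurd rfl hz
    | infty =>
      rw [OnePoint.continuousAt_infty', Filter.coclosedCompact_eq_cocompact,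
        ← Metric.cobounded_eq_cocompact]
      exact Filter.tendsto_inv₀_cobounded
  | coe c =>
    rw [OnePoint.continuousAt_coe]
    cases α with
    | zero => exact continuousAt_id
    | infty =>
      have hc : c ≠ 0 := fun h => hz (by rw [h]; rfl)
      exact continuousAt_inv₀ hc

theorem sphere_chart (α : Pole) (c : ℂ) : sphere (α.chart c) =
    match α with
    | .zero => ![2 * c.re / (1 + ‖c‖ ^ 2), 2 * c.im / (1 + ‖c‖ ^ 2),
      (‖c‖ ^ 2 - 1) / (1 + ‖c‖ ^ 2)]
    | .infty => ![2 * c.re / (1 + ‖c‖ ^ 2), -(2 * c.im / (1 + ‖c‖ ^ 2)),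
      -((‖c‖ ^ 2 - 1) / (1 + ‖c‖ ^ 2))] := by
  cases α with
  | zero => rfl
  | infty =>
    by_cases hc : c = 0
    · simp [Pole.chart, sphere, hc]
    · have h0 : ‖c‖ ≠ 0 := norm_ne_zero_iff.2 hc
      have h1 : (1 + ‖c‖ ^ 2) ≠ 0 := by positivity
      have h2 : (‖c‖ ^ 2 + 1) ≠ 0 := by positivity
      simp only [Pole.chart, hc, if_false, sphere, OnePoint.elim_some, Complex.inv_re,
        Complex.inv_im, Complex.normSq_eq_norm_sq, norm_inv]
      funext k
      fin_cases k <;> simp <;> field_simp <;> ring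

theorem contDiff_sphere_chart (α : Pole) : ContDiff ℝ ∞ fun c : ℂ => sphere (α.chart c) := by
  have h : ∀ c : ℂ, 1 + ‖c‖ ^ 2 ≠ 0 := fun c => by positivity
  have hn : ContDiff ℝ ∞ fun c : ℂ => ‖c‖ ^ 2 := contDiff_norm_sq ℝ
  have hre : ContDiff ℝ ∞ fun c : ℂ => c.re := Complex.reCLM.contDiff
  have him : ContDiff ℝ ∞ fun c : ℂ => c.im := Complex.imCLM.contDiff
  have hd : ContDiff ℝ ∞ fun c : ℂ => 1 + ‖c‖ ^ 2 := contDiff_const.add hn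
  have e0 := (contDiff_const (c := (2 : ℝ)).mul hre).div hd h
  have e1 := (contDiff_const (c := (2 : ℝ)).mul him).div hd h
  have e2 := (hn.sub (contDiff_const (c := (1 : ℝ)))).div hd h
  simp only [sphere_chart]
  refine contDiff_pi.2 fun k => ?_
  cases α with
  | zero => fin_cases k; exacts [e0, e1, e2]
  | infty => fin_cases k; exacts [e0, e1.neg, e2.neg]

theorem continuous_sphere : Continuous sphere := by
  rw [continuous_iff_continuousAt]
  have key : ∀ (α : Pole) (z : OnePoint ℂ), z ≠ α.opp.pt → ContinuousAt sphere z := by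
    intro α z hz
    have h := (contDiff_sphere_chart α).continuous.continuousAt.comp (α.continuousAt_coord hz)
    refine h.congr ?_
    filter_upwards [isOpen_ne.mem_nhds hz] with y hy
    simp [α.chart_coord hy]
  intro z
  by_cases hz : z = Pole.infty.pt
  · exact key .infty z (by rw [hz]; exact Pole.infty.pt_ne_opp)
  · exact key .zero z hz

theorem isEmbedding_sphere : Topology.IsEmbedding sphere :=
  (continuous_sphere.isClosedEmbedding sphere_injective).isEmbedding

theorem Pole.continuous_chart (α : Pole) : Continuous α.chart :=
  isEmbedding_sphere.continuous_iff.2 (contDiff_sphere_chart α).continuous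

/-! ### Logarithms and homogeneous coordinates along maps of contractible spaces -/

/-- A property of maps from a compact contractible space holds for all maps if it holds for the
constant maps and is stable under small changes of the map. -/
theorem _root_.ContinuousMap.induction_of_contractible {X Z Y : Type*} [TopologicalSpace X]
    [CompactSpace X] [ContractibleSpace X] [TopologicalSpace Z] [PseudoMetricSpace Y] (e : C(Z, Y))
    {ε : ℝ} (hε : 0 < ε) {Q : C(X, Z) → Prop} (hconst : ∀ z, Q (ContinuousMap.const X z))
    (hstep : ∀ f g : C(X, Z), Q f → (∀ x, dist (e (f x)) (e (g x)) < ε) → Q g) (f : C(X, Z)) :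
    Q f := by
  obtain ⟨x₀, ⟨H⟩⟩ := id_nullhomotopic X
  let G := H.symm
  obtain ⟨δ, hδ, hu⟩ := Metric.uniformContinuous_iff.1
    (CompactSpace.uniformContinuous_of_continuous
      (f := fun s : unitInterval => (e.comp f).comp (G.curry s)) (by fun_prop)) ε hε
  obtain ⟨m, hm⟩ := exists_nat_gt δ⁻¹
  have hm0 : (0 : ℝ) < m := (inv_pos.2 hδ).trans hm
  let t : ℕ → unitInterval := fun j => Set.projIcc 0 1 zero_le_one ((j : ℝ) / m)
  have ht : ∀ j, dist (t j) (t (j + 1)) < δ := by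
    intro j
    have h1 : dist (t j) (t (j + 1)) ≤ dist ((j : ℝ) / m) (((j + 1 : ℕ) : ℝ) / m) := by
      have := (LipschitzWith.projIcc (zero_le_one (α := ℝ))).dist_le_mul ((j : ℝ) / m)
        (((j + 1 : ℕ) : ℝ) / m)
      simpa [t] using this
    refine h1.trans_lt ?_
    rw [Real.dist_eq, ← sub_div, Nat.cast_add, Nat.cast_one, abs_div, abs_of_pos hm0]
    simp only [sub_add_cancel_left, abs_neg, abs_one]
    rw [one_div]
    exact inv_lt_of_inv_lt₀ hδ hm
  have hQ : ∀ j, Q (f.comp (G.curry (t j))) := by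
    intro j
    induction j with
    | zero =>
      convert hconst (f x₀) using 1
      ext x
      simp [t, G]
    | succ j ih =>
      refine hstep _ _ ih fun x => ?_
      exact lt_of_le_of_lt (ContinuousMap.dist_apply_le_dist
        (f := (e.comp f).comp (G.curry (t j))) (g := (e.comp f).comp (G.curry (t (j + 1)))) x) (hu (ht j))
  convert hQ m using 1
  ext x
  have : t m = 1 := by simp [t, div_self hm0.ne']
  simp [this]

instance (k : ℕ) : ContractibleSpace (stdSimplex ℝ (Fin (k + 1))) :=
  (convex_stdSimplex ℝ (Fin (k + 1))).contractibleSpace Set.Nonempty.of_subtype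

/-- A nowhere vanishing function on a contractible space has a logarithm. This property is passed on
from a function to another one which is close to it after normalization, as their quotient takes
values in the slit plane. -/
theorem exists_continuous_log {X : Type*} [TopologicalSpace X] [CompactSpace X]
    [ContractibleSpace X] (g : C(X, ℂ)) (hg : ∀ x, g x ≠ 0) :
    ∃ l : C(X, ℂ), ∀ x, Complex.exp (l x) = g x := by
  let f : C(X, {z : ℂ // z ≠ 0}) := ⟨fun x => ⟨g x, hg x⟩, by fun_prop⟩
  let e : C({z : ℂ // z ≠ 0}, ℂ) := ⟨fun z => z.1 / ‖z.1‖, by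
    refine continuous_subtype_val.div (by fun_prop) fun z => ?_
    exact Complex.ofReal_ne_zero.2 (norm_ne_zero_iff.2 z.2)⟩
  refine ContinuousMap.induction_of_contractible (X := X) e (ε := 1) one_pos
    (Q := fun f => ∃ l : C(X, ℂ), ∀ x, Complex.exp (l x) = (f x).1) ?_ ?_ f
  · intro z
    exact ⟨ContinuousMap.const X (Complex.log z.1), fun x => Complex.exp_log z.2⟩
  · rintro f₁ f₂ ⟨l, hl⟩ h
    have hq : ∀ x, (f₂ x).1 / (f₁ x).1 ∈ Complex.slitPlane := by
      intro x
      have h1 : (‖(f₁ x).1‖ : ℂ) ≠ 0 := Complex.ofReal_ne_zero.2 (norm_ne_zero_iff.2 (f₁ x).2)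
      have h2 : (‖(f₂ x).1‖ : ℂ) ≠ 0 := Complex.ofReal_ne_zero.2 (norm_ne_zero_iff.2 (f₂ x).2)
      have h3 : (f₁ x).1 ≠ 0 := (f₁ x).2
      set a := (f₁ x).1 / ‖(f₁ x).1‖ with ha
      set b := (f₂ x).1 / ‖(f₂ x).1‖ with hb
      have hna : ‖a‖ = 1 := by
        rw [ha, norm_div, Complex.norm_real, norm_norm, div_self (norm_ne_zero_iff.2 h3)]
      have ha0 : a ≠ 0 := norm_ne_zero_iff.1 (by rw [hna]; exact one_ne_zero)
      have hba : ‖b / a - 1‖ < 1 := by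
        have : b / a - 1 = (b - a) / a := by field_simp
        rw [this, norm_div, hna, div_one, ← dist_eq_norm, dist_comm]
        exact h x
      have hmem : b / a ∈ Complex.slitPlane := by
        have := Complex.mem_slitPlane_of_norm_lt_one hba
        simpa using this
      have hpos : (0 : ℝ) < ‖(f₂ x).1‖ / ‖(f₁ x).1‖ :=
        div_pos (norm_pos_iff.2 (f₂ x).2) (norm_pos_iff.2 h3)
      have heq : (f₂ x).1 / (f₁ x).1 = ((‖(f₂ x).1‖ / ‖(f₁ x).1‖ : ℝ) : ℂ) * (b / a) := by
        rw [ha, hb]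
        push_cast
        field_simp
      rw [heq]
      rw [Complex.mem_slitPlane_iff] at hmem ⊢
      rw [Complex.re_ofReal_mul, Complex.im_ofReal_mul]
      exact hmem.imp (fun h => mul_pos hpos h) fun h => mul_ne_zero hpos.ne' h
    refine ⟨⟨fun x => l x + Complex.log ((f₂ x).1 / (f₁ x).1), ?_⟩, fun x => ?_⟩
    · refine l.continuous.add (Continuous.clog ?_ hq)
      exact (continuous_subtype_val.comp f₂.continuous).div
        (continuous_subtype_val.comp f₁.continuous) fun x => (f₁ x).2
    · change Complex.exp (l x + Complex.log ((f₂ x).1 / (f₁ x).1)) = _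
      rw [Complex.exp_add, hl, Complex.exp_log (div_ne_zero (f₂ x).2 (f₁ x).2)]
      exact mul_div_cancel₀ _ (f₁ x).2

/-- Two continuous logarithms differ by a constant. -/
theorem sub_eq_sub_of_exp_eq {X : Type*} [TopologicalSpace X] [PreconnectedSpace X] (l l' : C(X, ℂ))
    (h : ∀ x, Complex.exp (l x) = Complex.exp (l' x)) (x y : X) : l x - l y = l' x - l' y := by
  have hd : ∀ x, ∃ k : ℤ, l x = l' x + k * (2 * Real.pi * Complex.I) := fun x =>
    Complex.exp_eq_exp_iff_exists_int.1 (h x)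
  choose k hk using hd
  have hpi : (2 * Real.pi * Complex.I : ℂ) ≠ 0 := Complex.two_pi_I_ne_zero
  have hkc : Continuous k := by
    have h1 : Continuous fun x => ((k x : ℝ)) := by
      have : (fun x => ((k x : ℝ))) = fun x =>
          ((l x - l' x) / (2 * Real.pi * Complex.I)).re := by
        funext x
        rw [hk x, add_sub_cancel_left, mul_div_cancel_right₀ _ hpi]
        simp
      rw [this]
      fun_prop
    exact Int.isClosedEmbedding_coe_real.isEmbedding.continuous_iff.2 h1
  have hxy : k x = k y := PreconnectedSpace.constant ‹_› hkc
  rw [hk x, hk y, hxy]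
  ring

end CubicalChains

namespace CubicalChains

/-! ### Winding numbers and lifts to homogeneous coordinates -/

/-- The affine map of standard simplices which is given by `f` on the vertices. -/
def simplexMap {p q : ℕ} (f : Fin (p + 1) → Fin (q + 1)) :
    C(stdSimplex ℝ (Fin (p + 1)), stdSimplex ℝ (Fin (q + 1))) :=
  ⟨stdSimplex.map f, stdSimplex.continuous_map f⟩

theorem simplexMap_comp {p q r : ℕ} (g : Fin (q + 1) → Fin (r + 1)) (f : Fin (p + 1) → Fin (q + 1)) :
    (simplexMap g).comp (simplexMap f) = simplexMap (g ∘ f) := by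
  ext x : 1
  exact (stdSimplex.map_comp_apply f g x)

theorem simplexMap_vertex {p q : ℕ} (f : Fin (p + 1) → Fin (q + 1)) (k : Fin (p + 1)) :
    simplexMap f (stdSimplex.vertex k) = stdSimplex.vertex (f k) :=
  stdSimplex.map_vertex f k

theorem SingSimplex.face_eq {n p : ℕ} (σ : SingSimplex n (p + 1)) (j : Fin (p + 2)) :
    σ.face j = ContinuousMap.comp σ (simplexMap j.succAbove) := rfl

open Classical in
/-- The change of `log g / 2πi` along the path `g` in `ℂ - {0}`. -/
def winding (g : C(stdSimplex ℝ (Fin 2), ℂ)) : ℂ :=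
  if h : ∃ l : C(stdSimplex ℝ (Fin 2), ℂ), ∀ x, Complex.exp (l x) = g x then
    (h.choose (stdSimplex.vertex 1) - h.choose (stdSimplex.vertex 0)) / (2 * Real.pi * Complex.I)
  else 0

instance (k : ℕ) : PreconnectedSpace (stdSimplex ℝ (Fin (k + 1))) := inferInstance

theorem winding_eq {g l : C(stdSimplex ℝ (Fin 2), ℂ)} (h : ∀ x, Complex.exp (l x) = g x) :
    winding g = (l (stdSimplex.vertex 1) - l (stdSimplex.vertex 0)) / (2 * Real.pi * Complex.I) := by
  have h' : ∃ l : C(stdSimplex ℝ (Fin 2), ℂ), ∀ x, Complex.exp (l x) = g x := ⟨l, h⟩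
  rw [winding, dif_pos h']
  rw [sub_eq_sub_of_exp_eq h'.choose l fun x => (h'.choose_spec x).trans (h x).symm]

theorem winding_mul {g k h : C(stdSimplex ℝ (Fin 2), ℂ)} (hk : ∀ x, k x ≠ 0) (hh : ∀ x, h x ≠ 0)
    (hg : ∀ x, g x = k x * h x) : winding g = winding k + winding h := by
  obtain ⟨l, hl⟩ := exists_continuous_log k hk
  obtain ⟨m, hm⟩ := exists_continuous_log h hh
  have : ∀ x, Complex.exp ((l + m) x) = g x := fun x => by
    rw [ContinuousMap.add_apply, Complex.exp_add, hl, hm, hg]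
  rw [winding_eq hl, winding_eq hm, winding_eq this]
  simp only [ContinuousMap.add_apply]
  ring

theorem winding_const {g : C(stdSimplex ℝ (Fin 2), ℂ)} {a : ℂ} (ha : a ≠ 0) (hg : ∀ x, g x = a) :
    winding g = 0 := by
  have : ∀ x, Complex.exp (ContinuousMap.const (stdSimplex ℝ (Fin 2)) (Complex.log a) x) = g x :=
    fun x => by rw [hg, ContinuousMap.const_apply, Complex.exp_log ha]
  rw [winding_eq this]
  simp

theorem sum_winding_face (h : C(stdSimplex ℝ (Fin 3), ℂ)) (hh : ∀ x, h x ≠ 0) :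
    ∑ j : Fin 3, (-1 : ℂ) ^ (j : ℕ) * winding (h.comp (simplexMap j.succAbove)) = 0 := by
  obtain ⟨l, hl⟩ := exists_continuous_log h hh
  have : ∀ j : Fin 3, winding (h.comp (simplexMap j.succAbove)) =
      (l (stdSimplex.vertex (j.succAbove 1)) - l (stdSimplex.vertex (j.succAbove 0))) /
        (2 * Real.pi * Complex.I) := by
    intro j
    rw [winding_eq (l := l.comp (simplexMap j.succAbove)) fun x => hl _]
    simp only [ContinuousMap.comp_apply, simplexMap_vertex]
  simp only [this, Fin.sum_univ_three]
  have e1 : (0 : Fin 3).succAbove 0 = 1 := rfl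
  have e2 : (0 : Fin 3).succAbove 1 = 2 := rfl
  have e3 : (1 : Fin 3).succAbove 0 = 0 := rfl
  have e4 : (1 : Fin 3).succAbove 1 = 2 := rfl
  have e5 : (2 : Fin 3).succAbove 0 = 0 := rfl
  have e6 : (2 : Fin 3).succAbove 1 = 1 := rfl
  rw [e1, e2, e3, e4, e5, e6]
  simp only [Fin.val_zero, Fin.val_one, Fin.val_two]
  ring

/-- Winding is the difference of the principal logarithms at the end points up to an integer; so it is
rational up to a coboundary. -/
theorem exists_winding_eq_add_int {g : C(stdSimplex ℝ (Fin 2), ℂ)} (hg : ∀ x, g x ≠ 0) :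
    ∃ m : ℤ, winding g = Complex.log (g (stdSimplex.vertex 1)) / (2 * Real.pi * Complex.I) -
      Complex.log (g (stdSimplex.vertex 0)) / (2 * Real.pi * Complex.I) + m := by
  obtain ⟨l, hl⟩ := exists_continuous_log g hg
  have hd : ∀ x, ∃ k : ℤ, l x = Complex.log (g x) + k * (2 * Real.pi * Complex.I) := fun x =>
    Complex.exp_eq_exp_iff_exists_int.1 (by rw [hl, Complex.exp_log (hg x)])
  obtain ⟨a, ha⟩ := hd (stdSimplex.vertex 0)
  obtain ⟨b, hb⟩ := hd (stdSimplex.vertex 1)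
  refine ⟨b - a, ?_⟩
  have hpi : (2 * Real.pi * Complex.I : ℂ) ≠ 0 := Complex.two_pi_I_ne_zero
  rw [winding_eq hl, ha, hb]
  push_cast
  field_simp
  ring

/-- `q` is a pair of homogeneous coordinates of `z ∈ ℙ¹`, the quotient of which is the coordinate
`Pole.coord` centred at `α`. -/
def Pole.IsHomogeneous (α : Pole) (q : ℂ × ℂ) (z : OnePoint ℂ) : Prop :=
  q ≠ 0 ∧ (z ≠ α.opp.pt → q.1 = α.coord z * q.2) ∧ (z = α.opp.pt → q.2 = 0)

theorem Pole.IsHomogeneous.snd_ne_zero {α : Pole} {q : ℂ × ℂ} {z : OnePoint ℂ}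
    (h : α.IsHomogeneous q z) (hz : z ≠ α.opp.pt) : q.2 ≠ 0 := by
  intro h0
  refine h.1 (Prod.ext ?_ h0)
  rw [h.2.1 hz, h0, mul_zero]
  rfl

theorem Pole.IsHomogeneous.swap {q : ℂ × ℂ} {z : OnePoint ℂ}
    (h : Pole.zero.IsHomogeneous q z) : Pole.infty.IsHomogeneous q.swap z := by
  obtain ⟨h0, h1, h2⟩ := h
  have h0' : q.swap ≠ 0 := fun h => h0 (by rw [← q.swap_swap, h]; rfl)
  refine ⟨h0', fun hz => ?_, fun hz => ?_⟩
  · by_cases hi : z = OnePoint.infty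
    · have := h2 hi
      simp [hi, Pole.coord, this]
    · have hc : Pole.zero.coord z ≠ 0 := fun h => hz ((Pole.zero.coord_eq_zero_iff hi).1 h)
      have := Pole.coord_opp .zero z
      change Pole.infty.coord z = _ at this
      rw [this, Prod.fst_swap, Prod.snd_swap, h1 hi, inv_mul_cancel_left₀ hc]
  · have : Pole.zero.coord z = 0 := by rw [hz]; rfl
    rw [Prod.snd_swap, h1 (by rw [hz]; exact Pole.zero.pt_ne_opp), this, zero_mul]

theorem Pole.isHomogeneous_of_ne_pt {α : Pole} {z : OnePoint ℂ} (hz : z ≠ α.pt) :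
    α.IsHomogeneous (1, α.opp.coord z) z := by
  refine ⟨fun h => one_ne_zero (congrArg Prod.fst h), fun h => ?_, fun h => ?_⟩
  · rw [α.coord_opp, mul_inv_cancel₀]
    exact fun h0 => hz ((α.coord_eq_zero_iff h).1 h0)
  · rw [h]
    exact α.opp.coord_pt

/-- The orthogonal projection of `ℂ²` on the line which corresponds to a point of the unit
sphere. -/
def lineProj (y : Fin 3 → ℝ) (q : ℂ × ℂ) : ℂ × ℂ :=
  (((1 + y 2 : ℝ) / 2 : ℂ) * q.1 + ((y 0 + y 1 * Complex.I) / 2) * q.2,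
    ((y 0 - y 1 * Complex.I) / 2) * q.1 + ((1 - y 2 : ℝ) / 2 : ℂ) * q.2)

theorem isHomogeneous_lineProj {z : OnePoint ℂ} {q : ℂ × ℂ} (h : lineProj (sphere z) q ≠ 0) :
    Pole.zero.IsHomogeneous (lineProj (sphere z) q) z := by
  refine ⟨h, fun hz => ?_, fun hz => ?_⟩
  · induction z using OnePoint.rec with
    | infty => exact absurd rfl hz
    | coe c =>
      have hN : (1 + (‖c‖ : ℂ) ^ 2) ≠ 0 := by
        have : (1 + ‖c‖ ^ 2 : ℝ) ≠ 0 := by positivity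
        exact_mod_cast this
      have hc : c = c.re + c.im * Complex.I := (Complex.re_add_im c).symm
      have hnc : (‖c‖ : ℂ) ^ 2 = (c.re : ℂ) ^ 2 + (c.im : ℂ) ^ 2 := by
        have := Complex.sq_norm c
        rw [Complex.normSq_apply] at this
        rw [← Complex.ofReal_pow, this]
        push_cast
        ring
      simp only [lineProj, sphere, OnePoint.elim_some, Matrix.cons_val, Pole.coord]
      push_cast
      field_simp
      rw [hnc]
      have hI := Complex.I_sq
      generalize (c.re : ℂ) = a at *
      generalize (c.im : ℂ) = b at *
      rw [hc]
      linear_combination (2 * b ^ 2 * q.1) * hI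
  · subst hz
    simp [lineProj, sphere, Pole.pt, Pole.opp]

theorem lineProj_of_isHomogeneous {z : OnePoint ℂ} {q : ℂ × ℂ} (h : Pole.zero.IsHomogeneous q z) :
    lineProj (sphere z) q = q := by
  induction z using OnePoint.rec with
  | infty =>
    have := h.2.2 rfl
    apply Prod.ext
    · simp [lineProj, sphere, this]
    · simp [lineProj, sphere, this]
  | coe c =>
    have h1 : q.1 = c * q.2 := h.2.1 (OnePoint.coe_ne_infty c)
    have hN : (1 + (‖c‖ : ℂ) ^ 2) ≠ 0 := by
      have : (1 + ‖c‖ ^ 2 : ℝ) ≠ 0 := by positivity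
      exact_mod_cast this
    have hc : c = c.re + c.im * Complex.I := (Complex.re_add_im c).symm
    have hnc : (‖c‖ : ℂ) ^ 2 = (c.re : ℂ) ^ 2 + (c.im : ℂ) ^ 2 := by
      have := Complex.sq_norm c
      rw [Complex.normSq_apply] at this
      rw [← Complex.ofReal_pow, this]
      push_cast
      ring
    apply Prod.ext
    · simp only [lineProj, sphere, OnePoint.elim_some, Matrix.cons_val, h1]
      push_cast
      field_simp
      rw [hnc]
      have hI := Complex.I_sq
      generalize (c.re : ℂ) = a at *
      generalize (c.im : ℂ) = b at *
      rw [hc]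
      ring
    · simp only [lineProj, sphere, OnePoint.elim_some, Matrix.cons_val, h1]
      push_cast
      field_simp
      rw [hnc]
      have hI := Complex.I_sq
      generalize (c.re : ℂ) = a at *
      generalize (c.im : ℂ) = b at *
      rw [hc]
      linear_combination (-2 * b ^ 2 * q.2) * hI

/-- A line can be projected isomorphically to a nearby line: at distance less than `1/2` the difference
of the two projections has norm less than one. -/
theorem lineProj_ne_zero {y y' : Fin 3 → ℝ} (hd : dist y y' < 1 / 2) {q : ℂ × ℂ} (hq : q ≠ 0)
    (h : lineProj y q = q) : lineProj y' q ≠ 0 := by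
  intro h0
  have hk : ∀ k, ‖((y k : ℂ) - y' k)‖ ≤ 1 / 2 := fun k => by
    rw [← Complex.ofReal_sub, Complex.norm_real, ← dist_eq_norm]
    exact (dist_le_pi_dist y y' k).trans hd.le
  have e1 : q.1 = ((y 2 - y' 2) / 2 : ℂ) * q.1 +
      (((y 0 - y' 0) + (y 1 - y' 1) * Complex.I) / 2) * q.2 := by
    have h1 := congrArg Prod.fst h
    have h2 := congrArg Prod.fst h0
    simp only [lineProj, Prod.fst_zero] at h1 h2
    push_cast at h1 h2
    linear_combination h2 - h1
  have e2 : q.2 = (((y 0 - y' 0) - (y 1 - y' 1) * Complex.I) / 2) * q.1 -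
      ((y 2 - y' 2) / 2 : ℂ) * q.2 := by
    have h1 := congrArg Prod.snd h
    have h2 := congrArg Prod.snd h0
    simp only [lineProj, Prod.snd_zero] at h1 h2
    push_cast at h1 h2
    linear_combination h2 - h1
  have n2 : ‖((y 2 - y' 2) / 2 : ℂ)‖ ≤ 1 / 4 := by
    rw [norm_div, Complex.norm_two]
    linarith [hk 2]
  have n01 : ‖(((y 0 - y' 0) + (y 1 - y' 1) * Complex.I) / 2 : ℂ)‖ ≤ 1 / 2 := by
    rw [norm_div, Complex.norm_two]
    have := norm_add_le ((y 0 : ℂ) - y' 0) ((y 1 - y' 1) * Complex.I)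
    rw [norm_mul, Complex.norm_I, mul_one] at this
    linarith [hk 0, hk 1]
  have n01' : ‖(((y 0 - y' 0) - (y 1 - y' 1) * Complex.I) / 2 : ℂ)‖ ≤ 1 / 2 := by
    rw [norm_div, Complex.norm_two]
    have := norm_sub_le ((y 0 : ℂ) - y' 0) ((y 1 - y' 1) * Complex.I)
    rw [norm_mul, Complex.norm_I, mul_one] at this
    linarith [hk 0, hk 1]
  have m1 : ‖q.1‖ ≤ 1 / 4 * ‖q.1‖ + 1 / 2 * ‖q.2‖ := by
    conv_lhs => rw [e1]
    refine (norm_add_le _ _).trans ?_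
    rw [norm_mul, norm_mul]
    gcongr
  have m2 : ‖q.2‖ ≤ 1 / 2 * ‖q.1‖ + 1 / 4 * ‖q.2‖ := by
    conv_lhs => rw [e2]
    refine (norm_sub_le _ _).trans ?_
    rw [norm_mul, norm_mul]
    gcongr
  have p1 := norm_nonneg q.1
  have p2 := norm_nonneg q.2
  have z1 : ‖q.1‖ = 0 := by linarith
  have z2 : ‖q.2‖ = 0 := by linarith
  exact hq (Prod.ext (norm_eq_zero.1 z1) (norm_eq_zero.1 z2))

theorem continuous_lineProj : Continuous fun x : (Fin 3 → ℝ) × (ℂ × ℂ) => lineProj x.1 x.2 := by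
  unfold lineProj
  fun_prop

/-- Homogeneous coordinates can be chosen continuously along a map from a compact contractible
space to `ℙ¹`. -/
theorem exists_homogeneous_lift {X : Type*} [TopologicalSpace X] [CompactSpace X]
    [ContractibleSpace X] (α : Pole) (f : C(X, OnePoint ℂ)) :
    ∃ q : C(X, ℂ × ℂ), (∀ x, α.IsHomogeneous (q x) (f x)) ∧
      ((∀ x, f x ≠ α.pt) → ∀ x, (q x).1 = 1) := by
  by_cases hf : ∀ x, f x ≠ α.pt
  · refine ⟨⟨fun x => (1, α.opp.coord (f x)), ?_⟩, fun x => Pole.isHomogeneous_of_ne_pt (hf x),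
      fun _ _ => rfl⟩
    refine continuous_const.prodMk (continuous_iff_continuousAt.2 fun x => ?_)
    exact (α.opp.continuousAt_coord (by rw [α.opp_opp]; exact hf x)).comp f.continuous.continuousAt
  · suffices h : ∃ q : C(X, ℂ × ℂ), ∀ x, Pole.zero.IsHomogeneous (q x) (f x) by
      obtain ⟨q, hq⟩ := h
      cases α with
      | zero => exact ⟨q, hq, fun h => absurd h hf⟩
      | infty =>
        exact ⟨⟨fun x => (q x).swap, continuous_swap.comp q.continuous⟩, fun x => (hq x).swap,
          fun h => absurd h hf⟩
    -- A lift of `f₁` gives a lift of a map `f₂` close to it by projection to the lines `f₂ x`.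
    refine ContinuousMap.induction_of_contractible ⟨sphere, continuous_sphere⟩ one_half_pos
      (Q := fun f => ∃ q : C(X, ℂ × ℂ), ∀ x, Pole.zero.IsHomogeneous (q x) (f x)) ?_ ?_ f
    · intro z
      by_cases hz : z = OnePoint.infty
      · refine ⟨ContinuousMap.const X (1, 0), fun x => ⟨?_, fun h => absurd hz h, fun _ => rfl⟩⟩
        exact fun h => one_ne_zero (congrArg Prod.fst h)
      · refine ⟨ContinuousMap.const X (Pole.zero.coord z, 1), fun x => ⟨?_, fun _ => ?_,
          fun h => absurd h hz⟩⟩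
        · exact fun h => one_ne_zero (congrArg Prod.snd h)
        · simp
    · rintro f₁ f₂ ⟨q, hq⟩ hd
      refine ⟨⟨fun x => lineProj (sphere (f₂ x)) (q x), ?_⟩, fun x => ?_⟩
      · exact continuous_lineProj.comp
          ((continuous_sphere.comp f₂.continuous).prodMk q.continuous)
      · exact isHomogeneous_lineProj (lineProj_ne_zero (hd x) (hq x).1
          (lineProj_of_isHomogeneous (hq x)))

end CubicalChains

namespace CubicalChains

/-! ### The integral of the logarithmic form along smooth paths -/

theorem SingSimplex.path_zero {n : ℕ} (σ : SingSimplex n 1) :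
    σ.path 0 = σ (stdSimplex.vertex 0) := by
  have h : stdSimplexHomeomorphUnitInterval (stdSimplex.vertex (S := ℝ) (0 : Fin 2)) = 0 :=
    stdSimplexHomeomorphUnitInterval_zero
  rw [path, Set.projIcc_left, show (⟨0, by simp⟩ : unitInterval) = 0 from rfl, ← h, Homeomorph.symm_apply_apply]

theorem SingSimplex.path_one {n : ℕ} (σ : SingSimplex n 1) :
    σ.path 1 = σ (stdSimplex.vertex 1) := by
  have h : stdSimplexHomeomorphUnitInterval (stdSimplex.vertex (S := ℝ) (1 : Fin 2)) = 1 :=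
    stdSimplexHomeomorphUnitInterval_one
  rw [path, Set.projIcc_right, show (⟨1, by simp⟩ : unitInterval) = 1 from rfl, ← h, Homeomorph.symm_apply_apply]

/-- The coordinate `Pole.coord` as a function on the unit sphere. -/
def Pole.sphereCoord (α : Pole) (y : Fin 3 → ℝ) : ℂ :=
  match α with
  | .zero => (y 0 + y 1 * Complex.I) / ((1 - y 2 : ℝ) : ℂ)
  | .infty => (y 0 - y 1 * Complex.I) / ((1 + y 2 : ℝ) : ℂ)

theorem Pole.sphereCoord_sphere (α : Pole) {z : OnePoint ℂ} (hz : z ≠ α.opp.pt) :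
    α.sphereCoord (sphere z) = α.coord z := by
  rw [← α.chart_coord hz, α.coord_chart]
  generalize α.coord z = c
  have h2 : ((1 : ℂ) + (‖c‖ : ℂ) ^ 2) ≠ 0 := by
    have : (1 + ‖c‖ ^ 2 : ℝ) ≠ 0 := by positivity
    exact_mod_cast this
  rw [sphere_chart]
  cases α <;>
  · simp only [sphereCoord, Matrix.cons_val]
    push_cast
    field_simp
    ring_nf
    nth_rewrite 3 [← Complex.re_add_im c]
    ring

theorem Pole.contDiffAt_sphereCoord (α : Pole) {z : OnePoint ℂ} (hz : z ≠ α.opp.pt) :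
    ContDiffAt ℝ ∞ α.sphereCoord (sphere z) := by
  have hd : ∀ c : ℂ, (((1 + ‖c‖ ^ 2 : ℝ))) ≠ 0 := fun c => by positivity
  rw [← α.chart_coord hz]
  generalize α.coord z = c
  have hof : ContDiff ℝ ∞ (fun x : ℝ => (x : ℂ)) := Complex.ofRealCLM.contDiff
  have hp : ∀ k, ContDiff ℝ ∞ (fun y : Fin 3 → ℝ => ((y k : ℝ) : ℂ)) := fun k =>
    hof.comp (contDiff_apply ℝ ℝ k)
  cases α with
  | zero =>
    unfold sphereCoord
    simp only [div_eq_mul_inv]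
    refine ContDiffAt.mul ?_ (ContDiffAt.inv ?_ ?_)
    · exact ((hp 0).add ((hp 1).mul contDiff_const)).contDiffAt
    · exact (hof.comp (contDiff_const.sub (contDiff_apply ℝ ℝ 2))).contDiffAt
    · rw [sphere_chart]
      refine Complex.ofReal_ne_zero.2 ?_
      simp only [Matrix.cons_val]
      rw [sub_ne_zero, ne_comm, ne_eq, div_eq_one_iff_eq (hd c)]
      intro h
      linarith
  | infty =>
    unfold sphereCoord
    simp only [div_eq_mul_inv]
    refine ContDiffAt.mul ?_ (ContDiffAt.inv ?_ ?_)
    · exact ((hp 0).sub ((hp 1).mul contDiff_const)).contDiffAt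
    · exact (hof.comp (contDiff_const.add (contDiff_apply ℝ ℝ 2))).contDiffAt
    · rw [sphere_chart]
      refine Complex.ofReal_ne_zero.2 ?_
      simp only [Matrix.cons_val]
      rw [← sub_eq_add_neg, sub_ne_zero, ne_comm, ne_eq, div_eq_one_iff_eq (hd c)]
      intro h
      linarith

variable {n : ℕ}

theorem mem_tube_iff {i : Fin n} {α : Pole} {z : P n} :
    z ∈ tube i α ↔ z i ≠ α.opp.pt ∧ ‖α.coord (z i)‖ < 1 := α.mem_disc_iff

theorem coord_ne_zero_of_mem {i : Fin n} {α : Pole} {z : P n} (hz : z ∈ tube i α \ hyper i α) :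
    α.coord (z i) ≠ 0 := fun h =>
  hz.2 ((α.coord_eq_zero_iff (mem_tube_iff.1 hz.1).1).1 h)

/-- The fundamental theorem of calculus for a continuous logarithm along the path. -/
theorem logIntegral_eq_winding {i : Fin n} {α : Pole} {σ : SingSimplex n 1}
    (hσ : Set.range σ ⊆ tube i α \ hyper i α)
    (hs : ContDiffOn ℝ ∞ (fun t => embed (σ.path t)) (Set.Icc 0 1))
    {g : C(stdSimplex ℝ (Fin 2), ℂ)} (hg : ∀ x, g x = α.coord (σ x i)) :
    logIntegral i α σ = winding g := by
  have hσ' : ∀ x, σ x ∈ tube i α \ hyper i α := fun x => hσ ⟨x, rfl⟩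
  have hpath : ∀ t, σ.path t ∈ tube i α \ hyper i α := fun t => hσ' _
  obtain ⟨l, hl⟩ := exists_continuous_log g fun x => by rw [hg]; exact coord_ne_zero_of_mem (hσ' x)
  let w : ℝ → ℂ := fun t => α.coord (σ.path t i)
  let L : ℝ → ℂ := fun t =>
    l (stdSimplexHomeomorphUnitInterval.symm (Set.projIcc 0 1 zero_le_one t))
  have hLw : ∀ t, Complex.exp (L t) = w t := fun t => by rw [hl, hg]; rfl
  have hLc : Continuous L := by
    exact l.continuous.comp (stdSimplexHomeomorphUnitInterval.symm.continuous.comp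
      continuous_projIcc)
  have hw0 : ∀ t, w t ≠ 0 := fun t => coord_ne_zero_of_mem (hpath t)
  have hwc : Continuous w := by
    have : w = fun t => Complex.exp (L t) := funext fun t => (hLw t).symm
    rw [this]
    exact Complex.continuous_exp.comp hLc
  have hwd : ContDiffOn ℝ ∞ w (Set.Icc 0 1) := by
    have h1 : ContDiffOn ℝ ∞ (fun t => α.sphereCoord (fun k => embed (σ.path t) (i, k)))
        (Set.Icc 0 1) := by
      intro t ht
      have h2 : ContDiffWithinAt ℝ ∞ (fun t => fun k => embed (σ.path t) (i, k)) (Set.Icc 0 1) t :=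
        contDiffWithinAt_pi.2 fun k => contDiffWithinAt_pi.1 (hs t ht) (i, k)
      exact (α.contDiffAt_sphereCoord (mem_tube_iff.1 (hpath t).1).1).comp_contDiffWithinAt t h2
    refine h1.congr fun t _ => ?_
    exact (α.sphereCoord_sphere (mem_tube_iff.1 (hpath t).1).1).symm
  have hder : ∀ t ∈ Set.Ioo (0 : ℝ) 1, HasDerivAt w (deriv w t) t := by
    intro t ht
    have := (hwd.contDiffAt (Icc_mem_nhds ht.1 ht.2)).differentiableAt (by simp)
    exact this.hasDerivAt
  have hLder : ∀ t ∈ Set.Ioo (0 : ℝ) 1, HasDerivAt L (deriv w t / w t) t := by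
    intro t ht
    have h1 : HasStrictDerivAt Complex.exp (Complex.exp (L t)) (L t) :=
      Complex.hasStrictDerivAt_exp _
    have h2 := h1.to_localInverse (Complex.exp_ne_zero _)
    have h3 : HasDerivAt w (deriv w t) t := hder t ht
    have h4 : HasDerivAt (h1.localInverse _ _ _ (Complex.exp_ne_zero _)) (Complex.exp (L t))⁻¹
        (w t) := by
      rw [← hLw t]
      exact h2.hasDerivAt
    have h5 := h4.comp t h3
    have h7 : deriv w t / w t = (Complex.exp (L t))⁻¹ * deriv w t := by
      rw [hLw t, inv_mul_eq_div]
    rw [h7]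
    refine h5.congr_of_eventuallyEq ?_
    have h6 : ∀ᶠ x in nhds (L t),
        h1.localInverse _ _ _ (Complex.exp_ne_zero _) (Complex.exp x) = x :=
      HasStrictFDerivAt.eventually_left_inverse _
    filter_upwards [hLc.continuousAt.eventually h6] with s hs
    rw [Function.comp_apply, ← hLw s, hs]
  have hint : IntervalIntegrable (fun t => deriv w t / w t) MeasureTheory.volume 0 1 := by
    have h1 : ContinuousOn (fun t => derivWithin w (Set.Icc 0 1) t / w t) (Set.Icc 0 1) :=
      (hwd.continuousOn_derivWithin (uniqueDiffOn_Icc zero_lt_one) (by simp)).div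
        hwc.continuousOn fun t _ => hw0 t
    refine (ContinuousOn.intervalIntegrable (u := fun t => derivWithin w (Set.Icc 0 1) t / w t)
      (by rwa [Set.uIcc_of_le zero_le_one])).congr_ae ?_
    rw [Set.uIoc_of_le zero_le_one, ← MeasureTheory.restrict_Ioo_eq_restrict_Ioc]
    filter_upwards [MeasureTheory.ae_restrict_mem measurableSet_Ioo] with t ht
    rw [derivWithin_of_mem_nhds (Icc_mem_nhds ht.1 ht.2)]
  have := intervalIntegral.integral_eq_sub_of_hasDerivAt_of_le zero_le_one hLc.continuousOn hLder hint
  rw [winding_eq hl, logIntegral]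
  change _ * ∫ t in (0 : ℝ)..1, deriv w t / w t = _
  rw [this, div_eq_inv_mul]
  congr 1
  have h0 : L 0 = l (stdSimplex.vertex 0) := by
    have h : stdSimplexHomeomorphUnitInterval (stdSimplex.vertex (S := ℝ) (0 : Fin 2)) = 0 :=
      stdSimplexHomeomorphUnitInterval_zero
    simp only [L]
    rw [Set.projIcc_left, show (⟨0, by simp⟩ : unitInterval) = 0 from rfl, ← h,
      Homeomorph.symm_apply_apply]
  have h1 : L 1 = l (stdSimplex.vertex 1) := by
    have h : stdSimplexHomeomorphUnitInterval (stdSimplex.vertex (S := ℝ) (1 : Fin 2)) = 1 :=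
      stdSimplexHomeomorphUnitInterval_one
    simp only [L]
    rw [Set.projIcc_right, show (⟨1, by simp⟩ : unitInterval) = 1 from rfl, ← h,
      Homeomorph.symm_apply_apply]
  rw [h0, h1]

end CubicalChains

namespace CubicalChains

/-! ### Singular Thom cocycles -/

section Lift

variable {n : ℕ} (i : Fin n) (α : Pole)

/-- A coordinate of a singular simplex. -/
def SingSimplex.coordinate {p : ℕ} (σ : SingSimplex n p) :
    C(stdSimplex ℝ (Fin (p + 1)), OnePoint ℂ) :=
  ⟨fun x => σ x i, (continuous_apply i).comp σ.continuous⟩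

/-- A choice of homogeneous coordinates of the `i`-th coordinate along a singular simplex, with
first entry `1` if the simplex does not meet `H_{i,α}`. -/
def lift {p : ℕ} (σ : SingSimplex n p) : C(stdSimplex ℝ (Fin (p + 1)), ℂ × ℂ) :=
  (exists_homogeneous_lift α (σ.coordinate i)).choose

theorem isHomogeneous_lift {p : ℕ} (σ : SingSimplex n p) (x : stdSimplex ℝ (Fin (p + 1))) :
    α.IsHomogeneous (lift i α σ x) (σ x i) :=
  (exists_homogeneous_lift α (σ.coordinate i)).choose_spec.1 x

theorem lift_fst_eq_one {p : ℕ} {σ : SingSimplex n p} (hσ : Set.range σ ⊆ (hyper i α)ᶜ)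
    (x : stdSimplex ℝ (Fin (p + 1))) : (lift i α σ x).1 = 1 :=
  (exists_homogeneous_lift α (σ.coordinate i)).choose_spec.2
    (fun x h => hσ ⟨x, rfl⟩ h) x

open Classical in
/-- The proportionality factor of two maps to the punctured plane which define the same map to
`ℙ¹`. -/
def ratio {X : Type*} [TopologicalSpace X] (q q' : C(X, ℂ × ℂ)) : C(X, ℂ) :=
  if h : ∃ r : C(X, ℂ), ∀ x, r x ≠ 0 ∧ q' x = r x • q x then h.choose else 1

theorem ratio_ne_zero {X : Type*} [TopologicalSpace X] (q q' : C(X, ℂ × ℂ)) (x : X) :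
    ratio q q' x ≠ 0 := by
  unfold ratio
  split_ifs with h
  · exact (h.choose_spec x).1
  · exact one_ne_zero

theorem eq_ratio_smul {X : Type*} [TopologicalSpace X] {q q' : C(X, ℂ × ℂ)} {f : X → OnePoint ℂ}
    {α : Pole} (hq : ∀ x, α.IsHomogeneous (q x) (f x)) (hq' : ∀ x, α.IsHomogeneous (q' x) (f x))
    (x : X) : q' x = ratio q q' x • q x := by
  have h : ∃ r : C(X, ℂ), ∀ x, r x ≠ 0 ∧ q' x = r x • q x := by
    have key : ∀ x, ∃ r : ℂ, r ≠ 0 ∧ q' x = r • q x := by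
      intro x
      by_cases hf : f x = α.opp.pt
      · have h1 := (hq x).2.2 hf
        have h2 := (hq' x).2.2 hf
        have h3 : (q x).1 ≠ 0 := fun h => (hq x).1 (Prod.ext h h1)
        have h4 : (q' x).1 ≠ 0 := fun h => (hq' x).1 (Prod.ext h h2)
        refine ⟨(q' x).1 / (q x).1, div_ne_zero h4 h3, Prod.ext ?_ ?_⟩
        · simp [h3]
        · simp [h1, h2]
      · have h3 := (hq x).snd_ne_zero hf
        have h4 := (hq' x).snd_ne_zero hf
        refine ⟨(q' x).2 / (q x).2, div_ne_zero h4 h3, Prod.ext ?_ ?_⟩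
        · rw [Prod.smul_fst, (hq x).2.1 hf, (hq' x).2.1 hf, smul_eq_mul]
          field_simp
        · simp [h3]
    choose r hr0 hr using key
    have hn : ∀ x, (Complex.normSq (q x).1 + Complex.normSq (q x).2 : ℂ) ≠ 0 := by
      intro x h
      have h' : Complex.normSq (q x).1 + Complex.normSq (q x).2 = 0 := by exact_mod_cast h
      have h1 := Complex.normSq_nonneg (q x).1
      have h2 := Complex.normSq_nonneg (q x).2
      exact (hq x).1 (Prod.ext (Complex.normSq_eq_zero.1 (by linarith))
        (Complex.normSq_eq_zero.1 (by linarith)))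
    refine ⟨⟨r, ?_⟩, fun x => ⟨hr0 x, hr x⟩⟩
    have hre : r = fun x => ((q' x).1 * (starRingEnd ℂ) (q x).1 +
        (q' x).2 * (starRingEnd ℂ) (q x).2) /
          (Complex.normSq (q x).1 + Complex.normSq (q x).2 : ℂ) := by
      funext x
      rw [eq_div_iff (hn x)]
      conv_rhs => rw [hr x]
      rw [Prod.smul_fst, Prod.smul_snd, smul_eq_mul, smul_eq_mul, mul_assoc, mul_assoc,
        Complex.mul_conj, Complex.mul_conj]
      ring
    rw [hre]
    refine Continuous.div ?_ ?_ hn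
    · fun_prop
    · have : Continuous Complex.normSq := Complex.continuous_normSq
      fun_prop
  rw [ratio, dif_pos h]
  exact (h.choose_spec x).2

theorem ratio_eq {X : Type*} [TopologicalSpace X] {q q' : C(X, ℂ × ℂ)} {f : X → OnePoint ℂ}
    {α : Pole} (hq : ∀ x, α.IsHomogeneous (q x) (f x)) (hq' : ∀ x, α.IsHomogeneous (q' x) (f x))
    {x : X} {r : ℂ} (hr : q' x = r • q x) : ratio q q' x = r := by
  have h := eq_ratio_smul hq hq' x
  rw [hr] at h
  exact (smul_left_injective ℂ (hq x).1 h).symm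

/-- The winding of the homogeneous coordinates chosen on an edge, relative to those given by `q`. -/
def relativeWinding {p : ℕ} (τ : SingSimplex n p) (q : C(stdSimplex ℝ (Fin (p + 1)), ℂ × ℂ))
    (x : Fin 2 → Fin (p + 1)) : ℂ :=
  winding (ratio (q.comp (simplexMap x)) (lift i α (ContinuousMap.comp τ (simplexMap x))))

/-- The obstruction to choosing homogeneous coordinates compatibly on a singular triangle and its
edges. -/
def complexThomCochain (τ : SingSimplex n 2) : ℂ :=
  -∑ j : Fin 3, (-1 : ℂ) ^ (j : ℕ) * relativeWinding i α τ (lift i α τ) j.succAbove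

theorem sum_sum_succAbove {M : Type*} [AddCommGroup M] [Module ℚ M] {p : ℕ}
    (w : (Fin (p + 1) → Fin (p + 3)) → M) :
    ∑ k : Fin (p + 3), (-1 : ℚ) ^ (k : ℕ) • ∑ j : Fin (p + 2), (-1 : ℚ) ^ (j : ℕ) •
      w (k.succAbove ∘ j.succAbove) = 0 := by
  have h := congrArg (Finsupp.linearCombination ℚ w)
    (Tuple.bd_bd (m := p + 1) (Finsupp.single (id : Fin (p + 3) → Fin (p + 3)) 1))
  rw [Tuple.bd_single, map_sum, map_sum, map_zero] at h
  rw [← h]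
  refine Finset.sum_congr rfl fun k _ => ?_
  rw [map_smul, map_smul, Tuple.bd_single, map_sum]
  congr 1
  refine Finset.sum_congr rfl fun j _ => ?_
  rw [map_smul, Finsupp.linearCombination_single, one_smul]
  rfl

/-- The relative winding of an edge with respect to a face of `ρ` differs from the one with respect to
`ρ` by the winding of a function on that face, which is a coboundary. -/
theorem relativeWinding_comp {p r : ℕ} (ρ : SingSimplex n r)
    {Q : C(stdSimplex ℝ (Fin (r + 1)), ℂ × ℂ)} (hQ : ∀ x, α.IsHomogeneous (Q x) (ρ x i))
    (f : Fin (p + 1) → Fin (r + 1)) (x : Fin 2 → Fin (p + 1)) :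
    relativeWinding i α ρ Q (f ∘ x) =
      relativeWinding i α (ContinuousMap.comp ρ (simplexMap f))
        (lift i α (ContinuousMap.comp ρ (simplexMap f))) x +
      winding ((ratio (Q.comp (simplexMap f))
        (lift i α (ContinuousMap.comp ρ (simplexMap f)))).comp (simplexMap x)) := by
  set ρf : SingSimplex n p := ContinuousMap.comp ρ (simplexMap f) with hρf
  have hcomp : ContinuousMap.comp ρ (simplexMap (f ∘ x)) = ContinuousMap.comp ρf (simplexMap x) := by
    rw [hρf, ContinuousMap.comp_assoc, simplexMap_comp]
  unfold relativeWinding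
  rw [hcomp]
  refine winding_mul (fun y => ratio_ne_zero _ _ _) (fun y => ratio_ne_zero _ _ _) fun y => ?_
  have h1 : ∀ y, α.IsHomogeneous ((Q.comp (simplexMap (f ∘ x))) y)
      (ContinuousMap.comp ρf (simplexMap x) y i) := fun y => by
    rw [← hcomp]
    exact hQ _
  refine ratio_eq h1 (isHomogeneous_lift i α _) ?_
  have h2 : ∀ y, α.IsHomogeneous (((lift i α ρf).comp (simplexMap x)) y)
      (ContinuousMap.comp ρf (simplexMap x) y i) := fun y => isHomogeneous_lift i α ρf _
  have h3 : ∀ y, α.IsHomogeneous ((Q.comp (simplexMap f)) y) (ρf y i) := fun y => hQ _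
  rw [eq_ratio_smul h2 (isHomogeneous_lift i α _) y, ContinuousMap.comp_apply,
    eq_ratio_smul h3 (isHomogeneous_lift i α ρf) (simplexMap x y), mul_smul]
  have : (Q.comp (simplexMap f)) (simplexMap x y) = (Q.comp (simplexMap (f ∘ x))) y := by
    rw [← simplexMap_comp]
    rfl
  rw [this]
  rfl

theorem sum_complexThomCochain_face (ρ : SingSimplex n 3) :
    ∑ k : Fin 4, (-1 : ℂ) ^ (k : ℕ) * complexThomCochain i α (ρ.face k) = 0 := by
  have h := sum_sum_succAbove (relativeWinding i α ρ (lift i α ρ))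
  have h2 : ∀ k : Fin 4, ∑ j : Fin 3, (-1 : ℚ) ^ (j : ℕ) •
      relativeWinding i α ρ (lift i α ρ) (k.succAbove ∘ j.succAbove) =
        -complexThomCochain i α (ρ.face k) := by
    intro k
    rw [complexThomCochain, neg_neg]
    have h3 := sum_winding_face (ratio ((lift i α ρ).comp (simplexMap k.succAbove))
        (lift i α (ρ.face k))) fun x => ratio_ne_zero _ _ x
    rw [← add_zero (∑ j : Fin 3, (-1 : ℂ) ^ (j : ℕ) * _), ← h3, ← Finset.sum_add_distrib]
    refine Finset.sum_congr rfl fun j _ => ?_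
    rw [relativeWinding_comp i α ρ (isHomogeneous_lift i α ρ), ← mul_add, Rat.smul_def]
    push_cast
    rfl
  rw [Finset.sum_congr rfl fun k _ => by rw [h2 k]] at h
  rw [← neg_eq_zero, ← h, ← Finset.sum_neg_distrib]
  refine Finset.sum_congr rfl fun k _ => ?_
  rw [Rat.smul_def]
  push_cast
  ring

/-- Off `H_{i,α}` the lifts are normalized by their first entry, so that they are compatible. -/
theorem complexThomCochain_eq_zero {τ : SingSimplex n 2} (hτ : Set.range τ ⊆ (hyper i α)ᶜ) :
    complexThomCochain i α τ = 0 := by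
  rw [complexThomCochain, neg_eq_zero]
  refine Finset.sum_eq_zero fun j _ => ?_
  rw [relativeWinding, winding_const one_ne_zero, mul_zero]
  intro x
  have hσ : Set.range (ContinuousMap.comp τ (simplexMap j.succAbove)) ⊆ (hyper i α)ᶜ := by
    rintro _ ⟨y, rfl⟩
    exact hτ ⟨_, rfl⟩
  have h2 : ∀ y, α.IsHomogeneous (((lift i α τ).comp (simplexMap j.succAbove)) y)
      (ContinuousMap.comp τ (simplexMap j.succAbove) y i) := fun y => isHomogeneous_lift i α τ _
  have h := eq_ratio_smul h2 (isHomogeneous_lift i α _) x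
  have h' := congrArg Prod.fst h
  rw [Prod.smul_fst, lift_fst_eq_one i α hσ, ContinuousMap.comp_apply, lift_fst_eq_one i α hτ,
    smul_eq_mul, mul_one] at h'
  exact h'.symm

/-- On `Δ` the Thom cochain is the coboundary of this cochain. -/
def tubeCochain (σ : SingSimplex n 1) : ℂ :=
  -winding ⟨fun x => (lift i α σ x).2, by fun_prop⟩

theorem complexThomCochain_eq {τ : SingSimplex n 2} (hτ : Set.range τ ⊆ tube i α) :
    complexThomCochain i α τ = ∑ j : Fin 3, (-1 : ℂ) ^ (j : ℕ) * tubeCochain i α (τ.face j) := by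
  have hne : ∀ x, (lift i α τ x).2 ≠ 0 := fun x =>
    (isHomogeneous_lift i α τ x).snd_ne_zero (mem_tube_iff.1 (hτ ⟨x, rfl⟩)).1
  have h3 := sum_winding_face ⟨fun x => (lift i α τ x).2, by fun_prop⟩ hne
  rw [complexThomCochain, ← Finset.sum_neg_distrib,
    ← sub_zero (∑ j : Fin 3, (-1 : ℂ) ^ (j : ℕ) * tubeCochain i α _), ← neg_zero, ← h3, sub_neg_eq_add,
    ← Finset.sum_add_distrib]
  refine Finset.sum_congr rfl fun j _ => ?_
  have hσ : Set.range (τ.face j) ⊆ tube i α := by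
    rintro _ ⟨y, rfl⟩
    exact hτ ⟨_, rfl⟩
  have h2 : ∀ y, α.IsHomogeneous (((lift i α τ).comp (simplexMap j.succAbove)) y)
      ((τ.face j) y i) := fun y => isHomogeneous_lift i α τ _
  have hw : winding ⟨fun x => (lift i α (τ.face j) x).2, by fun_prop⟩ =
      relativeWinding i α τ (lift i α τ) j.succAbove +
      winding (ContinuousMap.comp ⟨fun x => (lift i α τ x).2, by fun_prop⟩
        (simplexMap j.succAbove)) := by
    refine winding_mul (fun x => ratio_ne_zero _ _ _) (fun x => hne _) fun x => ?_
    exact congrArg Prod.snd (eq_ratio_smul h2 (isHomogeneous_lift i α _) x)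
  rw [tubeCochain, hw]
  ring

/-- Off `H_{i,α}` the chosen homogeneous coordinates are `(1, 1/w)`. -/
theorem tubeCochain_eq_winding {σ : SingSimplex n 1} (hσ : Set.range σ ⊆ tube i α \ hyper i α)
    {g : C(stdSimplex ℝ (Fin 2), ℂ)} (hg : ∀ x, g x = α.coord (σ x i)) :
    tubeCochain i α σ = winding g := by
  have hne : ∀ x, (lift i α σ x).2 ≠ 0 := fun x =>
    (isHomogeneous_lift i α σ x).snd_ne_zero (mem_tube_iff.1 (hσ ⟨x, rfl⟩).1).1
  have h1 := winding_mul (g := 1) (k := g) (h := ⟨fun x => (lift i α σ x).2, by fun_prop⟩)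
    (fun x => by rw [hg]; exact coord_ne_zero_of_mem (hσ ⟨x, rfl⟩)) hne fun x => by
      have := (isHomogeneous_lift i α σ x).2.1 (mem_tube_iff.1 (hσ ⟨x, rfl⟩).1).1
      rw [lift_fst_eq_one i α (fun y hy => (hσ hy).2)] at this
      rw [hg]
      exact this
  rw [winding_const one_ne_zero fun _ => rfl] at h1
  rw [tubeCochain]
  exact (eq_neg_of_add_eq_zero_left h1.symm).symm

/-- The coordinate along a singular simplex in `Δ`. -/
def coordMap {p : ℕ} (σ : SingSimplex n p) (hσ : Set.range σ ⊆ tube i α) :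
    C(stdSimplex ℝ (Fin (p + 1)), ℂ) :=
  ⟨fun x => α.coord (σ x i), continuous_iff_continuousAt.2 fun x =>
    ContinuousAt.comp (g := α.coord) (α.continuousAt_coord (mem_tube_iff.1 (hσ ⟨x, rfl⟩)).1)
      (σ.coordinate i).continuous.continuousAt⟩

theorem sum_tubeCochain_face {τ : SingSimplex n 2} (hτ : Set.range τ ⊆ tube i α \ hyper i α) :
    ∑ j : Fin 3, (-1 : ℂ) ^ (j : ℕ) * tubeCochain i α (τ.face j) = 0 := by
  rw [← complexThomCochain_eq i α (fun y hy => (hτ hy).1)]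
  exact complexThomCochain_eq_zero i α fun y hy => (hτ hy).2

theorem exists_ratRetraction : ∃ r : ℂ →ₗ[ℚ] ℚ, ∀ q : ℚ, r (q : ℂ) = q := by
  obtain ⟨r, hr⟩ := (Algebra.linearMap ℚ ℂ).exists_leftInverse_of_injective
    (LinearMap.ker_eq_bot.2 (algebraMap ℚ ℂ).injective)
  exact ⟨r, fun q => by simpa using LinearMap.congr_fun hr q⟩

/-- A singular Thom cocycle is obtained from the complex one by a `ℚ`-linear retraction of `ℂ` onto
`ℚ`. The retraction fixes integers, hence changes the winding only by the coboundary of a function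
of the end points. -/
theorem exists_isSingularThomCocycle : ∃ S : SingCochain n 2, IsSingularThomCocycle i α S := by
  obtain ⟨r, hr⟩ := exists_ratRetraction
  have hsum : ∀ (m : ℕ) (f : Fin m → ℂ), r (∑ j : Fin m, (-1 : ℂ) ^ (j : ℕ) * f j) =
      ∑ j : Fin m, (-1 : ℚ) ^ (j : ℕ) * r (f j) := by
    intro m f
    rw [map_sum]
    refine Finset.sum_congr rfl fun j _ => ?_
    rw [← smul_eq_mul (a := (-1 : ℚ) ^ (j : ℕ)), ← map_smul, Rat.smul_def]
    push_cast
    rfl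
  refine ⟨fun τ => r (complexThomCochain i α τ), fun ρ => ?_, fun τ hτ => ?_,
    fun σ => r (tubeCochain i α σ), ⟨fun τ hτ => ?_, ?_⟩, fun τ hτ => ?_⟩
  · rw [singCobd, ← hsum, sum_complexThomCochain_face, map_zero]
  · beta_reduce
    rw [complexThomCochain_eq_zero i α hτ, map_zero]
  · rw [singCobd, ← hsum, sum_tubeCochain_face i α hτ, map_zero]
  -- The winding of a path is an integer up to a difference of values of `B`.
  · let B : P n → ℂ := fun z => Complex.log (α.coord (z i)) / (2 * Real.pi * Complex.I)
    refine ⟨fun z => (r (B z) : ℂ) - B z, fun σ hσ hs => ?_⟩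
    have hg : ∀ x, coordMap i α σ (fun y hy => (hσ hy).1) x = α.coord (σ x i) := fun _ => rfl
    obtain ⟨m, hm⟩ := exists_winding_eq_add_int
      (g := coordMap i α σ (fun y hy => (hσ hy).1)) fun x => coord_ne_zero_of_mem (hσ ⟨x, rfl⟩)
    rw [hg, hg, ← σ.path_zero, ← σ.path_one] at hm
    change _ = B (σ.path 1) - B (σ.path 0) + m at hm
    have hrm : r (m : ℂ) = m := by simpa using hr m
    beta_reduce
    rw [logIntegral_eq_winding hσ hs hg, tubeCochain_eq_winding i α hσ hg, hm, map_add, map_sub, hrm]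
    push_cast
    ring
  · beta_reduce
    rw [singCobd, ← hsum, complexThomCochain_eq i α hτ]

end Lift

end CubicalChains

namespace CubicalChains

/-! ### Affine singular simplices and the logarithmic class on continuous paths -/

section Affine

variable {n : ℕ} {E : Type*} [NormedAddCommGroup E] [NormedSpace ℝ E]

open Classical in
/-- The singular simplex `t ↦ R (∑ t_j p_j)` (a constant one if this is not continuous). -/
def affSimplex (R : E → P n) {k : ℕ} (p : Fin (k + 1) → E) : SingSimplex n k :=
  if h : Continuous fun t : stdSimplex ℝ (Fin (k + 1)) => R (∑ j, t j • p j) then ⟨_, h⟩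
  else ContinuousMap.const _ fun _ => OnePoint.infty

theorem sum_smul_mem {C : Set E} (hC : Convex ℝ C) {k : ℕ} {p : Fin (k + 1) → E}
    (hp : ∀ j, p j ∈ C) (t : stdSimplex ℝ (Fin (k + 1))) : ∑ j, t j • p j ∈ C :=
  hC.sum_mem (fun j _ => t.2.1 j) t.2.2 fun j _ => hp j

theorem affSimplex_apply {R : E → P n} {C : Set E} (hC : Convex ℝ C) (hR : ContinuousOn R C) {k : ℕ}
    {p : Fin (k + 1) → E} (hp : ∀ j, p j ∈ C) (t : stdSimplex ℝ (Fin (k + 1))) :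
    affSimplex R p t = R (∑ j, t j • p j) := by
  have h : Continuous fun t : stdSimplex ℝ (Fin (k + 1)) => R (∑ j, t j • p j) := by
    refine hR.comp_continuous ?_ (sum_smul_mem hC hp)
    refine continuous_finsetSum _ fun j _ => ?_
    exact ((continuous_apply j).comp continuous_subtype_val).smul continuous_const
  rw [affSimplex, dif_pos h]
  rfl

theorem range_affSimplex {R : E → P n} {C : Set E} (hC : Convex ℝ C) (hR : ContinuousOn R C) {k : ℕ}
    {p : Fin (k + 1) → E} (hp : ∀ j, p j ∈ C) {A : Set (P n)} (hA : Set.MapsTo R C A) :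
    Set.range (affSimplex R p) ⊆ A := by
  rintro _ ⟨t, rfl⟩
  rw [affSimplex_apply hC hR hp]
  exact hA (sum_smul_mem hC hp t)

theorem affSimplex_face {R : E → P n} {C : Set E} (hC : Convex ℝ C) (hR : ContinuousOn R C) {k : ℕ}
    {p : Fin (k + 2) → E} (hp : ∀ j, p j ∈ C) (l : Fin (k + 2)) :
    (affSimplex R p).face l = affSimplex R (p ∘ l.succAbove) := by
  ext t : 1
  rw [affSimplex_apply hC hR (p := p ∘ l.succAbove) fun j => hp _]
  change affSimplex R p (stdSimplex.map l.succAbove t) = _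
  rw [affSimplex_apply hC hR hp, Fin.sum_univ_succAbove _ l]
  congr 1
  have h0 : stdSimplex.map l.succAbove t l = 0 := by
    rw [stdSimplex.map_coe, FunOnFinite.linearMap_apply_apply]
    exact Finset.sum_eq_zero fun j hj => absurd (Finset.mem_filter.1 hj).2 (Fin.succAbove_ne l j)
  rw [h0, zero_smul, zero_add]
  refine Finset.sum_congr rfl fun j _ => ?_
  have h1 : stdSimplex.map l.succAbove t (l.succAbove j) = t j := by
    rw [stdSimplex.map_coe, FunOnFinite.linearMap_apply_apply]
    rw [Finset.sum_eq_single j]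
    · intro b hb hbj
      exact absurd (Fin.succAbove_right_injective (Finset.mem_filter.1 hb).2) hbj
    · intro h
      simp at h
  rw [h1]
  rfl

theorem affSimplex_congr {F : Type*} [NormedAddCommGroup F] [NormedSpace ℝ F] {R : E → P n}
    {R' : F → P n} {C : Set E} {C' : Set F} (hC : Convex ℝ C) (hR : ContinuousOn R C)
    (hC' : Convex ℝ C') (hR' : ContinuousOn R' C') {k : ℕ} {p : Fin (k + 1) → E}
    {p' : Fin (k + 1) → F} (hp : ∀ j, p j ∈ C) (hp' : ∀ j, p' j ∈ C')
    (h : ∀ t : stdSimplex ℝ (Fin (k + 1)), R (∑ j, t j • p j) = R' (∑ j, t j • p' j)) :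
    affSimplex R p = affSimplex R' p' := by
  ext t : 1
  rw [affSimplex_apply hC hR hp, affSimplex_apply hC' hR' hp', h]

/-- A `1`-cocycle on `A` is additive on subdivided segments. -/
theorem edge_add_edge {A : Set (P n)} {G : SingSimplex n 1 → ℂ}
    (hG : ∀ τ : SingSimplex n 2, Set.range τ ⊆ A →
      ∑ j : Fin 3, (-1 : ℂ) ^ (j : ℕ) * G (τ.face j) = 0)
    {R : E → P n} {C : Set E} (hC : Convex ℝ C) (hR : ContinuousOn R C) (hA : Set.MapsTo R C A)
    {x y z : E} (hx : x ∈ C) (hy : y ∈ C) (hz : z ∈ C) :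
    G (affSimplex R ![x, y]) + G (affSimplex R ![y, z]) = G (affSimplex R ![x, z]) := by
  have hp : ∀ j, ![x, y, z] j ∈ C := fun j => by fin_cases j <;> assumption
  have h := hG (affSimplex R ![x, y, z]) (range_affSimplex hC hR hp hA)
  simp only [affSimplex_face hC hR hp, Fin.sum_univ_three] at h
  have e0 : ![x, y, z] ∘ (0 : Fin 3).succAbove = ![y, z] := by
    funext j; fin_cases j <;> rfl
  have e1 : ![x, y, z] ∘ (1 : Fin 3).succAbove = ![x, z] := by
    funext j; fin_cases j <;> rfl
  have e2 : ![x, y, z] ∘ (2 : Fin 3).succAbove = ![x, y] := by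
    funext j; fin_cases j <;> rfl
  rw [e0, e1, e2] at h
  simp only [Fin.val_zero, Fin.val_one, Fin.val_two] at h
  linear_combination h

theorem stdSimplex_symm_apply (t : unitInterval) :
    (stdSimplexHomeomorphUnitInterval.symm t) 0 = 1 - t.1 ∧
    (stdSimplexHomeomorphUnitInterval.symm t) 1 = t.1 := by
  have h : ∀ x : stdSimplex ℝ (Fin 2), (stdSimplexHomeomorphUnitInterval x).1 = x 1 := fun x => rfl
  have h1 := h (stdSimplexHomeomorphUnitInterval.symm t)
  rw [Homeomorph.apply_symm_apply] at h1
  refine ⟨?_, h1.symm⟩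
  have := stdSimplex.add_eq_one (stdSimplexHomeomorphUnitInterval.symm t)
  linarith

theorem affSimplex_path {R : E → P n} {C : Set E} (hC : Convex ℝ C) (hR : ContinuousOn R C)
    {x y : E} (hx : x ∈ C) (hy : y ∈ C) {t : ℝ} (ht : t ∈ Set.Icc (0 : ℝ) 1) :
    (affSimplex R ![x, y]).path t = R ((1 - t) • x + t • y) := by
  rw [SingSimplex.path, affSimplex_apply hC hR fun j => by fin_cases j <;> assumption]
  have h := stdSimplex_symm_apply ⟨t, ht⟩
  rw [Set.projIcc_of_mem zero_le_one ht, Fin.sum_univ_two, h.1, h.2]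
  rfl

end Affine

variable {n : ℕ}

/-- Each point of `Δ - H_{i,α}` has a neighbourhood which a smooth chart identifies with an open
subset of a convex set. -/
theorem exists_convex_chart {i : Fin n} {α : Pole} {z : P n} (hz : z ∈ tube i α \ hyper i α) :
    ∃ U ∈ nhds z, ∃ (C : Set (Fin n → ℂ)) (φ : P n → Fin n → ℂ) (ψ : (Fin n → ℂ) → P n),
      Convex ℝ C ∧ ContinuousOn φ U ∧ Continuous ψ ∧ ContDiff ℝ ∞ (fun v => embed (ψ v)) ∧
      Set.MapsTo φ U C ∧ Set.MapsTo ψ C (tube i α \ hyper i α) ∧ ∀ y ∈ U, ψ (φ y) = y := by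
  classical
  have hA : ∀ k, ∃ β : Pole, z k ≠ β.opp.pt ∧ (k = i → β = α) := by
    intro k
    by_cases hk : k = i
    · subst hk
      exact ⟨α, (mem_tube_iff.1 hz.1).1, fun _ => rfl⟩
    · by_cases hzk : z k = Pole.infty.pt
      · exact ⟨.infty, by rw [hzk]; exact Pole.infty.pt_ne_opp, fun h => absurd h hk⟩
      · exact ⟨.zero, hzk, fun h => absurd h hk⟩
  choose β hβ hβi using hA
  have hβi := hβi i rfl
  set a := α.coord (z i) with ha
  have ha0 : a ≠ 0 := coord_ne_zero_of_mem hz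
  let C : Set (Fin n → ℂ) := (fun v => v i) ⁻¹' (Metric.ball a ‖a‖ ∩ Metric.ball 0 1)
  let φ : P n → Fin n → ℂ := fun y k => (β k).coord (y k)
  let ψ : (Fin n → ℂ) → P n := fun v k => (β k).chart (v k)
  let V : Set (P n) := {y | ∀ k, y k ≠ (β k).opp.pt}
  have hV : IsOpen V := by
    have : V = ⋂ k, (fun y : P n => y k) ⁻¹' {w | w ≠ (β k).opp.pt} := by
      ext y
      simp [V]
    rw [this]
    exact isOpen_iInter_of_finite fun k => isOpen_ne.preimage (continuous_apply k)
  have hφ : ContinuousOn φ V := by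
    refine continuousOn_pi.2 fun k y hy => ContinuousAt.continuousWithinAt ?_
    exact ContinuousAt.comp (g := (β k).coord) ((β k).continuousAt_coord (hy k))
      (continuous_apply k).continuousAt
  have hCo : IsOpen C :=
    (Metric.isOpen_ball.inter Metric.isOpen_ball).preimage (continuous_apply i)
  refine ⟨V ∩ φ ⁻¹' C, (hφ.isOpen_inter_preimage hV hCo).mem_nhds ⟨hβ, ?_, ?_⟩, C, φ, ψ, ?_,
    hφ.mono Set.inter_subset_left, ?_, ?_, fun y hy => hy.2, ?_, ?_⟩
  · simp only [φ, hβi, Metric.mem_ball, ← ha, dist_self]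
    exact norm_pos_iff.2 ha0
  · simp only [φ, hβi, mem_ball_zero_iff]
    exact (mem_tube_iff.1 hz.1).2
  · exact ((convex_ball _ _).inter (convex_ball _ _)).linear_preimage
      (LinearMap.proj (R := ℝ) (φ := fun _ : Fin n => ℂ) i)
  · exact continuous_pi fun k => (β k).continuous_chart.comp (continuous_apply k)
  · refine contDiff_pi.2 fun k => ?_
    have h := (contDiff_sphere_chart (β k.1)).comp (contDiff_apply ℝ ℂ k.1 (n := ∞))
    exact contDiff_pi.1 h k.2
  · rintro v ⟨h1, h2⟩
    replace h1 : ‖v i - a‖ < ‖a‖ := mem_ball_iff_norm.1 h1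
    replace h2 : ‖v i‖ < 1 := mem_ball_zero_iff.1 h2
    have hc : ψ v i = α.chart (v i) := by simp only [ψ, hβi]
    refine ⟨mem_tube_iff.2 ⟨?_, ?_⟩, fun h => ?_⟩
    · rw [hc]
      exact α.chart_ne_opp _
    · rw [hc, α.coord_chart]
      exact h2
    · have h3 : ψ v i = α.pt := h
      have h4 : v i = 0 := by rw [← α.coord_chart (v i), ← hc, h3, α.coord_pt]
      rw [h4, zero_sub, norm_neg] at h1
      exact lt_irrefl _ h1
  · rintro y ⟨hy, -⟩
    funext k
    exact (β k).chart_coord (hy k)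

/-- A `1`-cocycle on `Δ - H_{i,α}` which vanishes on the smooth paths vanishes on all paths. -/
theorem eq_zero_of_smooth {i : Fin n} {α : Pole} {G : SingSimplex n 1 → ℂ}
    (hG : ∀ τ : SingSimplex n 2, Set.range τ ⊆ tube i α \ hyper i α →
      ∑ j : Fin 3, (-1 : ℂ) ^ (j : ℕ) * G (τ.face j) = 0)
    (hs : ∀ σ : SingSimplex n 1, Set.range σ ⊆ tube i α \ hyper i α →
      ContDiffOn ℝ ∞ (fun t => embed (σ.path t)) (Set.Icc 0 1) → G σ = 0)
    {σ : SingSimplex n 1} (hσ : Set.range σ ⊆ tube i α \ hyper i α) : G σ = 0 := by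
  set A := tube i α \ hyper i α with hAdef
  let γ : ℝ → P n := σ.path
  have hγ : Continuous γ := σ.continuous.comp
    (stdSimplexHomeomorphUnitInterval.symm.continuous.comp continuous_projIcc)
  have hγA : ∀ t, γ t ∈ A := fun t => hσ ⟨_, rfl⟩
  have hγm : Set.MapsTo γ Set.univ A := fun t _ => hγA t
  have hadd : ∀ x y z : ℝ, G (affSimplex γ ![x, y]) + G (affSimplex γ ![y, z]) =
      G (affSimplex γ ![x, z]) := fun x y z =>
    edge_add_edge hG convex_univ hγ.continuousOn hγm trivial trivial trivial
  have hself : ∀ x : ℝ, G (affSimplex γ ![x, x]) = 0 := fun x => by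
    simpa using hadd x x x
  -- locally the path is homotopic to a straight line in a chart
  have hloc : ∀ t₀ : ℝ, ∀ᶠ t in nhds t₀, G (affSimplex γ ![t₀, t]) = 0 := by
    intro t₀
    obtain ⟨U, hU, C, φ, ψ, hC, hφ, hψ, hψs, hφC, hψC, hψφ⟩ := exists_convex_chart (hγA t₀)
    obtain ⟨δ, hδ, hball⟩ := Metric.mem_nhds_iff.1 (hγ.continuousAt.preimage_mem_nhds hU)
    filter_upwards [Metric.ball_mem_nhds t₀ hδ] with t ht
    let B := Metric.ball t₀ δ
    have hB : Convex ℝ B := convex_ball _ _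
    let η : ℝ → Fin n → ℂ := fun r => φ (γ r)
    have hη : ContinuousOn η B := hφ.comp hγ.continuousOn fun r hr => hball hr
    have hηC : ∀ r ∈ B, η r ∈ C := fun r hr => hφC (hball hr)
    have ht₀ : t₀ ∈ B := Metric.mem_ball_self hδ
    -- the cone over the path with vertex its initial point
    let D : Set (ℝ × ℝ) := Set.Icc 0 1 ×ˢ B
    have hD : Convex ℝ D := (convex_Icc 0 1).prod hB
    let R : ℝ × ℝ → P n := fun x => ψ ((1 - x.1) • η t₀ + x.1 • η x.2)
    have hR : ContinuousOn R D := by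
      refine hψ.comp_continuousOn ?_
      have h1 : ContinuousOn (fun x : ℝ × ℝ => η x.2) D :=
        hη.comp continuousOn_snd fun x hx => hx.2
      exact ((continuous_const.sub continuous_fst).smul continuous_const).continuousOn.add
        (continuousOn_fst.smul h1)
    have hRA : Set.MapsTo R D A := by
      rintro x ⟨hx1, hx2⟩
      exact hψC (hC (hηC _ ht₀) (hηC _ hx2) (by linarith [hx1.2]) hx1.1 (by ring))
    have m0 : ((0 : ℝ), t₀) ∈ D := ⟨⟨le_rfl, zero_le_one⟩, ht₀⟩
    have m1 : ((1 : ℝ), t₀) ∈ D := ⟨⟨zero_le_one, le_rfl⟩, ht₀⟩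
    have m2 : ((1 : ℝ), t) ∈ D := ⟨⟨zero_le_one, le_rfl⟩, ht⟩
    have m3 : ((0 : ℝ), t) ∈ D := ⟨⟨le_rfl, zero_le_one⟩, ht⟩
    have hsm : ∀ (x y : ℝ × ℝ), x ∈ D → y ∈ D → ∀ a b : Fin n → ℂ,
        (∀ r ∈ Set.Icc (0 : ℝ) 1, R ((1 - r) • x + r • y) = ψ ((1 - r) • a + r • b)) →
        G (affSimplex R ![x, y]) = 0 := by
      intro x y hx hy a b hab
      refine hs _ (range_affSimplex hD hR (fun j => by fin_cases j <;> assumption) hRA) ?_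
      have h2 : ContDiff ℝ ∞ fun r : ℝ => embed (ψ ((1 - r) • a + r • b)) :=
        hψs.comp (((contDiff_const.sub contDiff_id).smul contDiff_const).add
          (contDiff_id.smul contDiff_const))
      refine h2.contDiffOn.congr fun r hr => ?_
      rw [affSimplex_path hD hR hx hy hr, hab r hr]
    have e1 : G (affSimplex R ![(0, t), (1, t)]) = 0 := by
      refine hsm _ _ m3 m2 (η t₀) (η t) fun r hr => ?_
      have : (1 - r) • ((0 : ℝ), t) + r • ((1 : ℝ), t) = (r, t) := by
        ext <;> simp
        ring
      rw [this]
    have e2 : G (affSimplex R ![(1, t₀), (0, t₀)]) = 0 := by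
      refine hsm _ _ m1 m0 (η t₀) (η t₀) fun r hr => ?_
      have : (1 - r) • ((1 : ℝ), t₀) + r • ((0 : ℝ), t₀) = (1 - r, t₀) := by
        ext <;> simp
        ring
      rw [this]
      simp only [R, sub_sub_cancel]
      rw [add_comm]
    have e3 : G (affSimplex R ![(0, t₀), (0, t)]) = 0 := by
      refine hsm _ _ m0 m3 (η t₀) (η t₀) fun r hr => ?_
      have : (1 - r) • ((0 : ℝ), t₀) + r • ((0 : ℝ), t) = (0, (1 - r) * t₀ + r * t) := by
        ext <;> simp
      rw [this]
      simp only [R, ← add_smul]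
      simp
    have e4 : affSimplex R ![(1, t₀), (1, t)] = affSimplex γ ![t₀, t] := by
      refine affSimplex_congr hD hR hB (hγ.continuousOn) (fun j => by fin_cases j <;> assumption)
        (fun j => by fin_cases j <;> assumption) fun r => ?_
      rw [Fin.sum_univ_two, Fin.sum_univ_two]
      have h1 := stdSimplex.add_eq_one r
      have hm : r 0 • t₀ + r 1 • t ∈ B := hB ht₀ ht (r.2.1 0) (r.2.1 1) h1
      have : r 0 • ![((1 : ℝ), t₀), (1, t)] 0 + r 1 • ![((1 : ℝ), t₀), (1, t)] 1 =
          (1, r 0 • t₀ + r 1 • t) := by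
        ext <;> simp [h1]
      rw [this]
      simp only [R, sub_self, zero_smul, one_smul, zero_add]
      exact hψφ _ (hball hm)
    rw [← e4, ← edge_add_edge hG hD hR hRA m1 m0 m2, e2, zero_add,
      ← edge_add_edge hG hD hR hRA m0 m3 m2, e3, e1, add_zero]
  have hconst : IsLocallyConstant fun t => G (affSimplex γ ![0, t]) := by
    rw [IsLocallyConstant.iff_eventually_eq]
    intro t₀
    filter_upwards [hloc t₀] with t ht
    rw [← hadd 0 t₀ t, ht, add_zero]
  have h1 := hconst.apply_eq_of_preconnectedSpace 1 0
  rw [hself] at h1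
  rw [← h1]
  congr 1
  ext x : 1
  rw [affSimplex_apply convex_univ hγ.continuousOn fun _ => trivial, Fin.sum_univ_two]
  have h : (stdSimplexHomeomorphUnitInterval x).1 = x 1 := rfl
  simp only [Matrix.cons_val_zero, Matrix.cons_val_one, smul_eq_mul, mul_zero, mul_one, zero_add]
  rw [← h]
  simp only [γ, SingSimplex.path]
  rw [Set.projIcc_val, Homeomorph.symm_apply_apply]

/-- A representative of the class of the logarithmic form is cohomologous to the winding cochain
on all continuous paths. -/
theorem RepresentsLogForm.exists_eq {i : Fin n} {α : Pole} {c : SingCochain n 1}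
    (h : RepresentsLogForm i α c) : ∃ b : P n → ℂ, ∀ σ : SingSimplex n 1,
      Set.range σ ⊆ tube i α \ hyper i α → (c σ : ℂ) = tubeCochain i α σ +
        (b (σ (stdSimplex.vertex 1)) - b (σ (stdSimplex.vertex 0))) := by
  obtain ⟨hc, b, hb⟩ := h
  refine ⟨b, fun σ hσ => ?_⟩
  have := eq_zero_of_smooth (G := fun σ => (c σ : ℂ) - tubeCochain i α σ -
    (b (σ (stdSimplex.vertex 1)) - b (σ (stdSimplex.vertex 0)))) ?_ ?_ hσ
  · linear_combination this
  · intro τ hτ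
    have h1 := congrArg (fun q : ℚ => (q : ℂ)) (hc τ hτ)
    have h2 := sum_tubeCochain_face i α hτ
    have h3 : ∀ j : Fin 3, ∀ k : Fin 2, (τ.face j) (stdSimplex.vertex k) =
        τ (stdSimplex.vertex (j.succAbove k)) := fun j k => by
      rw [SingSimplex.face_eq, ContinuousMap.comp_apply, simplexMap_vertex]
    simp only [singCobd] at h1
    push_cast at h1
    change ∑ j : Fin 3, (-1 : ℂ) ^ (j : ℕ) * (c (τ.face j) : ℂ) = 0 at h1
    simp only [Fin.sum_univ_three] at h1 h2
    simp only [Fin.sum_univ_three, h3]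
    have e1 : (0 : Fin 3).succAbove 0 = 1 := rfl
    have e2 : (0 : Fin 3).succAbove 1 = 2 := rfl
    have e3 : (1 : Fin 3).succAbove 0 = 0 := rfl
    have e4 : (1 : Fin 3).succAbove 1 = 2 := rfl
    have e5 : (2 : Fin 3).succAbove 0 = 0 := rfl
    have e6 : (2 : Fin 3).succAbove 1 = 1 := rfl
    rw [e1, e2, e3, e4, e5, e6]
    simp only [Fin.val_zero, Fin.val_one, Fin.val_two] at h1 h2 ⊢
    linear_combination h1 - h2
  · intro σ hσ hs
    have hw := tubeCochain_eq_winding i α hσ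
      (g := coordMap i α σ fun y hy => (hσ hy).1) fun _ => rfl
    have hl := logIntegral_eq_winding hσ hs
      (g := coordMap i α σ fun y hy => (hσ hy).1) fun _ => rfl
    rw [hb σ hσ hs, hw, hl, σ.path_zero, σ.path_one]
    ring

end CubicalChains

namespace CubicalChains

/-! ### Evaluation of Thom cocycles on relative cycles -/

namespace Triangulation

variable {n : ℕ} (T : Triangulation n)

open Classical in
/-- The homeomorphism `Φ` as a map on the ambient space (with a junk value outside of `|K|`). -/
def param (x : Fin T.N → ℝ) : P n :=
  if h : x ∈ T.K.space then T.Φ ⟨x, h⟩ else fun _ => OnePoint.infty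

theorem param_of_mem {x : Fin T.N → ℝ} (h : x ∈ T.K.space) : T.param x = T.Φ ⟨x, h⟩ := dif_pos h

theorem continuousOn_param : ContinuousOn T.param T.K.space := by
  rw [continuousOn_iff_continuous_domRestrict]
  have : T.K.space.domRestrict T.param = T.Φ := funext fun x => T.param_of_mem x.2
  rw [this]
  exact T.Φ.continuous

theorem IsSimplex.convexHull_subset_space {T : Triangulation n} {p : ℕ}
    {v : Fin (p + 1) → Fin T.N → ℝ} (hv : T.IsSimplex v) :
    convexHull ℝ (Set.range v) ⊆ T.K.space := by
  classical
  have := T.K.convexHull_subset_space hv.2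
  simpa using this

theorem IsSimplex.param_mem {T : Triangulation n} {p : ℕ} {v : Fin (p + 1) → Fin T.N → ℝ}
    (hv : T.IsSimplex v) {x : Fin T.N → ℝ} (hx : x ∈ convexHull ℝ (Set.range v)) :
    T.param x ∈ T.tupleCell v := by
  rw [T.param_of_mem (hv.convexHull_subset_space hx), mem_tupleCell]
  exact hx

theorem toSingular_eq {p : ℕ} {v : Fin (p + 1) → Fin T.N → ℝ} (hv : T.IsSimplex v) :
    T.toSingular v hv = affSimplex T.param v := by
  ext t : 1
  have hmem : ∀ j, v j ∈ convexHull ℝ (Set.range v) := fun j => subset_convexHull ℝ _ ⟨j, rfl⟩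
  rw [affSimplex_apply (convex_convexHull ℝ (Set.range v))
    (T.continuousOn_param.mono hv.convexHull_subset_space) hmem]
  rw [T.param_of_mem (hv.convexHull_subset_space (sum_smul_mem (convex_convexHull ℝ _) hmem t))]
  rfl

theorem mem_openCell_of_pos {s : Finset (Fin T.N → ℝ)} (hs : s ∈ T.K.faces)
    {w : (Fin T.N → ℝ) → ℝ} (hw : ∀ v ∈ s, 0 < w v) (hw1 : ∑ v ∈ s, w v = 1) :
    T.param (∑ v ∈ s, w v • v) ∈ T.openCell s := by
  classical
  have hmem : ∑ v ∈ s, w v • v ∈ convexHull ℝ (s : Set (Fin T.N → ℝ)) :=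
    (convex_convexHull ℝ _).sum_mem (fun v hv => (hw v hv).le) hw1
      fun v hv => subset_convexHull ℝ _ hv
  have hsp := T.K.convexHull_subset_space hs hmem
  refine ⟨⟨_, hsp⟩, ⟨hmem, fun t hts ht => ?_⟩, (T.param_of_mem hsp).symm⟩
  obtain ⟨w', hw', hw1', hsum⟩ := Finset.mem_convexHull'.1 ht
  obtain ⟨v, hvs, hvt⟩ := Finset.exists_of_ssubset hts
  have hind := T.K.indep hs
  rw [affineIndependent_iff] at hind
  let d : s → ℝ := fun v => w v - if (v : Fin T.N → ℝ) ∈ t then w' v else 0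
  have hd0 := hind Finset.univ d ?_ ?_ ⟨v, hvs⟩ (Finset.mem_univ _)
  · simp only [d, hvt, if_false, sub_zero] at hd0
    exact (hw v hvs).ne' hd0
  · rw [Finset.univ_eq_attach, Finset.sum_attach s
      (fun v => w v - if (v : Fin T.N → ℝ) ∈ t then w' v else 0), Finset.sum_sub_distrib, hw1,
      Finset.sum_ite_mem, Finset.inter_eq_right.2 hts.1, hw1', sub_self]
  · rw [Finset.univ_eq_attach, Finset.sum_attach s
      (fun v => (w v - if (v : Fin T.N → ℝ) ∈ t then w' v else 0) • v)]
    simp only [sub_smul, ite_smul, zero_smul]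
    rw [Finset.sum_sub_distrib, Finset.sum_ite_mem, Finset.inter_eq_right.2 hts.1, hsum, sub_self]

/-- The interior of a simplex is dense in the simplex. -/
theorem openCell_inter_nonempty {s : Finset (Fin T.N → ℝ)} (hs : s ∈ T.K.faces) {U : Set (P n)}
    (hU : IsOpen U) (h : (T.cell s ∩ U).Nonempty) : (T.openCell s ∩ U).Nonempty := by
  classical
  obtain ⟨_, ⟨x, hx, rfl⟩, hxU⟩ := h
  obtain ⟨w, hw, hw1, hsum⟩ := Finset.mem_convexHull'.1 hx
  have hne := T.K.nonempty_of_mem_faces hs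
  have hcard : (0 : ℝ) < s.card := by exact_mod_cast hne.card_pos
  let W : ℝ → (Fin T.N → ℝ) → ℝ := fun ε v => (1 - ε) * w v + ε * (s.card : ℝ)⁻¹
  let y : ℝ → Fin T.N → ℝ := fun ε => ∑ v ∈ s, W ε v • v
  have hy : Continuous y := by fun_prop
  have hW1 : ∀ ε, ∑ v ∈ s, W ε v = 1 := by
    intro ε
    simp only [W, Finset.sum_add_distrib, ← Finset.mul_sum, hw1, Finset.sum_const, nsmul_eq_mul]
    field_simp
    ring
  have hy0 : y 0 = x.1 := by
    rw [← hsum]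
    simp [y, W]
  have hysp : ∀ ε ∈ Set.Icc (0 : ℝ) 1, y ε ∈ T.K.space := by
    intro ε hε
    refine T.K.convexHull_subset_space hs ((convex_convexHull ℝ _).sum_mem (fun v hv => ?_) (hW1 ε)
      fun v hv => subset_convexHull ℝ _ hv)
    have h1 := hw v hv
    have h2 : 0 ≤ 1 - ε := by linarith [hε.2]
    have h3 := hε.1
    positivity
  have hc : ContinuousWithinAt (fun ε => T.param (y ε)) (Set.Icc 0 1) 0 :=
    (T.continuousOn_param.comp hy.continuousOn hysp) 0 ⟨le_rfl, zero_le_one⟩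
  have hU0 : T.param (y 0) ∈ U := by
    rw [hy0, T.param_of_mem x.2]
    exact hxU
  have h1 := hc.preimage_mem_nhdsWithin (hU.mem_nhds hU0)
  rw [nhdsWithin_Icc_eq_nhdsGE zero_lt_one] at h1
  have h2 : ∀ᶠ ε in nhdsWithin (0 : ℝ) (Set.Ioi 0), T.param (y ε) ∈ U :=
    nhdsWithin_mono 0 Set.Ioi_subset_Ici_self h1
  have h3 : ∀ᶠ ε in nhdsWithin (0 : ℝ) (Set.Ioi 0), ε ∈ Set.Ioo (0 : ℝ) 1 :=
    Ioo_mem_nhdsGT zero_lt_one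
  obtain ⟨ε, h4, h5⟩ := (h2.and h3).exists
  refine ⟨_, T.mem_openCell_of_pos hs (w := W ε) (fun v hv => ?_) (hW1 ε), h4⟩
  have h1 := hw v hv
  have h2 : 0 ≤ 1 - ε := by linarith [h5.2]
  have h3 := h5.1
  positivity

end Triangulation

variable {n : ℕ}

/-- The closed tube `{|w| ≤ 1}` around `H_{i,α}`. -/
def closedTube (i : Fin n) (α : Pole) : Set (P n) := {z | z i ≠ α.opp.pt ∧ ‖α.coord (z i)‖ ≤ 1}

theorem isOpen_tube (i : Fin n) (α : Pole) : IsOpen (tube i α) := by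
  have h : IsOpen α.disc := by
    have h1 : ContinuousOn α.coord {z | z ≠ α.opp.pt} := fun z hz =>
      (α.continuousAt_coord hz).continuousWithinAt
    have h2 : IsOpen {z : OnePoint ℂ | z ≠ α.opp.pt} := isOpen_ne
    have := h1.isOpen_inter_preimage h2 (Metric.isOpen_ball (x := (0 : ℂ)) (ε := 1))
    convert this using 1
    ext z
    rw [α.mem_disc_iff]
    simp
  exact h.preimage (continuous_apply i)

theorem hyper_subset_tube (i : Fin n) (α : Pole) : hyper i α ⊆ tube i α := by
  intro z hz
  have h : z i = α.pt := hz
  rw [mem_tube_iff, h, α.coord_pt]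
  exact ⟨α.pt_ne_opp, by simp⟩

theorem closedDisc_eq (i : Fin n) : closedDisc i = closedTube i .zero := by
  ext z
  constructor
  · rintro ⟨c, hc, h⟩
    refine ⟨by rw [hc]; exact OnePoint.coe_ne_infty c, by rw [hc]; exact h⟩
  · rintro ⟨h1, h2⟩
    exact ⟨Pole.zero.coord (z i), (Pole.zero.chart_coord h1).symm, h2⟩

theorem closedDisc_eq_compl (i : Fin n) : closedDisc i = (tube i .infty)ᶜ := by
  ext z
  rw [Set.mem_compl_iff, mem_tube_iff]
  have hopp : Pole.infty.opp = Pole.zero := rfl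
  simp only [closedDisc, Set.mem_ofPred_eq]
  generalize z i = w
  induction w using OnePoint.rec with
  | infty => simp [hopp, Pole.coord, Pole.pt]
  | coe c =>
    by_cases hc : c = 0
    · simp [hopp, Pole.coord, Pole.pt, hc]
    · have h0 : 0 < ‖c‖ := norm_pos_iff.2 hc
      simp [hopp, Pole.coord, Pole.pt, hc, inv_lt_one₀ h0]

theorem mem_closedTube_infty {i : Fin n} {z : P n} (h : z ∉ tube i .zero) :
    z ∈ closedTube i .infty := by
  rw [mem_tube_iff] at h
  have hopp : Pole.infty.opp = Pole.zero := rfl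
  have hopp' : Pole.zero.opp = Pole.infty := rfl
  simp only [closedTube, Set.mem_ofPred_eq]
  revert h
  generalize z i = w
  induction w using OnePoint.rec with
  | infty => simp [hopp, Pole.coord, Pole.pt]
  | coe c =>
    intro h
    simp only [hopp', Pole.pt, ne_eq, OnePoint.coe_ne_infty, not_false_eq_true, Pole.coord,
      OnePoint.elim_some, true_and, not_lt] at h
    have hc : c ≠ 0 := fun h0 => by simp [h0] at h; linarith
    have h0 : 0 < ‖c‖ := norm_pos_iff.2 hc
    simp [hopp, Pole.coord, Pole.pt, hc, inv_le_one₀ h0, h]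

/-- The simplices which meet `H_{i,α}` lie in the closed tube around it. -/
theorem GoodTriangulation.cell_subset_closedTube (T : GoodTriangulation n) {i : Fin n} {α : Pole}
    {s : Finset (Fin T.N → ℝ)} (hs : s ∈ T.K.faces) (h : (T.cell s ∩ hyper i α).Nonempty) :
    T.cell s ⊆ closedTube i α := by
  obtain ⟨y, hy, hyt⟩ := T.openCell_inter_nonempty hs (isOpen_tube i α)
    (h.mono (Set.inter_subset_inter_right _ (hyper_subset_tube i α)))
  cases α with
  | zero =>
    rw [← closedDisc_eq]
    refine (T.closedDisc_isSubcomplex i).cell_subset hs hy ?_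
    rw [closedDisc_eq]
    exact ⟨(mem_tube_iff.1 hyt).1, (mem_tube_iff.1 hyt).2.le⟩
  | infty =>
    intro z hz
    refine mem_closedTube_infty fun hzt => ?_
    obtain ⟨x, hx, hxt⟩ := T.openCell_inter_nonempty hs (isOpen_tube i .zero) ⟨z, hz, hzt⟩
    have hsub := (T.closedDisc_isSubcomplex i).cell_subset hs hx (by
      rw [closedDisc_eq]
      exact ⟨(mem_tube_iff.1 hxt).1, (mem_tube_iff.1 hxt).2.le⟩)
    have := hsub (T.openCell_subset_cell s hy)
    rw [closedDisc_eq_compl] at this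
    exact this hyt

end CubicalChains

namespace CubicalChains

/-! ### Contraction of the closed tube and values of Thom cocycles -/

variable {n : ℕ}

/-- The contraction `w ↦ (1 - τ/2) w` of the closed tube around `H_{i,α}`, composed with the
parametrization of `P^n` by a triangulation. -/
def shrink (T : Triangulation n) (i : Fin n) (α : Pole) (x : (Fin T.N → ℝ) × ℝ) : P n :=
  Function.update (T.param x.1) i
    (α.chart (((1 - x.2 / 2 : ℝ) : ℂ) * α.coord (T.param x.1 i)))

section Shrink

variable (T : Triangulation n) (i : Fin n) (α : Pole)

theorem coord_shrink (x : (Fin T.N → ℝ) × ℝ) :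
    α.coord (shrink T i α x i) = ((1 - x.2 / 2 : ℝ) : ℂ) * α.coord (T.param x.1 i) := by
  rw [shrink, Function.update_self, α.coord_chart]

theorem shrink_ne_opp (x : (Fin T.N → ℝ) × ℝ) : shrink T i α x i ≠ α.opp.pt := by
  rw [shrink, Function.update_self]
  exact α.chart_ne_opp _

theorem shrink_zero {x : Fin T.N → ℝ} (hx : T.param x i ≠ α.opp.pt) :
    shrink T i α (x, 0) = T.param x := by
  simp [shrink, α.chart_coord hx]

theorem continuousOn_shrink {C : Set (Fin T.N → ℝ)} (hC : C ⊆ T.K.space)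
    (hne : ∀ x ∈ C, T.param x i ≠ α.opp.pt) :
    ContinuousOn (shrink T i α) (C ×ˢ Set.Icc (0 : ℝ) 1) := by
  have h1 : ContinuousOn (fun x : (Fin T.N → ℝ) × ℝ => T.param x.1) (C ×ˢ Set.Icc (0 : ℝ) 1) :=
    T.continuousOn_param.comp continuousOn_fst fun x hx => hC hx.1
  have h2 : ContinuousOn (fun x : (Fin T.N → ℝ) × ℝ => α.coord (T.param x.1 i))
      (C ×ˢ Set.Icc (0 : ℝ) 1) := by
    intro x hx
    exact ContinuousAt.comp_continuousWithinAt (g := α.coord)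
      (f := fun x : (Fin T.N → ℝ) × ℝ => T.param x.1 i) (α.continuousAt_coord (hne _ hx.1))
      ((continuousOn_pi.1 h1 i) x hx)
  have h3 : ContinuousOn (fun x : (Fin T.N → ℝ) × ℝ =>
      α.chart (((1 - x.2 / 2 : ℝ) : ℂ) * α.coord (T.param x.1 i))) (C ×ˢ Set.Icc (0 : ℝ) 1) :=
    α.continuous_chart.comp_continuousOn
      ((Complex.continuous_ofReal.comp (by fun_prop)).continuousOn.mul h2)
  refine continuousOn_pi.2 fun j => ?_
  by_cases hj : j = i
  · subst hj
    simpa only [shrink, Function.update_self] using h3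
  · simpa only [shrink, Function.update_of_ne hj] using continuousOn_pi.1 h1 j

theorem shrink_mem_compl_hyper {x : (Fin T.N → ℝ) × ℝ} (hx : x.2 ∈ Set.Icc (0 : ℝ) 1)
    (hopp : T.param x.1 i ≠ α.opp.pt) (h : T.param x.1 ∉ hyper i α) :
    shrink T i α x ∉ hyper i α := by
  intro h0
  have h1 : shrink T i α x i = α.pt := h0
  have h2 := coord_shrink T i α x
  rw [h1, α.coord_pt, eq_comm, mul_eq_zero] at h2
  rcases h2 with h2 | h2
  · have : (1 - x.2 / 2 : ℝ) = 0 := by exact_mod_cast h2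
    linarith [hx.2]
  · exact h ((α.coord_eq_zero_iff hopp).1 h2)

theorem shrink_mem_tube {x : Fin T.N → ℝ} (hx : T.param x ∈ closedTube i α) :
    shrink T i α (x, 1) ∈ tube i α := by
  refine mem_tube_iff.2 ⟨shrink_ne_opp T i α _, ?_⟩
  rw [coord_shrink, norm_mul, Complex.norm_real]
  norm_num
  linarith [hx.2]

/-- The winding of `w` along an edge which is moved into `Δ`. -/
def edgeWinding (v : Fin 2 → Fin T.N → ℝ) : ℂ :=
  tubeCochain i α (affSimplex (shrink T i α) fun j => (v j, 1))

variable {T i α}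

theorem convex_prism {C : Set (Fin T.N → ℝ)} (hC : Convex ℝ C) :
    Convex ℝ (C ×ˢ Set.Icc (0 : ℝ) 1) := hC.prod (convex_Icc 0 1)

/-- The winding along an edge is read off from any logarithm of `w`. -/
theorem edgeWinding_eq {v : Fin 2 → Fin T.N → ℝ} (hv : T.IsSimplex v) {A : Set (P n)}
    (hvA : T.tupleCell v ⊆ A) (hA : A ⊆ closedTube i α) {l : P n → ℂ} (hl : ContinuousOn l A)
    (hexp : ∀ z ∈ A, Complex.exp (l z) = α.coord (z i)) :
    edgeWinding T i α v = (l (T.param (v 1)) - l (T.param (v 0))) / (2 * Real.pi * Complex.I) := by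
  let C := convexHull ℝ (Set.range v)
  have hC : Convex ℝ C := convex_convexHull ℝ _
  have hmem : ∀ j, v j ∈ C := fun j => subset_convexHull ℝ _ ⟨j, rfl⟩
  have hCA : ∀ x ∈ C, T.param x ∈ A := fun x hx => hvA (hv.param_mem hx)
  have hR := continuousOn_shrink T i α hv.convexHull_subset_space
    fun x hx => (hA (hCA x hx)).1
  have hp : ∀ j, ((v j, 1) : (Fin T.N → ℝ) × ℝ) ∈ C ×ˢ Set.Icc (0 : ℝ) 1 :=
    fun j => ⟨hmem j, zero_le_one, le_rfl⟩
  have hsum : ∀ t : stdSimplex ℝ (Fin 2), ∑ j, t j • ((v j, 1) : (Fin T.N → ℝ) × ℝ) =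
      (∑ j, t j • v j, 1) := by
    intro t
    have h1 := stdSimplex.add_eq_one t
    simp only [Fin.sum_univ_two]
    ext <;> simp [h1]
  have hval : ∀ t, affSimplex (shrink T i α) (fun j => (v j, 1)) t =
      shrink T i α (∑ j, t j • v j, 1) := fun t => by
    rw [affSimplex_apply (convex_prism hC) hR hp, hsum]
  have hne : ∀ z ∈ A, z ∉ hyper i α := by
    intro z hz h
    have h1 : z i = α.pt := h
    have h2 := hexp z hz
    rw [h1, α.coord_pt] at h2
    exact Complex.exp_ne_zero _ h2
  have hrange : Set.range (affSimplex (shrink T i α) fun j => (v j, 1)) ⊆ tube i α \ hyper i α := by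
    rintro _ ⟨t, rfl⟩
    have h1 := hCA _ (sum_smul_mem hC hmem t)
    rw [hval]
    exact ⟨shrink_mem_tube T i α (hA h1), shrink_mem_compl_hyper T i α ⟨zero_le_one, le_rfl⟩
      (hA h1).1 (hne _ h1)⟩
  rw [edgeWinding, tubeCochain_eq_winding i α hrange
    (g := coordMap i α _ fun y hy => (hrange hy).1) fun _ => rfl]
  -- The contraction multiplies `w` by `1/2`, which adds a constant to the logarithm.
  let L : C(stdSimplex ℝ (Fin 2), ℂ) :=
    ⟨fun t => Complex.log (1 / 2) + l (T.param (∑ j, t j • v j)), by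
      refine continuous_const.add (hl.comp_continuous ?_ fun t =>
        hCA _ (sum_smul_mem hC hmem t))
      refine (T.continuousOn_param.mono hv.convexHull_subset_space).comp_continuous ?_
        (sum_smul_mem hC hmem)
      refine continuous_finsetSum _ fun j _ => ?_
      exact ((continuous_apply j).comp continuous_subtype_val).smul continuous_const⟩
  have hL : ∀ t, Complex.exp (L t) = coordMap i α _ (fun y hy => (hrange hy).1) t := by
    intro t
    change Complex.exp (Complex.log (1 / 2) + l (T.param (∑ j, t j • v j))) =
      α.coord (affSimplex (shrink T i α) (fun j => (v j, 1)) t i)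
    rw [hval, coord_shrink, Complex.exp_add, Complex.exp_log (by norm_num),
      hexp _ (hCA _ (sum_smul_mem hC hmem t))]
    norm_num
  rw [winding_eq hL]
  have hv0 : ∑ j, (stdSimplex.vertex (S := ℝ) (0 : Fin 2)) j • v j = v 0 := by
    simp
  have hv1 : ∑ j, (stdSimplex.vertex (S := ℝ) (1 : Fin 2)) j • v j = v 1 := by
    simp
  change (Complex.log (1 / 2) + l (T.param (∑ j, (stdSimplex.vertex (S := ℝ) (1 : Fin 2)) j • v j)) -
    (Complex.log (1 / 2) + l (T.param (∑ j, (stdSimplex.vertex (S := ℝ) (0 : Fin 2)) j • v j)))) /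
      _ = _
  rw [hv0, hv1, add_sub_add_left_eq_sub]

end Shrink

namespace Triangulation

theorem IsOrdering.map_eq_zero {T : Triangulation n} {M : Type*} [AddCommGroup M] [Module ℚ M]
    {O : PartialOrder (Fin T.N → ℝ)} (hO : T.IsOrdering O) {p : ℕ} {A : Set (P n)}
    {f : T.Chain p →ₗ[ℚ] M} (hf : ∀ v, T.IsSimplex v → T.tupleCell v ⊆ A → f (T.elem v) = 0)
    {c : T.Chain p} (hc : c ∈ T.chainsIn A p) : f c = 0 := by
  rw [hO.map_eq_osum f, osum_apply]
  refine Finset.sum_eq_zero fun v _ => ?_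
  by_cases h : c.1 v = 0
  · rw [h, zero_smul]
  · rw [hf v (T.isSimplex_of_ne_zero c h) (hc v h), smul_zero]

theorem VanishesOff.apply_eq_zero {T : Triangulation n} {p : ℕ} {H : Set (P n)} {u : T.Cochain p}
    (hu : T.VanishesOff H u) {c : T.Chain p} (hc : c ∈ T.chainsIn Hᶜ p) : u c = 0 := by
  obtain ⟨O, hO⟩ := T.exists_isOrdering
  exact hO.map_eq_zero (fun v hv hvA => hu v hv (Set.disjoint_left.2 fun z hz => hvA hz)) hc

/-- The terms of the prism operator which involve an edge. -/
def prismEdge (S : SingCochain n 2) {E : Type*} [NormedAddCommGroup E] [NormedSpace ℝ E]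
    (R : E × ℝ → P n) (v : Fin 2 → E) : ℚ :=
  S (affSimplex R ![(v 0, 0), (v 1, 0), (v 1, 1)]) -
    S (affSimplex R ![(v 0, 0), (v 0, 1), (v 1, 1)])

/-- The values of a cocycle at the two ends of a prism differ by its values on the sides. -/
theorem prism_formula {S : SingCochain n 2} (hS : ∀ τ, singCobd S τ = 0) {E : Type*}
    [NormedAddCommGroup E] [NormedSpace ℝ E] {R : E × ℝ → P n} {C : Set E} (hC : Convex ℝ C)
    (hR : ContinuousOn R (C ×ˢ Set.Icc (0 : ℝ) 1)) {v : Fin 3 → E} (hv : ∀ j, v j ∈ C) :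
    S (affSimplex R fun j => (v j, 0)) = S (affSimplex R fun j => (v j, 1)) +
      ∑ j : Fin 3, (-1 : ℚ) ^ (j : ℕ) * prismEdge S R (v ∘ j.succAbove) := by
  have hD : Convex ℝ (C ×ˢ Set.Icc (0 : ℝ) 1) := hC.prod (convex_Icc 0 1)
  have hm0 : ∀ j, ((v j, (0 : ℝ)) : E × ℝ) ∈ C ×ˢ Set.Icc (0 : ℝ) 1 :=
    fun j => ⟨hv j, le_rfl, zero_le_one⟩
  have hm1 : ∀ j, ((v j, (1 : ℝ)) : E × ℝ) ∈ C ×ˢ Set.Icc (0 : ℝ) 1 :=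
    fun j => ⟨hv j, zero_le_one, le_rfl⟩
  have key : ∀ a b c d : E × ℝ, a ∈ C ×ˢ Set.Icc (0 : ℝ) 1 → b ∈ C ×ˢ Set.Icc (0 : ℝ) 1 →
      c ∈ C ×ˢ Set.Icc (0 : ℝ) 1 → d ∈ C ×ˢ Set.Icc (0 : ℝ) 1 →
      S (affSimplex R ![b, c, d]) - S (affSimplex R ![a, c, d]) + S (affSimplex R ![a, b, d]) -
        S (affSimplex R ![a, b, c]) = 0 := by
    intro a b c d ha hb hc hd
    have hp : ∀ j, ![a, b, c, d] j ∈ C ×ˢ Set.Icc (0 : ℝ) 1 := fun j => by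
      fin_cases j <;> assumption
    have h := hS (affSimplex R ![a, b, c, d])
    simp only [singCobd, affSimplex_face hD hR hp] at h
    change ∑ j : Fin 4, (-1 : ℚ) ^ (j : ℕ) * S (affSimplex R (![a, b, c, d] ∘ j.succAbove)) = 0 at h
    rw [Fin.sum_univ_four] at h
    have e0 : ![a, b, c, d] ∘ (0 : Fin 4).succAbove = ![b, c, d] := by
      funext j; fin_cases j <;> rfl
    have e1 : ![a, b, c, d] ∘ (1 : Fin 4).succAbove = ![a, c, d] := by
      funext j; fin_cases j <;> rfl
    have e2 : ![a, b, c, d] ∘ (2 : Fin 4).succAbove = ![a, b, d] := by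
      funext j; fin_cases j <;> rfl
    have e3 : ![a, b, c, d] ∘ (3 : Fin 4).succAbove = ![a, b, c] := by
      funext j; fin_cases j <;> rfl
    rw [e0, e1, e2, e3] at h
    have v3 : ((3 : Fin 4) : ℕ) = 3 := rfl
    simp only [Fin.val_zero, Fin.val_one, Fin.val_two, v3] at h
    linear_combination h
  have k1 := key (v 0, 0) (v 1, 0) (v 2, 0) (v 2, 1) (hm0 0) (hm0 1) (hm0 2) (hm1 2)
  have k2 := key (v 0, 0) (v 1, 0) (v 1, 1) (v 2, 1) (hm0 0) (hm0 1) (hm1 1) (hm1 2)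
  have k3 := key (v 0, 0) (v 0, 1) (v 1, 1) (v 2, 1) (hm0 0) (hm1 0) (hm1 1) (hm1 2)
  have w0 : (fun j => ((v j, 0) : E × ℝ)) = ![(v 0, 0), (v 1, 0), (v 2, 0)] := by
    funext j; fin_cases j <;> rfl
  have w1 : (fun j => ((v j, 1) : E × ℝ)) = ![(v 0, 1), (v 1, 1), (v 2, 1)] := by
    funext j; fin_cases j <;> rfl
  rw [w0, w1, Fin.sum_univ_three]
  have e1 : (0 : Fin 3).succAbove 0 = 1 := rfl
  have e2 : (0 : Fin 3).succAbove 1 = 2 := rfl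
  have e3 : (1 : Fin 3).succAbove 0 = 0 := rfl
  have e4 : (1 : Fin 3).succAbove 1 = 2 := rfl
  have e5 : (2 : Fin 3).succAbove 0 = 0 := rfl
  have e6 : (2 : Fin 3).succAbove 1 = 1 := rfl
  simp only [prismEdge, Function.comp_apply, e1, e2, e3, e4, e5, e6, Fin.val_zero, Fin.val_one,
    Fin.val_two]
  linear_combination -k1 + k2 - k3

/-- The value of a Thom cocycle of `H_{i,α}` on a chain `c` in the closed tube with boundary off
`H_{i,α}` is the winding of `w` along the boundary of `c`. -/
theorem IsThomCocycle.eq_osum_edgeWinding {T : Triangulation n} {i : Fin n} {α : Pole}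
    {u : T.Cochain 2} (hu : T.IsThomCocycle i α u) : ∃ O : PartialOrder (Fin T.N → ℝ),
      T.IsOrdering O ∧ ∀ c ∈ T.chainsIn (closedTube i α) 2,
        T.bdSucc 1 c ∈ T.chainsIn (hyper i α)ᶜ 1 →
          (u c : ℂ) = T.osum O (edgeWinding T i α) (T.bdSucc 1 c) := by
  obtain ⟨-, -, S, O, w, ⟨hS, hSoff, c₁, hc₁, hSc₁⟩, hO, hw, huS⟩ := hu
  refine ⟨O, hO, fun c hc hbc => ?_⟩
  obtain ⟨b, hb⟩ := hc₁.exists_eq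
  let R := shrink T i α
  -- the simplices of `c` and of its boundary
  have hsimp : ∀ v, c.1 v ≠ 0 → Convex ℝ (convexHull ℝ (Set.range v)) ∧
      ContinuousOn R (convexHull ℝ (Set.range v) ×ˢ Set.Icc (0 : ℝ) 1) ∧
      ∀ x ∈ convexHull ℝ (Set.range v), T.param x ∈ closedTube i α := by
    intro v hv
    have hvs := T.isSimplex_of_ne_zero c hv
    have h1 : ∀ x ∈ convexHull ℝ (Set.range v), T.param x ∈ closedTube i α :=
      fun x hx => hc v hv (hvs.param_mem hx)
    exact ⟨convex_convexHull ℝ _, continuousOn_shrink T i α hvs.convexHull_subset_space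
      fun x hx => (h1 x hx).1, h1⟩
  have hbd : ∀ e, (T.bdSucc 1 c).1 e ≠ 0 → ContinuousOn R (convexHull ℝ (Set.range e) ×ˢ
      Set.Icc (0 : ℝ) 1) ∧ (∀ x ∈ convexHull ℝ (Set.range e), T.param x ∈ closedTube i α) ∧
      ∀ x ∈ convexHull ℝ (Set.range e), T.param x ∉ hyper i α := by
    intro e he
    have hes := T.isSimplex_of_ne_zero _ he
    obtain ⟨x, -, hx⟩ := Finset.exists_ne_zero_of_sum_ne_zero (s := T.verts) he
    have hsub : Set.range e ⊆ Set.range (Fin.cons x e : Fin 3 → Fin T.N → ℝ) := by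
      rintro _ ⟨j, rfl⟩
      exact ⟨j.succ, by simp⟩
    have h := hsimp _ hx
    refine ⟨h.2.1.mono (Set.prod_mono (convexHull_mono hsub) subset_rfl),
      fun x hx => h.2.2 x (convexHull_mono hsub hx), fun x hx => hbc e he (hes.param_mem hx)⟩
  -- `u` is given by the singular cocycle `S` up to a coboundary which does not contribute.
  have hu1 : u c = T.osum O (fun v => S (affSimplex T.param v)) c := by
    have h1 : T.osum O (fun v => w (T.bdSucc 1 (T.elem v))) c = 0 := by
      have := hO.map_eq_osum (w ∘ₗ T.bdSucc 1) c
      simp only [LinearMap.comp_apply] at this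
      rw [← this]
      exact hw.apply_eq_zero hbc
    rw [hO.map_eq_osum u, ← add_zero (T.osum O (fun v => S _) c), ← h1, osum_apply, osum_apply,
      osum_apply, ← Finset.sum_add_distrib]
    refine Finset.sum_congr rfl fun v hv => ?_
    by_cases hcv : c.1 v = 0
    · simp [hcv]
    · have hvs := T.isSimplex_of_ne_zero c hcv
      rw [huS v hvs (T.mem_increasing.1 hv).2, T.toSingular_eq hvs, smul_add]
  -- The contraction into `Δ` does not change the value, since the sides of the prism over the
  -- boundary of `c` avoid `H_{i,α}`.
  have hu2 : u c = T.osum O (fun v => S (affSimplex R fun j => (v j, 1))) c := by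
    have h1 : T.osum O (prismEdge S R) (T.bdSucc 1 c) = 0 := by
      rw [osum_apply]
      refine Finset.sum_eq_zero fun e he => ?_
      by_cases hce : (T.bdSucc 1 c).1 e = 0
      · rw [hce, zero_smul]
      · obtain ⟨hRe, hK, hH⟩ := hbd e hce
        have hmem : ∀ j, e j ∈ convexHull ℝ (Set.range e) := fun j =>
          subset_convexHull ℝ _ ⟨j, rfl⟩
        have hD := convex_prism (T := T) (convex_convexHull ℝ (Set.range e))
        have hmap : Set.MapsTo R (convexHull ℝ (Set.range e) ×ˢ Set.Icc (0 : ℝ) 1)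
            (hyper i α)ᶜ := fun x hx =>
          shrink_mem_compl_hyper T i α hx.2 (hK _ hx.1).1 (hH _ hx.1)
        have h0 : ∀ j, ((e j, (0 : ℝ)) : (Fin T.N → ℝ) × ℝ) ∈
            convexHull ℝ (Set.range e) ×ˢ Set.Icc (0 : ℝ) 1 :=
          fun j => ⟨hmem j, le_rfl, zero_le_one⟩
        have h1 : ∀ j, ((e j, (1 : ℝ)) : (Fin T.N → ℝ) × ℝ) ∈
            convexHull ℝ (Set.range e) ×ˢ Set.Icc (0 : ℝ) 1 :=
          fun j => ⟨hmem j, zero_le_one, le_rfl⟩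
        rw [prismEdge, hSoff, hSoff, sub_zero, smul_zero]
        · refine range_affSimplex hD hRe (fun j => ?_) hmap
          fin_cases j
          exacts [h0 0, h1 0, h1 1]
        · refine range_affSimplex hD hRe (fun j => ?_) hmap
          fin_cases j
          exacts [h0 0, h0 1, h1 1]
    rw [hu1, ← add_zero (T.osum O (fun v => S (affSimplex R _)) c), ← h1, hO.osum_bdSucc, osum_apply,
      osum_apply, osum_apply, ← Finset.sum_add_distrib]
    refine Finset.sum_congr rfl fun v _ => ?_
    by_cases hcv : c.1 v = 0
    · simp [hcv]
    · obtain ⟨hC, hRv, hK⟩ := hsimp v hcv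
      have hmem : ∀ j, v j ∈ convexHull ℝ (Set.range v) := fun j =>
        subset_convexHull ℝ _ ⟨j, rfl⟩
      have h0 : affSimplex T.param v = affSimplex R fun j => (v j, 0) := by
        refine affSimplex_congr hC (T.continuousOn_param.mono
          (T.isSimplex_of_ne_zero c hcv).convexHull_subset_space) (convex_prism hC) hRv hmem
          (fun j => ⟨hmem j, le_rfl, zero_le_one⟩) fun t => ?_
        have hsum : ∑ j, t j • ((v j, 0) : (Fin T.N → ℝ) × ℝ) = (∑ j, t j • v j, 0) := by
          rw [Prod.ext_iff]
          simp [Prod.fst_sum, Prod.snd_sum]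
        rw [hsum]
        exact (shrink_zero T i α (hK _ (sum_smul_mem hC hmem t)).1).symm
      rw [h0, prism_formula hS hC hRv hmem, smul_add]
      rfl
  have hcast : ∀ (q : ℕ) (g : (Fin (q + 1) → Fin T.N → ℝ) → ℚ) (d : T.Chain q),
      ((T.osum O g d : ℚ) : ℂ) = T.osum O (fun v => (g v : ℂ)) d := by
    intro q g d
    rw [osum_apply, osum_apply]
    push_cast
    refine Finset.sum_congr rfl fun v _ => ?_
    rw [smul_eq_mul, Rat.cast_mul, Rat.smul_def]
  -- In `Δ` the cocycle `S` is the coboundary of `c₁`.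
  have hu3 : u c = T.osum O (fun e => c₁ (affSimplex R fun j => (e j, 1))) (T.bdSucc 1 c) := by
    rw [hu2, hO.osum_bdSucc]
    refine T.osum_congr O fun v hv hcv => ?_
    obtain ⟨hC, hRv, hK⟩ := hsimp v hcv
    have hmem : ∀ j, ((v j, 1) : (Fin T.N → ℝ) × ℝ) ∈
        convexHull ℝ (Set.range v) ×ˢ Set.Icc (0 : ℝ) 1 := fun j =>
      ⟨subset_convexHull ℝ _ ⟨j, rfl⟩, zero_le_one, le_rfl⟩
    have hsum : ∀ t : stdSimplex ℝ (Fin 3), ∑ j, t j • ((v j, 1) : (Fin T.N → ℝ) × ℝ) =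
        (∑ j, t j • v j, 1) := by
      intro t
      rw [Prod.ext_iff]
      simp only [Prod.fst_sum, Prod.snd_sum, Prod.smul_mk, smul_eq_mul, mul_one, true_and]
      exact t.2.2
    rw [hSc₁, singCobd]
    · refine Finset.sum_congr rfl fun j _ => ?_
      rw [affSimplex_face (convex_prism hC) hRv hmem, smul_eq_mul]
      rfl
    · rintro _ ⟨t, rfl⟩
      rw [affSimplex_apply (convex_prism hC) hRv hmem, hsum]
      exact shrink_mem_tube T i α (hK _ (sum_smul_mem hC (fun j => subset_convexHull ℝ _ ⟨j, rfl⟩) t))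
  rw [hu3, hcast]
  -- `c₁` is the winding up to a difference of values of `b`, which vanishes on cycles.
  have hvan : T.osum O (fun e : Fin 2 → Fin T.N → ℝ => b (R (e 1, 1)) - b (R (e 0, 1)))
      (T.bdSucc 1 c) = 0 := by
    have h1 := hO.osum_bdSucc (fun x : Fin 1 → Fin T.N → ℝ => b (R (x 0, 1))) (T.bdSucc 1 c)
    rw [bdSucc_bdSucc, map_zero] at h1
    rw [h1]
    refine T.osum_congr O fun e _ _ => ?_
    simp [Fin.sum_univ_two, sub_eq_add_neg]
  rw [← add_zero (T.osum O (edgeWinding T i α) _), ← hvan, osum_apply, osum_apply, osum_apply,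
    ← Finset.sum_add_distrib]
  refine Finset.sum_congr rfl fun e _ => ?_
  by_cases hce : (T.bdSucc 1 c).1 e = 0
  · simp [hce]
  · obtain ⟨hRe, hK, hH⟩ := hbd e hce
    have hC := convex_convexHull ℝ (Set.range e)
    have hmem' : ∀ j, e j ∈ convexHull ℝ (Set.range e) := fun j => subset_convexHull ℝ _ ⟨j, rfl⟩
    have hmem : ∀ j, ((e j, 1) : (Fin T.N → ℝ) × ℝ) ∈
        convexHull ℝ (Set.range e) ×ˢ Set.Icc (0 : ℝ) 1 := fun j =>
      ⟨hmem' j, zero_le_one, le_rfl⟩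
    have hval : ∀ t, affSimplex R (fun j => (e j, 1)) t = R (∑ j, t j • e j, 1) := by
      intro t
      rw [affSimplex_apply (convex_prism hC) hRe hmem]
      congr 1
      rw [Prod.ext_iff]
      simp only [Prod.fst_sum, Prod.snd_sum, Prod.smul_mk, smul_eq_mul, mul_one, true_and]
      exact t.2.2
    rw [hb, ← smul_add]
    · rw [hval, hval]
      simp [edgeWinding, R]
    · rintro _ ⟨t, rfl⟩
      have hm := sum_smul_mem hC hmem' t
      rw [hval]
      exact ⟨shrink_mem_tube T i α (hK _ hm),
        shrink_mem_compl_hyper T i α ⟨zero_le_one, le_rfl⟩ (hK _ hm).1 (hH _ hm)⟩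

end Triangulation
end CubicalChains

namespace CubicalChains

/-! ### Thom cocycles of a triangulation and of a subdivision -/

namespace Triangulation

variable {n : ℕ}

theorem bdSucc_mem_chainsIn {T : Triangulation n} {A : Set (P n)} {p : ℕ} {c : T.Chain (p + 1)}
    (hc : c ∈ T.chainsIn A (p + 1)) : T.bdSucc p c ∈ T.chainsIn A p := by
  intro v hv
  obtain ⟨x, -, hx⟩ := Finset.exists_ne_zero_of_sum_ne_zero (s := T.verts) hv
  refine Set.Subset.trans ?_ (hc _ hx)
  have h := T.tupleCell_comp_subset (Fin.cons x v : Fin (p + 2) → Fin T.N → ℝ) Fin.succ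
  rwa [show (Fin.cons x v : Fin (p + 2) → Fin T.N → ℝ) ∘ Fin.succ = v from
    funext fun j => by simp] at h

theorem map_mem_chainsIn {T T' : Triangulation n} {p q : ℕ} {f : T.Chain p →ₗ[ℚ] T'.Chain q}
    {H : Set (P n)} (hf : ∀ v, T.IsSimplex v → f (T.elem v) ∈ T'.chainsIn (T.tupleCell v ∩ H) q)
    {A : Set (P n)} {c : T.Chain p} (hc : c ∈ T.chainsIn A p) :
    f c ∈ T'.chainsIn (A ∩ H) q := by
  obtain ⟨O, hO⟩ := T.exists_isOrdering
  rw [hO.map_eq_osum f, osum_apply]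
  refine Submodule.sum_mem _ fun v _ => ?_
  by_cases h : c.1 v = 0
  · rw [h, zero_smul]
    exact Submodule.zero_mem _
  · exact Submodule.smul_mem _ _ (T'.chainsIn_mono (Set.inter_subset_inter_left _ (hc v h)) _
      (hf v (T.isSimplex_of_ne_zero c h)))

theorem mem_chainsIn_iff_support {T : Triangulation n} {A : Set (P n)} {p : ℕ} {c : T.Chain p} :
    c ∈ T.chainsIn A p ↔ T.support c ⊆ A :=
  ⟨fun h _ ⟨v, hv, hz⟩ => h v hv hz, fun h v hv _ hz => h ⟨v, hv, hz⟩⟩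

theorem IsSubdivisionOperator.mem_chainsIn {T T' : Triangulation n}
    {Λ : ∀ p, T.Chain p →ₗ[ℚ] T'.Chain p} (hΛ : IsSubdivisionOperator T T' Λ) {A : Set (P n)}
    {p : ℕ} {c : T.Chain p} (hc : c ∈ T.chainsIn A p) : Λ p c ∈ T'.chainsIn A p := by
  have := map_mem_chainsIn (f := Λ p) (H := Set.univ) (fun v hv => by
    rw [Set.inter_univ, mem_chainsIn_iff_support]
    exact hΛ.2.1 p v hv) hc
  rwa [Set.inter_univ] at this

theorem mem_verts_iff_isSimplex {T : Triangulation n} {x : Fin 1 → Fin T.N → ℝ} :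
    T.IsSimplex x ↔ x 0 ∈ T.verts := by
  classical
  constructor
  · intro h
    exact h.mem_verts 0
  · intro h
    refine ⟨fun a b _ => Subsingleton.elim (α := Fin 1) a b, ?_⟩
    convert T.singleton_mem_faces h
    ext y
    simp

theorem tupleCell_vertex {T : Triangulation n} {x : Fin 1 → Fin T.N → ℝ} (hx : T.IsSimplex x) :
    T.tupleCell x = {T.param (x 0)} := by
  have hr : Set.range x = {x 0} := by
    ext y
    simp [eq_comm]
  ext z
  constructor
  · intro hz
    obtain ⟨y, rfl⟩ := T.Φ.surjective z
    have := T.mem_tupleCell.1 hz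
    rw [hr, convexHull_singleton, Set.mem_singleton_iff] at this
    rw [Set.mem_singleton_iff, ← this, T.param_of_mem y.2]
  · rintro rfl
    exact hx.param_mem (subset_convexHull ℝ _ ⟨0, rfl⟩)

theorem augmentation_elem {T : Triangulation n} {x : Fin 1 → Fin T.N → ℝ} (hx : T.IsSimplex x) :
    T.augmentation (T.elem x) = 1 := by
  obtain ⟨O, hO⟩ := T.exists_isOrdering
  rw [← T.sum_increasing_zero O]
  have := T.osum_elem (O := O) (fun _ => (1 : ℚ)) hx (T.mem_increasing.2
    ⟨fun k => hx.mem_verts k, fun a b hab => absurd hab (by omega)⟩)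
  rw [osum_apply] at this
  simpa using this

/-- The subdivision of a vertex is the same vertex. -/
theorem IsSubdivisionOperator.osum_vertex {T T' : Triangulation n}
    {Λ : ∀ p, T.Chain p →ₗ[ℚ] T'.Chain p} (hΛ : IsSubdivisionOperator T T' Λ)
    {M : Type*} [AddCommGroup M] [Module ℚ M] (O' : PartialOrder (Fin T'.N → ℝ)) (h : P n → M)
    {x : Fin 1 → Fin T.N → ℝ} (hx : T.IsSimplex x) :
    T'.osum O' (fun v => h (T'.param (v 0))) (Λ 0 (T.elem x)) = h (T.param (x 0)) := by
  have h1 : T'.osum O' (fun v => h (T'.param (v 0))) (Λ 0 (T.elem x)) =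
      T'.osum O' (fun _ => h (T.param (x 0))) (Λ 0 (T.elem x)) := by
    refine T'.osum_congr O' fun v _ hv => ?_
    have hvs := T'.isSimplex_of_ne_zero _ hv
    have h2 := (mem_chainsIn_iff_support.2 (hΛ.2.1 0 x hx)) v hv
    rw [tupleCell_vertex hvs, tupleCell_vertex hx, Set.singleton_subset_singleton] at h2
    rw [h2]
  rw [h1, osum_apply, ← Finset.sum_smul, T'.sum_increasing_zero, hΛ.2.2, augmentation_elem hx,
    one_smul]

/-- A simplex in the closed tube which does not meet `H_{i,α}` carries a logarithm of `w`. -/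
theorem IsSimplex.exists_log {T : Triangulation n} {p : ℕ} {v : Fin (p + 1) → Fin T.N → ℝ}
    (hv : T.IsSimplex v) {i : Fin n} {α : Pole} (hA : T.tupleCell v ⊆ closedTube i α)
    (hH : T.tupleCell v ⊆ (hyper i α)ᶜ) :
    ∃ l : P n → ℂ, ContinuousOn l (T.tupleCell v) ∧
      ∀ z ∈ T.tupleCell v, Complex.exp (l z) = α.coord (z i) := by
  let C := convexHull ℝ (Set.range v)
  have hCc : IsCompact C := (Set.finite_range v).isCompact_convexHull (𝕜 := ℝ)
  have : CompactSpace C := isCompact_iff_compactSpace.1 hCc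
  have : ContractibleSpace C := (convex_convexHull ℝ (Set.range v)).contractibleSpace
    ⟨v 0, subset_convexHull ℝ _ ⟨0, rfl⟩⟩
  have hmem : ∀ x : C, T.param x.1 ∈ T.tupleCell v := fun x => hv.param_mem x.2
  have hpc : Continuous fun x : C => T.param x.1 :=
    (T.continuousOn_param.mono hv.convexHull_subset_space).comp_continuous continuous_subtype_val
      fun x => x.2
  let g : C(C, ℂ) := ⟨fun x => α.coord (T.param x.1 i), continuous_iff_continuousAt.2 fun x =>
    ContinuousAt.comp (g := α.coord) (f := fun x : C => T.param x.1 i)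
      (α.continuousAt_coord (hA (hmem x)).1)
      ((continuous_apply i).comp hpc).continuousAt⟩
  obtain ⟨l, hl⟩ := exists_continuous_log g fun x h =>
    hH (hmem x) ((α.coord_eq_zero_iff (hA (hmem x)).1).1 h)
  classical
  let L : P n → ℂ := fun z => if h : (T.Φ.symm z).1 ∈ C then l ⟨_, h⟩ else 0
  have hzC : ∀ z ∈ T.tupleCell v, (T.Φ.symm z).1 ∈ C := by
    intro z hz
    rw [← T.Φ.apply_symm_apply z] at hz
    exact T.mem_tupleCell.1 hz
  refine ⟨L, ?_, fun z hz => ?_⟩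
  · rw [continuousOn_iff_continuous_domRestrict]
    have : (T.tupleCell v).domRestrict L = fun z => l ⟨(T.Φ.symm z.1).1, hzC z.1 z.2⟩ := by
      funext z
      exact dif_pos (hzC z.1 z.2)
    rw [this]
    refine l.continuous.comp (Continuous.subtype_mk ?_ _)
    exact continuous_subtype_val.comp (T.Φ.symm.continuous.comp continuous_subtype_val)
  · have h1 : L z = l ⟨_, hzC z hz⟩ := dif_pos (hzC z hz)
    rw [h1, hl]
    change α.coord (T.param (T.Φ.symm z).1 i) = _
    rw [T.param_of_mem (T.Φ.symm z).2]
    simp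

/-- The winding along an edge does not change under subdivision. -/
theorem IsSubdivisionOperator.osum_edgeWinding {T T' : Triangulation n}
    {Λ : ∀ p, T.Chain p →ₗ[ℚ] T'.Chain p} (hΛ : IsSubdivisionOperator T T' Λ)
    {O' : PartialOrder (Fin T'.N → ℝ)} (hO' : T'.IsOrdering O') {i : Fin n} {α : Pole}
    {v : Fin 2 → Fin T.N → ℝ} (hv : T.IsSimplex v) (hA : T.tupleCell v ⊆ closedTube i α)
    (hH : T.tupleCell v ⊆ (hyper i α)ᶜ) :
    T'.osum O' (edgeWinding T' i α) (Λ 1 (T.elem v)) = edgeWinding T i α v := by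
  classical
  obtain ⟨l, hl, hexp⟩ := hv.exists_log hA hH
  let h : P n → ℂ := fun z => l z / (2 * Real.pi * Complex.I)
  -- The winding is the difference of the values of `h` at the end points, which subdivision
  -- preserves.
  have h1 : T'.osum O' (edgeWinding T' i α) (Λ 1 (T.elem v)) =
      T'.osum O' (fun x : Fin 1 → Fin T'.N → ℝ => h (T'.param (x 0)))
        (T'.bdSucc 0 (Λ 1 (T.elem v))) := by
    rw [hO'.osum_bdSucc]
    refine T'.osum_congr O' fun e _ he => ?_
    rw [edgeWinding_eq (T'.isSimplex_of_ne_zero _ he)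
      ((mem_chainsIn_iff_support.2 (hΛ.2.1 1 v hv)) e he) hA hl hexp]
    simp [Fin.sum_univ_two, h]
    ring
  rw [h1, hΛ.1, T.bdSucc_elem (by convert hv.2), edgeWinding_eq hv subset_rfl hA hl hexp,
    map_sum, map_sum]
  have h2 : ∀ j : Fin 2, T'.osum O' (fun x : Fin 1 → Fin T'.N → ℝ => h (T'.param (x 0)))
      (Λ 0 ((-1 : ℚ) ^ (j : ℕ) • T.elem (v ∘ j.succAbove))) =
      (-1 : ℚ) ^ (j : ℕ) • h (T.param (v (j.succAbove 0))) := by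
    intro j
    rw [map_smul, map_smul, hΛ.osum_vertex O' h (hv.face Fin.succAbove_right_injective)]
    rfl
  rw [Fin.sum_univ_two, h2, h2]
  simp [h]
  ring

/-- The part of a chain which consists of the simplices with property `Q`. -/
def filterChain (T : Triangulation n) (Q : Set (P n) → Prop) [DecidablePred Q] {p : ℕ}
    (c : T.Chain p) : T.Chain p where
  val v := if Q (T.tupleCell v) then c.1 v else 0
  property := by
    refine ⟨fun v hv => T.isSimplex_of_ne_zero c fun h => hv (by simp [h]), fun v π => ?_⟩
    simp only [tupleCell_comp_perm]
    split_ifs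
    · exact T.chain_comp c v π
    · simp

end Triangulation

open Triangulation

variable {n : ℕ}

/-- Thom cocycles of a triangulation and of a subdivision agree on cycles relative to the complement of
`H_{i,α}`: only the simplices which meet `H_{i,α}` contribute. They form a chain in the closed tube,
on which both cocycles are the winding of `w` along the boundary. -/
theorem Triangulation.IsThomCocycle.apply_eq_apply_of_relative_cycle {T : GoodTriangulation n}
    {T' : Triangulation n} {Λ : ∀ p, T.Chain p →ₗ[ℚ] T'.Chain p}
    (hΛ : IsSubdivisionOperator T.toTriangulation T' Λ) {i : Fin n} {α : Pole} {u : T.Cochain 2}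
    (hu : T.IsThomCocycle i α u) {u' : T'.Cochain 2} (hu' : T'.IsThomCocycle i α u')
    {c : T.Chain 2} (hc : T.bdSucc 1 c ∈ T.chainsIn (hyper i α)ᶜ 1) : u c = u' (Λ 2 c) := by
  classical
  let Q : Set (P n) → Prop := fun A => (A ∩ hyper i α).Nonempty
  let c₁ := T.filterChain Q c
  have hc₁ : c₁ ∈ T.chainsIn (closedTube i α) 2 := by
    intro v hv
    have hQ : Q (T.tupleCell v) := by
      by_contra h
      exact hv (if_neg h)
    have hvs := T.isSimplex_of_ne_zero c₁ hv
    exact T.cell_subset_closedTube hvs.2 hQ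
  have hc₂ : c - c₁ ∈ T.chainsIn (hyper i α)ᶜ 2 := by
    intro v hv z hz hzH
    have h1 : Q (T.tupleCell v) := ⟨z, hz, hzH⟩
    apply hv
    change c.1 v - (if Q (T.tupleCell v) then c.1 v else 0) = 0
    rw [if_pos h1, sub_self]
  have hb₁ : T.bdSucc 1 c₁ ∈ T.chainsIn (hyper i α)ᶜ 1 := by
    have h1 : T.bdSucc 1 c₁ = T.bdSucc 1 c - T.bdSucc 1 (c - c₁) := by rw [map_sub]; abel
    rw [h1]
    exact Submodule.sub_mem _ hc (bdSucc_mem_chainsIn hc₂)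
  have e1 : u (c - c₁) = 0 := hu.1.apply_eq_zero hc₂
  have e2 : u' (Λ 2 (c - c₁)) = 0 := hu'.1.apply_eq_zero (hΛ.mem_chainsIn hc₂)
  have e3 : u c₁ = u' (Λ 2 c₁) := by
    obtain ⟨O, hO, hE⟩ := hu.eq_osum_edgeWinding
    obtain ⟨O', hO', hE'⟩ := hu'.eq_osum_edgeWinding
    have h1 := hE c₁ hc₁ hb₁
    have h2 := hE' (Λ 2 c₁) (hΛ.mem_chainsIn hc₁) (by
      rw [hΛ.1]
      exact hΛ.mem_chainsIn hb₁)
    rw [hΛ.1, hO.map_eq_osum ((T'.osum O' (edgeWinding T' i α)) ∘ₗ Λ 1) (T.bdSucc 1 c₁) |>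
      fun h => (show T'.osum O' (edgeWinding T' i α) (Λ 1 (T.bdSucc 1 c₁)) = _ from h)] at h2
    have h3 : (u c₁ : ℂ) = u' (Λ 2 c₁) := by
      rw [h1, h2]
      refine T.osum_congr O fun v _ hv => ?_
      rw [LinearMap.comp_apply]
      exact (hΛ.osum_edgeWinding hO' (T.isSimplex_of_ne_zero _ hv)
        (bdSucc_mem_chainsIn hc₁ v hv) (hb₁ v hv)).symm
    exact_mod_cast h3
  rw [map_sub, sub_eq_zero] at e1
  rw [map_sub, map_sub, sub_eq_zero] at e2
  rw [e1, e2, e3]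

/-- The Thom cocycles of a triangulation and of a subdivision are cohomologous relative to the
complement of the hypersurface. -/
theorem Triangulation.IsThomCocycle.exists_cobounding {T : GoodTriangulation n}
    {T' : Triangulation n} {Λ : ∀ p, T.Chain p →ₗ[ℚ] T'.Chain p}
    (hΛ : IsSubdivisionOperator T.toTriangulation T' Λ) {i : Fin n} {α : Pole} {u : T.Cochain 2}
    (hu : T.IsThomCocycle i α u) {u' : T'.Cochain 2} (hu' : T'.IsThomCocycle i α u') :
    ∃ w : T.Cochain 1, (∀ c ∈ T.chainsIn (hyper i α)ᶜ 1, w c = 0) ∧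
      ∀ c, u c - u' (Λ 2 c) = w (T.bdSucc 1 c) := by
  -- A functional which vanishes on the kernel of the relative boundary `φ` factors through `φ`.
  let N := T.chainsIn (hyper i α)ᶜ 1
  let φ : T.Chain 2 →ₗ[ℚ] (T.Chain 1 ⧸ N) := N.mkQ ∘ₗ T.bdSucc 1
  let v : T.Cochain 2 := u - u' ∘ₗ Λ 2
  have hv : v ∈ (LinearMap.ker φ).dualAnnihilator := by
    rw [Submodule.mem_dualAnnihilator]
    intro c hc
    have h1 : T.bdSucc 1 c ∈ N := by
      rwa [LinearMap.mem_ker, LinearMap.comp_apply, Submodule.mkQ_apply,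
        Submodule.Quotient.mk_eq_zero] at hc
    exact sub_eq_zero.2 (hu.apply_eq_apply_of_relative_cycle hΛ hu' h1)
  rw [← LinearMap.range_dualMap_eq_dualAnnihilator_ker] at hv
  obtain ⟨w, hw⟩ := hv
  refine ⟨w ∘ₗ N.mkQ, fun c hc => ?_, fun c => ?_⟩
  · rw [LinearMap.comp_apply, Submodule.mkQ_apply, (Submodule.Quotient.mk_eq_zero N).2 hc, map_zero]
  · exact (LinearMap.congr_fun hw c).symm

end CubicalChains

namespace CubicalChains

/-! ### Carried maps and the comparison of cap products -/

namespace Triangulation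

variable {n : ℕ}

/-- A map of chain groups which takes the chains in a closed set `A` to chains in `A ∩ H`. -/
def CarriedBy {T T' : Triangulation n} (H : Set (P n)) {p q : ℕ}
    (f : T.Chain p →ₗ[ℚ] T'.Chain q) : Prop :=
  ∀ (A : Set (P n)) (c : T.Chain p), c ∈ T.chainsIn A p → f c ∈ T'.chainsIn (A ∩ H) q

section Carried

variable {T T' : Triangulation n} {H : Set (P n)}

theorem CarriedBy.sub {p q : ℕ} {f g : T.Chain p →ₗ[ℚ] T'.Chain q} (hf : CarriedBy H f)
    (hg : CarriedBy H g) : CarriedBy H (f - g) :=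
  fun A c hc => Submodule.sub_mem _ (hf A c hc) (hg A c hc)

theorem CarriedBy.comp_bdSucc {p q : ℕ} {f : T.Chain p →ₗ[ℚ] T'.Chain q} (hf : CarriedBy H f) :
    CarriedBy H (f ∘ₗ T.bdSucc p) :=
  fun A _ hc => hf A _ (bdSucc_mem_chainsIn hc)

theorem tupleCell_nonempty {p : ℕ} {v : Fin (p + 1) → Fin T.N → ℝ} (hv : T.IsSimplex v) :
    (T.tupleCell v).Nonempty :=
  (T.openCell_nonempty hv.2).mono (T.openCell_subset_cell _)

theorem eq_zero_of_mem_chainsIn_empty {p : ℕ} {c : T.Chain p} (hc : c ∈ T.chainsIn ∅ p) :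
    c = 0 := by
  refine Chain.ext fun v => ?_
  by_contra h
  exact (tupleCell_nonempty (T.isSimplex_of_ne_zero c h)).ne_empty
    (Set.subset_eq_empty (hc v h) rfl)

/-- Carried maps can be lifted, as they can be lifted on each simplex. -/
theorem exists_carriedBy {M : Type*} [AddCommGroup M] [Module ℚ M] {p q : ℕ}
    (f : T.Chain p →ₗ[ℚ] M) (g : T'.Chain q →ₗ[ℚ] M)
    (h : ∀ v, T.IsSimplex v → ∃ d ∈ T'.chainsIn (T.tupleCell v ∩ H) q, g d = f (T.elem v)) :
    ∃ D : T.Chain p →ₗ[ℚ] T'.Chain q, CarriedBy H D ∧ ∀ c, g (D c) = f c := by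
  classical
  obtain ⟨O, hO⟩ := T.exists_isOrdering
  choose! d hd hdf using h
  refine ⟨T.osum O d, fun A c hc => ?_, fun c => ?_⟩
  · rw [osum_apply]
    refine Submodule.sum_mem _ fun v _ => ?_
    by_cases h : c.1 v = 0
    · rw [h, zero_smul]
      exact Submodule.zero_mem _
    · exact Submodule.smul_mem _ _ (T'.chainsIn_mono (Set.inter_subset_inter_left _ (hc v h)) _
        (hd v (T.isSimplex_of_ne_zero c h)))
  · refine LinearMap.congr_fun (hO.hom_ext (f := g ∘ₗ T.osum O d) fun v hvO hv => ?_) c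
    rw [LinearMap.comp_apply, T.osum_elem _ hv hvO, hdf v hv]

theorem exists_mem_chainsIn_of_full (hH : T.IsFullSubcomplex H) {p q : ℕ}
    {M : Type*} [AddCommGroup M] [Module ℚ M] {g : T'.Chain q →ₗ[ℚ] M} {m : M}
    {v : Fin (p + 1) → Fin T.N → ℝ} (hv : T.IsSimplex v)
    (hm : ¬ (T.tupleCell v ∩ H).Nonempty → m = 0)
    (h : ∀ s ∈ T.K.faces, T.tupleCell v ∩ H = T.cell s → ∃ d ∈ T'.chainsIn (T.cell s) q, g d = m) :
    ∃ d ∈ T'.chainsIn (T.tupleCell v ∩ H) q, g d = m := by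
  by_cases hne : (T.tupleCell v ∩ H).Nonempty
  · obtain ⟨s, -, hs, hsH, -⟩ := hH.exists_face hv.2 hne
    obtain ⟨d, hd, hdm⟩ := h s hs hsH
    exact ⟨d, T'.chainsIn_mono hsH.ge _ hd, hdm⟩
  · exact ⟨0, Submodule.zero_mem _, by rw [map_zero, hm hne]⟩

theorem CarriedBy.apply_elem_eq_zero {p q : ℕ} {f : T.Chain p →ₗ[ℚ] T'.Chain q}
    (hf : CarriedBy H f) {v : Fin (p + 1) → Fin T.N → ℝ}
    (h : ¬ (T.tupleCell v ∩ H).Nonempty) : f (T.elem v) = 0 := by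
  refine eq_zero_of_mem_chainsIn_empty ?_
  rw [Set.not_nonempty_iff_eq_empty] at h
  rw [← h]
  exact hf _ _ (T.elem_mem_chainsIn fun _ => subset_rfl)

/-- The augmentation as a linear map. -/
def augmentationHom (T : Triangulation n) : T.Cochain 0 where
  toFun := T.augmentation
  map_add' c d := by simp [augmentation, Finset.sum_add_distrib]
  map_smul' r c := by simp [augmentation, Finset.mul_sum]

theorem elem_mem_chainsIn_self {p : ℕ} (v : Fin (p + 1) → Fin T.N → ℝ) :
    T.elem v ∈ T.chainsIn (T.tupleCell v) p :=
  T.elem_mem_chainsIn fun _ => subset_rfl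

/-- The method of acyclic carriers: a map `ψ` of degree `-2` which commutes with the boundary, is
carried by the intersections of the simplices with `H`, and has an augmentation which is the
coboundary of a cochain relative to the complement of `H`, is homotopic to zero by a carried
homotopy. -/
theorem exists_carried_homotopy (hsub : IsSubdivision T T') (hH : T.IsFullSubcomplex H)
    {Λ : ∀ p, T.Chain p →ₗ[ℚ] T'.Chain p} (hΛ : IsSubdivisionOperator T T' Λ)
    {ψ : ∀ k, T.Chain (k + 2) →ₗ[ℚ] T'.Chain k} (hψ : ∀ k, CarriedBy H (ψ k))
    (hcomm : ∀ k c, T'.bdSucc k (ψ (k + 1) c) = ψ k (T.bdSucc (k + 2) c))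
    {w : T.Cochain 1} (hw : ∀ c ∈ T.chainsIn Hᶜ 1, w c = 0)
    (haug : ∀ c, T'.augmentation (ψ 0 c) = w (T.bdSucc 1 c)) (k : ℕ) :
    ∃ (D : T.Chain (k + 1) →ₗ[ℚ] T'.Chain k) (E : T.Chain (k + 2) →ₗ[ℚ] T'.Chain (k + 1)),
      CarriedBy H D ∧ CarriedBy H E ∧
        ∀ c, T'.bdSucc k (E c) = ψ k c - D (T.bdSucc (k + 1) c) := by
  induction k with
  | zero =>
    obtain ⟨D, hD, hDw⟩ := exists_carriedBy (H := H) w T'.augmentationHom fun v hv => by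
      refine exists_mem_chainsIn_of_full hH hv (fun h => hw _ ?_) fun s hs hsH => ?_
      · refine T.chainsIn_mono ?_ _ (elem_mem_chainsIn_self v)
        exact fun z hz hzH => h ⟨z, hz, hzH⟩
      · obtain ⟨y, hy⟩ := T.K.nonempty_of_mem_faces hs
        have hx : T.IsSimplex (fun _ : Fin 1 => y) := mem_verts_iff_isSimplex.2 (T.mem_verts hs hy)
        refine ⟨w (T.elem v) • Λ 0 (T.elem fun _ => y), Submodule.smul_mem _ _
          (T'.chainsIn_mono ?_ _ (hΛ.mem_chainsIn (elem_mem_chainsIn_self _))), ?_⟩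
        · exact T.cell_mono fun z hz => by
            obtain ⟨_, -, rfl⟩ := Finset.mem_image.1 hz
            exact hy
        · rw [map_smul]
          change _ • T'.augmentation _ = _
          rw [hΛ.2.2, augmentation_elem hx, smul_eq_mul, mul_one]
    have hc : CarriedBy H (ψ 0 - D ∘ₗ T.bdSucc 1) := (hψ 0).sub hD.comp_bdSucc
    obtain ⟨E, hE, hEψ⟩ := exists_carriedBy (H := H) (ψ 0 - D ∘ₗ T.bdSucc 1) (T'.bdSucc 0)
      fun v hv => by
        refine exists_mem_chainsIn_of_full hH hv hc.apply_elem_eq_zero fun s hs hsH => ?_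
        refine T.exists_bdSucc_eq_of_augmentation hs (hsub.2 s hs)
          (hsH ▸ hc _ _ (elem_mem_chainsIn_self v)) ?_
        change T'.augmentationHom _ = 0
        rw [LinearMap.sub_apply, map_sub, LinearMap.comp_apply, hDw]
        exact sub_eq_zero.2 (haug _)
    exact ⟨D, E, hD, hE, hEψ⟩
  | succ k ih =>
    obtain ⟨D, E, hD, hE, hEψ⟩ := ih
    have hc : CarriedBy H (ψ (k + 1) - E ∘ₗ T.bdSucc (k + 2)) := (hψ _).sub hE.comp_bdSucc
    obtain ⟨E', hE', hEψ'⟩ := exists_carriedBy (H := H) (ψ (k + 1) - E ∘ₗ T.bdSucc (k + 2))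
      (T'.bdSucc (k + 1)) fun v hv => by
        refine exists_mem_chainsIn_of_full hH hv hc.apply_elem_eq_zero fun s hs hsH => ?_
        refine T.exists_bdSucc_eq_of_cycle hs (hsub.2 s hs)
          (hsH ▸ hc _ _ (elem_mem_chainsIn_self v)) ?_
        rw [LinearMap.sub_apply, map_sub, LinearMap.comp_apply, hEψ, hcomm, bdSucc_bdSucc,
          map_zero, sub_zero, sub_self]
    exact ⟨E, E', hE, hE', hEψ'⟩

end Carried

/-! ### Cap products with cocycles relative to the complement of a hypersurface -/

section Cap

variable {T : Triangulation n} {H : Set (P n)} {O : PartialOrder (Fin T.N → ℝ)} {u : T.Cochain 2}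

/-- The cap product with a `2`-cochain as a linear map. -/
def capHom (O : PartialOrder (Fin T.N → ℝ)) (u : T.Cochain 2) (k : ℕ) :
    T.Chain (k + 2) →ₗ[ℚ] T.Chain k :=
  T.capOn O 2 fun v => u (T.elem v)

theorem cap_eq_capHom (k : ℕ) (c : T.Chain (k + 2)) : T.cap O u c = capHom O u k c :=
  T.cap_eq_capOn O u c

theorem isSimplex_front {k q : ℕ} {v : Fin (k + q + 1) → Fin T.N → ℝ} (hv : T.IsSimplex v) :
    T.IsSimplex fun a : Fin (q + 1) => v (a.castLE (by omega)) :=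
  hv.face (f := fun a : Fin (q + 1) => a.castLE (by omega)) fun a b h => by
    simpa using h

theorem isSimplex_back {k q : ℕ} {v : Fin (k + q + 1) → Fin T.N → ℝ} (hv : T.IsSimplex v) :
    T.IsSimplex fun a : Fin (k + 1) => v ⟨a + q, by omega⟩ :=
  hv.face (f := fun a : Fin (k + 1) => (⟨a + q, by omega⟩ : Fin (k + q + 1))) fun a b h =>
    Fin.ext (by simpa using h)

/-- If a face of an increasing simplex meets `H`, then the vertices from its last vertex on
span a simplex in `H`. -/
theorem IsGoodOrdering.back_subset (hO : T.IsGoodOrdering O H) (hH : T.IsFullSubcomplex H)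
    {k q : ℕ} {v : Fin (k + q + 1) → Fin T.N → ℝ} (hv : T.IsSimplex v)
    (hvO : v ∈ T.increasing O (k + q))
    (h : (T.tupleCell (fun a : Fin (q + 1) => v (a.castLE (by omega))) ∩ H).Nonempty) :
    T.tupleCell (fun a : Fin (k + 1) => v ⟨a + q, by omega⟩) ⊆ H := by
  obtain ⟨s, hs, hsf, hsH, hx⟩ := hH.exists_face (isSimplex_front hv).2 h
  obtain ⟨x, hxs⟩ := T.K.nonempty_of_mem_faces hsf
  obtain ⟨a, -, ha⟩ := Finset.mem_image.1 (hs hxs)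
  have hxH : T.cell {x} ⊆ H := (hx x (hs hxs)).1 hxs
  refine hH.2 _ (isSimplex_back hv).2 fun y hy => ?_
  obtain ⟨b, -, rfl⟩ := Finset.mem_image.1 hy
  obtain ⟨h1, h2⟩ := T.mem_increasing.1 hvO
  have hle : O.le (v (a.castLE (by omega))) (v ⟨b + q, by omega⟩) := by
    rcases Nat.lt_or_ge a.1 (b + q) with hlt | hge
    · exact (O.lt_iff_le_not_ge _ _).1 (h2 _ _ (by simpa [Fin.lt_def] using hlt)) |>.1
    · rw [show (a.castLE (by omega) : Fin (k + q + 1)) = ⟨b + q, by omega⟩ from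
        Fin.ext (by simp; omega)]
      exact O.le_refl _
  refine hO.2 _ (h1 _) _ (h1 _) ?_ hle
  rw [ha]
  exact hxH

theorem capHom_carriedBy (hu : T.VanishesOff H u) (hO : T.IsGoodOrdering O H)
    (hH : T.IsFullSubcomplex H) (k : ℕ) : CarriedBy H (capHom O u k) := by
  intro A c hc
  unfold capHom capOn
  rw [osum_apply]
  refine Submodule.sum_mem _ fun v hvO => ?_
  by_cases h : c.1 v = 0
  · rw [h, zero_smul]
    exact Submodule.zero_mem _
  refine Submodule.smul_mem _ _ ?_
  have hv := T.isSimplex_of_ne_zero c h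
  by_cases hd : Disjoint (T.tupleCell fun a : Fin 3 => v (a.castLE (by omega))) H
  · beta_reduce
    rw [hu _ (isSimplex_front hv) hd, zero_smul]
    exact Submodule.zero_mem _
  · refine Submodule.smul_mem _ _ (T.elem_mem_chainsIn fun _ => ?_)
    refine Set.subset_inter ?_
      (hO.back_subset hH hv hvO (Set.not_disjoint_iff_nonempty_inter.1 hd))
    exact (T.tupleCell_comp_subset v fun a : Fin (k + 1) =>
      (⟨a + 2, by omega⟩ : Fin (k + 2 + 1))).trans (hc v h)

theorem bdSucc_capHom (hO : T.IsOrdering O) (hu : u ∘ₗ T.bdSucc 2 = 0) (k : ℕ)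
    (c : T.Chain (k + 3)) :
    T.bdSucc k (capHom O u (k + 1) c) = capHom O u k (T.bdSucc (k + 2) c) := by
  classical
  have h := hO.bdSucc_capOn_two (fun v => u (T.elem v)) c
  refine h.trans ?_
  have h0 : T.capOn O 3 (fun v => ∑ i : Fin 4, (-1) ^ (i : ℕ) * u (T.elem (v ∘ i.succAbove))) c
      = 0 := by
    unfold capOn
    rw [osum_apply]
    refine Finset.sum_eq_zero fun v _ => ?_
    by_cases hc : c.1 v = 0
    · rw [hc, zero_smul]
    have hv := isSimplex_front (k := k) (q := 3) (T.isSimplex_of_ne_zero c hc)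
    have h1 := LinearMap.congr_fun hu (T.elem fun a : Fin 4 => v (a.castLE (by omega)))
    rw [LinearMap.comp_apply, T.bdSucc_elem (by convert hv.2), map_sum] at h1
    simp only [map_smul, smul_eq_mul, LinearMap.zero_apply] at h1
    beta_reduce
    rw [h1, zero_smul, smul_zero]
  rw [h0, sub_zero]
  rfl

theorem augmentation_capHom (hO : T.IsOrdering O) (c : T.Chain 2) :
    T.augmentation (capHom O u 0 c) = u c := by
  change (T.augmentationHom ∘ₗ capHom O u 0) c = u c
  refine LinearMap.congr_fun (hO.hom_ext fun v hvO hv => ?_) c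
  rw [LinearMap.comp_apply]
  unfold capHom capOn
  have hb : T.IsSimplex fun a : Fin 1 => v ⟨a + 2, by omega⟩ := isSimplex_back (k := 0) hv
  rw [T.osum_elem (p := 0 + 2) _ hv hvO, map_smul]
  change _ • T.augmentation _ = _
  rw [augmentation_elem hb, smul_eq_mul, mul_one]
  rfl

end Cap

end Triangulation

open Triangulation

variable {n : ℕ}

theorem GoodTriangulation.hyper_isFull (T : GoodTriangulation n) (i : Fin n) (α : Pole) :
    T.IsFullSubcomplex (hyper i α) := by
  cases n with
  | zero => exact i.elim0
  | succ n => exact T.hyper_full i α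

theorem GoodTriangulation.card_image_of_isSimplex {T : GoodTriangulation n} {p : ℕ}
    {v : Fin (p + 1) → Fin T.N → ℝ} [DecidableEq (Fin T.N → ℝ)] (hv : T.IsSimplex v) :
    (Finset.univ.image v).card = p + 1 := by
  rw [Finset.card_image_of_injective _ hv.1, Finset.card_univ, Fintype.card_fin]

/-- A map of degree `-1` which is carried by the intersections with `H` takes chains which meet the
hypersurface `H` properly to chains in the divisor, because the simplices which do not lie in the
divisor have intersections with `H` of too small a dimension. -/
theorem GoodTriangulation.MeetsProperly.map_mem_divisorChain {T T' : GoodTriangulation n}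
    {i : Fin n} {α : Pole} {k : ℕ} {f : T.Chain (k + 1) →ₗ[ℚ] T'.Chain k}
    (hf : CarriedBy (hyper i α) f) {c : T.Chain (k + 1)} (hc : T.MeetsProperly c) :
    f c ∈ T'.divisorChain k := by
  classical
  obtain ⟨O, hO⟩ := T.exists_isOrdering
  rw [hO.map_eq_osum f, osum_apply]
  refine Submodule.sum_mem _ fun v _ => ?_
  by_cases h : c.1 v = 0
  · rw [h, zero_smul]
    exact Submodule.zero_mem _
  refine Submodule.smul_mem _ _ ?_
  have hv := T.isSimplex_of_ne_zero c h
  have hfv := hf _ _ (elem_mem_chainsIn_self v)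
  intro v' hv'
  have hv's := T'.isSimplex_of_ne_zero _ hv'
  have h1 := hfv v' hv'
  have hne : (T.tupleCell v ∩ hyper i α).Nonempty := (tupleCell_nonempty hv's).mono h1
  obtain ⟨s, hs, hsf, hsH, -⟩ := (T.hyper_isFull i α).exists_face hv.2 hne
  have h2 : T'.tupleCell v' ⊆ T.cell s := h1.trans hsH.le
  by_cases hsD : T.cell s ⊆ divisor n
  · exact h2.trans hsD
  have hsr : (s : Set (Fin T.N → ℝ)) ⊆ Set.range v := fun x hx => by simpa using hs hx
  let J : Fin n → Option Pole := Function.update (fun _ => none) i (some α)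
  have hJ : T.cell s ⊆ cubicalFace J := by
    intro z hz j β hβ
    have hzH : z i = α.pt := (hsH.ge hz).2
    by_cases hj : j = i
    · subst hj
      simp only [J, Function.update_self, Option.mem_def, Option.some.injEq] at hβ
      rw [hzH, hβ]
    · simp [J, hj] at hβ
  have hJ1 : codim J = 1 := by
    unfold codim
    rw [Finset.card_eq_one]
    refine ⟨i, ?_⟩
    ext j
    by_cases hj : j = i
    · subst hj
      simp [J]
    · simp [J, hj]
  have h3 := hc v h (fun hD => hsD ((T.cell_subset_tupleCell hsr).trans hD)) s
    (T.K.nonempty_of_mem_faces hsf) hsr J hJ hsD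
  have h4 := T.card_le_of_cell_subset T' hv's.2 hsf h2
  have h5 := GoodTriangulation.card_image_of_isSimplex hv's
  rw [show (Finset.univ.image v').card = k + 1 by convert h5] at h4
  omega

/-- The cap product with a Thom cocycle is compatible with subdivision, up to chains in the
divisor. -/
theorem GoodTriangulation.map_capHom_sub_capHom_mem {T T' : GoodTriangulation n}
    (hsub : IsSubdivision T.toTriangulation T'.toTriangulation)
    {Λ : ∀ p, T.Chain p →ₗ[ℚ] T'.Chain p}
    (hΛ : IsSubdivisionOperator T.toTriangulation T'.toTriangulation Λ) {i : Fin n} {α : Pole}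
    {u : T.Cochain 2} (hu : T.IsThomCocycle i α u) {O : PartialOrder (Fin T.N → ℝ)}
    (hO : T.IsGoodOrdering O (hyper i α)) {u' : T'.Cochain 2} (hu' : T'.IsThomCocycle i α u')
    {O' : PartialOrder (Fin T'.N → ℝ)} (hO' : T'.IsGoodOrdering O' (hyper i α)) {p : ℕ}
    {c : T.Chain (p + 2)} (hc : T.toRel c ∈ T.AC (p + 2)) :
    Λ p (capHom O u p c) - capHom O' u' p (Λ (p + 2) c) ∈ T'.divisorChain p := by
  obtain ⟨w, hw, hwu⟩ := hu.exists_cobounding hΛ hu'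
  let ψ : ∀ k, T.Chain (k + 2) →ₗ[ℚ] T'.Chain k := fun k =>
    Λ k ∘ₗ capHom O u k - capHom O' u' k ∘ₗ Λ (k + 2)
  obtain ⟨D, E, hD, hE, hDE⟩ := exists_carried_homotopy hsub (T.hyper_isFull i α) hΛ (ψ := ψ)
    (fun k => CarriedBy.sub
      (fun A c hc => hΛ.mem_chainsIn (capHom_carriedBy hu.1 hO (T.hyper_isFull i α) k A c hc))
      (fun A c hc => capHom_carriedBy hu'.1 hO' (T'.hyper_isFull i α) k A _ (hΛ.mem_chainsIn hc)))
    (fun k c => by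
      change T'.bdSucc k (Λ (k + 1) _ - capHom O' u' (k + 1) _) = Λ k _ - capHom O' u' k _
      rw [map_sub, hΛ.1, bdSucc_capHom hO.1 hu.2.1, bdSucc_capHom hO'.1 hu'.2.1, hΛ.1])
    hw (fun c => by
      rw [← hwu]
      change T'.augmentationHom (Λ 0 _ - capHom O' u' 0 _) = _
      rw [map_sub]
      change T'.augmentation _ - T'.augmentation _ = _
      rw [hΛ.2.2, augmentation_capHom hO.1, augmentation_capHom hO'.1]) p
  obtain ⟨h1, h2⟩ := (T.mem_AC_iff c).1 hc
  have h3 := hDE c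
  have h4 : Λ p (capHom O u p c) - capHom O' u' p (Λ (p + 2) c) =
      T'.bdSucc p (E c) + D (T.bdSucc (p + 1) c) := by
    rw [h3, sub_add_cancel]
    rfl
  rw [h4]
  exact Submodule.add_mem _ (bdSucc_mem_chainsIn (h1.map_mem_divisorChain hE))
    (GoodTriangulation.MeetsProperly.map_mem_divisorChain hD h2)

end CubicalChains

namespace CubicalChains

open Triangulation

/-! ### Existence of Thom cocycles and of good orderings -/

variable {n : ℕ}

theorem Triangulation.range_toSingular_subset (T : Triangulation n) {p : ℕ}
    {v : Fin (p + 1) → Fin T.N → ℝ} (hv : T.IsSimplex v) :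
    Set.range (T.toSingular v hv) ⊆ T.tupleCell v := by
  rw [T.toSingular_eq hv]
  exact range_affSimplex (convex_convexHull ℝ (Set.range v))
    (T.continuousOn_param.mono hv.convexHull_subset_space)
    (fun j => subset_convexHull ℝ _ ⟨j, rfl⟩) fun x hx => hv.param_mem hx

theorem Triangulation.exists_isThomCocycle (T : Triangulation n) (i : Fin n) (α : Pole) :
    ∃ u, T.IsThomCocycle i α u := by
  obtain ⟨S, hS⟩ := exists_isSingularThomCocycle i α
  obtain ⟨O, hO⟩ := T.exists_isOrdering
  refine ⟨T.osum O fun v => S (affSimplex T.param v), fun v hv hd => ?_, ?_,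
    S, O, 0, hS, hO, fun _ _ _ => rfl, fun v hv hvO => ?_⟩
  · rw [osum_apply]
    refine Finset.sum_eq_zero fun x _ => ?_
    by_cases h : (T.elem v).1 x = 0
    · rw [h, zero_smul]
    have hx := T.isSimplex_of_ne_zero _ h
    obtain ⟨-, π, rfl⟩ := T.exists_perm_of_elem_ne_zero h
    rw [← T.toSingular_eq hx, hS.2.1, smul_zero]
    refine (T.range_toSingular_subset hx).trans ?_
    rw [T.tupleCell_comp_perm]
    exact Set.disjoint_left.1 hd
  · ext c
    rw [LinearMap.comp_apply, hO.osum_bdSucc, osum_apply, LinearMap.zero_apply]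
    refine Finset.sum_eq_zero fun x _ => ?_
    by_cases h : c.1 x = 0
    · rw [h, zero_smul]
    have hx := T.isSimplex_of_ne_zero _ h
    have h1 := hS.1 (affSimplex T.param x)
    unfold singCobd at h1
    have h2 : ∀ j : Fin 4, (affSimplex T.param x).face j = affSimplex T.param (x ∘ j.succAbove) :=
      fun j => affSimplex_face (convex_convexHull ℝ (Set.range x))
        (T.continuousOn_param.mono hx.convexHull_subset_space)
        (fun j => subset_convexHull ℝ _ ⟨j, rfl⟩) j
    simp only [h2] at h1
    simp only [smul_eq_mul]
    rw [h1, mul_zero]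
  · rw [LinearMap.zero_apply, add_zero, T.osum_elem _ hv
      (T.mem_increasing.2 ⟨fun k => hv.mem_verts k, hvO⟩), T.toSingular_eq hv]

/-- As the union of the two hypersurfaces is a full subcomplex, no edge joins a vertex on the first
one to a vertex on the second one, unless one of the vertices lies on both. -/
theorem GoodTriangulation.cell_subset_or_cell_subset (T : GoodTriangulation n) {i k : Fin n}
    {α β : Pole} {s : Finset (Fin T.N → ℝ)} (hs : s ∈ T.K.faces) {x y : Fin T.N → ℝ} (hx : x ∈ s)
    (hy : y ∈ s) (hxi : T.cell {x} ⊆ hyper i α) (hyk : T.cell {y} ⊆ hyper k β) :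
    T.cell {x} ⊆ hyper k β ∨ T.cell {y} ⊆ hyper i α := by
  classical
  cases n with
  | zero => exact i.elim0
  | succ n =>
  have hfull : T.IsFullSubcomplex (hyper i α ∪ hyper k β) := by
    have h := T.faces_full ({Function.update (fun _ => none) i (some α)} ∪
      {Function.update (fun _ => none) k (some β)})
    rwa [Set.biUnion_union, ← hyper_eq_iUnion, ← hyper_eq_iUnion] at h
  have ht : ({x, y} : Finset (Fin T.N → ℝ)) ∈ T.K.faces :=
    T.K.down_closed hs (by
      intro z hz
      rcases Finset.mem_insert.1 hz with rfl | hz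
      · exact hx
      · rw [Finset.mem_singleton.1 hz]
        exact hy) (by simp)
  have hsub := hfull.2 _ ht fun z hz => by
    rcases Finset.mem_insert.1 hz with rfl | hz
    · exact hxi.trans Set.subset_union_left
    · rw [Finset.mem_singleton.1 hz]
      exact hyk.trans Set.subset_union_right
  obtain ⟨z, hz⟩ := T.openCell_nonempty ht
  rcases hsub (T.openCell_subset_cell _ hz) with h | h
  · right
    exact (T.cell_mono (by simp)).trans (IsSubcomplex.cell_subset (T.hyper_full i α).1 ht hz h)
  · left
    exact (T.cell_mono (by simp)).trans (IsSubcomplex.cell_subset (T.hyper_full k β).1 ht hz h)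

open Classical in
/-- The vertices are ordered by the set of those of the two hypersurfaces they lie on, and then by
an arbitrary linear ordering. -/
theorem GoodTriangulation.exists_isGoodOrdering (T : GoodTriangulation n) (i k : Fin n)
    (α β : Pole) : ∃ O : PartialOrder (Fin T.N → ℝ),
      T.IsGoodOrdering O (hyper i α) ∧ T.IsGoodOrdering O (hyper k β) := by
  obtain ⟨O₀, -⟩ := T.exists_isOrdering
  obtain ⟨L, -⟩ := exists_linearOrder O₀
  let b : (Fin T.N → ℝ) → Prop × Prop := fun x =>
    (T.cell {x} ⊆ hyper i α, T.cell {x} ⊆ hyper k β)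
  let O : PartialOrder (Fin T.N → ℝ) :=
    { le := fun x y => b x < b y ∨ b x = b y ∧ L.le x y
      lt := fun x y => (b x < b y ∨ b x = b y ∧ L.le x y) ∧ ¬ (b y < b x ∨ b y = b x ∧ L.le y x)
      lt_iff_le_not_ge := fun _ _ => Iff.rfl
      le_refl := fun x => Or.inr ⟨rfl, L.le_refl x⟩
      le_trans := by
        rintro x y z (h | ⟨h, h'⟩) (g | ⟨g, g'⟩)
        · exact Or.inl (h.trans g)
        · exact Or.inl (g ▸ h)
        · exact Or.inl (h ▸ g)
        · exact Or.inr ⟨h.trans g, L.le_trans _ _ _ h' g'⟩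
      le_antisymm := by
        rintro x y (h | ⟨h, h'⟩) (g | ⟨g, g'⟩)
        · exact absurd (h.trans g) (lt_irrefl _)
        · exact absurd (g ▸ h) (lt_irrefl _)
        · exact absurd (h ▸ g) (lt_irrefl _)
        · exact L.le_antisymm _ _ h' g' }
  have hle : ∀ x y, O.le x y → b x ≤ b y := by
    rintro x y (h | ⟨h, -⟩)
    · exact h.le
    · exact h.le
  have hO : T.IsOrdering O := by
    intro s hs x hx y hy
    have hb : b x ≤ b y ∨ b y ≤ b x := by
      by_cases h1 : (b x).1 ≤ (b y).1 <;> by_cases h2 : (b x).2 ≤ (b y).2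
      · exact Or.inl ⟨h1, h2⟩
      · have h2' : (b x).2 ∧ ¬ (b y).2 := Classical.not_imp.1 h2
        by_cases h3 : (b y).1
        · rcases T.cell_subset_or_cell_subset hs hy hx h3 h2'.1 with h | h
          · exact absurd h h2'.2
          · exact Or.inr ⟨fun _ => h, fun h => absurd h h2'.2⟩
        · exact Or.inr ⟨fun h => absurd h h3, fun h => absurd h h2'.2⟩
      · have h1' : (b x).1 ∧ ¬ (b y).1 := Classical.not_imp.1 h1
        by_cases h3 : (b y).2
        · rcases T.cell_subset_or_cell_subset hs hx hy h1'.1 h3 with h | h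
          · exact Or.inr ⟨fun h => absurd h h1'.2, fun _ => h⟩
          · exact absurd h h1'.2
        · exact Or.inr ⟨fun h => absurd h h1'.2, fun h => absurd h h3⟩
      · have h1' : (b x).1 ∧ ¬ (b y).1 := Classical.not_imp.1 h1
        have h2' : (b x).2 ∧ ¬ (b y).2 := Classical.not_imp.1 h2
        exact Or.inr ⟨fun h => absurd h h1'.2, fun h => absurd h h2'.2⟩
    by_cases he : b x = b y
    · exact (L.le_total x y).imp (fun h => Or.inr ⟨he, h⟩) fun h => Or.inr ⟨he.symm, h⟩
    · exact hb.imp (fun h => Or.inl (lt_of_le_of_ne h he)) fun h =>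
        Or.inl (lt_of_le_of_ne h (Ne.symm he))
  exact ⟨O, ⟨hO, fun x _ y _ h hxy => (hle x y hxy).1 h⟩,
    ⟨hO, fun x _ y _ h hxy => (hle x y hxy).2 h⟩⟩

end CubicalChains

namespace CubicalChains

open Triangulation

/-! ### Chains of the triangulation of a hypersurface -/

theorem Triangulation.exists_of_capOn_ne_zero {n : ℕ} {T : Triangulation n}
    {O : PartialOrder (Fin T.N → ℝ)} {p q : ℕ} {f : (Fin (q + 1) → Fin T.N → ℝ) → ℚ}
    {c : T.Chain (p + q)} {v : Fin (p + 1) → Fin T.N → ℝ} (h : (T.capOn O q f c).1 v ≠ 0) :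
    ∃ x, c.1 x ≠ 0 ∧ Set.range v ⊆ Set.range fun a : Fin (p + 1) => x ⟨a + q, by omega⟩ := by
  unfold capOn at h
  rw [osum_apply] at h
  have h1 := map_sum ((LinearMap.proj v : (_ → ℚ) →ₗ[ℚ] ℚ) ∘ₗ (T.Chain p).subtype)
    (fun x => c.1 x • (f (fun k : Fin (q + 1) => x (k.castLE (by omega))) •
      T.elem fun k : Fin (p + 1) => x ⟨k + q, by omega⟩)) (T.increasing O (p + q))
  obtain ⟨x, -, hx⟩ := Finset.exists_ne_zero_of_sum_ne_zero (h1.symm.trans_ne h)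
  refine ⟨x, left_ne_zero_of_mul hx, ?_⟩
  obtain ⟨-, π, hπ⟩ := T.exists_perm_of_elem_ne_zero
    (right_ne_zero_of_mul (right_ne_zero_of_mul hx))
  rw [hπ]
  rintro _ ⟨a, rfl⟩
  exact ⟨_, rfl⟩

namespace GoodTriangulation

variable {n : ℕ} (T : GoodTriangulation (n + 1)) (i : Fin (n + 1)) (α : Pole)

theorem face_isSimplex_iff {p : ℕ} {v : Fin (p + 1) → Fin T.N → ℝ} :
    (T.face i α).IsSimplex v ↔ T.IsSimplex v ∧ T.tupleCell v ⊆ hyper i α :=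
  ⟨fun h => ⟨⟨h.1, h.2.1⟩, h.2.2⟩, fun h => ⟨h.1.1, h.1.2, h.2⟩⟩

theorem ins_mem_cell_iff {s : Finset (Fin T.N → ℝ)} (hs : s ∈ (T.faceComplex i α).faces) {z : P n} :
    ins i α z ∈ T.cell s ↔ z ∈ (T.face i α).cell s := by
  rw [← T.ins_image_cell i α hs]
  exact (ins_injective i α).mem_set_image

theorem face_tupleCell_subset_iff {p : ℕ} {v : Fin (p + 1) → Fin T.N → ℝ}
    (hv : (T.face i α).IsSimplex v) {S : Set (P n)} {S' : Set (P (n + 1))}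
    (hSS : ∀ z, ins i α z ∈ S' ↔ z ∈ S) : (T.face i α).tupleCell v ⊆ S ↔ T.tupleCell v ⊆ S' :=
  T.cell_subset_iff i α hv.2 hSS

theorem ins_mem_divisor (z : P n) : ins i α z ∈ divisor (n + 1) ↔ z ∈ divisor n := by
  have h01 : α.pt ≠ ((1 : ℂ) : OnePoint ℂ) := by
    cases α <;> simp [Pole.pt]
  simp only [divisor, Set.mem_ofPred_eq, ins]
  rw [Fin.exists_iff_succAbove i]
  simp [h01]

theorem mem_verts_of_face {x : Fin T.N → ℝ} (hx : x ∈ (T.face i α).verts) : x ∈ T.verts :=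
  T.mem_verts ((T.face i α).singleton_mem_faces hx).1 (Finset.mem_singleton_self x)

theorem sum_verts_face {M : Type*} [AddCommMonoid M]
    (f : (Fin T.N → ℝ) → M) (hf : ∀ x ∉ (T.face i α).verts, f x = 0) :
    ∑ x ∈ T.verts, f x = ∑ x ∈ (T.face i α).verts, f x :=
  (Finset.sum_subset (fun _ => T.mem_verts_of_face i α) fun x _ => hf x).symm

/-- The inclusion of the chains of `K ∩ H_{i,α}` into those of `K`. -/
def faceIncl (p : ℕ) : (T.face i α).Chain p →ₗ[ℚ] T.Chain p where
  toFun c := ⟨c.1, fun v hv => ((T.face_isSimplex_iff i α).1 (c.2.1 v hv)).1, c.2.2⟩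
  map_add' _ _ := rfl
  map_smul' _ _ := rfl

open Classical in
/-- The part in `H_{i,α}` of a chain of `K`, as a chain of `K ∩ H_{i,α}`. -/
def faceRestrict (p : ℕ) : T.Chain p →ₗ[ℚ] (T.face i α).Chain p where
  toFun c := ⟨fun v => if (T.face i α).IsSimplex v then c.1 v else 0, fun v hv => by
    by_contra h
    exact hv (if_neg h), fun v π => by
      have : (T.face i α).IsSimplex (v ∘ π) ↔ (T.face i α).IsSimplex v :=
        ⟨fun h => by
          have := h.face (f := π.symm) π.symm.injective
          rwa [Function.comp_assoc, Equiv.self_comp_symm, Function.comp_id] at this,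
          fun h => h.face π.injective⟩
      simp only [this]
      split_ifs
      · exact T.chain_comp c v π
      · rw [mul_zero]⟩
  map_add' c d := Chain.ext fun v => by
    change (if _ then c.1 v + d.1 v else 0) = (if _ then c.1 v else 0) + (if _ then d.1 v else 0)
    split_ifs <;> simp
  map_smul' r c := Chain.ext fun v => by
    change (if _ then r * c.1 v else 0) = r * (if _ then c.1 v else 0)
    split_ifs <;> simp

variable {p : ℕ}

theorem faceIncl_val (c : (T.face i α).Chain p) : (T.faceIncl i α p c).1 = c.1 := rfl

theorem faceIncl_injective : Function.Injective (T.faceIncl i α p) :=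
  fun _ _ h => Subtype.ext (congrArg (fun c : T.Chain p => c.1) h)

theorem faceRestrict_val {c : T.Chain p} (hc : c ∈ T.chainsIn (hyper i α) p) :
    (T.faceRestrict i α p c).1 = c.1 := by
  classical
  funext v
  change (if (T.face i α).IsSimplex v then c.1 v else 0) = c.1 v
  split_ifs with h
  · rfl
  · by_contra h0
    have h0' : c.1 v ≠ 0 := Ne.symm h0
    exact h ((T.face_isSimplex_iff i α).2 ⟨T.isSimplex_of_ne_zero c h0', hc v h0'⟩)

theorem faceIncl_faceRestrict {c : T.Chain p} (hc : c ∈ T.chainsIn (hyper i α) p) :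
    T.faceIncl i α p (T.faceRestrict i α p c) = c :=
  Subtype.ext (T.faceRestrict_val i α hc)

theorem faceIncl_mem (c : (T.face i α).Chain p) :
    T.faceIncl i α p c ∈ T.chainsIn (hyper i α) p := fun _ hv =>
  ((T.face_isSimplex_iff i α).1 ((T.face i α).isSimplex_of_ne_zero c hv)).2

theorem faceIncl_elem {v : Fin (p + 1) → Fin T.N → ℝ} (hv : (T.face i α).IsSimplex v) :
    T.faceIncl i α p ((T.face i α).elem v) = T.elem v := by
  refine Chain.ext fun x => ?_
  rw [faceIncl_val, T.elem_apply ((T.face_isSimplex_iff i α).1 hv).1.2]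
  exact (T.face i α).elem_apply hv.2 x

theorem bdSucc_faceIncl (c : (T.face i α).Chain (p + 1)) :
    T.bdSucc p (T.faceIncl i α (p + 1) c) = T.faceIncl i α p ((T.face i α).bdSucc p c) := by
  refine Chain.ext fun v => T.sum_verts_face i α _ fun x hx => ?_
  by_contra h
  have := ((T.face i α).isSimplex_of_ne_zero c h).mem_verts 0
  exact hx this

theorem augmentation_faceIncl (c : (T.face i α).Chain 0) :
    T.augmentation (T.faceIncl i α 0 c) = (T.face i α).augmentation c := by
  refine T.sum_verts_face i α _ fun x hx => ?_
  by_contra h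
  exact hx (((T.face i α).isSimplex_of_ne_zero c h).mem_verts 0)

theorem faceRestrict_bdSucc {c : T.Chain (p + 1)} (hc : c ∈ T.chainsIn (hyper i α) (p + 1)) :
    (T.face i α).bdSucc p (T.faceRestrict i α (p + 1) c) =
      T.faceRestrict i α p (T.bdSucc p c) := by
  apply T.faceIncl_injective i α
  rw [← bdSucc_faceIncl, faceIncl_faceRestrict _ _ _ hc,
    faceIncl_faceRestrict _ _ _ (bdSucc_mem_chainsIn hc)]

theorem faceIncl_mem_chainsIn_iff {S : Set (P n)} {S' : Set (P (n + 1))}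
    (hSS : ∀ z, ins i α z ∈ S' ↔ z ∈ S) {c : (T.face i α).Chain p} :
    T.faceIncl i α p c ∈ T.chainsIn S' p ↔ c ∈ (T.face i α).chainsIn S p :=
  forall_congr' fun _ => forall_congr' fun hv =>
    (T.face_tupleCell_subset_iff i α ((T.face i α).isSimplex_of_ne_zero c hv) hSS).symm

/-! ### The cap product with a Thom cocycle as a chain of the hypersurface -/

variable {T i α}

theorem codim_insertNth (J : Fin n → Option Pole) :
    codim (Fin.insertNth (α := fun _ => Option Pole) i (some α) J) = codim J + 1 := by
  unfold codim
  simp only [Finset.card_filter]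
  rw [Fin.sum_univ_succAbove _ i]
  simp [add_comm]

/-- Capping with a Thom cocycle preserves admissibility: the faces of a simplex of the cap product
are faces of a simplex of the chain which lie in `H_{i,α}`. -/
theorem MeetsProperly.faceRestrict_capHom {u : T.Cochain 2} {O : PartialOrder (Fin T.N → ℝ)}
    {c : T.Chain (p + 2)} (hc : T.MeetsProperly c) :
    (T.face i α).MeetsProperly (T.faceRestrict i α p (capHom O u p c)) := by
  classical
  intro v hv hvD s hne hsv J hsJ hsD
  have hvs := (T.face i α).isSimplex_of_ne_zero _ hv
  have hv' : (capHom O u p c).1 v ≠ 0 := by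
    intro h
    apply hv
    change (if (T.face i α).IsSimplex v then (capHom O u p c).1 v else 0) = 0
    rw [if_pos hvs, h]
  have hs : s ∈ (T.faceComplex i α).faces := hvs.mem_faces hsv hne
  obtain ⟨x, hxc, hxv⟩ : ∃ x, c.1 x ≠ 0 ∧ Set.range v ⊆ Set.range x := by
    obtain ⟨x, hxc, hxv⟩ := exists_of_capOn_ne_zero hv'
    refine ⟨x, hxc, hxv.trans ?_⟩
    rintro _ ⟨a, rfl⟩
    exact ⟨_, rfl⟩
  have hSS : ∀ z, ins i α z ∈ cubicalFace (Fin.insertNth (α := fun _ => Option Pole) i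
      (some α) J) ↔ z ∈ cubicalFace J := fun z => ins_mem_cubicalFace i α J z
  have h3 : ¬ T.cell s ⊆ divisor (n + 1) := fun h =>
    hsD ((T.cell_subset_iff i α hs (ins_mem_divisor i α)).2 h)
  have h4 := hc x hxc (fun h => h3 ((T.cell_subset_tupleCell (hsv.trans hxv)).trans h)) s hne
    (hsv.trans hxv) _ ((T.cell_subset_iff i α hs hSS).1 hsJ) h3
  rw [codim_insertNth] at h4
  change Finset.card (α := Fin T.N → ℝ) s + _ ≤ _
  omega

variable {u : T.Cochain 2} {O : PartialOrder (Fin T.N → ℝ)}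

theorem capHom_mem_hyper (hu : T.IsThomCocycle i α u) (hO : T.IsGoodOrdering O (hyper i α))
    (c : T.Chain (p + 2)) : capHom O u p c ∈ T.chainsIn (hyper i α) p := by
  have h := capHom_carriedBy hu.1 hO (T.hyper_full i α) p Set.univ c fun _ _ => Set.subset_univ _
  rwa [Set.univ_inter] at h

theorem faceRestrict_capHom_mem_AC (hu : T.IsThomCocycle i α u)
    (hO : T.IsGoodOrdering O (hyper i α)) {c : T.Chain (p + 2)} (hc : T.toRel c ∈ T.AC (p + 2)) :
    (T.face i α).toRel (T.faceRestrict i α p (capHom O u p c)) ∈ (T.face i α).AC p := by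
  obtain ⟨h1, h2⟩ := (T.mem_AC_iff c).1 hc
  refine ((T.face i α).mem_AC_iff _).2 ⟨h1.faceRestrict_capHom, ?_⟩
  cases p with
  | zero => exact fun v hv => absurd rfl hv
  | succ p =>
    change (T.face i α).MeetsProperly ((T.face i α).bdSucc p _)
    rw [faceRestrict_bdSucc _ _ _ (capHom_mem_hyper hu hO c), bdSucc_capHom hO.1 hu.2.1]
    exact MeetsProperly.faceRestrict_capHom h2

theorem faceRestrict_mem_divisorChain {c : T.Chain p} (hc : c ∈ T.divisorChain p) :
    T.faceRestrict i α p c ∈ (T.face i α).divisorChain p := by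
  classical
  intro v hv
  have hvs := (T.face i α).isSimplex_of_ne_zero _ hv
  have hv' : c.1 v ≠ 0 := by
    intro h
    apply hv
    change (if (T.face i α).IsSimplex v then c.1 v else 0) = 0
    rw [if_pos hvs, h]
  exact (T.face_tupleCell_subset_iff i α hvs (ins_mem_divisor i α)).2 (hc v hv')

end GoodTriangulation

end CubicalChains

namespace CubicalChains

open Triangulation

/-! ### Subdivisions of hypersurfaces -/

namespace GoodTriangulation

variable {n : ℕ}

theorem isSubdivision_refl (T : Triangulation n) : IsSubdivision T T := by
  refine ⟨fun s hs => ⟨s, hs, subset_rfl⟩, fun s hs z hz => ?_⟩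
  obtain ⟨t, hts, hne, hzt⟩ := T.exists_openCell hz
  exact ⟨t, T.K.down_closed hs hts hne, T.openCell_subset_cell t hzt, T.cell_mono hts⟩

theorem isSubdivisionOperator_id (T : Triangulation n) :
    IsSubdivisionOperator T T fun _ => LinearMap.id :=
  ⟨fun _ _ => rfl, fun _ v _ => mem_chainsIn_iff_support.1 (elem_mem_chainsIn_self v),
    fun _ => rfl⟩

section Face

variable {T T' : GoodTriangulation (n + 1)} {i : Fin (n + 1)} {α : Pole}

/-- The triangulations of a hypersurface inherit subdivision, since a simplex of `K` meets the
hypersurface in a single face. -/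
theorem isSubdivision_face (h : IsSubdivision T.toTriangulation T'.toTriangulation) :
    IsSubdivision (T.face i α).toTriangulation (T'.face i α).toTriangulation := by
  constructor
  · intro s' hs'
    obtain ⟨s, hs, hss⟩ := h.1 s' hs'.1
    have hne : (T.cell s ∩ hyper i α).Nonempty := by
      obtain ⟨z, hz⟩ := T'.openCell_nonempty hs'.1
      exact ⟨z, hss (T'.openCell_subset_cell _ hz), hs'.2 (T'.openCell_subset_cell _ hz)⟩
    obtain ⟨t, -, ht, htH, -⟩ := (T.hyper_full i α).exists_face hs hne
    have htF : t ∈ (T.faceComplex i α).faces := ⟨ht, htH.ge.trans Set.inter_subset_right⟩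
    refine ⟨t, htF, fun z hz => ?_⟩
    rw [← ins_mem_cell_iff T' i α hs'] at hz
    exact (ins_mem_cell_iff T i α htF).1 (htH.le ⟨hss hz, ins_mem_hyper i α z⟩)
  · intro s hs
    exact T'.isSubcomplex_face i α (fun z => ins_mem_cell_iff T i α hs) (h.2 s hs.1)

variable (i α) in
/-- The map induced by a subdivision operator on the chains of a hypersurface. -/
def faceOperator (Λ : ∀ p, T.Chain p →ₗ[ℚ] T'.Chain p) (p : ℕ) :
    (T.face i α).Chain p →ₗ[ℚ] (T'.face i α).Chain p :=
  T'.faceRestrict i α p ∘ₗ Λ p ∘ₗ T.faceIncl i α p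

variable {Λ : ∀ p, T.Chain p →ₗ[ℚ] T'.Chain p}

theorem faceIncl_faceOperator
    (hΛ : IsSubdivisionOperator T.toTriangulation T'.toTriangulation Λ) {p : ℕ}
    (c : (T.face i α).Chain p) :
    T'.faceIncl i α p (faceOperator i α Λ p c) = Λ p (T.faceIncl i α p c) :=
  T'.faceIncl_faceRestrict i α (hΛ.mem_chainsIn (T.faceIncl_mem i α c))

theorem isSubdivisionOperator_faceOperator
    (hΛ : IsSubdivisionOperator T.toTriangulation T'.toTriangulation Λ) :
    IsSubdivisionOperator (T.face i α).toTriangulation (T'.face i α).toTriangulation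
      (faceOperator i α Λ) := by
  refine ⟨fun p c => ?_, fun p v hv => ?_, fun c => ?_⟩
  · apply T'.faceIncl_injective i α
    rw [← bdSucc_faceIncl, faceIncl_faceOperator hΛ, hΛ.1, faceIncl_faceOperator hΛ,
      bdSucc_faceIncl]
  · rw [← mem_chainsIn_iff_support]
    refine (T'.faceIncl_mem_chainsIn_iff i α (S' := T.tupleCell v)
      (fun z => ins_mem_cell_iff T i α hv.2)).1 ?_
    rw [faceIncl_faceOperator hΛ, T.faceIncl_elem i α hv]
    exact hΛ.mem_chainsIn (elem_mem_chainsIn_self (T := T.toTriangulation) v)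
  · rw [← augmentation_faceIncl, faceIncl_faceOperator hΛ, hΛ.2.2, augmentation_faceIncl]

end Face

theorem toLim_eq_toLim {T T' : GoodTriangulation n}
    (h : IsSubdivision T.toTriangulation T'.toTriangulation)
    {Λ : ∀ p, T.Chain p →ₗ[ℚ] T'.Chain p}
    (hΛ : IsSubdivisionOperator T.toTriangulation T'.toTriangulation Λ) {p : ℕ} {c : T.Chain p}
    (hc : T.toRel c ∈ T.AC p) (hc' : T'.toRel (Λ p c) ∈ T'.AC p) :
    T.toLim p ⟨T.toRel c, hc⟩ = T'.toLim p ⟨T'.toRel (Λ p c), hc'⟩ :=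
  (Submodule.Quotient.eq _).2 (Submodule.subset_span ⟨T, T', Λ, c, hc, hc', h, hΛ, rfl⟩)

theorem toLim_congr {T : GoodTriangulation n} {p : ℕ} {c d : T.Chain p}
    (hc : T.toRel c ∈ T.AC p) (hd : T.toRel d ∈ T.AC p) (h : c - d ∈ T.divisorChain p) :
    T.toLim p ⟨T.toRel c, hc⟩ = T.toLim p ⟨T.toRel d, hd⟩ := by
  congr 2
  exact T.toRel_eq_iff.2 h

end GoodTriangulation

/-! ### The face maps -/

open GoodTriangulation

variable {n : ℕ}

theorem GoodTriangulation.exists_capData (T : GoodTriangulation (n + 1)) (i : Fin (n + 1))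
    (α : Pole) : ∃ x : T.Cochain 2 × PartialOrder (Fin T.N → ℝ),
      T.IsThomCocycle i α x.1 ∧ T.IsGoodOrdering x.2 (hyper i α) := by
  obtain ⟨u, hu⟩ := T.exists_isThomCocycle i α
  obtain ⟨O, hO, -⟩ := T.exists_isGoodOrdering i i α α
  exact ⟨(u, O), hu, hO⟩

theorem capHom_mem_divisorChain {T : GoodTriangulation (n + 1)} {i : Fin (n + 1)} {α : Pole}
    {u : T.Cochain 2} {O : PartialOrder (Fin T.N → ℝ)} (hu : T.IsThomCocycle i α u)
    (hO : T.IsGoodOrdering O (hyper i α)) {p : ℕ} {c : T.Chain (p + 2)}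
    (hc : c ∈ T.divisorChain (p + 2)) : capHom O u p c ∈ T.divisorChain p :=
  T.chainsIn_mono Set.inter_subset_left _
    (capHom_carriedBy hu.1 hO (T.hyper_full i α) p (divisor (n + 1)) c hc)

/-- The cap product with a chosen Thom cocycle and a chosen good ordering, on the admissible
relative chains of a triangulation. -/
def faceAC (i : Fin (n + 1)) (α : Pole) (p : ℕ) (T : GoodTriangulation (n + 1)) :
    T.AC (p + 2) →ₗ[ℚ] (T.face i α).AC p :=
  let x := (T.exists_capData i α).choose
  have hx := (T.exists_capData i α).choose_spec
  let f : T.RelChain (p + 2) →ₗ[ℚ] (T.face i α).RelChain p :=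
    (T.divisorChain (p + 2)).mapQ ((T.face i α).divisorChain p)
      (T.faceRestrict i α p ∘ₗ capHom x.2 x.1 p) fun _ hc =>
        faceRestrict_mem_divisorChain (capHom_mem_divisorChain hx.1 hx.2 hc)
  f.restrict fun γ hγ => by
    obtain ⟨c, rfl⟩ := T.exists_toRel_eq γ
    exact faceRestrict_capHom_mem_AC hx.1 hx.2 hγ

theorem exists_faceAC_eq (i : Fin (n + 1)) (α : Pole) (p : ℕ) (T : GoodTriangulation (n + 1)) :
    ∃ (u : T.Cochain 2) (O : PartialOrder (Fin T.N → ℝ)) (hu : T.IsThomCocycle i α u)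
      (hO : T.IsGoodOrdering O (hyper i α)), ∀ (c : T.Chain (p + 2))
      (hc : T.toRel c ∈ T.AC (p + 2)), faceAC i α p T ⟨T.toRel c, hc⟩ =
        ⟨(T.face i α).toRel (T.faceRestrict i α p (capHom O u p c)),
          faceRestrict_capHom_mem_AC hu hO hc⟩ :=
  ⟨_, _, (T.exists_capData i α).choose_spec.1, (T.exists_capData i α).choose_spec.2,
    fun _ _ => rfl⟩

/-- The class of the cap product in the limit depends neither on the Thom cocycle nor on the
ordering, and does not change under subdivision. -/
theorem toLim_faceRestrict_capHom {T T' : GoodTriangulation (n + 1)}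
    (hsub : IsSubdivision T.toTriangulation T'.toTriangulation)
    {Λ : ∀ p, T.Chain p →ₗ[ℚ] T'.Chain p}
    (hΛ : IsSubdivisionOperator T.toTriangulation T'.toTriangulation Λ) {i : Fin (n + 1)}
    {α : Pole} {u : T.Cochain 2} (hu : T.IsThomCocycle i α u) {O : PartialOrder (Fin T.N → ℝ)}
    (hO : T.IsGoodOrdering O (hyper i α)) {u' : T'.Cochain 2} (hu' : T'.IsThomCocycle i α u')
    {O' : PartialOrder (Fin T'.N → ℝ)} (hO' : T'.IsGoodOrdering O' (hyper i α)) {p : ℕ}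
    {c : T.Chain (p + 2)} (hc : T.toRel c ∈ T.AC (p + 2))
    (hc' : T'.toRel (Λ (p + 2) c) ∈ T'.AC (p + 2)) :
    (T.face i α).toLim p ⟨_, faceRestrict_capHom_mem_AC hu hO hc⟩ =
      (T'.face i α).toLim p ⟨_, faceRestrict_capHom_mem_AC hu' hO' hc'⟩ := by
  have h1 : faceOperator i α Λ p (T.faceRestrict i α p (capHom O u p c)) -
      T'.faceRestrict i α p (capHom O' u' p (Λ (p + 2) c)) ∈ (T'.face i α).divisorChain p := by
    have h2 : faceOperator i α Λ p (T.faceRestrict i α p (capHom O u p c)) =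
        T'.faceRestrict i α p (Λ p (capHom O u p c)) := by
      change T'.faceRestrict i α p (Λ p (T.faceIncl i α p (T.faceRestrict i α p _))) = _
      rw [T.faceIncl_faceRestrict i α (capHom_mem_hyper hu hO c)]
    rw [h2, ← map_sub]
    exact faceRestrict_mem_divisorChain (map_capHom_sub_capHom_mem hsub hΛ hu hO hu' hO' hc)
  have h3 : (T'.face i α).toRel (faceOperator i α Λ p
      (T.faceRestrict i α p (capHom O u p c))) ∈ (T'.face i α).AC p := by
    rw [(T'.face i α).toRel_eq_iff.2 h1]
    exact faceRestrict_capHom_mem_AC hu' hO' hc'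
  rw [toLim_eq_toLim (isSubdivision_face hsub) (isSubdivisionOperator_faceOperator hΛ) _ h3]
  exact toLim_congr _ _ h1

open Classical in
theorem exists_isFaceMap (p : ℕ) (i : Fin (n + 1)) (α : Pole) :
    ∃ F : ACLim (n + 1) (p + 2) →ₗ[ℚ] ACLim n p, IsFaceMap i α F := by
  let G : (DirectSum (GoodTriangulation (n + 1)) fun T => T.AC (p + 2)) →ₗ[ℚ] ACLim n p :=
    DirectSum.toModule ℚ (GoodTriangulation (n + 1)) (ACLim n p)
      fun T => (T.face i α).toLim p ∘ₗ faceAC i α p T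
  have hG : limitRelations (n + 1) (p + 2) ≤ LinearMap.ker G := by
    refine Submodule.span_le.2 ?_
    rintro _ ⟨T, T', Λ, c, hc, hc', hsub, hΛ, rfl⟩
    obtain ⟨u, O, hu, hO, h⟩ := exists_faceAC_eq i α p T
    obtain ⟨u', O', hu', hO', h'⟩ := exists_faceAC_eq i α p T'
    rw [SetLike.mem_coe, LinearMap.mem_ker, map_sub, sub_eq_zero]
    simp only [G, DirectSum.toModule_lof, LinearMap.comp_apply]
    rw [h, h']
    exact toLim_faceRestrict_capHom hsub hΛ hu hO hu' hO' hc hc'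
  refine ⟨(limitRelations (n + 1) (p + 2)).liftQ G hG, fun T u O hu hO c hc => ?_⟩
  refine ⟨T.faceRestrict i α p (capHom O u p c), faceRestrict_capHom_mem_AC hu hO hc, ?_, ?_⟩
  · rw [cap_eq_capHom]
    exact T.faceRestrict_val i α (capHom_mem_hyper hu hO c)
  · obtain ⟨u', O', hu', hO', h'⟩ := exists_faceAC_eq i α p T
    change G (DirectSum.lof ℚ _ _ T _) = _
    simp only [G, DirectSum.toModule_lof, LinearMap.comp_apply]
    rw [h']
    exact toLim_faceRestrict_capHom (isSubdivision_refl _) (isSubdivisionOperator_id _) hu' hO' hu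
      hO hc hc

theorem ACLim.hom_ext {p : ℕ} {M : Type*} [AddCommGroup M] [Module ℚ M]
    {F G : ACLim n p →ₗ[ℚ] M} (h : ∀ (T : GoodTriangulation n) (c : T.Chain p)
      (hc : T.toRel c ∈ T.AC p), F (T.toLim p ⟨T.toRel c, hc⟩) = G (T.toLim p ⟨T.toRel c, hc⟩)) :
    F = G := by
  classical
  refine Submodule.linearMap_qext _ (DirectSum.linearMap_ext _ fun T => LinearMap.ext ?_)
  rintro ⟨γ, hγ⟩
  obtain ⟨c, rfl⟩ := T.exists_toRel_eq γ
  exact h T c hγ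

theorem IsFaceMap.apply_toLim {p : ℕ} {i : Fin (n + 1)} {α : Pole}
    {F : ACLim (n + 1) (p + 2) →ₗ[ℚ] ACLim n p} (hF : IsFaceMap i α F)
    {T : GoodTriangulation (n + 1)} {u : T.Cochain 2} {O : PartialOrder (Fin T.N → ℝ)}
    (hu : T.IsThomCocycle i α u) (hO : T.IsGoodOrdering O (hyper i α)) {c : T.Chain (p + 2)}
    (hc : T.toRel c ∈ T.AC (p + 2)) :
    F (T.toLim (p + 2) ⟨T.toRel c, hc⟩) =
      (T.face i α).toLim p ⟨(T.face i α).toRel (T.faceRestrict i α p (capHom O u p c)),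
        faceRestrict_capHom_mem_AC hu hO hc⟩ := by
  obtain ⟨c', hc', h1, h2⟩ := hF T u O hu hO c hc
  have h3 : c' = T.faceRestrict i α p (capHom O u p c) := by
    apply T.faceIncl_injective i α
    rw [T.faceIncl_faceRestrict i α (capHom_mem_hyper hu hO c), ← cap_eq_capHom]
    exact Subtype.ext h1
  subst h3
  exact h2

theorem existsUnique_isFaceMap (p : ℕ) (i : Fin (n + 1)) (α : Pole) :
    ∃! F : ACLim (n + 1) (p + 2) →ₗ[ℚ] ACLim n p, IsFaceMap i α F := by
  obtain ⟨F, hF⟩ := exists_isFaceMap p i α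
  refine ⟨F, hF, fun G hG => ACLim.hom_ext fun T c hc => ?_⟩
  obtain ⟨x, hu, hO⟩ := T.exists_capData i α
  rw [hF.apply_toLim hu hO hc, hG.apply_toLim hu hO hc]

theorem isFaceMap_faceMap (p : ℕ) (i : Fin (n + 1)) (α : Pole) :
    IsFaceMap i α (faceMap n p i α) :=
  Classical.epsilon_spec (exists_isFaceMap p i α)

end CubicalChains

namespace CubicalChains

open Triangulation GoodTriangulation

/-! ### Restriction of Thom cocycles and of orderings to a hypersurface -/

section Restriction

variable {n : ℕ} {i : Fin (n + 1)} {α : Pole} {j : Fin n} {β : Pole}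

theorem ins_mem_hyper_succAbove {z : P n} :
    ins i α z ∈ hyper (i.succAbove j) β ↔ z ∈ hyper j β := by
  simp [hyper, ins]

/-- The inclusion of a hypersurface as a continuous map. -/
def insMap (i : Fin (n + 1)) (α : Pole) : C(P n, P (n + 1)) := ⟨ins i α, continuous_ins i α⟩

theorem range_insMap_comp_subset {p : ℕ} {σ : SingSimplex n p} {A : Set (P n)}
    {B : Set (P (n + 1))} (hAB : ∀ z ∈ A, ins i α z ∈ B) (hσ : Set.range σ ⊆ A) :
    Set.range ((insMap i α).comp σ) ⊆ B := by
  rintro _ ⟨t, rfl⟩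
  exact hAB _ (hσ ⟨t, rfl⟩)

theorem singCobd_insMap_comp {p : ℕ} (S : SingCochain (n + 1) p) (τ : SingSimplex n (p + 1)) :
    singCobd (fun σ => S ((insMap i α).comp σ)) τ = singCobd S ((insMap i α).comp τ) := rfl

theorem contDiff_insR : ContDiff ℝ ∞ (insR (n := n) i α) := by
  refine contDiff_pi.2 fun k => ?_
  obtain ⟨k, l⟩ := k
  refine Fin.succAboveCases i ?_ (fun j => ?_) k
  · simp only [insR, Fin.insertNth_apply_same]
    exact contDiff_const
  · simp only [insR, Fin.insertNth_apply_succAbove]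
    fun_prop

theorem RepresentsLogForm.restrict {c : SingCochain (n + 1) 1}
    (hc : RepresentsLogForm (i.succAbove j) β c) :
    RepresentsLogForm j β fun σ => c ((insMap i α).comp σ) := by
  have hA : ∀ z ∈ tube j β \ hyper j β,
      ins i α z ∈ tube (i.succAbove j) β \ hyper (i.succAbove j) β := by
    rintro z ⟨h1, h2⟩
    refine ⟨?_, fun h => h2 (ins_mem_hyper_succAbove.1 h)⟩
    simpa [tube, ins] using h1
  obtain ⟨h1, b, hb⟩ := hc
  refine ⟨fun τ hτ => ?_, fun z => b (ins i α z), fun σ hσ hs => ?_⟩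
  · rw [singCobd_insMap_comp]
    exact h1 _ (range_insMap_comp_subset hA hτ)
  · have h2 := hb ((insMap i α).comp σ) (range_insMap_comp_subset hA hσ) (by
      have h3 : (fun t => embed (SingSimplex.path ((insMap i α).comp σ) t)) =
          insR i α ∘ fun t => embed (σ.path t) := by
        funext t
        exact embed_ins i α _
      rw [h3]
      exact contDiff_insR.comp_contDiffOn hs)
    rw [h2]
    have h4 : ∀ t, SingSimplex.path ((insMap i α).comp σ) t (i.succAbove j) = σ.path t j :=
      fun t => by
        change ins i α (σ.path t) (i.succAbove j) = _
        simp [ins]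
    simp only [logIntegral, h4]
    rfl

theorem IsSingularThomCocycle.restrict {S : SingCochain (n + 1) 2}
    (hS : IsSingularThomCocycle (i.succAbove j) β S) :
    IsSingularThomCocycle j β fun σ => S ((insMap i α).comp σ) := by
  obtain ⟨h1, h2, c, hc, h3⟩ := hS
  refine ⟨fun τ => h1 ((insMap i α).comp τ), fun τ hτ => h2 _ (range_insMap_comp_subset
    (A := (hyper j β)ᶜ) (fun z hz h => hz (ins_mem_hyper_succAbove.1 h)) hτ), _, hc.restrict (i := i) (α := α), fun τ hτ => ?_⟩
  rw [singCobd_insMap_comp]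
  refine h3 _ (range_insMap_comp_subset (fun z hz => ?_) hτ)
  simpa [tube, ins] using hz

variable {T : GoodTriangulation (n + 1)}

theorem Triangulation.VanishesOff.restrict {p : ℕ} {w : T.Cochain p}
    (hw : T.VanishesOff (hyper (i.succAbove j) β) w) :
    (T.face i α).VanishesOff (hyper j β) (w ∘ₗ T.faceIncl i α p) := by
  intro v hv hd
  rw [LinearMap.comp_apply, T.faceIncl_elem i α hv]
  refine hw v ((T.face_isSimplex_iff i α).1 hv).1 (Set.disjoint_left.2 fun z hz hzH => ?_)
  obtain ⟨y, hy, rfl⟩ := (T.ins_image_cell i α hv.2).ge hz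
  exact Set.disjoint_left.1 hd hy (ins_mem_hyper_succAbove.1 hzH)

/-- The restriction to `H_{i,α}` of a Thom cocycle of another hypersurface is a Thom cocycle. -/
theorem Triangulation.IsThomCocycle.restrict {u : T.Cochain 2} (hu : T.IsThomCocycle (i.succAbove j) β u) :
    (T.face i α).IsThomCocycle j β (u ∘ₗ T.faceIncl i α 2) := by
  obtain ⟨h1, h2, S, O, w, hS, hO, hw, h3⟩ := hu
  refine ⟨h1.restrict, ?_, _, O, w ∘ₗ T.faceIncl i α 1, hS.restrict (i := i) (α := α),
    fun s hs => hO s hs.1, hw.restrict, fun v hv hvO => ?_⟩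
  · ext c
    change u (T.faceIncl i α 2 ((T.face i α).bdSucc 2 c)) = 0
    rw [← bdSucc_faceIncl]
    exact LinearMap.congr_fun h2 _
  · have hvT := ((T.face_isSimplex_iff i α).1 hv).1
    have h4 := h3 v hvT hvO
    have h5 : (insMap i α).comp ((T.face i α).toSingular v hv) = T.toSingular v hvT := by
      ext t : 1
      exact T.ins_faceHomeo i α _
    rw [LinearMap.comp_apply, LinearMap.comp_apply, ← bdSucc_faceIncl, T.faceIncl_elem i α hv,
      h4, h5]

theorem Triangulation.IsGoodOrdering.restrict {O : PartialOrder (Fin T.N → ℝ)}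
    (hO : T.IsGoodOrdering O (hyper (i.succAbove j) β)) :
    (T.face i α).IsGoodOrdering O (hyper j β) := by
  refine ⟨fun s hs => hO.1 s hs.1, fun v hv w hw h hvw => ?_⟩
  have h1 := fun x hx => T.cell_subset_iff i α ((T.face i α).singleton_mem_faces (x := x) hx)
    (S := hyper j β) (S' := hyper (i.succAbove j) β) fun z => ins_mem_hyper_succAbove
  exact (h1 w hw).2 (hO.2 v (T.mem_verts_of_face i α hv) w (T.mem_verts_of_face i α hw)
    ((h1 v hv).1 h) hvw)

/-- Capping in a hypersurface with the restriction of a cocycle is the same as capping with the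
cocycle. -/
theorem faceIncl_capHom {u : T.Cochain 2} {O : PartialOrder (Fin T.N → ℝ)} {p : ℕ}
    (hO : T.IsOrdering O) (c : (T.face i α).Chain (p + 2)) :
    T.faceIncl i α p (capHom (T := (T.face i α).toTriangulation) O (u ∘ₗ T.faceIncl i α 2) p c) =
      capHom O u p (T.faceIncl i α (p + 2) c) := by
  have hO' : (T.face i α).IsOrdering O := fun s hs => hO s hs.1
  refine LinearMap.congr_fun (hO'.hom_ext (f := T.faceIncl i α p ∘ₗ
    capHom (T := (T.face i α).toTriangulation) O (u ∘ₗ T.faceIncl i α 2) p)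
    (g := capHom O u p ∘ₗ T.faceIncl i α (p + 2)) fun v hvO hv => ?_) c
  have hvT := ((T.face_isSimplex_iff i α).1 hv).1
  have hvO' : v ∈ T.increasing O (p + 2) :=
    T.mem_increasing.2 ⟨hvT.mem_verts, ((T.face i α).mem_increasing.1 hvO).2⟩
  rw [LinearMap.comp_apply, LinearMap.comp_apply, T.faceIncl_elem i α hv]
  unfold capHom capOn
  rw [T.osum_elem _ hvT hvO', (T.face i α).osum_elem _ hv hvO, map_smul]
  exact congrArg₂ (fun (r : ℚ) (x : T.Chain p) => r • x)
    (congrArg u (T.faceIncl_elem i α (isSimplex_front hv)))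
    (T.faceIncl_elem i α (isSimplex_back hv))

end Restriction

end CubicalChains

namespace CubicalChains

open Triangulation GoodTriangulation

/-! ### The commutator of two cap products -/

namespace Triangulation

variable {n : ℕ} {T : Triangulation n} {O : PartialOrder (Fin T.N → ℝ)}

theorem capOn_congr {p q : ℕ} {f g : (Fin (q + 1) → Fin T.N → ℝ) → ℚ} (h : ∀ v, T.IsSimplex v →
    f v = g v) (c : T.Chain (p + q)) : T.capOn O q f c = T.capOn O q g c := by
  unfold capOn
  refine T.osum_congr O fun v _ hv => ?_
  rw [h _ (isSimplex_front (T.isSimplex_of_ne_zero c hv))]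

theorem capOn_sub {p q : ℕ} (f g : (Fin (q + 1) → Fin T.N → ℝ) → ℚ) (c : T.Chain (p + q)) :
    T.capOn O q (fun v => f v - g v) c = T.capOn O q f c - T.capOn O q g c := by
  unfold capOn
  rw [osum_apply, osum_apply, osum_apply, ← Finset.sum_sub_distrib]
  exact Finset.sum_congr rfl fun v _ =>
    (congrArg (c.1 v • ·) (sub_smul (f fun k : Fin (q + 1) => v (k.castLE (by omega)))
      (g fun k : Fin (q + 1) => v (k.castLE (by omega)))
      (T.elem fun k : Fin (p + 1) => v ⟨k + q, by omega⟩))).trans (smul_sub _ _ _)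

/-- Two successive cap products are the cap product with the cup product. -/
theorem capOn_capOn (f g : (Fin 3 → Fin T.N → ℝ) → ℚ) {p : ℕ} (c : T.Chain (p + 4)) :
    T.capOn O 2 g (T.capOn O (p := p + 2) 2 f c) =
      T.capOn O 4 (fun y => f ![y 0, y 1, y 2] * g ![y 2, y 3, y 4]) c := by
  unfold capOn
  rw [T.osum_apply O _ c, T.osum_apply O _ c, map_sum]
  refine Finset.sum_congr rfl fun v hvO => ?_
  by_cases h : c.1 v = 0
  · rw [h, zero_smul, zero_smul, map_zero]
  have hv := T.isSimplex_of_ne_zero c h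
  have hb : T.IsSimplex fun k : Fin (p + 2 + 1) => v ⟨k + 2, by omega⟩ :=
    isSimplex_back (k := p + 2) (q := 2) hv
  have hbO : (fun k : Fin (p + 2 + 1) => v ⟨k + 2, by omega⟩) ∈ T.increasing O (p + 2) :=
    T.mem_increasing.2 ⟨hb.mem_verts, fun a b hab => (T.mem_increasing.1 hvO).2 _ _
      (Nat.add_lt_add_right (Fin.lt_def.1 hab) 2)⟩
  rw [map_smul, map_smul, T.osum_elem _ hb hbO]
  refine congrArg (c.1 v • ·) ((smul_smul _ _ _).trans ?_)
  have e1 : (fun k : Fin 3 => v (k.castLE (by omega))) = ![v (Fin.castLE (by omega) (0 : Fin 5)),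
      v (Fin.castLE (by omega) (1 : Fin 5)), v (Fin.castLE (by omega) (2 : Fin 5))] := by
    funext k
    fin_cases k <;> rfl
  have e2 : (fun k : Fin 3 => v ⟨(k.castLE (by omega) : Fin (p + 2 + 1)) + 2, by
      have := k.2
      change k.1 + 2 < p + 4 + 1
      omega⟩) = ![v (Fin.castLE (by omega) (2 : Fin 5)),
      v (Fin.castLE (by omega) (3 : Fin 5)), v (Fin.castLE (by omega) (4 : Fin 5))] := by
    funext k
    fin_cases k <;> rfl
  exact congrArg₂ (fun (r : ℚ) (x : T.Chain p) => r • x)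
    (congrArg₂ (fun a b => f a * g b) e1 e2) rfl

/-- The `∪_1`-product of two `2`-cochains, on increasing simplices. -/
def cupOne {V : Type*} (f g : (Fin 3 → V) → ℚ) (v : Fin 4 → V) : ℚ :=
  f ![v 0, v 2, v 3] * g ![v 0, v 1, v 2] - f ![v 0, v 1, v 3] * g ![v 1, v 2, v 3]

/-- The cup product of cocycles is commutative up to the coboundary of their `∪_1`-product. -/
theorem cobd_cupOne {f g : (Fin 3 → Fin T.N → ℝ) → ℚ}
    (hf : ∀ v : Fin 4 → Fin T.N → ℝ, T.IsSimplex v →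
      ∑ i : Fin 4, (-1) ^ (i : ℕ) * f (v ∘ i.succAbove) = 0)
    (hg : ∀ v : Fin 4 → Fin T.N → ℝ, T.IsSimplex v →
      ∑ i : Fin 4, (-1) ^ (i : ℕ) * g (v ∘ i.succAbove) = 0)
    {y : Fin 5 → Fin T.N → ℝ} (hy : T.IsSimplex y) :
    ∑ i : Fin 5, (-1) ^ (i : ℕ) * cupOne f g (y ∘ i.succAbove) =
      g ![y 0, y 1, y 2] * f ![y 2, y 3, y 4] - f ![y 0, y 1, y 2] * g ![y 2, y 3, y 4] := by
  have key : ∀ f : (Fin 3 → Fin T.N → ℝ) → ℚ, (∀ v : Fin 4 → Fin T.N → ℝ, T.IsSimplex v →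
      ∑ i : Fin 4, (-1) ^ (i : ℕ) * f (v ∘ i.succAbove) = 0) → ∀ a b c d : Fin 5,
      Function.Injective ![a, b, c, d] → f ![y b, y c, y d] - f ![y a, y c, y d] +
        f ![y a, y b, y d] - f ![y a, y b, y c] = 0 := by
    intro f hf a b c d hinj
    have h := hf _ (hy.face hinj)
    rw [Fin.sum_univ_four] at h
    have e0 : (y ∘ ![a, b, c, d]) ∘ (0 : Fin 4).succAbove = ![y b, y c, y d] := by
      funext k
      fin_cases k <;> rfl
    have e1 : (y ∘ ![a, b, c, d]) ∘ (1 : Fin 4).succAbove = ![y a, y c, y d] := by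
      funext k
      fin_cases k <;> rfl
    have e2 : (y ∘ ![a, b, c, d]) ∘ (2 : Fin 4).succAbove = ![y a, y b, y d] := by
      funext k
      fin_cases k <;> rfl
    have e3 : (y ∘ ![a, b, c, d]) ∘ (3 : Fin 4).succAbove = ![y a, y b, y c] := by
      funext k
      fin_cases k <;> rfl
    rw [e0, e1, e2, e3] at h
    norm_num at h
    linear_combination h
  have e : ∑ i : Fin 5, (-1) ^ (i : ℕ) * cupOne f g (y ∘ i.succAbove) =
      cupOne f g ![y 1, y 2, y 3, y 4] - cupOne f g ![y 0, y 2, y 3, y 4] +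
      cupOne f g ![y 0, y 1, y 3, y 4] - cupOne f g ![y 0, y 1, y 2, y 4] +
      cupOne f g ![y 0, y 1, y 2, y 3] := by
    have e0 : y ∘ (0 : Fin 5).succAbove = ![y 1, y 2, y 3, y 4] := by
      funext k
      fin_cases k <;> rfl
    have e1 : y ∘ (1 : Fin 5).succAbove = ![y 0, y 2, y 3, y 4] := by
      funext k
      fin_cases k <;> rfl
    have e2 : y ∘ (2 : Fin 5).succAbove = ![y 0, y 1, y 3, y 4] := by
      funext k
      fin_cases k <;> rfl
    have e3 : y ∘ (3 : Fin 5).succAbove = ![y 0, y 1, y 2, y 4] := by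
      funext k
      fin_cases k <;> rfl
    have e4 : y ∘ (4 : Fin 5).succAbove = ![y 0, y 1, y 2, y 3] := by
      funext k
      fin_cases k <;> rfl
    rw [Fin.sum_univ_five, e0, e1, e2, e3, e4]
    norm_num
    ring
  rw [e]
  have hdec : ∀ a b c d : Fin 5, a < b → b < c → c < d → Function.Injective ![a, b, c, d] := by
    decide
  have f1 := key f hf 0 1 2 4 (hdec _ _ _ _ (by decide) (by decide) (by decide))
  have f2 := key f hf 0 2 3 4 (hdec _ _ _ _ (by decide) (by decide) (by decide))
  have f3 := key f hf 0 1 3 4 (hdec _ _ _ _ (by decide) (by decide) (by decide))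
  have g1 := key g hg 0 1 2 3 (hdec _ _ _ _ (by decide) (by decide) (by decide))
  have g2 := key g hg 1 2 3 4 (hdec _ _ _ _ (by decide) (by decide) (by decide))
  simp only [cupOne, Matrix.cons_val]
  linear_combination (-g ![y 2, y 3, y 4]) * f1 + f ![y 0, y 3, y 4] * g1 +
    f ![y 0, y 1, y 4] * g2 - g ![y 0, y 1, y 2] * f2 + g ![y 1, y 2, y 3] * f3

theorem sum_cocycle_eq_zero {u : T.Cochain 2} (hu : u ∘ₗ T.bdSucc 2 = 0)
    {v : Fin 4 → Fin T.N → ℝ} (hv : T.IsSimplex v) :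
    ∑ i : Fin 4, (-1) ^ (i : ℕ) * u (T.elem (v ∘ i.succAbove)) = 0 := by
  classical
  have h := LinearMap.congr_fun hu (T.elem v)
  rw [LinearMap.comp_apply, T.bdSucc_elem (by convert hv.2), map_sum] at h
  simpa only [map_smul, smul_eq_mul, LinearMap.zero_apply] using h

end Triangulation

variable {n : ℕ}

/-- A simplex which contributes to the cap product with the `∪_1`-product of Thom cocycles of two
hypersurfaces ends with a face in their intersection. This face is too large for a simplex of an
admissible chain, unless it lies in the divisor. -/
theorem capOn_cupOne_mem_divisorChain {T : GoodTriangulation n} {i k : Fin n} (hik : i ≠ k)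
    {α β : Pole} {O : PartialOrder (Fin T.N → ℝ)} (hO : T.IsGoodOrdering O (hyper i α))
    (hO' : T.IsGoodOrdering O (hyper k β)) {u u' : T.Cochain 2}
    (hu : T.VanishesOff (hyper i α) u) (hu' : T.VanishesOff (hyper k β) u') {p : ℕ}
    {c : T.Chain (p + 3)} (hc : T.MeetsProperly c) :
    T.capOn O 3 (cupOne (fun v => u (T.elem v)) fun v => u' (T.elem v)) c ∈
      T.divisorChain p := by
  classical
  unfold capOn
  rw [osum_apply]
  refine Submodule.sum_mem _ fun v hvO => ?_
  by_cases h : c.1 v = 0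
  · rw [h, zero_smul]
    exact Submodule.zero_mem _
  refine Submodule.smul_mem _ _ ?_
  have hv := T.isSimplex_of_ne_zero c h
  let y : Fin 4 → Fin T.N → ℝ := fun a => v (a.castLE (by omega))
  let b : Fin (p + 1) → Fin T.N → ℝ := fun a => v ⟨a + 3, by omega⟩
  have hy : T.IsSimplex y := isSimplex_front (k := p) (q := 3) hv
  have hb : T.IsSimplex b := isSimplex_back (k := p) (q := 3) hv
  change cupOne (fun v => u (T.elem v)) (fun v => u' (T.elem v)) y • T.elem b ∈ _
  by_cases h0 : cupOne (fun v => u (T.elem v)) (fun v => u' (T.elem v)) y = 0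
  · rw [h0, zero_smul]
    exact Submodule.zero_mem _
  have meets : ∀ (l : Fin n) (γ : Pole) (w : T.Cochain 2), T.VanishesOff (hyper l γ) w →
      ∀ a : Fin 3 → Fin 4, Function.Injective a → w (T.elem (y ∘ a)) ≠ 0 →
        (T.tupleCell y ∩ hyper l γ).Nonempty := by
    intro l γ w hw a ha hne
    by_contra hd
    refine hne (hw _ (hy.face ha) (Set.disjoint_left.2 fun z hz hzH => hd ⟨z, ?_, hzH⟩))
    exact T.tupleCell_comp_subset y a hz
  have hH : (T.tupleCell y ∩ hyper i α).Nonempty ∧ (T.tupleCell y ∩ hyper k β).Nonempty := by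
    have e : ∀ a b c : Fin 4, ![y a, y b, y c] = y ∘ ![a, b, c] := fun a b c => by
      funext k
      fin_cases k <;> rfl
    simp only [cupOne, e] at h0
    by_cases h1 : u (T.elem (y ∘ ![0, 2, 3])) * u' (T.elem (y ∘ ![0, 1, 2])) = 0
    · rw [h1, zero_sub, neg_eq_zero] at h0
      exact ⟨meets i α u hu _ (by decide) (left_ne_zero_of_mul h0),
        meets k β u' hu' _ (by decide) (right_ne_zero_of_mul h0)⟩
    · exact ⟨meets i α u hu _ (by decide) (left_ne_zero_of_mul h1),
        meets k β u' hu' _ (by decide) (right_ne_zero_of_mul h1)⟩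
  have hbi : T.tupleCell b ⊆ hyper i α := hO.back_subset (T.hyper_isFull i α) hv hvO hH.1
  have hbk : T.tupleCell b ⊆ hyper k β := hO'.back_subset (T.hyper_isFull k β) hv hvO hH.2
  refine Submodule.smul_mem _ _ (T.elem_mem_chainsIn fun _ => ?_)
  by_contra hD
  have hbv : Set.range b ⊆ Set.range v := by
    rintro _ ⟨a, rfl⟩
    exact ⟨_, rfl⟩
  let s : Finset (Fin T.N → ℝ) := Finset.univ.image b
  have hs : (s : Set (Fin T.N → ℝ)) = Set.range b := by simp [s]
  have hsb : T.cell s = T.tupleCell b := by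
    unfold tupleCell
    congr
  let J : Fin n → Option Pole := Function.update (Function.update (fun _ => none) i (some α)) k
    (some β)
  have hJ : T.cell s ⊆ cubicalFace J := by
    rw [hsb]
    intro z hz j γ hγ
    by_cases hjk : j = k
    · subst hjk
      simp only [J, Function.update_self, Option.mem_def, Option.some.injEq] at hγ
      rw [← hγ]
      exact hbk hz
    · by_cases hji : j = i
      · subst hji
        simp only [J, Function.update_of_ne hjk, Function.update_self, Option.mem_def,
          Option.some.injEq] at hγ
        rw [← hγ]
        exact hbi hz
      · simp [J, hjk, hji] at hγ
  have hJ2 : codim J = 2 := by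
    unfold codim
    rw [← Finset.card_pair hik]
    congr 1
    ext j
    by_cases hjk : j = k
    · simp [J, hjk]
    · by_cases hji : j = i
      · subst hji
        simp [J, hjk]
      · simp [J, hjk, hji]
  have h5 := hc v h (fun h => hD ((T.cell_subset_tupleCell (hs.le.trans hbv)).trans h |>
    fun h' => hsb ▸ h')) s (by simp [s]) (hs.le.trans hbv) J hJ (by rwa [hsb])
  rw [card_image_of_isSimplex hb, hJ2] at h5
  omega

/-- Cap products with Thom cocycles of two different hypersurfaces commute on admissible chains. -/
theorem capHom_capHom_sub_mem {T : GoodTriangulation n} {i k : Fin n} (hik : i ≠ k)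
    {α β : Pole} {O : PartialOrder (Fin T.N → ℝ)} (hO : T.IsGoodOrdering O (hyper i α))
    (hO' : T.IsGoodOrdering O (hyper k β)) {u u' : T.Cochain 2}
    (hu : T.IsThomCocycle i α u) (hu' : T.IsThomCocycle k β u') {p : ℕ}
    {c : T.Chain (p + 4)} (hc : T.toRel c ∈ T.AC (p + 4)) :
    capHom O u' p (capHom O u (p + 2) c) - capHom O u p (capHom O u' (p + 2) c) ∈
      T.divisorChain p := by
  let f : (Fin 3 → Fin T.N → ℝ) → ℚ := fun v => u (T.elem v)
  let g : (Fin 3 → Fin T.N → ℝ) → ℚ := fun v => u' (T.elem v)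
  obtain ⟨h1, h2⟩ := (T.mem_AC_iff c).1 hc
  -- By the Leibniz rule the commutator is a sum of two terms which contain the `∪_1`-product, and
  -- these lie in the divisor.
  have h3 := hO.1.bdSucc_capOn_three (cupOne f g) c
  have h4 : T.capOn O 4 (fun v => ∑ i : Fin 5, (-1) ^ (i : ℕ) * cupOne f g (v ∘ i.succAbove)) c =
      capHom O u p (capHom O u' (p + 2) c) - capHom O u' p (capHom O u (p + 2) c) := by
    rw [capOn_congr (fun v hv => cobd_cupOne (fun v hv => sum_cocycle_eq_zero hu.2.1 hv)
      (fun v hv => sum_cocycle_eq_zero hu'.2.1 hv) hv), capOn_sub]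
    exact congrArg₂ (· - ·) (capOn_capOn g f c).symm (capOn_capOn f g c).symm
  rw [h4] at h3
  rw [← neg_sub, Submodule.neg_mem_iff, sub_eq_iff_eq_add.1 h3.symm]
  refine Submodule.add_mem _ (bdSucc_mem_chainsIn ?_) ?_
  · exact capOn_cupOne_mem_divisorChain hik hO hO' hu.1 hu'.1 (p := p + 1) h1
  · exact capOn_cupOne_mem_divisorChain hik hO hO' hu.1 hu'.1 h2

end CubicalChains

namespace CubicalChains

open Triangulation GoodTriangulation

/-! ### Iterated face maps -/

variable {n : ℕ}

theorem GoodTriangulation.mk_congr {N : ℕ} {K K' : Geometry.SimplicialComplex ℝ (Fin N → ℝ)}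
    {hf : K.faces.Finite} {hf' : K'.faces.Finite} {Φ : K.space ≃ₜ P n} {Φ' : K'.space ≃ₜ P n}
    {h1 h1' h2 h2' h3 h3' h4 h4' h5 h5'} (hK : K = K')
    (hΦ : ∀ x (h : x ∈ K.space) (h' : x ∈ K'.space), Φ ⟨x, h⟩ = Φ' ⟨x, h'⟩) :
    (⟨⟨N, K, hf, Φ, h1⟩, h2, h3, h4, h5⟩ : GoodTriangulation n) =
      ⟨⟨N, K', hf', Φ', h1'⟩, h2', h3', h4', h5'⟩ := by
  subst hK
  obtain rfl : Φ = Φ' := Homeomorph.ext fun x => hΦ x.1 x.2 x.2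
  rfl

/-- The triangulation of the intersection of two hypersurfaces does not depend on the order in
which the coordinates are omitted. -/
theorem GoodTriangulation.face_face (T : GoodTriangulation (n + 2)) (i : Fin (n + 2))
    (j : Fin (n + 1)) (α β : Pole) :
    (T.face i α).face j β = (T.face (i.succAbove j) β).face (j.predAbove i) α := by
  have hfaces : ∀ (i : Fin (n + 2)) (j : Fin (n + 1)) (α β : Pole) (s : Finset (Fin T.N → ℝ)),
      s ∈ ((T.face i α).faceComplex j β).faces ↔
        s ∈ T.K.faces ∧ T.cell s ⊆ hyper i α ∧ T.cell s ⊆ hyper (i.succAbove j) β := by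
    intro i j α β s
    constructor
    · rintro ⟨hs, hsj⟩
      exact ⟨hs.1, hs.2, (T.cell_subset_iff i α hs fun z => ins_mem_hyper_succAbove).1 hsj⟩
    · rintro ⟨hs, hsi, hsj⟩
      exact ⟨⟨hs, hsi⟩, (T.cell_subset_iff i α (s := s) ⟨hs, hsi⟩
        fun z => ins_mem_hyper_succAbove).2 hsj⟩
  refine GoodTriangulation.mk_congr ?_ ?_
  · refine Geometry.SimplicialComplex.ext (Set.ext fun s => ?_)
    refine (hfaces i j α β s).trans (Iff.trans ?_ (hfaces (i.succAbove j) (j.predAbove i) β α s).symm)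
    rw [Fin.succAbove_succAbove_predAbove]
    tauto
  · intro x h h'
    funext k
    exact congrArg (T.Φ ⟨x, _⟩) (Fin.succAbove_succAbove_succAbove_predAbove i j k).symm

/-- Equality of classes over triangulations which are equal, but not definitionally so; the underlying
functions of the two chains have the same type, and are compared as such. -/
theorem GoodTriangulation.toLim_eq_of_eq {A B : GoodTriangulation n} (hAB : A = B) {p : ℕ}
    {a : A.Chain p} {b : B.Chain p} (ha : A.toRel a ∈ A.AC p) (hb : B.toRel b ∈ B.AC p)
    (h : ∀ b' : A.Chain p, HEq b'.1 b.1 → a - b' ∈ A.divisorChain p) :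
    A.toLim p ⟨A.toRel a, ha⟩ = B.toLim p ⟨B.toRel b, hb⟩ := by
  subst hAB
  exact toLim_congr ha hb (h b HEq.rfl)

/-- Two face maps commute, up to the shift of the indices. -/
theorem faceMap_comp_faceMap (p : ℕ) (i : Fin (n + 2)) (j : Fin (n + 1)) (α β : Pole) :
    faceMap n p j β ∘ₗ faceMap (n + 1) (p + 2) i α =
      faceMap n p (j.predAbove i) α ∘ₗ faceMap (n + 1) (p + 2) (i.succAbove j) β := by
  refine ACLim.hom_ext fun T c hc => ?_
  obtain ⟨u, hu⟩ := T.exists_isThomCocycle i α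
  obtain ⟨u', hu'⟩ := T.exists_isThomCocycle (i.succAbove j) β
  obtain ⟨O, hO, hO'⟩ := T.exists_isGoodOrdering i (i.succAbove j) α β
  have huO : T.IsThomCocycle ((i.succAbove j).succAbove (j.predAbove i)) α u := by
    rwa [Fin.succAbove_succAbove_predAbove]
  have hOO : T.IsGoodOrdering O (hyper ((i.succAbove j).succAbove (j.predAbove i)) α) := by
    rwa [Fin.succAbove_succAbove_predAbove]
  rw [LinearMap.comp_apply, LinearMap.comp_apply,
    (isFaceMap_faceMap (p + 2) i α).apply_toLim hu hO hc,
    (isFaceMap_faceMap (p + 2) (i.succAbove j) β).apply_toLim hu' hO' hc,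
    (isFaceMap_faceMap p j β).apply_toLim (hu'.restrict (i := i) (α := α)) hO'.restrict,
    (isFaceMap_faceMap p (j.predAbove i) α).apply_toLim
      (huO.restrict (i := i.succAbove j) (α := β)) hOO.restrict]
  refine toLim_eq_of_eq (T.face_face i j α β) _ _ fun b' hb' => ?_
  have key : ∀ (i : Fin (n + 2)) (j : Fin (n + 1)) (α β : Pole) {u u' : T.Cochain 2}
      (hu : T.IsThomCocycle i α u) (hO : T.IsGoodOrdering O (hyper i α))
      (hu' : T.IsThomCocycle (i.succAbove j) β u')
      (hO' : T.IsGoodOrdering O (hyper (i.succAbove j) β)),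
      ((T.face i α).faceRestrict j β p (capHom (T := (T.face i α).toTriangulation) O
        (u' ∘ₗ T.faceIncl i α 2) p (T.faceRestrict i α (p + 2) (capHom O u (p + 2) c)))).1 =
      (capHom O u' p (capHom O u (p + 2) c)).1 := by
    intro i j α β u u' hu hO hu' hO'
    rw [(T.face i α).faceRestrict_val j β (capHom_mem_hyper hu'.restrict hO'.restrict _)]
    have h1 := faceIncl_capHom (u := u') hO.1 (T.faceRestrict i α (p + 2) (capHom O u (p + 2) c))
    rw [T.faceIncl_faceRestrict i α (capHom_mem_hyper hu hO c)] at h1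
    exact congrArg Subtype.val h1
  have h1 := key i j α β hu hO hu' hO'
  have h2 := (eq_of_heq hb').trans
    (key (i.succAbove j) (j.predAbove i) β α hu' hO' huO hOO)
  have h3 := capHom_capHom_sub_mem (Fin.succAbove_ne i j).symm hO hO' hu hu' hc
  refine ((T.face i α).faceIncl_mem_chainsIn_iff j β (ins_mem_divisor j β)).1
    ((T.faceIncl_mem_chainsIn_iff i α (ins_mem_divisor i α)).1 ?_)
  have h4 : T.faceIncl i α p ((T.face i α).faceIncl j β p
      ((T.face i α).faceRestrict j β p (capHom (T := (T.face i α).toTriangulation) O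
        (u' ∘ₗ T.faceIncl i α 2) p (T.faceRestrict i α (p + 2) (capHom O u (p + 2) c))) - b')) =
      capHom O u' p (capHom O u (p + 2) c) - capHom O u p (capHom O u' (p + 2) c) := by
    refine Subtype.ext ?_
    exact congrArg₂ (· - ·) h1 h2
  rw [h4]
  exact h3

theorem cubicalDifferential_comp (n p : ℕ) :
    cubicalDifferential n p ∘ₗ cubicalDifferential (n + 1) (p + 2) = 0 := by
  let G : Fin (n + 2) × Fin (n + 1) → (ACLim (n + 2) (p + 4) →ₗ[ℚ] ACLim n p) := fun x =>
    (faceMap n p x.2 .zero - faceMap n p x.2 .infty) ∘ₗ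
      (faceMap (n + 1) (p + 2) x.1 .zero - faceMap (n + 1) (p + 2) x.1 .infty)
  -- The involution `(i, j) ↦ (i.succAbove j, j.predAbove i)` exchanges the two ways to omit a pair
  -- of coordinates. It fixes `G` and reverses the sign.
  have hG : ∀ i j, G (i, j) = G (i.succAbove j, j.predAbove i) := by
    intro i j
    simp only [G, LinearMap.sub_comp, LinearMap.comp_sub]
    rw [faceMap_comp_faceMap p i j .zero .zero, faceMap_comp_faceMap p i j .zero .infty,
      faceMap_comp_faceMap p i j .infty .zero, faceMap_comp_faceMap p i j .infty .infty]
    abel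
  have h1 : cubicalDifferential n p ∘ₗ cubicalDifferential (n + 1) (p + 2) =
      ∑ x : Fin (n + 2) × Fin (n + 1), (-1 : ℚ) ^ (x.1 + x.2 : ℕ) • G x := by
    rw [Fintype.sum_prod_type]
    unfold cubicalDifferential
    refine LinearMap.ext fun z => ?_
    simp only [LinearMap.comp_apply, LinearMap.sum_apply, LinearMap.smul_apply, map_sum, map_smul,
      G]
    refine Finset.sum_congr rfl fun i _ => ?_
    rw [Finset.smul_sum]
    refine Finset.sum_congr rfl fun j _ => ?_
    rw [pow_add, mul_smul]
  rw [h1]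
  refine Finset.sum_involution (fun x _ => (x.1.succAbove x.2, x.2.predAbove x.1)) ?_ ?_ ?_ ?_
  · rintro ⟨i, j⟩ -
    rw [← hG, Fin.neg_one_pow_succAbove_add_predAbove]
    exact (congrArg _ (neg_smul _ (G (i, j)))).trans (add_neg_cancel _)
  · rintro ⟨i, j⟩ - - h
    exact Fin.succAbove_ne i j (congrArg Prod.fst h)
  · exact fun _ _ => Finset.mem_univ _
  · rintro ⟨i, j⟩ -
    exact Prod.ext (Fin.succAbove_succAbove_predAbove i j)
      (Fin.predAbove_predAbove_succAbove i j)

end CubicalChains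

end

theorem mainTheorem4 :
    (∀ (n p : ℕ) (i : Fin (n + 1)) (α : CubicalChains.Pole),
      ∃! F : CubicalChains.ACLim (n + 1) (p + 2) →ₗ[ℚ] CubicalChains.ACLim n p,
        CubicalChains.IsFaceMap i α F) ∧
    ∀ n p : ℕ, CubicalChains.cubicalDifferential n p ∘ₗ
      CubicalChains.cubicalDifferential (n + 1) (p + 2) = 0 := by
  exact ⟨fun n p i α => CubicalChains.existsUnique_isFaceMap p i α,
    CubicalChains.cubicalDifferential_comp⟩
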